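/- **Setting.** A lattice $G\subset\mathbb R^2$ is a discrete subgroup of rank $2$. A *periodic 2-tiling* $\mathbf T$ of the plane is given by a lattice $G$ and measurable sets (generators) $E_1,E_2\subset\mathbb R^2$ such that the sets $E_k+g$ ($k=1,2$, $g\in G$) have pairwise negligible intersections and cover $\mathbb R^2$ up to a negligible set. It is *non-degenerate* if $|E_1|,|E_2|>0$. Its perimeter is $\mathrm{Per}(\mathbf T)=\frac12\big(\mathrm{Per}(E_1)+\mathrm{Per}(E_2)\big)$, where $\mathrm{Per}(E)$ is the Caccioppoli perimeter. $\mathbf T$ is *isoperimetric* (with free lattice) if $\mathrm{Per}(\mathbf T)\le\mathrm{Per}(\mathbf T')$ for every periodic 2-tiling $\mathbf T'$, with respect to any lattice, whose generators satisfy $|E_k'|=|E_k|$ for $k=1,2$. $\mathbf T$ is a *$(3;9)$ configuration* if for some $p>0$, up to negligible sets, $E_1$ is a closed region bounded by a simple closed curve made of three circular arcs of curvature $p$, convex as seen from $E_1$, and $E_2$ is a closed region bounded by a simple closed curve made of nine edges: six straight segments, and three circular arcs of curvature $p$ which are concave as seen from $E_2$, arranged cyclically so that every two consecutive segments are followed by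 one arc; all edges have positive length and all interior angles of both regions are equal to $120^\circ$. **Theorem.** Let $\mathbf T$ be a non-degenerate, isoperimetric periodic 2-tiling of the plane which is a $(3;9)$ configuration, with lattice $G$ and generators $E_1,E_2$. Then: 1. There are a closed regular hexagon $H$ with vertices $v_0,\dots,v_5$ in cyclic order, and a number $r>0$, such that $G$ is the lattice of the honeycomb tiling generated by $H$ (that is, $G$ is generated by the translations carrying $H$ to the hexagons adjacent to it in that tiling), and, up to negligible sets, $$E_1=R_0+g\ \text{ for some } g\in G,\qquad E_2=H\setminus(R_0\cup R_2\cup R_4),$$ where, for $k=0,2,4$, $R_k$ is the Reuleaux triangle of width $r$ centered at $v_k$ (the intersection of the three closed disks of radius $r$ centered at the vertices of an equilateral triangle of side $r$ centered at $v_k$) whose three vertices lie on the three rays from $v_k$ along the edges of the honeycomb tiling that meet at $v_k$. 2. $$0<\frac{|E_1|}{|E_1|+|E_2|}<\frac{\pi}{\sqrt3}-1 .$$ 3. $$\mathrm{Per}(\mathbf T)=\sqrt2\,\sqrt{\pi-\sqrt3}\,\sqrt{|E_1|}+\sqrt[4]{12}\,\sqrt{|E_1|+|E_2|}.$$ 4.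 Given $|E_1|$ and $|E_2|$, the configuration is unique up to isometry: if $\mathbf T'$ is another non-degenerate isoperimetric periodic 2-tiling which is a $(3;9)$ configuration, with generators $E'_1,E_2'$ such that $|E_k'|=|E_k|$ for $k=1,2$, then there is an isometry of the plane which, for each $k$, carries the tiles $E_k+g$, $g\in G$, onto the tiles $E_k'+g'$, $g'\in G'$ (with $G'$ the lattice of $\mathbf T'$), up to negligible sets. -/

import Mathlib

open MeasureTheory Set
open scoped ENNReal

noncomputable section

/-- The Euclidean plane `ℝ²`, with its Euclidean norm and Lebesgue measure. -/
abbrev Plane : Type := EuclideanSpace ℝ (Fin 2)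

/-- The unit vector `(cos θ, sin θ)`. -/
def dir (θ : ℝ) : Plane := !₂[Real.cos θ, Real.sin θ]

/-! ### Perimeter -/

/-- The divergence of a vector field on the plane. -/
def divergence (X : Plane → Plane) (x : Plane) : ℝ :=
  ∑ i : Fin 2, fderiv ℝ X x (EuclideanSpace.single i 1) i

/-- The Caccioppoli (De Giorgi) perimeter of a measurable set `E`: the supremum of `∫_E div X` over
compactly supported `C¹` vector fields `X` with `|X| ≤ 1`. It may be `∞`. -/
def perimeter (E : Set Plane) : ℝ≥0∞ :=
  ⨆ (X : Plane → Plane) (_ : ContDiff ℝ 1 X) (_ : HasCompactSupport X) (_ : ∀ x, ‖X x‖ ≤ 1),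
    ENNReal.ofReal (∫ x in E, divergence X x)

/-! ### Periodic tilings -/

/-- The shiftSet `E + g`. -/
def shiftSet (g : Plane) (E : Set Plane) : Set Plane := (fun x => x + g) '' E

/-- A periodic `N`-tiling `{E_k + g : k, g ∈ G}` of the plane, given by its lattice `G` (a discrete
subgroup of rank two) and its generators `E_k`; the sets `E_k + g` have pairwise negligible
intersections, and cover the plane up to a negligible set. -/
structure PeriodicTiling (N : ℕ) where
  lattice : Submodule ℤ Plane
  [discrete : DiscreteTopology lattice]
  [isZLattice : IsZLattice ℝ lattice]
  tile : Fin N → Set Plane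
  measurableSet_tile : ∀ k, MeasurableSet (tile k)
  disjoint : ∀ k l : Fin N, ∀ g ∈ lattice, ∀ h ∈ lattice, (k, g) ≠ (l, h) →
    volume (shiftSet g (tile k) ∩ shiftSet h (tile l)) = 0
  cover : volume (⋃ k, ⋃ g ∈ lattice, shiftSet g (tile k))ᶜ = 0

namespace PeriodicTiling

variable {N : ℕ}

/-- Every generator has positive area. -/
def NonDegenerate (T : PeriodicTiling N) : Prop := ∀ k, 0 < volume (T.tile k)

/-- The perimeter `½ ∑ Per(E_k)` of a periodic tiling. -/
def per (T : PeriodicTiling N) : ℝ≥0∞ := (∑ k, perimeter (T.tile k)) / 2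

/-- `T` has the least perimeter among all periodic tilings, with respect to arbitrary lattices,
whose generators have the same areas. -/
def Isoperimetric (T : PeriodicTiling N) : Prop :=
  ∀ T' : PeriodicTiling N, (∀ k, volume (T'.tile k) = volume (T.tile k)) → T.per ≤ T'.per

/-- Some isometry of the plane carries the tiles of `T` to the tiles of `T'`, up to negligible
sets, and respects the labels `k` of the tiles. -/
def Congruent (T T' : PeriodicTiling N) : Prop :=
  ∃ φ : Plane ≃ᵢ Plane, ∀ k,
    (∀ g ∈ T.lattice, ∃ g' ∈ T'.lattice,
      φ '' shiftSet g (T.tile k) =ᵐ[volume] shiftSet g' (T'.tile k)) ∧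
    (∀ g' ∈ T'.lattice, ∃ g ∈ T.lattice,
      φ '' shiftSet g (T.tile k) =ᵐ[volume] shiftSet g' (T'.tile k))

end PeriodicTiling

/-! ### Curvilinear polygons -/

/-- The unit speed curve with starting point `A`, initial direction `dir θ` and constant signed
curvature `κ`: a straight line for `κ = 0`, and otherwise a circle of radius `1 / |κ|`, turning to
the left for `κ > 0` and to the right for `κ < 0`. -/
def arcPoint (A : Plane) (θ κ t : ℝ) : Plane := A + ∫ s in (0 : ℝ)..t, dir (θ + κ * s)

/-- A cyclic sequence of `n` oriented edges. Edge `i` starts at `vertex i` in the direction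
`dir (angle i)`, and is a straight segment or circular arc with signed curvature `curv i` and
length `len i`. -/
structure EdgeCycle (n : ℕ) where
  vertex : Fin n → Plane
  angle : Fin n → ℝ
  curv : Fin n → ℝ
  len : Fin n → ℝ

/-- The point at arc length `t` along the edge `i`. -/
def EdgeCycle.point {n : ℕ} (P : EdgeCycle n) (i : Fin n) (t : ℝ) : Plane :=
  arcPoint (P.vertex i) (P.angle i) (P.curv i) t

/-- `E` is the closed curvilinear `n`-gon, with all interior angles equal to `2π/3` (120 degrees),
whose boundary, traversed counterclockwise, is the cycle of edges `P`. The indices of the edges are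
cyclic, so `i + 1` is `0` for the last `i`. In particular an edge of positive curvature is convex
(seen from `E`), and one of negative curvature is concave. -/
structure EdgeCycle.Bounds {n : ℕ} [NeZero n] (P : EdgeCycle n) (E : Set Plane) : Prop where
  /-- The edges are not degenerate. -/
  len_pos : ∀ i, 0 < P.len i
  /-- Each edge ends where the next one starts. -/
  vertex_succ : ∀ i, P.vertex (i + 1) = P.point i (P.len i)
  /-- At each vertex the tangent turns to the left by `π/3`. -/
  angle_succ : ∀ i,
    dir (P.angle (i + 1)) = dir (P.angle i + P.curv i * P.len i + Real.pi / 3)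
  /-- The closed curve is simple. -/
  simple : ∀ i j, ∀ s ∈ Ico 0 (P.len i), ∀ t ∈ Ico 0 (P.len j),
    P.point i s = P.point j t → i = j ∧ s = t
  /-- The closed curve is traversed counterclockwise: the tangent makes one full positive turn. -/
  turning : ∑ i, (P.curv i * P.len i + Real.pi / 3) = 2 * Real.pi
  /-- `E` is the closed bounded region enclosed by the curve. -/
  isCompact : IsCompact E
  closure_interior : closure (interior E) = E
  frontier_eq : frontier E = ⋃ i, P.point i '' Icc 0 (P.len i)

/-- The configuration `(3;9)`: for some pressure `p > 0`, up to negligible sets, `E₁` (the tile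
`0`) is a curvilinear triangle with three edges of curvature `p`, and `E₂` (the tile `1`) is a
chipped hexagon, that is, a curvilinear polygon with nine edges, six flat ones and three concave
ones of curvature `-p`, where every two flat edges are followed by a concave one. All interior
angles are of 120 degrees. -/
def PeriodicTiling.IsType39 (T : PeriodicTiling 2) : Prop :=
  ∃ (p : ℝ) (P₁ : EdgeCycle 3) (P₂ : EdgeCycle 9) (F₁ F₂ : Set Plane),
    0 < p ∧
    P₁.Bounds F₁ ∧ F₁ =ᵐ[volume] T.tile 0 ∧ (∀ i, P₁.curv i = p) ∧
    P₂.Bounds F₂ ∧ F₂ =ᵐ[volume] T.tile 1 ∧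
      (∀ i : Fin 9, P₂.curv i = if (i : ℕ) % 3 = 2 then -p else 0)

/-! ### The honeycomb -/

/-- The vertices of the regular hexagon with center `c` and side `ℓ`, where `dir θ` points from the
center to the vertex with index `0`. -/
def hexVertex (c : Plane) (θ ℓ : ℝ) (k : ℕ) : Plane := c + ℓ • dir (θ + k * (Real.pi / 3))

/-- The closed regular hexagon with center `c` and side `ℓ`. -/
def regularHexagon (c : Plane) (θ ℓ : ℝ) : Set Plane :=
  convexHull ℝ (range fun k : Fin 6 => hexVertex c θ ℓ k)

/-- The lattice of the translations that preserve the honeycomb tiling generated by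
`regularHexagon c θ ℓ`: it is generated by the translations to two neighboring hexagons. -/
def honeycombLattice (θ ℓ : ℝ) : Submodule ℤ Plane :=
  Submodule.span ℤ {(Real.sqrt 3 * ℓ) • dir (θ + Real.pi / 6),
    (Real.sqrt 3 * ℓ) • dir (θ + Real.pi / 2)}

/-- The Reuleaux triangle with center `v` and width `r`: the intersection of the three closed disks
of radius `r` centered at the vertices of an equilateral triangle with center `v` and side `r`;
`dir θ` points from the center to one of the vertices. -/
def reuleaux (v : Plane) (θ r : ℝ) : Set Plane :=
  ⋂ k : Fin 3, Metric.closedBall (v + (r / Real.sqrt 3) • dir (θ + k * (2 * Real.pi / 3))) r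

end

/-! The shape of both tiles is rigid. In a curvilinear triangle with three sides of curvature `p`
and angles of 120°, the turning condition makes the three opening angles add up to `π`, and the
condition that the curve closes says that three unit vectors have sum zero. Hence every opening
angle is `π/3` and `E₁` is a Reuleaux triangle of width `1/p = √3 ρ`, with `ρ` the distance from
center to vertex (`triangle_len`, `triangle_eq`).

Every boundary point of this triangle is a boundary point of another tile (`exists_mem_frontier`). A
circle meets a line, or a circle of equal radius and different center, in a countable set. So, up to
countably many points, each side of the triangle is covered by concave arcs of translates of `E₂` on
the same circle (`countable_unmatched`). The opening angles `x, y, z` of the three concave arcs add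
up to `π`, and their normals occupy three intervals of directions separated by gaps of lengths `z,
x, y`. The normals of the triangle occupy intervals of length `π/3` with period `2π/3`, so each gap
has length at most `π/3` by `gap_le`, and all three are equal to `π/3`. The concave arcs are
therefore translates, by lattice vectors, of the sides of the triangle (`exists_matching`). It
follows that `E₂` is an equiangular hexagon minus three Reuleaux triangles centered at alternate
vertices, the centers being congruent modulo `G`.

A curve determines the region that it bounds by an elementary replacement for the Jordan curve
theorem (`EdgeCycle.Bounds.eq_compl`): beside an inner point of an edge there are only two sides.
Areas and perimeters come from one device, `HasFlux`, which records the integral of a divergence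
over a region as a sum of boundary fluxes. It is proved for triangles and sectors by the divergence
theorem in fan coordinates, and extended by cutting and pasting.

The union of the two generators is a fundamental domain, so the covolume of `G` is the area of the
hexagon, `(√3/2) N`. The vectors joining the chip centers span a sublattice of covolume `(√3/2)(N +
d²/2)`, where `d` is the difference of two opposite sides. Since `d²` is small the index is less
than two, hence it is one and `d = 0`: the hexagon is centrally symmetric and the vectors generate
`G` (`lattice_eq`).

If `a, b, c` are the side lengths of this hexagon, its area is proportional to `ab + bc + ca` and,
for given `ρ`, the perimeter of the tiling is a constant plus `a + b + c`. The regular honeycomb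
with the same areas is a competitor, so `(a + b + c)² ≤ 3 (ab + bc + ca)`, which forces `a = b = c`
(`regular`). Let `ℓ` be the common side. The inequality `ρ < ℓ` gives the bound on the areas, and
the two areas determine `ρ` and `ℓ`, hence the perimeter and the tiling up to a change of frame. -/

/-! ### Unit vectors and the oblique frame with angle `π/3`. -/

/-- The determinant of two vectors of the plane. -/
noncomputable def cross (u v : Plane) : ℝ := u 0 * v 1 - u 1 * v 0

/-- The point with oblique coordinates `(a, b)` in the frame with origin `q` and axes
`dir α`, `dir (α + π / 3)`. -/
noncomputable def eis (q : Plane) (α a b : ℝ) : Plane :=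
  q + a • dir α + b • dir (α + Real.pi / 3)

@[simp] theorem dir_apply_zero (θ : ℝ) : dir θ 0 = Real.cos θ := rfl

@[simp] theorem dir_apply_one (θ : ℝ) : dir θ 1 = Real.sin θ := rfl

theorem plane_ext {x y : Plane} (h0 : x 0 = y 0) (h1 : x 1 = y 1) : x = y := by
  ext i; fin_cases i <;> assumption

theorem plane_ext_iff {x y : Plane} : x = y ↔ x 0 = y 0 ∧ x 1 = y 1 :=
  ⟨fun h => by rw [h]; exact ⟨rfl, rfl⟩, fun h => plane_ext h.1 h.2⟩

theorem norm_sq_plane (x : Plane) : ‖x‖ ^ 2 = x 0 ^ 2 + x 1 ^ 2 := by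
  rw [EuclideanSpace.norm_sq_eq]; simp

@[simp] theorem norm_dir (θ : ℝ) : ‖dir θ‖ = 1 := by
  have h : ‖dir θ‖ ^ 2 = 1 := by rw [norm_sq_plane]; simp
  nlinarith [norm_nonneg (dir θ)]

theorem abs_cross_le (u v : Plane) : |cross u v| ≤ ‖u‖ * ‖v‖ := by
  apply abs_le_of_sq_le_sq _ (by positivity)
  rw [mul_pow, norm_sq_plane, norm_sq_plane, cross]
  nlinarith [sq_nonneg (u 0 * v 0 + u 1 * v 1)]

theorem contDiff_dir {n : WithTop ℕ∞} : ContDiff ℝ n dir := by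
  rw [contDiff_piLp]
  intro i
  fin_cases i
  · exact Real.contDiff_cos
  · exact Real.contDiff_sin

@[fun_prop] theorem continuous_dir : Continuous dir := (contDiff_dir (n := 0)).continuous

theorem hasDerivAt_dir (θ : ℝ) : HasDerivAt dir (dir (θ + Real.pi / 2)) θ := by
  rw [hasDerivAt_iff_hasFDerivAt, ← hasFDerivWithinAt_univ, hasFDerivWithinAt_piLp]
  intro i
  fin_cases i
  · have h := (Real.hasDerivAt_cos θ).hasFDerivAt
    rw [hasFDerivWithinAt_univ]; refine h.congr_fderiv ?_
    ext; simp [Real.cos_add]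
  · have h := (Real.hasDerivAt_sin θ).hasFDerivAt
    rw [hasFDerivWithinAt_univ]; refine h.congr_fderiv ?_
    ext; simp [Real.sin_add]

theorem dir_add_pi (θ : ℝ) : dir (θ + Real.pi) = -dir θ := by
  apply plane_ext <;> simp

theorem dir_add_two_pi (θ : ℝ) : dir (θ + 2 * Real.pi) = dir θ := by
  apply plane_ext <;> simp

theorem dir_add_int_mul (θ : ℝ) (k : ℤ) : dir (θ + k * (2 * Real.pi)) = dir θ := by
  apply plane_ext <;> simp [Real.cos_add_int_mul_two_pi, Real.sin_add_int_mul_two_pi]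

theorem dir_eq_dir_iff {θ φ : ℝ} : dir θ = dir φ ↔ ∃ k : ℤ, φ = θ + k * (2 * Real.pi) := by
  constructor
  · intro h
    have h0 := congrArg (fun x : Plane => x 0) h
    have h1 := congrArg (fun x : Plane => x 1) h
    simp only [dir_apply_zero, dir_apply_one] at h0 h1
    have hc : Real.cos (φ - θ) = 1 := by
      rw [Real.cos_sub, ← h0, ← h1]; nlinarith [Real.sin_sq_add_cos_sq θ]
    obtain ⟨k, hk⟩ := (Real.cos_eq_one_iff _).1 hc
    exact ⟨k, by linarith⟩
  · rintro ⟨k, rfl⟩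
    exact (dir_add_int_mul θ k).symm

/-- The angles of an `EdgeCycle` are prescribed only through `dir`, that is, modulo `2π`; this
allows computing with them as if they were numbers. -/
theorem dir_congr_add {θ φ : ℝ} (h : dir θ = dir φ) (s : ℝ) : dir (θ + s) = dir (φ + s) := by
  obtain ⟨k, rfl⟩ := dir_eq_dir_iff.1 h
  rw [show θ + k * (2 * Real.pi) + s = θ + s + k * (2 * Real.pi) by ring, dir_add_int_mul]

theorem cos_two_pi_div_three : Real.cos (2 * Real.pi / 3) = -1 / 2 := by
  rw [show 2 * Real.pi / 3 = Real.pi - Real.pi / 3 by ring, Real.cos_pi_sub, Real.cos_pi_div_three]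
  ring

theorem sin_two_pi_div_three : Real.sin (2 * Real.pi / 3) = Real.sqrt 3 / 2 := by
  rw [show 2 * Real.pi / 3 = Real.pi - Real.pi / 3 by ring, Real.sin_pi_sub, Real.sin_pi_div_three]

theorem dir_add_two_pi_div_three (α : ℝ) :
    dir (α + 2 * Real.pi / 3) = dir (α + Real.pi / 3) - dir α := by
  apply plane_ext <;>
    simp [Real.cos_add, Real.sin_add, cos_two_pi_div_three, sin_two_pi_div_three] <;> ring

theorem dir_add_four_pi_div_three (α : ℝ) :
    dir (α + 4 * Real.pi / 3) = -dir (α + Real.pi / 3) := by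
  rw [show α + 4 * Real.pi / 3 = α + Real.pi / 3 + Real.pi by ring, dir_add_pi]

theorem dir_add_five_pi_div_three (α : ℝ) :
    dir (α + 5 * Real.pi / 3) = dir α - dir (α + Real.pi / 3) := by
  rw [show α + 5 * Real.pi / 3 = α + 2 * Real.pi / 3 + Real.pi by ring, dir_add_pi,
    dir_add_two_pi_div_three, neg_sub]

theorem sq_sqrt_three : Real.sqrt 3 * Real.sqrt 3 = 3 := Real.mul_self_sqrt (by norm_num)

theorem dir_add_pi_div_six (α : ℝ) :
    dir (α + Real.pi / 6) = (1 / Real.sqrt 3) • (dir α + dir (α + Real.pi / 3)) := by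
  have h3 : Real.sqrt 3 ≠ 0 := by positivity
  have := sq_sqrt_three
  apply plane_ext <;> simp [Real.cos_add, Real.sin_add] <;> field_simp
  · linear_combination (Real.cos α) * this
  · linear_combination (Real.sin α) * this

/-- In the oblique frame the rotation by `2π/3` has integer coefficients. It transfers facts about
one corner of a Reuleaux triangle to the other two. -/
theorem eis_rotate (q : Plane) (α a b : ℝ) :
    eis q (α + 2 * Real.pi / 3) a b = eis q α (-a - b) a := by
  rw [eis, eis, show α + 2 * Real.pi / 3 + Real.pi / 3 = α + Real.pi by ring, dir_add_pi,
    dir_add_two_pi_div_three]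
  module

theorem eis_eis (q : Plane) (α a b a' b' : ℝ) :
    eis (eis q α a b) α a' b' = eis q α (a + a') (b + b') := by
  simp only [eis]; module

theorem eis_zero (q : Plane) (α : ℝ) : eis q α 0 0 = q := by simp [eis]

theorem cross_dir_dir (θ φ : ℝ) : cross (dir θ) (dir φ) = Real.sin (φ - θ) := by
  rw [cross, Real.sin_sub]; simp; ring

theorem eis_apply_zero (q : Plane) (α a b : ℝ) :
    eis q α a b 0 = q 0 + a * Real.cos α + b * Real.cos (α + Real.pi / 3) := by simp [eis]

theorem eis_apply_one (q : Plane) (α a b : ℝ) :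
    eis q α a b 1 = q 1 + a * Real.sin α + b * Real.sin (α + Real.pi / 3) := by simp [eis]

/-- The two axes have inner product `1/2`. In these coordinates disks are quadratic inequalities
with rational coefficients, and hexagon sides are linear ones. -/
theorem norm_sq_oblique (α a b : ℝ) :
    ‖a • dir α + b • dir (α + Real.pi / 3)‖ ^ 2 = a ^ 2 + a * b + b ^ 2 := by
  rw [norm_sq_plane]
  simp only [PiLp.add_apply, PiLp.smul_apply, smul_eq_mul, dir_apply_zero, dir_apply_one]
  have h : Real.cos α * Real.cos (α + Real.pi / 3) + Real.sin α * Real.sin (α + Real.pi / 3)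
      = 1 / 2 := by
    rw [← Real.cos_sub, show α - (α + Real.pi / 3) = -(Real.pi / 3) by ring, Real.cos_neg,
      Real.cos_pi_div_three]
  linear_combination a ^ 2 * Real.sin_sq_add_cos_sq α +
    b ^ 2 * Real.sin_sq_add_cos_sq (α + Real.pi / 3) + 2 * a * b * h

theorem dist_sq_eis (q : Plane) (α a b a' b' : ℝ) :
    dist (eis q α a b) (eis q α a' b') ^ 2 =
      (a - a') ^ 2 + (a - a') * (b - b') + (b - b') ^ 2 := by
  rw [dist_eq_norm, ← norm_sq_oblique α]
  congr 2
  simp only [eis]; module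

theorem exists_eis (q : Plane) (α : ℝ) (x : Plane) : ∃ a b : ℝ, x = eis q α a b := by
  have h3 : Real.sqrt 3 ≠ 0 := by positivity
  -- Cramer's rule; the determinant of the frame is `√3/2`.
  refine ⟨(2 / Real.sqrt 3) * ((x 0 - q 0) * Real.sin (α + Real.pi / 3) -
      (x 1 - q 1) * Real.cos (α + Real.pi / 3)),
    (2 / Real.sqrt 3) * (Real.cos α * (x 1 - q 1) - Real.sin α * (x 0 - q 0)), ?_⟩
  have h := sq_sqrt_three
  have hs := Real.sin_sq_add_cos_sq α
  have key : Real.cos α * Real.sin (α + Real.pi / 3) - Real.sin α * Real.cos (α + Real.pi / 3)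
      = Real.sqrt 3 / 2 := by
    have := cross_dir_dir α (α + Real.pi / 3)
    rw [cross] at this
    simp only [dir_apply_zero, dir_apply_one, add_sub_cancel_left, Real.sin_pi_div_three] at this
    exact this
  simp only [eis_apply_zero, eis_apply_one, plane_ext_iff]
  generalize Real.cos (α + Real.pi / 3) = c at *
  generalize Real.sin (α + Real.pi / 3) = s at *
  constructor
  · field_simp
    linear_combination (-2 * (x 0 - q 0)) * key
  · field_simp
    linear_combination (-2 * (x 1 - q 1)) * key

theorem eis_injective {q : Plane} {α a b a' b' : ℝ} (h : eis q α a b = eis q α a' b') :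
    a = a' ∧ b = b' := by
  have h2 := dist_sq_eis q α a b a' b'
  rw [h, dist_self] at h2
  have h3 : (a - a') ^ 2 + (a - a') * (b - b') + (b - b') ^ 2 = 0 := by rw [← h2]; norm_num
  have hb : b - b' = 0 := by nlinarith [sq_nonneg (2 * (a - a') + (b - b')), sq_nonneg (b - b')]
  have ha : a - a' = 0 := by nlinarith [sq_nonneg (2 * (b - b') + (a - a')), sq_nonneg (a - a')]
  exact ⟨by linarith, by linarith⟩

/-! ### Arcs -/

theorem hasDerivAt_arcPoint (A : Plane) (θ κ t : ℝ) :
    HasDerivAt (arcPoint A θ κ) (dir (θ + κ * t)) t := by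
  have hc : Continuous fun s : ℝ => dir (θ + κ * s) := by fun_prop
  exact (intervalIntegral.integral_hasDerivAt_right (hc.intervalIntegrable _ _)
    (hc.stronglyMeasurableAtFilter _ _) hc.continuousAt).const_add A

@[simp] theorem arcPoint_zero (A : Plane) (θ κ : ℝ) : arcPoint A θ κ 0 = A := by
  simp [arcPoint]

theorem continuous_arcPoint (A : Plane) (θ κ : ℝ) : Continuous (arcPoint A θ κ) :=
  continuous_iff_continuousAt.2 fun t => (hasDerivAt_arcPoint A θ κ t).continuousAt

theorem arcPoint_congr {θ θ' : ℝ} (h : dir θ = dir θ') (A : Plane) (κ : ℝ) :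
    arcPoint A θ κ = arcPoint A θ' κ := by
  funext t
  simp only [arcPoint]
  congr 2
  funext s
  exact dir_congr_add h _

theorem arcPoint_straight (A : Plane) (θ t : ℝ) : arcPoint A θ 0 t = A + t • dir θ := by
  simp [arcPoint]

theorem hasDerivAt_dir_affine (θ κ t : ℝ) :
    HasDerivAt (fun s : ℝ => dir (θ + κ * s)) (κ • dir (θ + κ * t + Real.pi / 2)) t := by
  have h : HasDerivAt (fun s : ℝ => θ + κ * s) κ t := by
    simpa using ((hasDerivAt_id t).const_mul κ).const_add θ
  exact (hasDerivAt_dir _).scomp t h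

/-- A primitive of `dir (θ + κ s)` is `(1/κ) dir (θ - π/2 + κ s)`. The formula exhibits the center
`A - (1/κ) dir (θ - π/2)` of the circle. -/
theorem arcPoint_curved (A : Plane) (θ t : ℝ) {κ : ℝ} (hκ : κ ≠ 0) :
    arcPoint A θ κ t =
      A + (1 / κ) • (dir (θ - Real.pi / 2 + κ * t) - dir (θ - Real.pi / 2)) := by
  have hd : ∀ s : ℝ, HasDerivAt (fun s : ℝ => (1 / κ) • dir (θ - Real.pi / 2 + κ * s))
      (dir (θ + κ * s)) s := by
    intro s
    refine ((hasDerivAt_dir_affine (θ - Real.pi / 2) κ s).const_smul (1 / κ)).congr_deriv ?_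
    rw [smul_smul, one_div_mul_cancel hκ, one_smul]
    congr 1; ring
  have hc : Continuous fun s : ℝ => dir (θ + κ * s) := by fun_prop
  rw [arcPoint, intervalIntegral.integral_eq_sub_of_hasDerivAt (fun s _ => hd s)
    (hc.intervalIntegrable _ _)]
  simp [smul_sub]

/-! ### Gauss–Green formula on fans -/

/-- The identification of `ℝ × ℝ` with the plane. -/
def prodToPlane : ℝ × ℝ ≃ᵐ Plane :=
  (MeasurableEquiv.finTwoArrow (α := ℝ)).symm.trans (MeasurableEquiv.toLp 2 (Fin 2 → ℝ))

@[simp] theorem prodToPlane_apply_zero (p : ℝ × ℝ) : prodToPlane p 0 = p.1 := rfl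

@[simp] theorem prodToPlane_apply_one (p : ℝ × ℝ) : prodToPlane p 1 = p.2 := rfl

theorem measurePreserving_prodToPlane : MeasurePreserving prodToPlane :=
  ((volume_preserving_finTwoArrow ℝ).symm _).trans
    (EuclideanSpace.volume_preserving_symm_measurableEquiv_toLp (Fin 2)).symm

theorem HasDerivAt.plane_apply {u : ℝ → Plane} {u' : Plane} {t : ℝ} (h : HasDerivAt u u' t)
    (i : Fin 2) : HasDerivAt (fun t => u t i) (u' i) t :=
  ((EuclideanSpace.proj i : Plane →L[ℝ] ℝ).hasFDerivAt).comp_hasDerivAt t h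

theorem HasDerivAt.cross {u v : ℝ → Plane} {u' v' : Plane} {t : ℝ} (hu : HasDerivAt u u' t)
    (hv : HasDerivAt v v' t) :
    HasDerivAt (fun t => cross (u t) (v t)) (cross u' (v t) + cross (u t) v') t := by
  refine (((hu.plane_apply 0).mul (hv.plane_apply 1)).sub
    ((hu.plane_apply 1).mul (hv.plane_apply 0))).congr_deriv ?_
  simp only [_root_.cross]; ring

theorem Differentiable.cross {E : Type*} [NormedAddCommGroup E] [NormedSpace ℝ E] {u v : E → Plane}
    (hu : Differentiable ℝ u) (hv : Differentiable ℝ v) :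
    Differentiable ℝ fun x => cross (u x) (v x) := by
  have hu' := differentiable_piLp 2 |>.1 hu
  have hv' := differentiable_piLp 2 |>.1 hv
  exact ((hu' 0).mul (hv' 1)).sub ((hu' 1).mul (hv' 0))

theorem Continuous.cross {E : Type*} [TopologicalSpace E] {u v : E → Plane}
    (hu : Continuous u) (hv : Continuous v) : Continuous fun x => cross (u x) (v x) := by
  simp only [_root_.cross]; fun_prop

theorem plane_eq_basis (w : Plane) :
    w = w 0 • EuclideanSpace.single 0 (1 : ℝ) + w 1 • EuclideanSpace.single 1 (1 : ℝ) := by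
  apply plane_ext <;> simp

/-- The identity `tr L · det (w, v) = det (L w, v) + det (w, L v)` for `L` the differential of `X`;
it turns the divergence into a divergence in the parameters of a fan. -/
theorem divergence_mul_cross (X : Plane → Plane) (x w v : Plane) :
    divergence X x * cross w v = cross (fderiv ℝ X x w) v + cross w (fderiv ℝ X x v) := by
  have hw := congrArg (fderiv ℝ X x) (plane_eq_basis w)
  have hv := congrArg (fderiv ℝ X x) (plane_eq_basis v)
  rw [map_add, map_smul, map_smul] at hw hv
  rw [hw, hv, divergence, Fin.sum_univ_two]
  simp only [cross, PiLp.add_apply, PiLp.smul_apply, smul_eq_mul]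
  ring

theorem continuous_divergence {X : Plane → Plane} (hX : ContDiff ℝ 1 X) :
    Continuous (divergence X) := by
  have h := hX.continuous_fderiv one_ne_zero
  have : divergence X = fun x => ∑ i : Fin 2, fderiv ℝ X x (EuclideanSpace.single i 1) i := rfl
  rw [this]
  fun_prop

/-- The fan with apex `O` over the curve `c`. -/
noncomputable def fan (O : Plane) (c : ℝ → Plane) (p : ℝ × ℝ) : Plane := O + p.1 • (c p.2 - O)

/-- Change of variables: the Jacobian of `(s, t) ↦ O + s (c t - O)` is `s · cross (c t - O) (c' t)`.
Its nonnegativity is assumed in order to drop the absolute value. -/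
theorem setIntegral_fan {O : Plane} {c c' : ℝ → Plane} (hc : ∀ t, HasDerivAt c (c' t) t)
    {S : Set (ℝ × ℝ)} (hS : MeasurableSet S) (hinj : InjOn (fan O c) S)
    (hpos : ∀ p ∈ S, 0 ≤ p.1 * cross (c p.2 - O) (c' p.2)) (f : Plane → ℝ) :
    ∫ x in fan O c '' S, f x =
      ∫ p in S, f (fan O c p) * (p.1 * cross (c p.2 - O) (c' p.2)) := by
  set e := prodToPlane with he
  let g : ℝ × ℝ → ℝ × ℝ := fun p => (O 0 + p.1 * (c p.2 0 - O 0), O 1 + p.1 * (c p.2 1 - O 1))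
  have hge : ∀ p, e (g p) = fan O c p := fun p => by apply plane_ext <;> simp [e, g, fan]
  let g' : ℝ × ℝ → ℝ × ℝ →L[ℝ] ℝ × ℝ := fun p =>
    (Matrix.toLin (.finTwoProd ℝ) (.finTwoProd ℝ)
      !![c p.2 0 - O 0, p.1 * c' p.2 0; c p.2 1 - O 1, p.1 * c' p.2 1]).toContinuousLinearMap
  have hg : ∀ p, HasFDerivAt g (g' p) p := by
    intro p
    simp only [g']
    rw [Matrix.toLin_finTwoProd_toContinuousLinearMap]
    have h : ∀ i : Fin 2, HasFDerivAt (fun p : ℝ × ℝ => O i + p.1 * (c p.2 i - O i))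
        (p.1 • (c' p.2 i • ContinuousLinearMap.snd ℝ ℝ ℝ) +
          (c p.2 i - O i) • ContinuousLinearMap.fst ℝ ℝ ℝ) p := fun i =>
      ((hasFDerivAt_fst (p := p)).mul
        ((((hc p.2).plane_apply i).comp_hasFDerivAt p (f := Prod.snd)
          (hasFDerivAt_snd (p := p))).sub_const (O i))).const_add (O i)
    refine ((h 0).prodMk (h 1)).congr_fderiv ?_
    ext <;> simp
  have hdet : ∀ p, (g' p).det = p.1 * cross (c p.2 - O) (c' p.2) := by
    intro p
    simp only [g', LinearMap.det_toContinuousLinearMap, LinearMap.det_toLin,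
      Matrix.det_fin_two_of, cross, PiLp.sub_apply]
    ring
  have hginj : InjOn g S := fun p hp p' hp' h => hinj hp hp' (by rw [← hge, ← hge, h])
  have himg : e ⁻¹' (fan O c '' S) = g '' S := by
    ext x
    simp only [mem_preimage, mem_image, ← hge]
    exact ⟨fun ⟨p, hp, h⟩ => ⟨p, hp, e.injective h⟩, fun ⟨p, hp, h⟩ => ⟨p, hp, by rw [h]⟩⟩
  rw [← measurePreserving_prodToPlane.setIntegral_preimage_emb e.measurableEmbedding f, himg,
    integral_image_eq_integral_abs_det_fderiv_smul volume hS
      (fun p _ => (hg p).hasFDerivWithinAt) hginj]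
  refine setIntegral_congr_fun hS fun p hp => ?_
  rw [hge, hdet, smul_eq_mul, abs_of_nonneg (hpos p hp), mul_comm]

/-- The flux of `X` through the segment from `A` to `B`, towards the right. -/
noncomputable def segFlux (X : Plane → Plane) (A B : Plane) : ℝ :=
  ∫ t in (0 : ℝ)..1, cross (X (A + t • (B - A))) (B - A)

/-- In the parameters `(s, t)` the integrand is `∂f/∂s + ∂g/∂t`, so the divergence theorem on a
rectangle applies. The side `s = 0` contributes nothing, the side `s = 1` gives the flux through the
curve, and the other two give the fluxes through the segments from the apex. The interval `Ioc 0 1`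
leaves out the apex, where the fan is not injective. -/
theorem setIntegral_divergence_fan {O : Plane} {c c' c'' : ℝ → Plane}
    (hc : ∀ t, HasDerivAt c (c' t) t) (hc' : ∀ t, HasDerivAt c' (c'' t) t) {a b : ℝ} (hab : a ≤ b)
    (hinj : InjOn (fan O c) (Ioc 0 1 ×ˢ Icc a b))
    (hpos : ∀ t ∈ Icc a b, 0 ≤ cross (c t - O) (c' t)) {X : Plane → Plane} (hX : ContDiff ℝ 1 X) :
    ∫ x in fan O c '' (Ioc 0 1 ×ˢ Icc a b), divergence X x =
      segFlux X O (c a) + (∫ t in a..b, cross (X (c t)) (c' t)) - segFlux X O (c b) := by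
  have hXd : Differentiable ℝ X := hX.differentiable one_ne_zero
  have hcd : Differentiable ℝ c := fun t => (hc t).differentiableAt
  have hcd' : Differentiable ℝ c' := fun t => (hc' t).differentiableAt
  have hfan : Differentiable ℝ (fan O c) :=
    fun p => ((differentiable_fst p).smul
      (((hcd _).comp p (differentiable_snd p)).sub_const O)).const_add O
  have hfs : ∀ s t, HasDerivAt (fun s => fan O c (s, t)) (c t - O) s := fun s t => by
    simpa [fan] using ((hasDerivAt_id s).smul_const (c t - O)).const_add O
  have hft : ∀ s t, HasDerivAt (fun t => fan O c (s, t)) (s • c' t) t := fun s t => by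
    simpa [fan] using (((hc t).sub_const O).const_smul s).const_add O
  have hXs : ∀ s t, HasDerivAt (fun s => X (fan O c (s, t)))
      (fderiv ℝ X (fan O c (s, t)) (c t - O)) s := fun s t =>
    (hXd _).hasFDerivAt.comp_hasDerivAt s (hfs s t)
  have hXt : ∀ s t, HasDerivAt (fun t => X (fan O c (s, t)))
      (fderiv ℝ X (fan O c (s, t)) (s • c' t)) t := fun s t =>
    (hXd _).hasFDerivAt.comp_hasDerivAt t (hft s t)
  let f : ℝ × ℝ → ℝ := fun p => p.1 * cross (X (fan O c p)) (c' p.2)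
  let g : ℝ × ℝ → ℝ := fun p => cross (c p.2 - O) (X (fan O c p))
  have hf : Differentiable ℝ f :=
    differentiable_fst.mul ((hXd.comp hfan).cross (hcd'.comp differentiable_snd))
  have hg : Differentiable ℝ g :=
    ((hcd.comp differentiable_snd).sub (differentiable_const O)).cross (hXd.comp hfan)
  have hsum : ∀ p, fderiv ℝ f p (1, 0) + fderiv ℝ g p (0, 1) =
      divergence X (fan O c p) * (p.1 * cross (c p.2 - O) (c' p.2)) := by
    rintro ⟨s, t⟩
    have h1 : HasDerivAt (fun s => f (s, t)) (fderiv ℝ f (s, t) (1, 0)) s :=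
      HasFDerivAt.comp_hasDerivAt (f := fun s : ℝ => (s, t)) s (hf (s, t)).hasFDerivAt
        ((hasDerivAt_id s).prodMk (hasDerivAt_const s t))
    have h1' : HasDerivAt (fun s => f (s, t)) _ s :=
      (hasDerivAt_id s).mul ((hXs s t).cross (hasDerivAt_const s (c' t)))
    have h2 : HasDerivAt (fun t => g (s, t)) (fderiv ℝ g (s, t) (0, 1)) t :=
      HasFDerivAt.comp_hasDerivAt (f := fun t : ℝ => (s, t)) t (hg (s, t)).hasFDerivAt
        ((hasDerivAt_const t s).prodMk (hasDerivAt_id t))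
    have h2' : HasDerivAt (fun t => g (s, t)) _ t := ((hc t).sub_const O).cross (hXt s t)
    rw [h1.unique h1', h2.unique h2']
    have h3 := divergence_mul_cross X (fan O c (s, t)) (c t - O) (c' t)
    rw [map_smul]
    simp only [id_eq, one_mul, cross, PiLp.smul_apply, smul_eq_mul, PiLp.zero_apply, mul_zero,
      sub_zero, add_zero] at h3 ⊢
    linear_combination (-s) * h3
  have hcont : Continuous fun p : ℝ × ℝ =>
      divergence X (fan O c p) * (p.1 * cross (c p.2 - O) (c' p.2)) :=
    ((continuous_divergence hX).comp hfan.continuous).mul (continuous_fst.mul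
      (((hcd.continuous.comp continuous_snd).sub continuous_const).cross
        (hcd'.continuous.comp continuous_snd)))
  have hdiv := integral_divergence_prod_Icc_of_hasFDerivAt_of_le f g (fderiv ℝ f) (fderiv ℝ g)
    (0, a) (1, b) ⟨zero_le_one, hab⟩ hf.continuous.continuousOn hg.continuous.continuousOn
    (fun x _ => (hf x).hasFDerivAt) (fun x _ => (hg x).hasFDerivAt)
    (by simp only [hsum]; exact hcont.continuousOn.integrableOn_compact isCompact_Icc)
  simp only [hsum] at hdiv
  rw [setIntegral_fan hc (measurableSet_Ioc.prod measurableSet_Icc) hinj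
    (fun p hp => mul_nonneg hp.1.1.le (hpos p.2 hp.2))]
  have hae : (Ioc (0 : ℝ) 1 ×ˢ Icc a b : Set (ℝ × ℝ)) =ᵐ[volume] Icc ((0 : ℝ), a) (1, b) := by
    rw [show Icc ((0 : ℝ), a) (1, b) = Icc 0 1 ×ˢ Icc a b from (Icc_prod_Icc 0 1 a b).symm]
    exact Measure.set_prod_ae_eq Ioc_ae_eq_Icc Filter.EventuallyEq.rfl
  rw [setIntegral_congr_set hae, hdiv]
  -- The minus sign is the antisymmetry of `cross`.
  have hseg : ∀ t, (∫ s in (0 : ℝ)..1, g (s, t)) = - segFlux X O (c t) := by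
    intro t
    rw [segFlux, ← intervalIntegral.integral_neg]
    congr 1; funext s
    simp only [g, fan, cross]; ring
  simp only [hseg]
  simp [f, fan]
  ring

/-! ### Oblique coordinates -/

/-- The first oblique coordinate in the frame `q`, `dir α`, `dir (α + π / 3)`. -/
noncomputable def coordA (q : Plane) (α : ℝ) (x : Plane) : ℝ :=
  2 / Real.sqrt 3 * cross (x - q) (dir (α + Real.pi / 3))

/-- The second oblique coordinate in the frame `q`, `dir α`, `dir (α + π / 3)`. -/
noncomputable def coordB (q : Plane) (α : ℝ) (x : Plane) : ℝ :=
  2 / Real.sqrt 3 * cross (dir α) (x - q)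

theorem cross_frame (α : ℝ) : cross (dir α) (dir (α + Real.pi / 3)) = Real.sqrt 3 / 2 := by
  rw [cross_dir_dir, add_sub_cancel_left, Real.sin_pi_div_three]

@[simp] theorem coordA_eis (q : Plane) (α a b : ℝ) : coordA q α (eis q α a b) = a := by
  have h3 : Real.sqrt 3 ≠ 0 := by positivity
  have h := cross_frame α
  simp only [coordA, eis, cross, PiLp.sub_apply, PiLp.add_apply, PiLp.smul_apply,
    smul_eq_mul] at h ⊢
  generalize dir (α + Real.pi / 3) = v at *
  field_simp
  linear_combination 2 * a * h

@[simp] theorem coordB_eis (q : Plane) (α a b : ℝ) : coordB q α (eis q α a b) = b := by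
  have h3 : Real.sqrt 3 ≠ 0 := by positivity
  have h := cross_frame α
  simp only [coordB, eis, cross, PiLp.sub_apply, PiLp.add_apply, PiLp.smul_apply,
    smul_eq_mul] at h ⊢
  generalize dir (α + Real.pi / 3) = v at *
  field_simp
  linear_combination 2 * b * h

theorem coord_rotate (q : Plane) (α : ℝ) (x : Plane) :
    coordA q (α + 2 * Real.pi / 3) x = coordB q α x ∧
      coordB q (α + 2 * Real.pi / 3) x = -coordA q α x - coordB q α x := by
  obtain ⟨a, b, rfl⟩ := exists_eis q (α + 2 * Real.pi / 3) x
  rw [coordA_eis, coordB_eis, eis_rotate, coordA_eis, coordB_eis]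
  exact ⟨rfl, by ring⟩

theorem coord_shift (q : Plane) (α a b : ℝ) (x : Plane) :
    coordA (eis q α a b) α x = coordA q α x - a ∧
      coordB (eis q α a b) α x = coordB q α x - b := by
  obtain ⟨a', b', rfl⟩ := exists_eis (eis q α a b) α x
  rw [coordA_eis, coordB_eis, eis_eis, coordA_eis, coordB_eis]
  exact ⟨by ring, by ring⟩

@[fun_prop] theorem continuous_coordA (q : Plane) (α : ℝ) : Continuous (coordA q α) := by
  unfold coordA cross; fun_prop

@[fun_prop] theorem continuous_coordB (q : Plane) (α : ℝ) : Continuous (coordB q α) := by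
  unfold coordB cross; fun_prop

theorem eis_smul_vsub_vadd (q : Plane) (α c a b a' b' a'' b'' : ℝ) :
    c • (eis q α a b - eis q α a' b') + eis q α a'' b'' =
      eis q α (c * (a - a') + a'') (c * (b - b') + b'') := by
  simp only [eis]; module

theorem volume_line (q : Plane) (α : ℝ) {l m : ℝ} (n : ℝ) (h : l ≠ 0 ∨ m ≠ 0) :
    volume {x | l * coordA q α x + m * coordB q α x = n} = 0 := by
  let s : AffineSubspace ℝ Plane :=
    { carrier := {x | l * coordA q α x + m * coordB q α x = n}
      smul_vsub_vadd_mem' := by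
        intro c x y z hx hy hz
        obtain ⟨a, b, rfl⟩ := exists_eis q α x
        obtain ⟨a', b', rfl⟩ := exists_eis q α y
        obtain ⟨a'', b'', rfl⟩ := exists_eis q α z
        simp only [mem_ofPred_eq, coordA_eis, coordB_eis, vsub_eq_sub, vadd_eq_add,
          eis_smul_vsub_vadd] at *
        linear_combination c * hx - c * hy + hz }
  -- The affine subspace is proper: otherwise the values at three points give `l = m = 0`.
  refine Measure.addHaar_affineSubspace volume s fun hs => ?_
  have hmem : ∀ x, l * coordA q α x + m * coordB q α x = n := fun x => by
    have : x ∈ s := hs ▸ AffineSubspace.mem_top ℝ Plane x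
    exact this
  have h0 := hmem (eis q α 0 0)
  have h1 := hmem (eis q α 1 0)
  have h2 := hmem (eis q α 0 1)
  simp only [coordA_eis, coordB_eis] at h0 h1 h2
  rcases h with h | h <;> apply h <;> linarith

theorem isBounded_of_coord {q : Plane} {α C : ℝ} {E : Set Plane}
    (h : ∀ x ∈ E, |coordA q α x| ≤ C ∧ |coordB q α x| ≤ C) : Bornology.IsBounded E := by
  refine (Metric.isBounded_iff_subset_closedBall q).2 ⟨2 * C, fun x hx => ?_⟩
  obtain ⟨a, b, rfl⟩ := exists_eis q α x
  have := h _ hx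
  rw [coordA_eis, coordB_eis] at this
  rw [mem_closedBall_iff_norm, show eis q α a b - q = a • dir α + b • dir (α + Real.pi / 3) by
    simp only [eis]; module]
  refine (norm_add_le _ _).trans ?_
  rw [norm_smul, norm_smul, norm_dir, norm_dir, Real.norm_eq_abs, Real.norm_eq_abs]
  linarith

/-! ### Flux functionals -/

/-- The set `E` is bounded, and the integral of a divergence over `E` is given by `Φ`. -/
structure HasFlux (E : Set Plane) (Φ : (Plane → Plane) → ℝ) : Prop where
  nullMeasurableSet : NullMeasurableSet E
  isBounded : Bornology.IsBounded E
  integral_eq : ∀ X, ContDiff ℝ 1 X → ∫ x in E, divergence X x = Φ X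

theorem integrableOn_divergence {X : Plane → Plane} (hX : ContDiff ℝ 1 X) {E : Set Plane}
    (hE : Bornology.IsBounded E) : IntegrableOn (divergence X) E := by
  obtain ⟨R, hR⟩ := hE.subset_closedBall 0
  exact ((continuous_divergence hX).continuousOn.integrableOn_compact
    (isCompact_closedBall (0 : Plane) R)).mono_set hR

namespace HasFlux

variable {E F : Set Plane} {Φ Ψ : (Plane → Plane) → ℝ}

theorem congr (h : HasFlux E Φ) (hΦ : ∀ X, ContDiff ℝ 1 X → Φ X = Ψ X) : HasFlux E Ψ :=
  ⟨h.1, h.2, fun X hX => (h.3 X hX).trans (hΦ X hX)⟩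

theorem congr_ae (h : HasFlux E Φ) (hF : Bornology.IsBounded F) (hEF : E =ᵐ[volume] F) :
    HasFlux F Φ :=
  ⟨h.1.congr hEF, hF, fun X hX => by rw [← setIntegral_congr_set hEF, h.3 X hX]⟩

theorem union (h : HasFlux E Φ) (h' : HasFlux F Ψ) (hd : AEDisjoint volume E F) :
    HasFlux (E ∪ F) fun X => Φ X + Ψ X :=
  ⟨h.1.union h'.1, h.2.union h'.2, fun X hX => by
    rw [setIntegral_union₀ hd h'.1 (integrableOn_divergence hX h.2)
      (integrableOn_divergence hX h'.2), h.3 X hX, h'.3 X hX]⟩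

/-- Cutting pieces off a simple region yields the fluxes of corners, hexagons and chipped hexagons,
without parametrizing these regions. -/
theorem of_union (h : HasFlux (E ∪ F) Φ) (h' : HasFlux F Ψ) (hE : NullMeasurableSet E)
    (hd : AEDisjoint volume E F) : HasFlux E fun X => Φ X - Ψ X :=
  ⟨hE, h.2.subset subset_union_left, fun X hX => by
    rw [← h.3 X hX, setIntegral_union₀ hd h'.1
      (integrableOn_divergence hX (h.2.subset subset_union_left))
      (integrableOn_divergence hX h'.2), h'.3 X hX]; ring⟩

theorem divergence_id (x : Plane) : divergence (fun y => y) x = 2 := by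
  simp [divergence]

/-- The identity field has divergence 2, so the same boundary formulas also give the areas. -/
theorem two_mul_area (h : HasFlux E Φ) : 2 * volume.real E = Φ fun y => y := by
  rw [← h.3 (fun y => y) contDiff_id]
  simp [divergence_id, mul_comm]

end HasFlux

/-! ### Flux through segments -/

theorem segFlux_line (X : Plane → Plane) (A v : Plane) (a b : ℝ) :
    segFlux X (A + a • v) (A + b • v) = ∫ t in a..b, cross (X (A + t • v)) v := by
  rw [segFlux]
  have h1 : A + b • v - (A + a • v) = (b - a) • v := by module
  simp only [h1]
  have h2 : ∀ t : ℝ, cross (X (A + a • v + t • (b - a) • v)) ((b - a) • v) =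
      (b - a) * cross (X (A + (a + (b - a) * t) • v)) v := by
    intro t
    rw [show A + a • v + t • (b - a) • v = A + (a + (b - a) * t) • v by module]
    simp only [cross, PiLp.smul_apply, smul_eq_mul]; ring
  simp only [h2]
  have := intervalIntegral.mul_integral_comp_add_mul (a := 0) (b := 1)
    (f := fun s => cross (X (A + s • v)) v) (b - a) a
  rw [intervalIntegral.integral_const_mul, this]
  simp

theorem continuous_cross_line {X : Plane → Plane} (hX : Continuous X) (A v w : Plane) :
    Continuous fun t : ℝ => cross (X (A + t • v)) w := by
  unfold cross; fun_prop

theorem segFlux_comm (X : Plane → Plane) (A B : Plane) : segFlux X A B = -segFlux X B A := by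
  have h0 : A + (0 : ℝ) • (B - A) = A := by module
  have h1 : A + (1 : ℝ) • (B - A) = B := by module
  have h := segFlux_line X A (B - A)
  have h01 := h 0 1
  have h10 := h 1 0
  rw [h0, h1] at h01 h10
  rw [h01, h10, intervalIntegral.integral_symm]

theorem segFlux_add {X : Plane → Plane} (hX : Continuous X) (A v : Plane) (a b c : ℝ) :
    segFlux X (A + a • v) (A + b • v) + segFlux X (A + b • v) (A + c • v) =
      segFlux X (A + a • v) (A + c • v) := by
  have hc := continuous_cross_line hX A v v
  rw [segFlux_line, segFlux_line, segFlux_line,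
    intervalIntegral.integral_add_adjacent_intervals (hc.intervalIntegrable _ _)
      (hc.intervalIntegrable _ _)]

/-! ### Triangles -/

/-- The closed triangle with vertices `O`, `O + u`, `O + v`. -/
def tri (O u v : Plane) : Set Plane :=
  {z | ∃ x y : ℝ, 0 ≤ x ∧ 0 ≤ y ∧ x + y ≤ 1 ∧ z = O + x • u + y • v}

theorem cross_combo (u v : Plane) (x y x' y' : ℝ) :
    cross (x • u + y • v) (x' • u + y' • v) = (x * y' - y * x') * cross u v := by
  simp only [cross, PiLp.add_apply, PiLp.smul_apply, smul_eq_mul]; ring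

theorem combo_injective {u v : Plane} (h : cross u v ≠ 0) {x y x' y' : ℝ}
    (hxy : x • u + y • v = x' • u + y' • v) : x = x' ∧ y = y' := by
  have h0 := cross_combo u v (x - x') (y - y') 1 0
  have h1 := cross_combo u v (x - x') (y - y') 0 1
  have hz : (x - x') • u + (y - y') • v = 0 := by
    have := sub_eq_zero.2 hxy
    rw [← this]; module
  rw [hz] at h0 h1
  simp only [cross, PiLp.zero_apply, zero_mul, sub_zero, mul_one, mul_zero, zero_sub] at h0 h1
  have e0 := (mul_eq_zero.1 h0.symm).resolve_right h
  have e1 := (mul_eq_zero.1 h1.symm).resolve_right h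
  constructor <;> linarith

theorem isBounded_tri (O u v : Plane) : Bornology.IsBounded (tri O u v) := by
  refine (Metric.isBounded_iff_subset_closedBall O).2 ⟨‖u‖ + ‖v‖, ?_⟩
  rintro _ ⟨x, y, hx, hy, hxy, rfl⟩
  rw [mem_closedBall_iff_norm, show O + x • u + y • v - O = x • u + y • v by module]
  refine (norm_add_le _ _).trans ?_
  rw [norm_smul, norm_smul, Real.norm_of_nonneg hx, Real.norm_of_nonneg hy]
  exact add_le_add (mul_le_of_le_one_left (norm_nonneg _) (by linarith))
    (mul_le_of_le_one_left (norm_nonneg _) (by linarith))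

theorem hasFlux_tri {O u v : Plane} (h : 0 < cross u v) :
    HasFlux (tri O u v) fun X =>
      segFlux X O (O + u) + segFlux X (O + u) (O + v) + segFlux X (O + v) O := by
  -- The triangle is the fan with apex `O` over the opposite side, up to the apex itself.
  let c : ℝ → Plane := fun t => O + u + t • (v - u)
  have hc : ∀ t, HasDerivAt c (v - u) t := fun t => by
    refine (((hasDerivAt_id t).smul_const (v - u)).const_add (O + u)).congr_deriv (one_smul _ _)
  have hc' : ∀ t : ℝ, HasDerivAt (fun _ : ℝ => v - u) 0 t := fun t => hasDerivAt_const t _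
  have hfan : ∀ p : ℝ × ℝ, fan O c p = O + ((p.1 * (1 - p.2)) • u + (p.1 * p.2) • v) := fun p => by
    simp only [fan, c]; module
  have hinj : InjOn (fan O c) (Ioc 0 1 ×ˢ Icc 0 1) := by
    rintro ⟨s, t⟩ ⟨hs, ht⟩ ⟨s', t'⟩ ⟨hs', ht'⟩ heq
    rw [hfan, hfan] at heq
    obtain ⟨h1, h2⟩ := combo_injective h.ne' (add_left_cancel heq)
    simp only at h1 h2 hs hs'
    have e : s = s' := by linarith
    subst e
    exact Prod.ext rfl (mul_left_cancel₀ hs.1.ne' h2)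
  have hpos : ∀ t ∈ Icc (0 : ℝ) 1, 0 ≤ cross (c t - O) (v - u) := by
    intro t _
    have : cross (c t - O) (v - u) = cross u v := by
      simp only [c, cross, PiLp.sub_apply, PiLp.add_apply, PiLp.smul_apply, smul_eq_mul]; ring
    rw [this]; exact h.le
  have himg : fan O c '' (Ioc 0 1 ×ˢ Icc 0 1) =ᵐ[volume] tri O u v := by
    have hsub : fan O c '' (Ioc 0 1 ×ˢ Icc 0 1) ⊆ tri O u v := by
      rintro _ ⟨⟨s, t⟩, ⟨hs, ht⟩, rfl⟩
      exact ⟨s * (1 - t), s * t, mul_nonneg hs.1.le (by linarith [ht.2]),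
        mul_nonneg hs.1.le ht.1, by linarith [hs.2], by rw [hfan]; module⟩
    refine ae_eq_set.2 ⟨by rw [sdiff_eq_empty.2 hsub]; simp, measure_mono_null ?_
      (measure_singleton O)⟩
    rintro z ⟨⟨x, y, hx, hy, hxy, rfl⟩, hz⟩
    by_contra hO
    apply hz
    have hpos : 0 < x + y := by
      refine lt_of_le_of_ne (by linarith) fun h0 => hO ?_
      have : x = 0 := by linarith
      have : y = 0 := by linarith
      subst_vars; simp
    -- Inverse of the fan map: `x + y` is the height above the apex, `y / (x + y)` the position
    -- along the opposite side.
    refine ⟨(x + y, y / (x + y)), ⟨⟨hpos, hxy⟩, ⟨by positivity, ?_⟩⟩, ?_⟩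
    · rw [div_le_one hpos]; linarith
    · rw [hfan]
      have h1 : (x + y) * (y / (x + y)) = y := by field_simp
      have h2 : (x + y) * (1 - y / (x + y)) = x := by rw [mul_sub, h1]; ring
      simp only [h1, h2]; module
  have hmeas : NullMeasurableSet (tri O u v) := by
    refine NullMeasurableSet.congr (MeasurableSet.nullMeasurableSet ?_) himg
    have : (fan O c) = fun p => O + ((p.1 * (1 - p.2)) • u + (p.1 * p.2) • v) := funext hfan
    exact (measurableSet_Ioc.prod measurableSet_Icc).image_of_continuousOn_injOn
      (by rw [this]; fun_prop) hinj
  refine ⟨hmeas, isBounded_tri _ _ _, fun X hX => ?_⟩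
  rw [← setIntegral_congr_set himg, setIntegral_divergence_fan hc hc' zero_le_one hinj hpos hX,
    segFlux_comm X (O + v) O]
  have e0 : c 0 = O + u := by simp [c]
  have e1 : c 1 = O + v := by simp [c]
  have e2 : segFlux X (O + u) (O + v) = ∫ t in (0 : ℝ)..1, cross (X (c t)) (v - u) := by
    rw [segFlux, show O + v - (O + u) = v - u by module]
  rw [e0, e1, e2]
  ring

/-! ### Circular sectors and corners of Reuleaux triangles -/

theorem dir_add_eq (α φ : ℝ) : dir (α + φ) =
    (Real.cos φ - Real.sin φ / Real.sqrt 3) • dir α +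
      (2 / Real.sqrt 3 * Real.sin φ) • dir (α + Real.pi / 3) := by
  have h3 : Real.sqrt 3 ≠ 0 := by positivity
  have := sq_sqrt_three
  apply plane_ext <;> simp [Real.cos_add, Real.sin_add] <;> field_simp <;> ring

theorem cross_smul_smul (r s : ℝ) (u v : Plane) : cross (r • u) (s • v) = r * s * cross u v := by
  simp only [cross, PiLp.smul_apply, smul_eq_mul]; ring

theorem exists_polar (φ : ℝ) (y : Plane) :
    ∃ t ∈ Ioc (-Real.pi) Real.pi, y = ‖y‖ • dir (φ + t) := by
  set z : ℂ := ⟨y 0, y 1⟩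
  have hz : ‖z‖ = ‖y‖ := by
    have : ‖z‖ ^ 2 = ‖y‖ ^ 2 := by
      rw [norm_sq_plane, Complex.sq_norm, Complex.normSq_apply]; simp only [z]; ring
    exact (pow_left_inj₀ (norm_nonneg _) (norm_nonneg _) two_ne_zero).1 this
  have hy : y = ‖y‖ • dir (Complex.arg z) := by
    apply plane_ext
    · simp [← hz, Complex.norm_mul_cos_arg, z]
    · simp [← hz, Complex.norm_mul_sin_arg, z]
  refine ⟨toIocMod Real.two_pi_pos (-Real.pi) (Complex.arg z - φ), ?_, ?_⟩
  · have := toIocMod_mem_Ioc Real.two_pi_pos (-Real.pi) (Complex.arg z - φ)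
    exact ⟨this.1, by linarith [this.2]⟩
  · have h := self_sub_toIocDiv_zsmul Real.two_pi_pos (-Real.pi) (Complex.arg z - φ)
    rw [zsmul_eq_mul] at h
    have : Complex.arg z = φ + toIocMod Real.two_pi_pos (-Real.pi) (Complex.arg z - φ) +
        (toIocDiv Real.two_pi_pos (-Real.pi) (Complex.arg z - φ) : ℤ) * (2 * Real.pi) := by
      linarith
    rw [this, dir_add_int_mul] at hy
    exact hy

/-- The closed circular sector with apex `p`, opening angle `π / 3`, radius `√3 ρ` and initial
direction `dir (α + π / 6)`. -/
def sector (p : Plane) (α ρ : ℝ) : Set Plane :=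
  {x | coordA p α x ≤ coordB p α x ∧ 0 ≤ 2 * coordA p α x + coordB p α x ∧
    coordA p α x ^ 2 + coordA p α x * coordB p α x + coordB p α x ^ 2 ≤ 3 * ρ ^ 2}

/-- The outward flux through the circular arc of opening angle `π / 3`, with center `p`, radius `r`
and initial direction `dir φ`. -/
noncomputable def arcFlux (X : Plane → Plane) (p : Plane) (r φ : ℝ) : ℝ :=
  ∫ t in (0 : ℝ)..Real.pi / 3, cross (X (p + r • dir (φ + t))) (r • dir (φ + t + Real.pi / 2))

theorem coord_polar (p : Plane) (α s t : ℝ) :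
    p + s • dir (α + t) = eis p α (s * (Real.cos t - Real.sin t / Real.sqrt 3))
      (s * (2 / Real.sqrt 3 * Real.sin t)) := by
  rw [eis, dir_add_eq α t]; module

theorem dist_sq_coord (q : Plane) (α : ℝ) (x : Plane) :
    ‖x - q‖ ^ 2 = coordA q α x ^ 2 + coordA q α x * coordB q α x + coordB q α x ^ 2 := by
  obtain ⟨a, b, rfl⟩ := exists_eis q α x
  rw [coordA_eis, coordB_eis, ← norm_sq_oblique α a b]
  congr 2
  simp only [eis]; module

theorem hasFlux_sector (p : Plane) (α : ℝ) {ρ : ℝ} (hρ : 0 < ρ) :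
    HasFlux (sector p α ρ) fun X =>
      segFlux X p (p + (Real.sqrt 3 * ρ) • dir (α + Real.pi / 6)) +
        arcFlux X p (Real.sqrt 3 * ρ) (α + Real.pi / 6) -
        segFlux X p (p + (Real.sqrt 3 * ρ) • dir (α + Real.pi / 6 + Real.pi / 3)) := by
  set r := Real.sqrt 3 * ρ with hr
  have hr0 : 0 < r := by positivity
  have hr2 : r ^ 2 = 3 * ρ ^ 2 := by rw [hr, mul_pow, Real.sq_sqrt (by norm_num)]
  have hπ := Real.pi_pos
  have h3 : 0 < Real.sqrt 3 := by positivity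
  set φ := α + Real.pi / 6 with hφ
  -- The sector is the fan over its own arc. The factor `1 *` matches the form of
  -- `hasDerivAt_dir_affine`.
  let c : ℝ → Plane := fun t => p + r • dir (φ + 1 * t)
  have hc : ∀ t, HasDerivAt c (r • dir (φ + Real.pi / 2 + 1 * t)) t := fun t => by
    refine (((hasDerivAt_dir_affine φ 1 t).const_smul r).const_add p).congr_deriv ?_
    rw [one_smul]; congr 2; ring
  have hc' : ∀ t : ℝ, HasDerivAt (fun t : ℝ => r • dir (φ + Real.pi / 2 + 1 * t)) _ t := fun t =>
    (hasDerivAt_dir_affine (φ + Real.pi / 2) 1 t).const_smul r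
  have hfan : ∀ x : ℝ × ℝ, fan p c x = p + (x.1 * r) • dir (φ + x.2) := fun x => by
    simp only [fan, c, one_mul]; module
  have hinj : InjOn (fan p c) (Ioc 0 1 ×ˢ Icc 0 (Real.pi / 3)) := by
    rintro ⟨s, t⟩ ⟨hs, ht⟩ ⟨s', t'⟩ ⟨hs', ht'⟩ heq
    rw [hfan, hfan] at heq
    simp only at hs hs' ht ht'
    have h1 := add_left_cancel heq
    have h2 := congrArg norm h1
    rw [norm_smul, norm_smul, norm_dir, norm_dir, Real.norm_of_nonneg (by nlinarith [hs.1]),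
      Real.norm_of_nonneg (by nlinarith [hs'.1])] at h2
    have e : s = s' := by simpa [hr0.ne'] using h2
    subst e
    have h4 := smul_right_injective Plane (mul_pos hs.1 hr0).ne' h1
    obtain ⟨k, hk⟩ := dir_eq_dir_iff.1 h4
    simp only at hk
    -- Both parameters lie in an interval of length `π/3`, so a difference that is a multiple of
    -- `2π` vanishes.
    have hk0 : k = 0 := by
      have h5 : (k : ℝ) * (2 * Real.pi) < 1 * (2 * Real.pi) := by linarith [ht.1, ht'.2]
      have h6 : (-1 : ℝ) * (2 * Real.pi) < k * (2 * Real.pi) := by linarith [ht.2, ht'.1]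
      have h7 := lt_of_mul_lt_mul_right h5 (by positivity)
      have h8 := lt_of_mul_lt_mul_right h6 (by positivity)
      have : k < 1 := by exact_mod_cast h7
      have : -1 < k := by exact_mod_cast h8
      omega
    rw [hk0] at hk
    exact Prod.ext rfl (by push_cast at hk; simp only; linarith)
  have hpos : ∀ t ∈ Icc (0 : ℝ) (Real.pi / 3),
      0 ≤ cross (c t - p) (r • dir (φ + Real.pi / 2 + 1 * t)) := by
    intro t _
    have h1 : c t - p = r • dir (φ + t) := by simp [c]
    have h2 := cross_dir_dir (φ + t) (φ + Real.pi / 2 + 1 * t)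
    rw [show φ + Real.pi / 2 + 1 * t - (φ + t) = Real.pi / 2 by ring, Real.sin_pi_div_two] at h2
    rw [h1]
    have h4 : cross (r • dir (φ + t)) (r • dir (φ + Real.pi / 2 + 1 * t)) = r ^ 2 := by
      rw [cross_smul_smul, h2]; ring
    rw [h4]; positivity
  have hco : ∀ s t, p + s • dir (φ + t) = eis p α
      (s * (Real.cos (Real.pi / 6 + t) - Real.sin (Real.pi / 6 + t) / Real.sqrt 3))
      (s * (2 / Real.sqrt 3 * Real.sin (Real.pi / 6 + t))) := fun s t => by
    rw [← coord_polar, hφ, add_assoc]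
  -- In polar coordinates the two linear forms that define the sector are positive multiples of `sin
  -- t` and `cos (π/6 + t)`. For `t` in `(-π, π]` both are nonnegative exactly when `0 ≤ t ≤ π/3`.
  have hBA : ∀ s t, coordB p α (p + s • dir (φ + t)) - coordA p α (p + s • dir (φ + t)) =
      s * (2 * Real.sin t) := fun s t => by
    have := sq_sqrt_three
    rw [hco, coordA_eis, coordB_eis, Real.sin_add, Real.cos_add, Real.cos_pi_div_six,
      Real.sin_pi_div_six]
    field_simp
    linear_combination (-s * Real.cos t) * this
  have hAB : ∀ s t, 2 * coordA p α (p + s • dir (φ + t)) + coordB p α (p + s • dir (φ + t)) =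
      s * (2 * Real.cos (Real.pi / 6 + t)) := fun s t => by
    rw [hco, coordA_eis, coordB_eis]; field_simp; ring
  have himg : fan p c '' (Ioc 0 1 ×ˢ Icc 0 (Real.pi / 3)) =ᵐ[volume] sector p α ρ := by
    have hsub : fan p c '' (Ioc 0 1 ×ˢ Icc 0 (Real.pi / 3)) ⊆ sector p α ρ := by
      rintro _ ⟨⟨s, t⟩, ⟨hs, ht⟩, rfl⟩
      simp only at hs ht
      rw [hfan, sector, mem_ofPred_eq]
      refine ⟨?_, ?_, ?_⟩
      · have := hBA (s * r) t
        have h5 := Real.sin_nonneg_of_nonneg_of_le_pi ht.1 (by linarith [ht.2])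
        have h6 : 0 ≤ s * r * (2 * Real.sin t) := by have := hs.1; positivity
        linarith
      · rw [hAB]
        have h5 := Real.cos_nonneg_of_neg_pi_div_two_le_of_le (x := Real.pi / 6 + t)
          (by linarith [ht.1]) (by linarith [ht.2])
        have := hs.1; positivity
      · rw [← dist_sq_coord, add_sub_cancel_left, norm_smul, norm_dir, mul_one, Real.norm_eq_abs,
          sq_abs, mul_pow, hr2]
        have : s ^ 2 ≤ 1 := by nlinarith [hs.1, hs.2]
        nlinarith [sq_nonneg ρ]
    refine ae_eq_set.2 ⟨by rw [sdiff_eq_empty.2 hsub]; simp, measure_mono_null ?_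
      (measure_singleton p)⟩
    rintro x ⟨⟨h1, h2, hN⟩, hx⟩
    by_contra hxp
    apply hx
    obtain ⟨t, ht, hxt⟩ := exists_polar φ (x - p)
    have hn : 0 < ‖x - p‖ := norm_pos_iff.2 (sub_ne_zero.2 hxp)
    have hx' : x = p + ‖x - p‖ • dir (φ + t) := by rw [← hxt]; module
    have hA := hBA ‖x - p‖ t
    have hB := hAB ‖x - p‖ t
    rw [← hx'] at hA hB
    have hs0 : 0 ≤ Real.sin t := by
      have : 0 ≤ ‖x - p‖ * (2 * Real.sin t) := by rw [← hA]; linarith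
      have := (mul_nonneg_iff_of_pos_left hn).1 this
      linarith
    have hc0 : 0 ≤ Real.cos (Real.pi / 6 + t) := by
      have : 0 ≤ ‖x - p‖ * (2 * Real.cos (Real.pi / 6 + t)) := by rw [← hB]; linarith
      have := (mul_nonneg_iff_of_pos_left hn).1 this
      linarith
    have ht0 : 0 ≤ t := by
      by_contra h
      push Not at h
      linarith [Real.sin_neg_of_neg_of_neg_pi_lt h ht.1]
    have ht1 : t ≤ Real.pi / 3 := by
      by_contra h
      push Not at h
      linarith [Real.cos_neg_of_pi_div_two_lt_of_lt (x := Real.pi / 6 + t)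
        (by linarith) (by linarith [ht.2])]
    rw [← dist_sq_coord, ← hr2] at hN
    have hle : ‖x - p‖ ≤ r := (pow_le_pow_iff_left₀ hn.le hr0.le two_ne_zero).1 hN
    refine ⟨(‖x - p‖ / r, t), ⟨⟨by positivity, (div_le_one hr0).2 hle⟩, ht0, ht1⟩, ?_⟩
    rw [hfan]
    simp only [div_mul_cancel₀ _ hr0.ne']
    exact hx'.symm
  have hbdd : Bornology.IsBounded (sector p α ρ) := by
    refine (Metric.isBounded_iff_subset_closedBall p).2 ⟨r, fun x hx => ?_⟩
    rw [mem_closedBall_iff_norm]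
    have := hx.2.2
    rw [← dist_sq_coord, ← hr2] at this
    exact (pow_le_pow_iff_left₀ (norm_nonneg _) hr0.le two_ne_zero).1 this
  have hmeas : NullMeasurableSet (sector p α ρ) := by
    refine NullMeasurableSet.congr (MeasurableSet.nullMeasurableSet ?_) himg
    have : (fan p c) = fun x => p + (x.1 * r) • dir (φ + x.2) := funext hfan
    exact (measurableSet_Ioc.prod measurableSet_Icc).image_of_continuousOn_injOn
      (by rw [this]; fun_prop) hinj
  refine ⟨hmeas, hbdd, fun X hX => ?_⟩
  rw [← setIntegral_congr_set himg,
    setIntegral_divergence_fan hc hc' (by positivity) hinj hpos hX]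
  have e0 : c 0 = p + r • dir φ := by simp [c]
  have e1 : c (Real.pi / 3) = p + r • dir (φ + Real.pi / 3) := by simp [c]
  have e2 : ∀ t, φ + Real.pi / 2 + t = φ + t + Real.pi / 2 := fun t => by ring
  rw [e0, e1, arcFlux]
  simp only [c, one_mul, e2]

/-- The part of the Reuleaux triangle with center `q`, width `√3 ρ` and a vertex in the direction
`dir α` that lies between the rays from `q` with directions `dir α` and `dir (α + 2 π / 3)`. -/
def corner (q : Plane) (α ρ : ℝ) : Set Plane :=
  {x | 0 ≤ coordB q α x ∧ 0 ≤ coordA q α x + coordB q α x ∧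
    coordA q α x ^ 2 + coordA q α x * (coordB q α x + ρ) + (coordB q α x + ρ) ^ 2 ≤ 3 * ρ ^ 2}

/-- The outward flux through the circular arc of `corner q α ρ`. -/
noncomputable def cornerFlux (X : Plane → Plane) (q : Plane) (α ρ : ℝ) : ℝ :=
  arcFlux X (eis q α 0 (-ρ)) (Real.sqrt 3 * ρ) (α + Real.pi / 6)

theorem volume_line_subset {q : Plane} {α l m n : ℝ} (h : l ≠ 0 ∨ m ≠ 0) {E : Set Plane}
    (hE : ∀ a b, eis q α a b ∈ E → l * a + m * b = n) : volume E = 0 := by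
  refine measure_mono_null (fun x hx => ?_) (volume_line q α n h)
  obtain ⟨a, b, rfl⟩ := exists_eis q α x
  simpa using hE a b hx

theorem mem_tri_eis {q : Plane} {α a0 b0 u0 u1 v0 v1 a b D : ℝ} (hD : u0 * v1 - u1 * v0 = D)
    (hpos : 0 < D) :
    eis q α a b ∈ tri (eis q α a0 b0) (u0 • dir α + u1 • dir (α + Real.pi / 3))
        (v0 • dir α + v1 • dir (α + Real.pi / 3)) ↔
      0 ≤ (a - a0) * v1 - (b - b0) * v0 ∧ 0 ≤ u0 * (b - b0) - u1 * (a - a0) ∧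
        (a - a0) * v1 - (b - b0) * v0 + (u0 * (b - b0) - u1 * (a - a0)) ≤ D := by
  have key : ∀ x y : ℝ, eis q α a0 b0 + x • (u0 • dir α + u1 • dir (α + Real.pi / 3)) +
      y • (v0 • dir α + v1 • dir (α + Real.pi / 3)) =
      eis q α (a0 + x * u0 + y * v0) (b0 + x * u1 + y * v1) := fun x y => by
    simp only [eis]; module
  constructor
  · rintro ⟨x, y, hx, hy, hxy, h⟩
    rw [key] at h
    obtain ⟨rfl, rfl⟩ := eis_injective h
    have e1 : (a0 + x * u0 + y * v0 - a0) * v1 - (b0 + x * u1 + y * v1 - b0) * v0 = x * D := by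
      rw [← hD]; ring
    have e2 : u0 * (b0 + x * u1 + y * v1 - b0) - u1 * (a0 + x * u0 + y * v0 - a0) = y * D := by
      rw [← hD]; ring
    rw [e1, e2]
    exact ⟨by positivity, by positivity, by nlinarith⟩
  · rintro ⟨h1, h2, h3⟩
    refine ⟨((a - a0) * v1 - (b - b0) * v0) / D, (u0 * (b - b0) - u1 * (a - a0)) / D,
      by positivity, by positivity, ?_, ?_⟩
    · rw [← add_div, div_le_one hpos]; exact h3
    · rw [key]
      congr 1 <;> field_simp <;> rw [← hD] <;> ring

theorem cross_frame_combo (α u0 u1 v0 v1 : ℝ) :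
    cross (u0 • dir α + u1 • dir (α + Real.pi / 3)) (v0 • dir α + v1 • dir (α + Real.pi / 3)) =
      (u0 * v1 - u1 * v0) * (Real.sqrt 3 / 2) := by
  rw [cross_combo, cross_frame]

theorem hasFlux_tri_eis (q : Plane) (α a0 b0 : ℝ) {u0 u1 v0 v1 : ℝ}
    (h : 0 < u0 * v1 - u1 * v0) :
    HasFlux (tri (eis q α a0 b0) (u0 • dir α + u1 • dir (α + Real.pi / 3))
        (v0 • dir α + v1 • dir (α + Real.pi / 3))) fun X =>
      segFlux X (eis q α a0 b0) (eis q α (a0 + u0) (b0 + u1)) +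
        segFlux X (eis q α (a0 + u0) (b0 + u1)) (eis q α (a0 + v0) (b0 + v1)) +
        segFlux X (eis q α (a0 + v0) (b0 + v1)) (eis q α a0 b0) := by
  have key : ∀ x y : ℝ, eis q α a0 b0 + (x • dir α + y • dir (α + Real.pi / 3)) =
      eis q α (a0 + x) (b0 + y) := fun x y => by
    simp only [eis]; module
  have := hasFlux_tri (O := eis q α a0 b0) (u := u0 • dir α + u1 • dir (α + Real.pi / 3))
    (v := v0 • dir α + v1 • dir (α + Real.pi / 3))
    (by rw [cross_frame_combo]; positivity)
  simpa only [key] using this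

theorem isClosed_corner (q : Plane) (α ρ : ℝ) : IsClosed (corner q α ρ) := by
  have h1 : IsClosed {x | 0 ≤ coordB q α x} := isClosed_le (by fun_prop) (by fun_prop)
  have h2 : IsClosed {x | 0 ≤ coordA q α x + coordB q α x} :=
    isClosed_le (by fun_prop) (by fun_prop)
  have h3 : IsClosed {x | coordA q α x ^ 2 + coordA q α x * (coordB q α x + ρ) +
      (coordB q α x + ρ) ^ 2 ≤ 3 * ρ ^ 2} := isClosed_le (by fun_prop) (by fun_prop)
  exact h1.inter (h2.inter h3)

/-- The arc of the corner is centered at the opposite vertex `p` of the Reuleaux triangle. The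
sector with apex `p` over this arc consists of the corner and two triangles with common side `p q`;
subtracting these leaves the corner. -/
theorem hasFlux_corner (q : Plane) (α : ℝ) {ρ : ℝ} (hρ : 0 < ρ) :
    HasFlux (corner q α ρ) fun X =>
      segFlux X q (eis q α ρ 0) + cornerFlux X q α ρ + segFlux X (eis q α (-ρ) ρ) q := by
  have h3 : 0 < Real.sqrt 3 := by positivity
  set p := eis q α 0 (-ρ) with hp
  have hS := hasFlux_sector p α hρ
  have hs := sq_sqrt_three
  have e1 : p + (Real.sqrt 3 * ρ) • dir (α + Real.pi / 6) = eis q α ρ 0 := by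
    rw [dir_add_pi_div_six, smul_smul, show Real.sqrt 3 * ρ * (1 / Real.sqrt 3) = ρ by field_simp,
      hp]
    simp only [eis]; module
  have e2 : p + (Real.sqrt 3 * ρ) • dir (α + Real.pi / 6 + Real.pi / 3) = eis q α (-ρ) ρ := by
    rw [show α + Real.pi / 6 + Real.pi / 3 = α + Real.pi / 3 + Real.pi / 6 by ring,
      dir_add_pi_div_six, smul_smul, show Real.sqrt 3 * ρ * (1 / Real.sqrt 3) = ρ by field_simp,
      hp, show α + Real.pi / 3 + Real.pi / 3 = α + 2 * Real.pi / 3 by ring,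
      dir_add_two_pi_div_three]
    simp only [eis]; module
  rw [e1, e2] at hS
  have hT1 := hasFlux_tri_eis q α 0 (-ρ) (u0 := ρ) (u1 := ρ) (v0 := 0) (v1 := ρ) (by nlinarith)
  have hT2 := hasFlux_tri_eis q α 0 (-ρ) (u0 := 0) (u1 := ρ) (v0 := -ρ) (v1 := 2 * ρ)
    (by nlinarith)
  have hm1 : ∀ a b, eis q α a b ∈ tri (eis q α 0 (-ρ)) (ρ • dir α + ρ • dir (α + Real.pi / 3))
      ((0 : ℝ) • dir α + ρ • dir (α + Real.pi / 3)) ↔ 0 ≤ a ∧ a ≤ b + ρ ∧ b ≤ 0 := fun a b => by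
    rw [mem_tri_eis (D := ρ ^ 2) (by ring) (by positivity)]
    constructor
    · rintro ⟨h1, h2, h3⟩
      refine ⟨?_, ?_, ?_⟩ <;> nlinarith
    · rintro ⟨h1, h2, h3⟩
      refine ⟨?_, ?_, ?_⟩ <;> nlinarith
  have hm2 : ∀ a b, eis q α a b ∈ tri (eis q α 0 (-ρ))
      ((0 : ℝ) • dir α + ρ • dir (α + Real.pi / 3))
      ((-ρ) • dir α + (2 * ρ) • dir (α + Real.pi / 3)) ↔
      a ≤ 0 ∧ 0 ≤ 2 * a + b + ρ ∧ a + b ≤ 0 := fun a b => by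
    rw [mem_tri_eis (D := ρ ^ 2) (by ring) (by positivity)]
    constructor
    · rintro ⟨h1, h2, h3⟩
      refine ⟨?_, ?_, ?_⟩ <;> nlinarith
    · rintro ⟨h1, h2, h3⟩
      refine ⟨?_, ?_, ?_⟩ <;> nlinarith
  generalize tri (eis q α 0 (-ρ)) (ρ • dir α + ρ • dir (α + Real.pi / 3))
      ((0 : ℝ) • dir α + ρ • dir (α + Real.pi / 3)) = T1 at hT1 hm1
  generalize tri (eis q α 0 (-ρ)) ((0 : ℝ) • dir α + ρ • dir (α + Real.pi / 3))
      ((-ρ) • dir α + (2 * ρ) • dir (α + Real.pi / 3)) = T2 at hT2 hm2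
  have hmc : ∀ a b, eis q α a b ∈ corner q α ρ ↔
      0 ≤ b ∧ 0 ≤ a + b ∧ a ^ 2 + a * (b + ρ) + (b + ρ) ^ 2 ≤ 3 * ρ ^ 2 := fun a b => by
    simp [corner]
  have hms : ∀ a b, eis q α a b ∈ sector p α ρ ↔ a ≤ b + ρ ∧ 0 ≤ 2 * a + (b + ρ) ∧
      a ^ 2 + a * (b + ρ) + (b + ρ) ^ 2 ≤ 3 * ρ ^ 2 := fun a b => by
    obtain ⟨ha, hb⟩ := coord_shift q α 0 (-ρ) (eis q α a b)
    rw [sector, mem_ofPred_eq, hp, ha, hb]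
    simp
  have hunion : sector p α ρ = corner q α ρ ∪ T1 ∪ T2 := by
    ext x
    obtain ⟨a, b, rfl⟩ := exists_eis q α x
    rw [mem_union, mem_union, hms, hmc, hm1, hm2]
    constructor
    · rintro ⟨h1, h2, hN⟩
      rcases le_total 0 b with hb | hb
      · rcases le_total 0 (a + b) with hab | hab
        · exact Or.inl (Or.inl ⟨hb, hab, hN⟩)
        · exact Or.inr ⟨by linarith, by linarith, hab⟩
      · rcases le_total 0 a with ha | ha
        · exact Or.inl (Or.inr ⟨ha, h1, hb⟩)
        · exact Or.inr ⟨ha, by linarith, by linarith⟩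
    · rintro ((⟨hb, hab, hN⟩ | ⟨ha, h1, hb⟩) | ⟨ha, h1, hab⟩)
      -- On the corner, the disk inequality already implies the two linear inequalities of the
      -- sector.
      · refine ⟨?_, ?_, hN⟩ <;> by_contra! h
        · nlinarith [mul_nonneg hb hρ.le]
        · nlinarith [mul_nonneg hb hρ.le, mul_nonneg hab hρ.le, mul_nonneg hb hab]
      · exact ⟨h1, by linarith, by nlinarith⟩
      · exact ⟨by linarith, by linarith, by nlinarith⟩
  rw [hunion] at hS
  have hd2 : AEDisjoint volume (corner q α ρ ∪ T1) T2 := by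
    rw [AEDisjoint, union_inter_distrib_right]
    refine measure_union_null (volume_line_subset (q := q) (α := α) (l := 1) (m := 1) (n := 0)
      (by simp) fun a b => ?_) (volume_line_subset (q := q) (α := α) (l := 1) (m := 0) (n := 0)
      (by simp) fun a b => ?_)
    · rw [mem_inter_iff, hmc, hm2]; rintro ⟨⟨h1, h2, h3⟩, h4, h5, h6⟩; linarith
    · rw [mem_inter_iff, hm1, hm2]; rintro ⟨⟨h1, h2, h3⟩, h4, h5, h6⟩; linarith
  have hd1 : AEDisjoint volume (corner q α ρ) T1 := by
    refine volume_line_subset (q := q) (α := α) (l := 0) (m := 1) (n := 0) (by simp) fun a b => ?_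
    rw [mem_inter_iff, hmc, hm1]; rintro ⟨⟨h1, h2, h3⟩, h4, h5, h6⟩; linarith
  have hmeas := (isClosed_corner q α ρ).measurableSet.nullMeasurableSet (μ := volume)
  have h := (hS.of_union hT2 (hmeas.union hT1.1) hd2).of_union hT1 hmeas hd1
  refine h.congr fun X _ => ?_
  have f1 : eis q α (0 + ρ) (-ρ + ρ) = eis q α ρ 0 := by congr 1 <;> ring
  have f2 : eis q α (0 + 0) (-ρ + ρ) = q := by
    rw [zero_add, neg_add_cancel, eis_zero]
  have f3 : eis q α (0 + -ρ) (-ρ + 2 * ρ) = eis q α (-ρ) ρ := by congr 1 <;> ring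
  rw [f1, f2, f3, ← hp, segFlux_comm X (eis q α ρ 0) q, segFlux_comm X q p,
    segFlux_comm X q (eis q α (-ρ) ρ), segFlux_comm X (eis q α (-ρ) ρ) p, cornerFlux, ← hp]
  ring

/-! ### Reuleaux triangles -/

theorem sqrt_three_mul_div (ρ : ℝ) : Real.sqrt 3 * ρ / Real.sqrt 3 = ρ := by
  have : Real.sqrt 3 ≠ 0 := by positivity
  field_simp

theorem mem_closedBall_eis {q : Plane} {α a b a' b' ρ : ℝ} (hρ : 0 < ρ) :
    eis q α a b ∈ Metric.closedBall (eis q α a' b') (Real.sqrt 3 * ρ) ↔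
      (a - a') ^ 2 + (a - a') * (b - b') + (b - b') ^ 2 ≤ 3 * ρ ^ 2 := by
  rw [Metric.mem_closedBall, ← dist_sq_eis q α,
    show 3 * ρ ^ 2 = (Real.sqrt 3 * ρ) ^ 2 by rw [mul_pow, Real.sq_sqrt (by norm_num)]]
  exact (pow_le_pow_iff_left₀ dist_nonneg (by positivity) two_ne_zero).symm

theorem mem_ball_eis {q : Plane} {α a b a' b' ρ : ℝ} (hρ : 0 < ρ) :
    eis q α a b ∈ Metric.ball (eis q α a' b') (Real.sqrt 3 * ρ) ↔
      (a - a') ^ 2 + (a - a') * (b - b') + (b - b') ^ 2 < 3 * ρ ^ 2 := by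
  rw [Metric.mem_ball, ← dist_sq_eis q α,
    show 3 * ρ ^ 2 = (Real.sqrt 3 * ρ) ^ 2 by rw [mul_pow, Real.sq_sqrt (by norm_num)]]
  exact (pow_lt_pow_iff_left₀ dist_nonneg (by positivity) two_ne_zero).symm

theorem reuleaux_center (q : Plane) (α ρ : ℝ) :
    q + ρ • dir α = eis q α ρ 0 ∧ q + ρ • dir (α + 2 * Real.pi / 3) = eis q α (-ρ) ρ ∧
      q + ρ • dir (α + 4 * Real.pi / 3) = eis q α 0 (-ρ) := by
  rw [dir_add_two_pi_div_three, dir_add_four_pi_div_three]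
  simp only [eis]
  refine ⟨?_, ?_, ?_⟩ <;> module

theorem reuleaux_eq_inter (q : Plane) (α ρ : ℝ) : reuleaux q α (Real.sqrt 3 * ρ) =
    Metric.closedBall (eis q α ρ 0) (Real.sqrt 3 * ρ) ∩
      (Metric.closedBall (eis q α (-ρ) ρ) (Real.sqrt 3 * ρ) ∩
        Metric.closedBall (eis q α 0 (-ρ)) (Real.sqrt 3 * ρ)) := by
  obtain ⟨e0, e1, e2⟩ := reuleaux_center q α ρ
  ext x
  simp only [reuleaux, mem_iInter, Fin.forall_fin_succ, sqrt_three_mul_div, mem_inter_iff]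
  simp only [Fin.val_zero, Nat.cast_zero, zero_mul, add_zero, Fin.val_succ, zero_add,
    Nat.cast_one, one_mul, ← e0, ← e1, ← e2, Nat.cast_add, IsEmpty.forall_iff, and_true,
    show (1 + 1 : ℝ) * (2 * Real.pi / 3) = 4 * Real.pi / 3 by ring]

theorem mem_reuleaux {q : Plane} {α a b ρ : ℝ} (hρ : 0 < ρ) :
    eis q α a b ∈ reuleaux q α (Real.sqrt 3 * ρ) ↔
      (a - ρ) ^ 2 + (a - ρ) * b + b ^ 2 ≤ 3 * ρ ^ 2 ∧
      (a + ρ) ^ 2 + (a + ρ) * (b - ρ) + (b - ρ) ^ 2 ≤ 3 * ρ ^ 2 ∧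
      a ^ 2 + a * (b + ρ) + (b + ρ) ^ 2 ≤ 3 * ρ ^ 2 := by
  rw [reuleaux_eq_inter, mem_inter_iff, mem_inter_iff, mem_closedBall_eis hρ,
    mem_closedBall_eis hρ, mem_closedBall_eis hρ]
  simp only [sub_zero, sub_neg_eq_add]

theorem convex_reuleaux (q : Plane) (α r : ℝ) : Convex ℝ (reuleaux q α r) :=
  convex_iInter fun _ => convex_closedBall _ _

theorem isClosed_reuleaux (q : Plane) (α r : ℝ) : IsClosed (reuleaux q α r) :=
  isClosed_iInter fun _ => Metric.isClosed_closedBall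

theorem mem_interior_reuleaux {q : Plane} {α a b ρ : ℝ} (hρ : 0 < ρ) :
    eis q α a b ∈ interior (reuleaux q α (Real.sqrt 3 * ρ)) ↔
      (a - ρ) ^ 2 + (a - ρ) * b + b ^ 2 < 3 * ρ ^ 2 ∧
      (a + ρ) ^ 2 + (a + ρ) * (b - ρ) + (b - ρ) ^ 2 < 3 * ρ ^ 2 ∧
      a ^ 2 + a * (b + ρ) + (b + ρ) ^ 2 < 3 * ρ ^ 2 := by
  have hr : Real.sqrt 3 * ρ ≠ 0 := by positivity
  rw [reuleaux_eq_inter, interior_inter, interior_inter, interior_closedBall _ hr,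
    interior_closedBall _ hr, interior_closedBall _ hr, mem_inter_iff, mem_inter_iff,
    mem_ball_eis hρ, mem_ball_eis hρ, mem_ball_eis hρ]
  simp only [sub_zero, sub_neg_eq_add]

theorem reuleaux_rotate (q : Plane) (α : ℝ) {ρ : ℝ} (hρ : 0 < ρ) :
    reuleaux q (α + 2 * Real.pi / 3) (Real.sqrt 3 * ρ) = reuleaux q α (Real.sqrt 3 * ρ) := by
  ext x
  obtain ⟨a, b, rfl⟩ := exists_eis q (α + 2 * Real.pi / 3) x
  rw [mem_reuleaux hρ, eis_rotate, mem_reuleaux hρ]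
  ring_nf
  tauto

theorem reuleaux_rotate' (q : Plane) (α : ℝ) {ρ : ℝ} (hρ : 0 < ρ) :
    reuleaux q (α + 4 * Real.pi / 3) (Real.sqrt 3 * ρ) = reuleaux q α (Real.sqrt 3 * ρ) := by
  rw [show α + 4 * Real.pi / 3 = α + 2 * Real.pi / 3 + 2 * Real.pi / 3 by ring,
    reuleaux_rotate _ _ hρ, reuleaux_rotate _ _ hρ]

/-- Between two of the rays through the vertices only the disk around the opposite vertex matters;
the inequalities of the other two disks follow from it. -/
theorem corner_eq (q : Plane) (α : ℝ) {ρ : ℝ} (hρ : 0 < ρ) : corner q α ρ =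
    {x ∈ reuleaux q α (Real.sqrt 3 * ρ) | 0 ≤ coordB q α x ∧ 0 ≤ coordA q α x + coordB q α x} := by
  ext x
  obtain ⟨a, b, rfl⟩ := exists_eis q α x
  rw [mem_sep_iff, mem_reuleaux hρ, corner, mem_ofPred_eq, coordA_eis, coordB_eis]
  constructor
  · rintro ⟨hb, hab, hN⟩
    exact ⟨⟨by nlinarith, by nlinarith, hN⟩, hb, hab⟩
  · rintro ⟨⟨_, _, hN⟩, hb, hab⟩
    exact ⟨hb, hab, hN⟩

/-- Membership in the three corners, in the oblique coordinates of the first one. -/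
theorem mem_corner {q : Plane} {α a b ρ : ℝ} (hρ : 0 < ρ) :
    (eis q α a b ∈ corner q α ρ ↔
      eis q α a b ∈ reuleaux q α (Real.sqrt 3 * ρ) ∧ 0 ≤ b ∧ 0 ≤ a + b) ∧
    (eis q α a b ∈ corner q (α + 2 * Real.pi / 3) ρ ↔
      eis q α a b ∈ reuleaux q α (Real.sqrt 3 * ρ) ∧ a + b ≤ 0 ∧ a ≤ 0) ∧
    (eis q α a b ∈ corner q (α + 4 * Real.pi / 3) ρ ↔
      eis q α a b ∈ reuleaux q α (Real.sqrt 3 * ρ) ∧ 0 ≤ a ∧ b ≤ 0) := by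
  have h1 := coord_rotate q α (eis q α a b)
  have h2 := coord_rotate q (α + 2 * Real.pi / 3) (eis q α a b)
  rw [show α + 2 * Real.pi / 3 + 2 * Real.pi / 3 = α + 4 * Real.pi / 3 by ring] at h2
  rw [corner_eq _ _ hρ, corner_eq _ _ hρ, corner_eq _ _ hρ, reuleaux_rotate _ _ hρ,
    reuleaux_rotate' _ _ hρ]
  simp only [mem_sep_iff, h2.1, h2.2, h1.1, h1.2, coordA_eis, coordB_eis]
  refine ⟨trivial, and_congr_right fun _ => ?_, and_congr_right fun _ => ?_⟩ <;>
    constructor <;> rintro ⟨h, h'⟩ <;> constructor <;> linarith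

theorem reuleaux_eq_union (q : Plane) (α : ℝ) {ρ : ℝ} (hρ : 0 < ρ) :
    reuleaux q α (Real.sqrt 3 * ρ) =
      corner q α ρ ∪ corner q (α + 2 * Real.pi / 3) ρ ∪ corner q (α + 4 * Real.pi / 3) ρ := by
  ext x
  obtain ⟨a, b, rfl⟩ := exists_eis q α x
  obtain ⟨h0, h1, h2⟩ := mem_corner (q := q) (α := α) (a := a) (b := b) hρ
  rw [mem_union, mem_union, h0, h1, h2]
  constructor
  · intro h
    rcases le_total 0 b with hb | hb <;> rcases le_total 0 (a + b) with hab | hab <;>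
      rcases le_total 0 a with ha | ha
    all_goals first
      | exact Or.inl (Or.inl ⟨h, hb, hab⟩)
      | exact Or.inl (Or.inr ⟨h, hab, ha⟩)
      | exact Or.inr ⟨h, ha, hb⟩
      | exact Or.inl (Or.inl ⟨h, by linarith, by linarith⟩)
  · rintro ((h | h) | h) <;> exact h.1

/-- Completing the square in one disk inequality bounds one of the forms `a`, `b`, `a + b` on one
side. These linear bounds reduce every later question of disjointness to linear arithmetic. -/
theorem reuleaux_support {q : Plane} {α a b ρ : ℝ} (hρ : 0 < ρ)
    (h : eis q α a b ∈ reuleaux q α (Real.sqrt 3 * ρ)) :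
    -ρ ≤ a ∧ a ≤ ρ ∧ -ρ ≤ b ∧ b ≤ ρ ∧ -ρ ≤ a + b ∧ a + b ≤ ρ := by
  obtain ⟨h0, h1, h2⟩ := (mem_reuleaux hρ).1 h
  refine ⟨?_, ?_, ?_, ?_, ?_, ?_⟩
  · nlinarith [sq_nonneg (a - ρ + 2 * b)]
  · nlinarith [sq_nonneg (a + ρ + 2 * (b - ρ))]
  · nlinarith [sq_nonneg (b - ρ + 2 * (a + ρ))]
  · nlinarith [sq_nonneg (b + ρ + 2 * a)]
  · nlinarith [sq_nonneg (a - ρ - b)]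
  · nlinarith [sq_nonneg (a - (b + ρ))]

theorem isBounded_reuleaux (q : Plane) (α r : ℝ) : Bornology.IsBounded (reuleaux q α r) :=
  Metric.isBounded_closedBall.subset (iInter_subset _ 0)

theorem corner_rotate_endpoints (q : Plane) (α ρ : ℝ) :
    eis q (α + 2 * Real.pi / 3) ρ 0 = eis q α (-ρ) ρ ∧
    eis q (α + 2 * Real.pi / 3) (-ρ) ρ = eis q α 0 (-ρ) ∧
    eis q (α + 4 * Real.pi / 3) ρ 0 = eis q α 0 (-ρ) ∧
    eis q (α + 4 * Real.pi / 3) (-ρ) ρ = eis q α ρ 0 := by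
  rw [show α + 4 * Real.pi / 3 = α + 2 * Real.pi / 3 + 2 * Real.pi / 3 by ring]
  simp only [eis_rotate]
  refine ⟨?_, ?_, ?_, ?_⟩ <;> congr 1 <;> ring

theorem hasFlux_reuleaux (q : Plane) (α : ℝ) {ρ : ℝ} (hρ : 0 < ρ) :
    HasFlux (reuleaux q α (Real.sqrt 3 * ρ)) fun X =>
      cornerFlux X q α ρ + cornerFlux X q (α + 2 * Real.pi / 3) ρ +
        cornerFlux X q (α + 4 * Real.pi / 3) ρ := by
  obtain ⟨e1, e2, e3, e4⟩ := corner_rotate_endpoints q α ρ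
  have hm := fun a b => mem_corner (q := q) (α := α) (a := a) (b := b) hρ
  have h01 : AEDisjoint volume (corner q α ρ) (corner q (α + 2 * Real.pi / 3) ρ) := by
    refine volume_line_subset (q := q) (α := α) (l := 1) (m := 1) (n := 0) (by simp)
      fun a b => ?_
    rw [mem_inter_iff, (hm a b).1, (hm a b).2.1]; rintro ⟨⟨_, h1, h2⟩, _, h3, h4⟩; linarith
  have h2 : AEDisjoint volume (corner q α ρ ∪ corner q (α + 2 * Real.pi / 3) ρ)
      (corner q (α + 4 * Real.pi / 3) ρ) := by
    rw [AEDisjoint, union_inter_distrib_right]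
    refine measure_union_null (volume_line_subset (q := q) (α := α) (l := 0) (m := 1) (n := 0)
      (by simp) fun a b => ?_) (volume_line_subset (q := q) (α := α) (l := 1) (m := 0) (n := 0)
      (by simp) fun a b => ?_)
    · rw [mem_inter_iff, (hm a b).1, (hm a b).2.2]; rintro ⟨⟨_, h1, h2⟩, _, h3, h4⟩; linarith
    · rw [mem_inter_iff, (hm a b).2.1, (hm a b).2.2]; rintro ⟨⟨_, h1, h2⟩, _, h3, h4⟩; linarith
  rw [reuleaux_eq_union _ _ hρ]
  refine (((hasFlux_corner q α hρ).union (hasFlux_corner q _ hρ) h01).union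
    (hasFlux_corner q _ hρ) h2).congr fun X _ => ?_
  rw [e1, e2, e3, e4, segFlux_comm X (eis q α (-ρ) ρ) q, segFlux_comm X (eis q α 0 (-ρ)) q,
    segFlux_comm X (eis q α ρ 0) q]
  ring

/-! ### Equiangular hexagons -/

/-- The equiangular hexagon with vertices `(0, 0)`, `(A, 0)`, `(A, S - A)`, `(S - B, B)`, `(-m, B)`,
`(-m, m)` in the oblique coordinates of the frame `q`, `dir α`, `dir (α + π / 3)`. -/
def hexSet (q : Plane) (α A m S B : ℝ) : Set Plane :=
  {x | (0 ≤ coordB q α x ∧ coordB q α x ≤ B) ∧ (-m ≤ coordA q α x ∧ coordA q α x ≤ A) ∧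
    0 ≤ coordA q α x + coordB q α x ∧ coordA q α x + coordB q α x ≤ S}

theorem mem_hexSet {q : Plane} {α A m S B a b : ℝ} : eis q α a b ∈ hexSet q α A m S B ↔
    (0 ≤ b ∧ b ≤ B) ∧ (-m ≤ a ∧ a ≤ A) ∧ 0 ≤ a + b ∧ a + b ≤ S := by
  simp [hexSet]

theorem isClosed_hexSet (q : Plane) (α A m S B : ℝ) : IsClosed (hexSet q α A m S B) := by
  have h1 : IsClosed {x | 0 ≤ coordB q α x} := isClosed_le (by fun_prop) (by fun_prop)
  have h2 : IsClosed {x | coordB q α x ≤ B} := isClosed_le (by fun_prop) (by fun_prop)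
  have h3 : IsClosed {x | -m ≤ coordA q α x} := isClosed_le (by fun_prop) (by fun_prop)
  have h4 : IsClosed {x | coordA q α x ≤ A} := isClosed_le (by fun_prop) (by fun_prop)
  have h5 : IsClosed {x | 0 ≤ coordA q α x + coordB q α x} :=
    isClosed_le (by fun_prop) (by fun_prop)
  have h6 : IsClosed {x | coordA q α x + coordB q α x ≤ S} :=
    isClosed_le (by fun_prop) (by fun_prop)
  exact (h1.inter h2).inter ((h3.inter h4).inter (h5.inter h6))

theorem segFlux_eis_add {X : Plane → Plane} (hX : Continuous X) (q : Plane)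
    (α x y d₀ d₁ s t u : ℝ) :
    segFlux X (eis q α (x + s * d₀) (y + s * d₁)) (eis q α (x + t * d₀) (y + t * d₁)) +
      segFlux X (eis q α (x + t * d₀) (y + t * d₁)) (eis q α (x + u * d₀) (y + u * d₁)) =
    segFlux X (eis q α (x + s * d₀) (y + s * d₁)) (eis q α (x + u * d₀) (y + u * d₁)) := by
  have key : ∀ s : ℝ, eis q α (x + s * d₀) (y + s * d₁) =
      eis q α x y + s • (d₀ • dir α + d₁ • dir (α + Real.pi / 3)) := fun s => by
    simp only [eis]; module
  simp only [key]
  exact segFlux_add hX _ _ _ _ _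

theorem segFlux_add_A {X : Plane → Plane} (hX : Continuous X) (q : Plane) (α y s t u : ℝ) :
    segFlux X (eis q α s y) (eis q α t y) + segFlux X (eis q α t y) (eis q α u y) =
      segFlux X (eis q α s y) (eis q α u y) := by
  simpa using segFlux_eis_add hX q α 0 y 1 0 s t u

theorem segFlux_add_B {X : Plane → Plane} (hX : Continuous X) (q : Plane) (α x s t u : ℝ) :
    segFlux X (eis q α x s) (eis q α x t) + segFlux X (eis q α x t) (eis q α x u) =
      segFlux X (eis q α x s) (eis q α x u) := by
  simpa using segFlux_eis_add hX q α x 0 0 1 s t u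

theorem segFlux_add_C {X : Plane → Plane} (hX : Continuous X) (q : Plane) (α x s t u : ℝ) :
    segFlux X (eis q α (x - s) s) (eis q α (x - t) t) +
      segFlux X (eis q α (x - t) t) (eis q α (x - u) u) =
      segFlux X (eis q α (x - s) s) (eis q α (x - u) u) := by
  simpa [sub_eq_add_neg] using segFlux_eis_add hX q α x 0 (-1) 1 s t u

/-- The closed triangle `a₀ ≤ a`, `b₀ ≤ b`, `a + b ≤ a₀ + b₀ + l` in oblique coordinates. -/
theorem hasFlux_coordTri (q : Plane) (α a₀ b₀ : ℝ) {l : ℝ} (hl : 0 < l) :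
    HasFlux {x | a₀ ≤ coordA q α x ∧ b₀ ≤ coordB q α x ∧
        coordA q α x + coordB q α x ≤ a₀ + b₀ + l} fun X =>
      segFlux X (eis q α a₀ b₀) (eis q α (a₀ + l) b₀) +
        segFlux X (eis q α (a₀ + l) b₀) (eis q α a₀ (b₀ + l)) +
        segFlux X (eis q α a₀ (b₀ + l)) (eis q α a₀ b₀) := by
  have h := hasFlux_tri_eis q α a₀ b₀ (u0 := l) (u1 := 0) (v0 := 0) (v1 := l) (by nlinarith)
  have he : {x | a₀ ≤ coordA q α x ∧ b₀ ≤ coordB q α x ∧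
        coordA q α x + coordB q α x ≤ a₀ + b₀ + l} =
      tri (eis q α a₀ b₀) (l • dir α + (0 : ℝ) • dir (α + Real.pi / 3))
        ((0 : ℝ) • dir α + l • dir (α + Real.pi / 3)) := by
    ext x
    obtain ⟨a, b, rfl⟩ := exists_eis q α x
    rw [mem_tri_eis (D := l ^ 2) (by ring) (by positivity), mem_ofPred_eq, coordA_eis, coordB_eis]
    constructor
    · rintro ⟨h1, h2, h3⟩
      refine ⟨?_, ?_, ?_⟩ <;> nlinarith
    · rintro ⟨h1, h2, h3⟩
      refine ⟨?_, ?_, ?_⟩ <;> nlinarith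
  rw [he]
  simpa only [add_zero] using h

theorem isBounded_hexSet (q : Plane) (α A m S B : ℝ) :
    Bornology.IsBounded (hexSet q α A m S B) := by
  refine isBounded_of_coord (q := q) (α := α) (C := |A| + |m| + |B|) fun x hx => ?_
  obtain ⟨⟨h1, h2⟩, ⟨h3, h4⟩, h5, h6⟩ := hx
  refine ⟨abs_le.2 ⟨?_, ?_⟩, abs_le.2 ⟨?_, ?_⟩⟩ <;>
    linarith [abs_nonneg A, abs_nonneg m, abs_nonneg B, le_abs_self A, le_abs_self m, le_abs_self B]

/-- An equiangular hexagon is an equilateral triangle, of side `S + m`, with three equilateral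
triangles cut off at its corners, of sides `S - A`, `S - B + m` and `m`. -/
theorem hasFlux_hexSet (q : Plane) (α : ℝ) {A m S B : ℝ} (h0 : 0 < A) (h1 : 0 < S - A)
    (h2 : 0 < A + B - S) (h3 : 0 < S - B + m) (h4 : 0 < B - m) (h5 : 0 < m) :
    HasFlux (hexSet q α A m S B) fun X =>
      segFlux X q (eis q α A 0) + segFlux X (eis q α A 0) (eis q α A (S - A)) +
      segFlux X (eis q α A (S - A)) (eis q α (S - B) B) +
      segFlux X (eis q α (S - B) B) (eis q α (-m) B) +
      segFlux X (eis q α (-m) B) (eis q α (-m) m) + segFlux X (eis q α (-m) m) q := by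
  have hT := hasFlux_coordTri q α (-m) 0 (l := S + m) (by linarith)
  have hT1 := hasFlux_coordTri q α A 0 h1
  have hT2 := hasFlux_coordTri q α (-m) B h3
  have hT3 := hasFlux_coordTri q α (-m) 0 h5
  have hm : ∀ a b a₀ b₀ l : ℝ, eis q α a b ∈ {x | a₀ ≤ coordA q α x ∧ b₀ ≤ coordB q α x ∧
        coordA q α x + coordB q α x ≤ a₀ + b₀ + l} ↔ a₀ ≤ a ∧ b₀ ≤ b ∧ a + b ≤ a₀ + b₀ + l :=
    fun a b a₀ b₀ l => by simp
  have m0 := fun a b => hm a b (-m) 0 (S + m)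
  have m1 := fun a b => hm a b A 0 (S - A)
  have m2 := fun a b => hm a b (-m) B (S - B + m)
  have m3 := fun a b => hm a b (-m) 0 m
  clear hm
  generalize {x | -m ≤ coordA q α x ∧ 0 ≤ coordB q α x ∧
        coordA q α x + coordB q α x ≤ -m + 0 + (S + m)} = T at hT m0
  generalize {x | A ≤ coordA q α x ∧ 0 ≤ coordB q α x ∧
        coordA q α x + coordB q α x ≤ A + 0 + (S - A)} = T1 at hT1 m1
  generalize {x | -m ≤ coordA q α x ∧ B ≤ coordB q α x ∧
        coordA q α x + coordB q α x ≤ -m + B + (S - B + m)} = T2 at hT2 m2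
  generalize {x | -m ≤ coordA q α x ∧ 0 ≤ coordB q α x ∧
        coordA q α x + coordB q α x ≤ -m + 0 + m} = T3 at hT3 m3
  have hunion : T = hexSet q α A m S B ∪ T1 ∪ T2 ∪ T3 := by
    ext x
    obtain ⟨a, b, rfl⟩ := exists_eis q α x
    rw [mem_union, mem_union, mem_union, m0, m1, m2, m3, mem_hexSet]
    constructor
    · rintro ⟨h1, h2, h3⟩
      by_cases c1 : A ≤ a
      · exact Or.inl (Or.inl (Or.inr ⟨c1, h2, by linarith⟩))
      by_cases c2 : B ≤ b
      · exact Or.inl (Or.inr ⟨h1, c2, by linarith⟩)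
      by_cases c3 : a + b ≤ 0
      · exact Or.inr ⟨h1, h2, by linarith⟩
      · push Not at c1 c2 c3
        exact Or.inl (Or.inl (Or.inl ⟨⟨h2, c2.le⟩, ⟨h1, c1.le⟩, c3.le, by linarith⟩))
    · rintro (((⟨⟨h1, h2⟩, ⟨h3, h4⟩, h5, h6⟩ | ⟨h1, h2, h3⟩) | ⟨h1, h2, h3⟩) | ⟨h1, h2, h3⟩) <;>
        exact ⟨by linarith, by linarith, by linarith⟩
  rw [hunion] at hT
  have d1 : AEDisjoint volume (hexSet q α A m S B) T1 := by
    refine volume_line_subset (q := q) (α := α) (l := 1) (m := 0) (n := A) (by simp)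
      fun a b => ?_
    rw [mem_inter_iff, mem_hexSet, m1]
    rintro ⟨⟨⟨h1, h2⟩, ⟨h3, h4⟩, h5, h6⟩, h7, h8, h9⟩; linarith
  have d2 : AEDisjoint volume (hexSet q α A m S B ∪ T1) T2 := by
    refine volume_line_subset (q := q) (α := α) (l := 0) (m := 1) (n := B) (by simp)
      fun a b => ?_
    rw [mem_inter_iff, mem_union, mem_hexSet, m1, m2]
    rintro ⟨⟨⟨h1, h2⟩, ⟨h3, h4⟩, h5, h6⟩ | ⟨h1, h2, h3⟩, h7, h8, h9⟩ <;> linarith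
  have d3 : AEDisjoint volume (hexSet q α A m S B ∪ T1 ∪ T2) T3 := by
    refine volume_line_subset (q := q) (α := α) (l := 1) (m := 1) (n := 0) (by simp)
      fun a b => ?_
    rw [mem_inter_iff, mem_union, mem_union, mem_hexSet, m1, m2, m3]
    rintro ⟨(⟨⟨h1, h2⟩, ⟨h3, h4⟩, h5, h6⟩ | ⟨h1, h2, h3⟩) | ⟨h1, h2, h3⟩, h7, h8, h9⟩ <;> linarith
  have hH := (isClosed_hexSet q α A m S B).measurableSet.nullMeasurableSet (μ := volume)
  have h := ((hT.of_union hT3 ((hH.union hT1.1).union hT2.1) d3).of_union hT2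
    (hH.union hT1.1) d2).of_union hT1 hH d1
  refine h.congr fun X hX => ?_
  have hXc := hX.continuous
  have s1 := segFlux_add_A hXc q α 0 (-m) 0 S
  have s2 := segFlux_add_A hXc q α 0 0 A S
  have s3 := segFlux_add_C hXc q α S 0 (S - A) (S + m)
  have s4 := segFlux_add_C hXc q α S (S - A) B (S + m)
  have s5 := segFlux_add_B hXc q α (-m) (S + m) B 0
  have s6 := segFlux_add_B hXc q α (-m) B m 0
  simp only [sub_zero, show S - (S - A) = A by ring, show S - (S + m) = -m by ring] at s3 s4
  simp only [show -m + (S + m) = S by ring, show A + (S - A) = S by ring, zero_add,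
    show -m + (S - B + m) = S - B by ring, show B + (S - B + m) = S + m by ring,
    neg_add_cancel, eis_zero] at *
  rw [segFlux_comm X (eis q α (-m) m) q, segFlux_comm X (eis q α A 0) (eis q α A (S - A)),
    segFlux_comm X (eis q α (S - B) B) (eis q α (-m) B)]
  linarith

/-! ### Chipped hexagons -/

/-- The three Reuleaux triangles at the first, third and fifth vertex of `hexSet q α A m S B`. -/
def chips (q : Plane) (α A m S B ρ : ℝ) : Set Plane :=
  reuleaux q α (Real.sqrt 3 * ρ) ∪ reuleaux (eis q α A (S - A)) α (Real.sqrt 3 * ρ) ∪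
    reuleaux (eis q α (-m) B) α (Real.sqrt 3 * ρ)

/-- The interiors of the three Reuleaux triangles. -/
def openChips (q : Plane) (α A m S B ρ : ℝ) : Set Plane :=
  interior (reuleaux q α (Real.sqrt 3 * ρ)) ∪
    interior (reuleaux (eis q α A (S - A)) α (Real.sqrt 3 * ρ)) ∪
    interior (reuleaux (eis q α (-m) B) α (Real.sqrt 3 * ρ))

/-- The hexagon with the three Reuleaux triangles removed. -/
def chippedHex (q : Plane) (α A m S B ρ : ℝ) : Set Plane :=
  hexSet q α A m S B \ openChips q α A m S B ρ

theorem isClosed_chippedHex (q : Plane) (α A m S B ρ : ℝ) :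
    IsClosed (chippedHex q α A m S B ρ) :=
  (isClosed_hexSet q α A m S B).sdiff
    ((isOpen_interior.union isOpen_interior).union isOpen_interior)

theorem ae_eq_interior_reuleaux (q : Plane) (α r : ℝ) :
    (interior (reuleaux q α r) : Set Plane) =ᵐ[volume] reuleaux q α r :=
  interior_ae_eq_of_null_frontier ((convex_reuleaux q α r).addHaar_frontier volume)

theorem chippedHex_ae_eq (q : Plane) (α A m S B ρ : ℝ) :
    (chippedHex q α A m S B ρ : Set Plane) =ᵐ[volume]
      (hexSet q α A m S B \ chips q α A m S B ρ : Set Plane) :=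
  (Filter.EventuallyEq.refl _ _).diff (((ae_eq_interior_reuleaux _ _ _).union
    (ae_eq_interior_reuleaux _ _ _)).union (ae_eq_interior_reuleaux _ _ _))

/-- The sides of the hexagon `hexSet q α A m S B` are longer than `ρ`. -/
structure LongSides (A m S B ρ : ℝ) : Prop where
  pos : 0 < ρ
  side₀ : ρ < A
  side₁ : ρ < S - A
  side₂ : ρ < A + B - S
  side₃ : ρ < S - B + m
  side₄ : ρ < B - m
  side₅ : ρ < m

theorem eis_eq_shift (q : Plane) (α a b x y : ℝ) :
    eis q α a b = eis (eis q α x y) α (a - x) (b - y) := by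
  rw [eis_eis]; congr 1 <;> ring

theorem mem_corner_chips {q : Plane} {α a b A m S B ρ : ℝ} (hρ : 0 < ρ) :
    (eis q α a b ∈ corner q α ρ ↔
      eis q α a b ∈ reuleaux q α (Real.sqrt 3 * ρ) ∧ 0 ≤ b ∧ 0 ≤ a + b) ∧
    (eis q α a b ∈ corner (eis q α A (S - A)) (α + 2 * Real.pi / 3) ρ ↔
      eis q α a b ∈ reuleaux (eis q α A (S - A)) α (Real.sqrt 3 * ρ) ∧ a + b ≤ S ∧ a ≤ A) ∧
    (eis q α a b ∈ corner (eis q α (-m) B) (α + 4 * Real.pi / 3) ρ ↔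
      eis q α a b ∈ reuleaux (eis q α (-m) B) α (Real.sqrt 3 * ρ) ∧ -m ≤ a ∧ b ≤ B) := by
  refine ⟨(mem_corner hρ).1, ?_, ?_⟩
  · rw [eis_eq_shift q α a b A (S - A), (mem_corner hρ).2.1]
    refine and_congr_right fun _ => ⟨?_, ?_⟩ <;> rintro ⟨h, h'⟩ <;> constructor <;> linarith
  · rw [eis_eq_shift q α a b (-m) B, (mem_corner hρ).2.2]
    refine and_congr_right fun _ => ⟨?_, ?_⟩ <;> rintro ⟨h, h'⟩ <;> constructor <;> linarith

theorem chips_support {q : Plane} {α a b A m S B ρ : ℝ} (hρ : 0 < ρ) :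
    (eis q α a b ∈ reuleaux q α (Real.sqrt 3 * ρ) →
      -ρ ≤ a ∧ a ≤ ρ ∧ -ρ ≤ b ∧ b ≤ ρ ∧ -ρ ≤ a + b ∧ a + b ≤ ρ) ∧
    (eis q α a b ∈ reuleaux (eis q α A (S - A)) α (Real.sqrt 3 * ρ) →
      A - ρ ≤ a ∧ a ≤ A + ρ ∧ S - A - ρ ≤ b ∧ b ≤ S - A + ρ ∧ S - ρ ≤ a + b ∧ a + b ≤ S + ρ) ∧
    (eis q α a b ∈ reuleaux (eis q α (-m) B) α (Real.sqrt 3 * ρ) →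
      -m - ρ ≤ a ∧ a ≤ -m + ρ ∧ B - ρ ≤ b ∧ b ≤ B + ρ ∧ B - m - ρ ≤ a + b ∧
        a + b ≤ B - m + ρ) := by
  refine ⟨reuleaux_support hρ, fun h => ?_, fun h => ?_⟩
  · rw [eis_eq_shift q α a b A (S - A)] at h
    obtain ⟨h1, h2, h3, h4, h5, h6⟩ := reuleaux_support hρ h
    refine ⟨?_, ?_, ?_, ?_, ?_, ?_⟩ <;> linarith
  · rw [eis_eq_shift q α a b (-m) B] at h
    obtain ⟨h1, h2, h3, h4, h5, h6⟩ := reuleaux_support hρ h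
    refine ⟨?_, ?_, ?_, ?_, ?_, ?_⟩ <;> linarith

/-- As the sides are longer than `ρ`, a chip meets the hexagon exactly in the corner that lies
between the two sides at its vertex. -/
theorem hexSet_eq_union {q : Plane} {α A m S B ρ : ℝ} (h : LongSides A m S B ρ) :
    hexSet q α A m S B = (hexSet q α A m S B \ chips q α A m S B ρ) ∪ corner q α ρ ∪
      corner (eis q α A (S - A)) (α + 2 * Real.pi / 3) ρ ∪
      corner (eis q α (-m) B) (α + 4 * Real.pi / 3) ρ := by
  obtain ⟨hρ, h0, h1, h2, h3, h4, h5⟩ := h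
  ext x
  obtain ⟨a, b, rfl⟩ := exists_eis q α x
  obtain ⟨m0, m1, m2⟩ := mem_corner_chips (q := q) (α := α) (a := a) (b := b) (A := A) (m := m)
    (S := S) (B := B) hρ
  obtain ⟨s0, s1, s2⟩ := chips_support (q := q) (α := α) (a := a) (b := b) (A := A) (m := m)
    (S := S) (B := B) hρ
  simp only [mem_union, mem_sdiff, m0, m1, m2, mem_hexSet, chips]
  constructor
  · intro hx
    by_cases k0 : eis q α a b ∈ reuleaux q α (Real.sqrt 3 * ρ)
    · exact Or.inl (Or.inl (Or.inr ⟨k0, hx.1.1, hx.2.2.1⟩))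
    by_cases k1 : eis q α a b ∈ reuleaux (eis q α A (S - A)) α (Real.sqrt 3 * ρ)
    · exact Or.inl (Or.inr ⟨k1, hx.2.2.2, hx.2.1.2⟩)
    by_cases k2 : eis q α a b ∈ reuleaux (eis q α (-m) B) α (Real.sqrt 3 * ρ)
    · exact Or.inr ⟨k2, hx.2.1.1, hx.1.2⟩
    · exact Or.inl (Or.inl (Or.inl ⟨hx, fun h => h.elim (fun h => h.elim k0 k1) k2⟩))
  · rintro (((h | ⟨h, c1, c2⟩) | ⟨h, c1, c2⟩) | ⟨h, c1, c2⟩)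
    · exact h.1
    · obtain ⟨d1, d2, d3, d4, d5, d6⟩ := s0 h
      exact ⟨⟨by linarith, by linarith⟩, ⟨by linarith, by linarith⟩, by linarith, by linarith⟩
    · obtain ⟨d1, d2, d3, d4, d5, d6⟩ := s1 h
      exact ⟨⟨by linarith, by linarith⟩, ⟨by linarith, by linarith⟩, by linarith, by linarith⟩
    · obtain ⟨d1, d2, d3, d4, d5, d6⟩ := s2 h
      exact ⟨⟨by linarith, by linarith⟩, ⟨by linarith, by linarith⟩, by linarith, by linarith⟩

/-- The three Reuleaux triangles are pairwise disjoint. -/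
theorem disjoint_chips {q : Plane} {α A m S B ρ : ℝ} (h : LongSides A m S B ρ) :
    Disjoint (reuleaux q α (Real.sqrt 3 * ρ))
      (reuleaux (eis q α A (S - A)) α (Real.sqrt 3 * ρ)) ∧
    Disjoint (reuleaux q α (Real.sqrt 3 * ρ)) (reuleaux (eis q α (-m) B) α (Real.sqrt 3 * ρ)) ∧
    Disjoint (reuleaux (eis q α A (S - A)) α (Real.sqrt 3 * ρ))
      (reuleaux (eis q α (-m) B) α (Real.sqrt 3 * ρ)) := by
  obtain ⟨hρ, h0, h1, h2, h3, h4, h5⟩ := h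
  simp only [Set.disjoint_left]
  refine ⟨fun x => ?_, fun x => ?_, fun x => ?_⟩ <;>
    obtain ⟨a, b, rfl⟩ := exists_eis q α x <;> intro hx hy <;>
    obtain ⟨s0, s1, s2⟩ := chips_support (q := q) (α := α) (a := a) (b := b) (A := A) (m := m)
      (S := S) (B := B) hρ
  · obtain ⟨d1, d2, d3, d4, d5, d6⟩ := s0 hx
    obtain ⟨e1, e2, e3, e4, e5, e6⟩ := s1 hy
    linarith
  · obtain ⟨d1, d2, d3, d4, d5, d6⟩ := s0 hx
    obtain ⟨e1, e2, e3, e4, e5, e6⟩ := s2 hy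
    linarith
  · obtain ⟨d1, d2, d3, d4, d5, d6⟩ := s1 hx
    obtain ⟨e1, e2, e3, e4, e5, e6⟩ := s2 hy
    linarith

theorem corner_subset_chips {q : Plane} {α A m S B ρ : ℝ} (hρ : 0 < ρ) :
    corner q α ρ ⊆ reuleaux q α (Real.sqrt 3 * ρ) ∧
    corner (eis q α A (S - A)) (α + 2 * Real.pi / 3) ρ ⊆
      reuleaux (eis q α A (S - A)) α (Real.sqrt 3 * ρ) ∧
    corner (eis q α (-m) B) (α + 4 * Real.pi / 3) ρ ⊆
      reuleaux (eis q α (-m) B) α (Real.sqrt 3 * ρ) := by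
  have hm := fun a b => mem_corner_chips (q := q) (α := α) (a := a) (b := b) (A := A) (m := m)
    (S := S) (B := B) hρ
  refine ⟨fun x hx => ?_, fun x hx => ?_, fun x hx => ?_⟩ <;>
    obtain ⟨a, b, rfl⟩ := exists_eis q α x
  · exact ((hm a b).1.1 hx).1
  · exact ((hm a b).2.1.1 hx).1
  · exact ((hm a b).2.2.1 hx).1

/-- The hexagon minus the (closed) Reuleaux triangles, and the three corners, are disjoint. -/
theorem disjoint_pieces {q : Plane} {α A m S B ρ : ℝ} (h : LongSides A m S B ρ) :
    Disjoint (hexSet q α A m S B \ chips q α A m S B ρ) (corner q α ρ) ∧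
    Disjoint (hexSet q α A m S B \ chips q α A m S B ρ ∪ corner q α ρ)
      (corner (eis q α A (S - A)) (α + 2 * Real.pi / 3) ρ) ∧
    Disjoint (hexSet q α A m S B \ chips q α A m S B ρ ∪ corner q α ρ ∪
      corner (eis q α A (S - A)) (α + 2 * Real.pi / 3) ρ)
      (corner (eis q α (-m) B) (α + 4 * Real.pi / 3) ρ) := by
  obtain ⟨d1, d2, d3⟩ := disjoint_chips (q := q) (α := α) h
  obtain ⟨c1, c2, c3⟩ := corner_subset_chips (q := q) (α := α) (A := A) (m := m) (S := S)
    (B := B) h.pos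
  have u1 : corner q α ρ ⊆ chips q α A m S B ρ := c1.trans fun x hx => Or.inl (Or.inl hx)
  have u2 : corner (eis q α A (S - A)) (α + 2 * Real.pi / 3) ρ ⊆ chips q α A m S B ρ :=
    c2.trans fun x hx => Or.inl (Or.inr hx)
  have u3 : corner (eis q α (-m) B) (α + 4 * Real.pi / 3) ρ ⊆ chips q α A m S B ρ :=
    c3.trans fun x hx => Or.inr hx
  refine ⟨disjoint_sdiff_left.mono_right u1, ?_, ?_⟩
  · exact (disjoint_sdiff_left.mono_right u2).union_left (d1.mono c1 c2)
  · exact ((disjoint_sdiff_left.mono_right u3).union_left (d2.mono c1 c3)).union_left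
      (d3.mono c2 c3)

theorem isClosed_chips (q : Plane) (α A m S B ρ : ℝ) : IsClosed (chips q α A m S B ρ) :=
  ((isClosed_reuleaux _ _ _).union (isClosed_reuleaux _ _ _)).union (isClosed_reuleaux _ _ _)

theorem measurableSet_hexSet_diff (q : Plane) (α A m S B ρ : ℝ) :
    MeasurableSet (hexSet q α A m S B \ chips q α A m S B ρ) :=
  (isClosed_hexSet q α A m S B).measurableSet.diff (isClosed_chips q α A m S B ρ).measurableSet

/-- The outward flux through the boundary of the chipped hexagon. -/
noncomputable def chippedFlux (q : Plane) (α A m S B ρ : ℝ) (X : Plane → Plane) : ℝ :=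
  segFlux X (eis q α ρ 0) (eis q α A 0) +
    segFlux X (eis q α A 0) (eis q α A (S - A - ρ)) -
    cornerFlux X (eis q α A (S - A)) (α + 2 * Real.pi / 3) ρ +
    segFlux X (eis q α (A - ρ) (S - A + ρ)) (eis q α (S - B) B) +
    segFlux X (eis q α (S - B) B) (eis q α (-m + ρ) B) -
    cornerFlux X (eis q α (-m) B) (α + 4 * Real.pi / 3) ρ +
    segFlux X (eis q α (-m) (B - ρ)) (eis q α (-m) m) +
    segFlux X (eis q α (-m) m) (eis q α (-ρ) ρ) - cornerFlux X q α ρ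

theorem hasFlux_chippedHex (q : Plane) (α : ℝ) {A m S B ρ : ℝ} (h : LongSides A m S B ρ) :
    HasFlux (chippedHex q α A m S B ρ) (chippedFlux q α A m S B ρ) := by
  have hH := hasFlux_hexSet q α (h.pos.trans h.side₀) (h.pos.trans h.side₁) (h.pos.trans h.side₂)
    (h.pos.trans h.side₃) (h.pos.trans h.side₄) (h.pos.trans h.side₅)
  rw [hexSet_eq_union h] at hH
  obtain ⟨d1, d2, d3⟩ := disjoint_pieces (q := q) (α := α) h
  have hm := (measurableSet_hexSet_diff q α A m S B ρ).nullMeasurableSet (μ := volume)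
  have hc0 := hasFlux_corner q α h.pos
  have hc1 := hasFlux_corner (eis q α A (S - A)) (α + 2 * Real.pi / 3) h.pos
  have hc2 := hasFlux_corner (eis q α (-m) B) (α + 4 * Real.pi / 3) h.pos
  have h' := ((hH.of_union hc2 ((hm.union hc0.1).union hc1.1) d3.aedisjoint).of_union hc1
    (hm.union hc0.1) d2.aedisjoint).of_union hc0 hm d1.aedisjoint
  refine (h'.congr_ae ((isBounded_hexSet q α A m S B).subset sdiff_subset)
    (chippedHex_ae_eq q α A m S B ρ).symm).congr fun X hX => ?_
  have hXc := hX.continuous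
  obtain ⟨e1, e2, -, -⟩ := corner_rotate_endpoints (eis q α A (S - A)) α ρ
  obtain ⟨-, -, e3, e4⟩ := corner_rotate_endpoints (eis q α (-m) B) α ρ
  -- Six sides of the hexagon are split at the points where the chips begin; the initial pieces
  -- cancel against the straight sides of the corners.
  have s0 := segFlux_add_A hXc q α 0 0 ρ A
  have s1 := segFlux_add_B hXc q α A 0 (S - A - ρ) (S - A)
  have s2 := segFlux_add_C hXc q α S (S - A) (S - A + ρ) B
  have s3 := segFlux_add_A hXc q α B (S - B) (-m + ρ) (-m)
  have s4 := segFlux_add_B hXc q α (-m) B (B - ρ) m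
  have s5 := segFlux_add_C hXc q α 0 m ρ 0
  rw [e1, e2, e3, e4, chippedFlux]
  simp only [eis_eis, add_zero, eis_zero, zero_sub, sub_zero,
    show S - (S - A) = A by ring, show S - (S - A + ρ) = A - ρ by ring] at *
  simp only [← sub_eq_add_neg] at *
  rw [segFlux_comm X (eis q α (-m) B) (eis q α (-m) (B - ρ))] at *
  rw [segFlux_comm X (eis q α A (S - A)) (eis q α (A - ρ) (S - A + ρ))] at *
  rw [segFlux_comm X q (eis q α ρ 0)] at *
  linarith

/-! ### Areas -/

theorem segFlux_id (A B : Plane) : segFlux (fun y => y) A B = cross A B := by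
  have : ∀ t : ℝ, cross (A + t • (B - A)) (B - A) = cross A B := fun t => by
    simp only [cross, PiLp.sub_apply, PiLp.add_apply, PiLp.smul_apply, smul_eq_mul]; ring
  simp [segFlux, this]

theorem cross_eis (q : Plane) (α a b a' b' : ℝ) : cross (eis q α a b) (eis q α a' b') =
    (a * b' - b * a') * (Real.sqrt 3 / 2) + (a' - a) * cross q (dir α) +
      (b' - b) * cross q (dir (α + Real.pi / 3)) := by
  rw [← cross_frame α]
  simp only [cross, eis, PiLp.add_apply, PiLp.smul_apply, smul_eq_mul]; ring

theorem area_hexSet (q : Plane) (α : ℝ) {A m S B : ℝ} (h0 : 0 < A) (h1 : 0 < S - A)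
    (h2 : 0 < A + B - S) (h3 : 0 < S - B + m) (h4 : 0 < B - m) (h5 : 0 < m) :
    volume.real (hexSet q α A m S B) =
      Real.sqrt 3 / 2 * ((A + m) * B - m ^ 2 / 2 - (A + B - S) ^ 2 / 2) := by
  have h := (hasFlux_hexSet q α h0 h1 h2 h3 h4 h5).two_mul_area
  simp only [segFlux_id] at h
  have hq := eis_zero q α
  have e1 := cross_eis q α 0 0 A 0
  have e2 := cross_eis q α (-m) m 0 0
  rw [hq] at e1 e2
  rw [e1, e2, cross_eis, cross_eis, cross_eis, cross_eis] at h
  linarith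

/-- The integrand is `r²` plus the cross product of the center with the velocity: the first term
integrates to `3 ρ² · π/3`, the second to a cross product with the chord. -/
theorem cornerFlux_id (q : Plane) (α ρ : ℝ) : cornerFlux (fun y => y) q α ρ =
    Real.pi * ρ ^ 2 + cross (eis q α 0 (-ρ)) (eis q α (-ρ) ρ - eis q α ρ 0) := by
  set p := eis q α 0 (-ρ)
  set r := Real.sqrt 3 * ρ with hr
  have hs : Real.sqrt 3 ≠ 0 := by positivity
  set φ := α + Real.pi / 6
  have hint : ∀ t : ℝ, cross (p + r • dir (φ + t)) (r • dir (φ + t + Real.pi / 2)) =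
      r ^ 2 + r * cross p (dir (φ + Real.pi / 2 + 1 * t)) := fun t => by
    have := cross_dir_dir (φ + t) (φ + t + Real.pi / 2)
    rw [add_sub_cancel_left, Real.sin_pi_div_two] at this
    rw [show φ + Real.pi / 2 + 1 * t = φ + t + Real.pi / 2 by ring, ← mul_one (r ^ 2), ← this]
    simp only [cross, PiLp.add_apply, PiLp.smul_apply, smul_eq_mul]; ring
  have hd : ∀ t : ℝ, HasDerivAt (fun t => r ^ 2 * t + r * cross p (dir (φ + 1 * t)))
      (r ^ 2 + r * cross p (dir (φ + Real.pi / 2 + 1 * t))) t := fun t => by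
    refine (((hasDerivAt_id t).const_mul (r ^ 2)).add
      (((hasDerivAt_const t p).cross (hasDerivAt_dir_affine φ 1 t)).const_mul r)).congr_deriv ?_
    rw [one_smul, show φ + 1 * t + Real.pi / 2 = φ + Real.pi / 2 + 1 * t by ring]
    simp [cross]
  have hc : Continuous fun t : ℝ => r ^ 2 + r * cross p (dir (φ + Real.pi / 2 + 1 * t)) := by
    unfold cross; fun_prop
  rw [cornerFlux, arcFlux]
  simp only [← hr]
  rw [intervalIntegral.integral_congr (fun t _ => hint t),
    intervalIntegral.integral_eq_sub_of_hasDerivAt (fun t _ => hd t) (hc.intervalIntegrable _ _)]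
  have e : eis q α (-ρ) ρ - eis q α ρ 0 = r • (dir (φ + Real.pi / 3) - dir φ) := by
    rw [show φ + Real.pi / 3 = α + Real.pi / 3 + Real.pi / 6 by simp only [φ]; ring,
      dir_add_pi_div_six, dir_add_pi_div_six,
      show α + Real.pi / 3 + Real.pi / 3 = α + 2 * Real.pi / 3 by ring,
      dir_add_two_pi_div_three, ← smul_sub, smul_smul, hr,
      show Real.sqrt 3 * ρ * (1 / Real.sqrt 3) = ρ by field_simp]
    simp only [eis]; module
  have hr2 : r ^ 2 = 3 * ρ ^ 2 := by rw [hr, mul_pow, Real.sq_sqrt (by norm_num)]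
  rw [e, hr2]
  simp only [one_mul, mul_zero, add_zero, cross, PiLp.sub_apply, PiLp.smul_apply, smul_eq_mul]
  ring

theorem area_corner (q : Plane) (α : ℝ) {ρ : ℝ} (hρ : 0 < ρ) :
    volume.real (corner q α ρ) = (Real.pi - Real.sqrt 3) / 2 * ρ ^ 2 := by
  have h := (hasFlux_corner q α hρ).two_mul_area
  simp only [segFlux_id, cornerFlux_id] at h
  have hq := eis_zero q α
  have e1 := cross_eis q α 0 0 ρ 0
  have e2 := cross_eis q α (-ρ) ρ 0 0
  have e3 : cross (eis q α 0 (-ρ)) (eis q α (-ρ) ρ - eis q α ρ 0) =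
      cross (eis q α 0 (-ρ)) (eis q α (-ρ) ρ) - cross (eis q α 0 (-ρ)) (eis q α ρ 0) := by
    simp only [cross, PiLp.sub_apply]; ring
  rw [hq] at e1 e2
  rw [e1, e2, e3, cross_eis, cross_eis] at h
  linarith

theorem area_reuleaux (q : Plane) (α : ℝ) {ρ : ℝ} (hρ : 0 < ρ) :
    volume.real (reuleaux q α (Real.sqrt 3 * ρ)) = 3 * ((Real.pi - Real.sqrt 3) / 2 * ρ ^ 2) := by
  have hR := (hasFlux_reuleaux q α hρ).two_mul_area
  have h0 := (hasFlux_corner q α hρ).two_mul_area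
  have h1 := (hasFlux_corner q (α + 2 * Real.pi / 3) hρ).two_mul_area
  have h2 := (hasFlux_corner q (α + 4 * Real.pi / 3) hρ).two_mul_area
  rw [area_corner _ _ hρ] at h0 h1 h2
  obtain ⟨e1, e2, e3, e4⟩ := corner_rotate_endpoints q α ρ
  simp only [e1, e2, e3, e4, segFlux_comm (fun y => y) (eis q α (-ρ) ρ) q,
    segFlux_comm (fun y => y) (eis q α 0 (-ρ)) q, segFlux_comm (fun y => y) (eis q α ρ 0) q]
    at h0 h1 h2
  linarith

theorem area_chippedHex (q : Plane) (α : ℝ) {A m S B ρ : ℝ} (h : LongSides A m S B ρ) :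
    volume.real (chippedHex q α A m S B ρ) =
      Real.sqrt 3 / 2 * ((A + m) * B - m ^ 2 / 2 - (A + B - S) ^ 2 / 2) -
        3 * ((Real.pi - Real.sqrt 3) / 2 * ρ ^ 2) := by
  have hH := area_hexSet q α (h.pos.trans h.side₀) (h.pos.trans h.side₁) (h.pos.trans h.side₂)
    (h.pos.trans h.side₃) (h.pos.trans h.side₄) (h.pos.trans h.side₅)
  rw [hexSet_eq_union h] at hH
  obtain ⟨d1, d2, d3⟩ := disjoint_pieces (q := q) (α := α) h
  have hf : volume (hexSet q α A m S B \ chips q α A m S B ρ) ≠ ⊤ :=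
    ((isBounded_hexSet q α A m S B).subset sdiff_subset).measure_lt_top.ne
  have hc : ∀ q α, volume (corner q α ρ) ≠ ⊤ := fun q α =>
    (hasFlux_corner q α h.pos).isBounded.measure_lt_top.ne
  have hm : ∀ q α, MeasurableSet (corner q α ρ) := fun q α => (isClosed_corner q α ρ).measurableSet
  rw [measureReal_union d3 (hm _ _) (measure_union_ne_top (measure_union_ne_top hf (hc _ _))
      (hc _ _)) (hc _ _),
    measureReal_union d2 (hm _ _) (measure_union_ne_top hf (hc _ _)) (hc _ _),
    measureReal_union d1 (hm _ _) hf (hc _ _), area_corner _ _ h.pos, area_corner _ _ h.pos,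
    area_corner _ _ h.pos] at hH
  rw [measureReal_congr (chippedHex_ae_eq q α A m S B ρ)]
  linarith

/-! ### Perimeter of curvilinear polygons -/

theorem perimeter_le {E : Set Plane} {Φ : (Plane → Plane) → ℝ} (hE : HasFlux E Φ) {L : ℝ}
    (hL : ∀ X, ContDiff ℝ 1 X → (∀ x, ‖X x‖ ≤ 1) → Φ X ≤ L) : perimeter E ≤ ENNReal.ofReal L := by
  refine iSup_le fun X => iSup_le fun hX => iSup_le fun _ => iSup_le fun hX1 => ?_
  rw [hE.integral_eq X hX]
  exact ENNReal.ofReal_le_ofReal (hL X hX hX1)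

theorem le_perimeter {E : Set Plane} {Φ : (Plane → Plane) → ℝ} (hE : HasFlux E Φ)
    {X : Plane → Plane} (hX : ContDiff ℝ 1 X) (hc : HasCompactSupport X) (h1 : ∀ x, ‖X x‖ ≤ 1) :
    ENNReal.ofReal (Φ X) ≤ perimeter E := by
  rw [← hE.integral_eq X hX]
  exact le_iSup₂_of_le X hX (le_iSup₂_of_le hc h1 le_rfl)

/-- The outward flux of `X` through the edges of `P`. -/
noncomputable def EdgeCycle.flux {n : ℕ} (P : EdgeCycle n) (X : Plane → Plane) : ℝ :=
  ∑ i, ∫ t in (0 : ℝ)..P.len i, cross (X (P.point i t)) (dir (P.angle i + P.curv i * t))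

theorem abs_cross_dir_le {X : Plane → Plane} (h1 : ∀ x, ‖X x‖ ≤ 1) (x : Plane) (θ : ℝ) :
    |cross (X x) (dir θ)| ≤ 1 := by
  refine (abs_cross_le _ _).trans ?_
  rw [norm_dir, mul_one]; exact h1 x

/-- A smooth map to the closed unit disk that fixes the unit circle. -/
noncomputable def squash (y : Plane) : Plane := (2 / (1 + ‖y‖ ^ 2)) • y

theorem contDiff_squash : ContDiff ℝ 1 squash := by
  have h : ContDiff ℝ 1 fun y : Plane => 1 + ‖y‖ ^ 2 := contDiff_const.add (contDiff_norm_sq ℝ)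
  exact (contDiff_const.div h fun y => by positivity).smul contDiff_id

theorem norm_squash_le (y : Plane) : ‖squash y‖ ≤ 1 := by
  rw [squash, norm_smul, Real.norm_of_nonneg (by positivity), div_mul_eq_mul_div,
    div_le_one (by positivity)]
  nlinarith [sq_nonneg (‖y‖ - 1)]

theorem squash_of_norm_eq_one {y : Plane} (h : ‖y‖ = 1) : squash y = y := by
  rw [squash, h]; norm_num

@[simp] theorem squash_zero : squash 0 = 0 := by simp [squash]

/-- The outer normal of an arc is the restriction of an affine field of the plane, whatever the
curvature. This gives both a smooth extension of the normal and a test for lying on the circle. -/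
theorem normal_arcPoint (A : Plane) (θ κ t : ℝ) :
    dir (θ - Real.pi / 2) + κ • (arcPoint A θ κ t - A) = dir (θ + κ * t - Real.pi / 2) := by
  rcases eq_or_ne κ 0 with rfl | hκ
  · simp
  · rw [arcPoint_curved _ _ _ hκ, add_sub_cancel_left, smul_smul, mul_one_div_cancel hκ, one_smul,
      add_sub_cancel]
    congr 1; ring

theorem EdgeCycle.continuous_point {n : ℕ} (P : EdgeCycle n) (i : Fin n) :
    Continuous (P.point i) := continuous_arcPoint _ _ _

/-- A smooth field of length at most one that coincides with the outer normal of the cycle `P`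
away from its vertices. -/
theorem EdgeCycle.exists_normal_field {n : ℕ} (P : EdgeCycle n)
    (hsimple : ∀ i j, ∀ s ∈ Ico 0 (P.len i), ∀ t ∈ Ico 0 (P.len j),
      P.point i s = P.point j t → i = j ∧ s = t) {δ : ℝ} (hδ : 0 < δ) :
    ∃ X : Plane → Plane, ContDiff ℝ 1 X ∧ HasCompactSupport X ∧ (∀ x, ‖X x‖ ≤ 1) ∧
      ∀ i, ∀ t ∈ Icc δ (P.len i - δ),
        X (P.point i t) = dir (P.angle i + P.curv i * t - Real.pi / 2) := by
  classical
  -- Once their ends are removed the edges are disjoint compact sets, so smooth cut-off functions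
  -- separate them.
  let K : Fin n → Set Plane := fun i => P.point i '' Icc δ (P.len i - δ)
  have hK : ∀ i, IsCompact (K i) := fun i => isCompact_Icc.image (P.continuous_point i)
  have hdisj : ∀ i j, i ≠ j → Disjoint (K i) (K j) := by
    intro i j hij
    rw [Set.disjoint_left]
    rintro _ ⟨s, hs, rfl⟩ ⟨t, ht, h⟩
    exact hij (hsimple i j s ⟨by linarith [hs.1], by linarith [hs.2]⟩ t
      ⟨by linarith [ht.1], by linarith [ht.2]⟩ h.symm).1
  obtain ⟨R, hR⟩ := (isCompact_iUnion hK).isBounded.subset_ball (0 : Plane)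
  have hχ : ∀ i, ∃ f : Plane → ℝ, ContDiff ℝ 1 f ∧ (∀ x ∉ Metric.ball (0 : Plane) R, f x = 0) ∧
      (∀ j, j ≠ i → ∀ x ∈ K j, f x = 0) ∧ ∀ x ∈ K i, f x = 1 := by
    intro i
    have hs : IsClosed ((Metric.ball (0 : Plane) R)ᶜ ∪ ⋃ j : {j // j ≠ i}, K j) :=
      Metric.isOpen_ball.isClosed_compl.union
        (isClosed_iUnion_of_finite fun j => (hK j).isClosed)
    have hd : Disjoint ((Metric.ball (0 : Plane) R)ᶜ ∪ ⋃ j : {j // j ≠ i}, K j) (K i) := by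
      refine Disjoint.union_left ?_ (disjoint_iUnion_left.2 fun j => hdisj j i j.2)
      exact disjoint_compl_left_iff_subset.2 ((subset_iUnion K i).trans hR)
    obtain ⟨f, hf0, hf1, -⟩ := exists_contMDiffMap_zero_one_of_isClosed
      (modelWithCornersSelf ℝ Plane) (n := 1) hs (hK i).isClosed hd
    refine ⟨f, f.contMDiff.contDiff, fun x hx => hf0 (Or.inl hx), fun j hj x hx => hf0 (Or.inr ?_),
      fun x hx => hf1 hx⟩
    exact mem_iUnion.2 ⟨⟨j, hj⟩, hx⟩
  choose χ hχc hχ0 hχj hχ1 using hχ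
  let v : Fin n → Plane → Plane := fun i x =>
    dir (P.angle i - Real.pi / 2) + P.curv i • (x - P.vertex i)
  have hv : ∀ i, ContDiff ℝ 1 (v i) := fun i =>
    contDiff_const.add ((contDiff_id.sub contDiff_const).const_smul _)
  -- The sum of the localized affine fields may be long somewhere; `squash` shortens it and does not
  -- change it where it is a unit normal.
  refine ⟨fun x => squash (∑ i, χ i x • v i x), ?_, ?_, fun x => norm_squash_le _, ?_⟩
  · exact contDiff_squash.comp (ContDiff.sum fun i _ => (hχc i).smul (hv i))
  · refine HasCompactSupport.intro (isCompact_closedBall (0 : Plane) R) fun x hx => ?_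
    have hx' : x ∉ Metric.ball (0 : Plane) R := fun h => hx (Metric.ball_subset_closedBall h)
    simp [hχ0 _ x hx']
  · intro i t ht
    have hmem : P.point i t ∈ K i := mem_image_of_mem _ ht
    have hsum : ∑ j, χ j (P.point i t) • v j (P.point i t) = v i (P.point i t) := by
      rw [Finset.sum_eq_single i, hχ1 i _ hmem, one_smul]
      · intro j _ hj
        rw [hχj j i hj.symm _ hmem, zero_smul]
      · simp
    have hval : v i (P.point i t) = dir (P.angle i + P.curv i * t - Real.pi / 2) :=
      normal_arcPoint _ _ _ _
    simp only [hsum, hval]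
    exact squash_of_norm_eq_one (norm_dir _)

theorem EdgeCycle.continuous_flux_integrand {n : ℕ} (P : EdgeCycle n) {X : Plane → Plane}
    (hX : Continuous X) (i : Fin n) :
    Continuous fun t => cross (X (P.point i t)) (dir (P.angle i + P.curv i * t)) :=
  (hX.comp (P.continuous_point i)).cross (by fun_prop)

/-- The flux integrand is at most 1, which bounds the perimeter above. The reverse inequality comes
from testing with fields that equal the normal on most of the curve. -/
theorem EdgeCycle.perimeter_eq {n : ℕ} (P : EdgeCycle n) (hlen : ∀ i, 0 < P.len i)
    (hsimple : ∀ i j, ∀ s ∈ Ico 0 (P.len i), ∀ t ∈ Ico 0 (P.len j),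
      P.point i s = P.point j t → i = j ∧ s = t) {E : Set Plane} (hE : HasFlux E P.flux) :
    perimeter E = ENNReal.ofReal (∑ i, P.len i) := by
  refine le_antisymm (perimeter_le hE fun X hX h1 => ?_) ?_
  · refine Finset.sum_le_sum fun i _ => ?_
    have h : ∀ t ∈ Icc 0 (P.len i), cross (X (P.point i t)) (dir (P.angle i + P.curv i * t)) ≤ 1 :=
      fun t _ => (le_abs_self _).trans (abs_cross_dir_le h1 _ _)
    have := intervalIntegral.integral_mono_on (hlen i).le
      ((P.continuous_flux_integrand hX.continuous i).intervalIntegrable _ _)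
      (intervalIntegrable_const (μ := volume)) h
    simpa using this
  · have hmain : ∀ δ : ℝ, 0 < δ → (∀ i, 2 * δ ≤ P.len i) →
        ENNReal.ofReal (∑ i, (P.len i - 4 * δ)) ≤ perimeter E := by
      intro δ hδ hδl
      obtain ⟨X, hX, hXc, hX1, hXn⟩ := P.exists_normal_field hsimple hδ
      refine le_trans (ENNReal.ofReal_le_ofReal ?_) (le_perimeter hE hX hXc hX1)
      refine Finset.sum_le_sum fun i _ => ?_
      have hc := P.continuous_flux_integrand hX.continuous i
      have hlow : ∀ a b : ℝ, a ≤ b → -(b - a) ≤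
          ∫ t in a..b, cross (X (P.point i t)) (dir (P.angle i + P.curv i * t)) := by
        intro a b hab
        have := intervalIntegral.integral_mono_on hab (intervalIntegrable_const (μ := volume))
          (hc.intervalIntegrable a b)
          (fun t _ => neg_le_of_abs_le (abs_cross_dir_le hX1 (P.point i t)
            (P.angle i + P.curv i * t)))
        simpa using this
      have hmid : ∫ t in δ..P.len i - δ,
          cross (X (P.point i t)) (dir (P.angle i + P.curv i * t)) = P.len i - 2 * δ := by
        rw [intervalIntegral.integral_congr (g := fun _ => (1 : ℝ))]
        · simp; ring
        · intro t ht
          rw [uIcc_of_le (by linarith [hδl i])] at ht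
          simp only [hXn i t ht, cross_dir_dir]
          rw [show P.angle i + P.curv i * t - (P.angle i + P.curv i * t - Real.pi / 2) =
            Real.pi / 2 by ring, Real.sin_pi_div_two]
      have h0 := hlow 0 δ hδ.le
      have h1 := hlow (P.len i - δ) (P.len i) (by linarith)
      have hadd := intervalIntegral.integral_add_adjacent_intervals
        (hc.intervalIntegrable (μ := volume) 0 δ) (hc.intervalIntegrable δ (P.len i - δ))
      have hadd' := intervalIntegral.integral_add_adjacent_intervals
        (hc.intervalIntegrable (μ := volume) 0 (P.len i - δ))
        (hc.intervalIntegrable (P.len i - δ) (P.len i))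
      linarith
    have hlim : Filter.Tendsto (fun δ : ℝ => ENNReal.ofReal (∑ i, (P.len i - 4 * δ)))
        (nhdsWithin 0 (Ioi 0)) (nhds (ENNReal.ofReal (∑ i, P.len i))) := by
      refine ENNReal.tendsto_ofReal ?_
      have hc : Continuous fun δ : ℝ => ∑ i, (P.len i - 4 * δ) := by fun_prop
      have := hc.tendsto 0
      simp only [mul_zero, sub_zero] at this
      exact this.mono_left nhdsWithin_le_nhds
    refine le_of_tendsto hlim ?_
    have hev : ∀ᶠ δ in nhdsWithin (0 : ℝ) (Ioi 0), ∀ i, 2 * δ ≤ P.len i := by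
      rw [Filter.eventually_all]
      intro i
      have : ∀ᶠ δ in nhds (0 : ℝ), δ < P.len i / 2 := Iio_mem_nhds (by linarith [hlen i])
      filter_upwards [this.filter_mono nhdsWithin_le_nhds] with δ hδ
      linarith
    filter_upwards [hev, self_mem_nhdsWithin] with δ h hδ
    exact hmain δ hδ h

/-! ### The region bounded by a curvilinear polygon -/

theorem contDiff_arcPoint (A : Plane) (θ κ : ℝ) : ContDiff ℝ 1 (arcPoint A θ κ) := by
  rcases eq_or_ne κ 0 with rfl | hκ
  · have : arcPoint A θ 0 = fun t => A + t • dir θ := funext (arcPoint_straight A θ)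
    rw [this]
    exact contDiff_const.add (contDiff_id.smul contDiff_const)
  · have : arcPoint A θ κ = fun t => A + (1 / κ) • (dir (θ - Real.pi / 2 + κ * t) -
        dir (θ - Real.pi / 2)) := funext fun t => arcPoint_curved A θ t hκ
    rw [this]
    exact contDiff_const.add (((contDiff_dir.comp (contDiff_const.add
      (contDiff_const.mul contDiff_id))).sub contDiff_const).const_smul _)

/-- The collar map of an arc: the point at distance `p.2` to the left of the point at arc length
`p.1`. -/
noncomputable def collar (A : Plane) (θ κ : ℝ) (p : ℝ × ℝ) : Plane :=
  arcPoint A θ κ p.1 + p.2 • dir (θ + κ * p.1 + Real.pi / 2)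

theorem contDiff_collar (A : Plane) (θ κ : ℝ) : ContDiff ℝ 1 (collar A θ κ) :=
  ((contDiff_arcPoint A θ κ).comp contDiff_fst).add (contDiff_snd.smul (contDiff_dir.comp
    ((contDiff_const.add (contDiff_const.mul contDiff_fst)).add contDiff_const)))

theorem exists_combo_dir (φ : ℝ) (y : Plane) :
    ∃ a b : ℝ, a • dir φ + b • dir (φ + Real.pi / 2) = y := by
  refine ⟨y 0 * Real.cos φ + y 1 * Real.sin φ, y 1 * Real.cos φ - y 0 * Real.sin φ, ?_⟩
  have h := Real.sin_sq_add_cos_sq φ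
  apply plane_ext <;> simp [Real.cos_add, Real.sin_add]
  · linear_combination (y 0) * h
  · linear_combination (y 1) * h

/-- The differential of the collar at `(t, 0)` sends the standard basis to the tangent and the
normal, so it is onto and the map is open there. -/
theorem map_collar_nhds (A : Plane) (θ κ t : ℝ) :
    Filter.map (collar A θ κ) (nhds (t, 0)) = nhds (arcPoint A θ κ t) := by
  have hs := (contDiff_collar A θ κ).contDiffAt.hasStrictFDerivAt one_ne_zero (x := (t, 0))
  set D := fderiv ℝ (collar A θ κ) (t, 0)
  have h1 : D (1, 0) = dir (θ + κ * t) := by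
    have ha : HasDerivAt (fun s : ℝ => collar A θ κ (s, 0)) (D (1, 0)) t :=
      HasFDerivAt.comp_hasDerivAt (f := fun s : ℝ => (s, (0 : ℝ))) t hs.hasFDerivAt
        ((hasDerivAt_id t).prodMk (hasDerivAt_const t 0))
    have hb : (fun s : ℝ => collar A θ κ (s, 0)) = arcPoint A θ κ := by
      funext s; simp [collar]
    rw [hb] at ha
    exact ha.unique (hasDerivAt_arcPoint A θ κ t)
  have h2 : D (0, 1) = dir (θ + κ * t + Real.pi / 2) := by
    have ha : HasDerivAt (fun s : ℝ => collar A θ κ (t, s)) (D (0, 1)) 0 :=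
      HasFDerivAt.comp_hasDerivAt (f := fun s : ℝ => (t, s)) 0 hs.hasFDerivAt
        ((hasDerivAt_const 0 t).prodMk (hasDerivAt_id 0))
    have hb : HasDerivAt (fun s : ℝ => collar A θ κ (t, s))
        ((1 : ℝ) • dir (θ + κ * t + Real.pi / 2)) 0 :=
      ((hasDerivAt_id (0 : ℝ)).smul_const (dir (θ + κ * t + Real.pi / 2))).const_add
        (arcPoint A θ κ t)
    rw [one_smul] at hb
    exact ha.unique hb
  have hsurj : D.range = ⊤ := by
    refine LinearMap.range_eq_top.2 fun y => ?_
    obtain ⟨a, b, rfl⟩ := exists_combo_dir (θ + κ * t) y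
    refine ⟨a • (1, 0) + b • (0, 1), ?_⟩
    rw [map_add, map_smul, map_smul]
    exact congrArg₂ _ (congrArg _ h1) (congrArg _ h2)
  have := hs.map_nhds_eq_of_surj hsurj
  rw [this]
  simp [collar]

/-- The affine normal field has norm 1 on the arc and norm `|1 - κ h|` at distance `h` from it. The
bound on `κ h` excludes `1 - κ h = -1`, the antipodal point, so `κ h = 0`; when the arc is straight,
orthogonality of tangent and normal concludes. -/
theorem collar_notMem_arc {A : Plane} {θ κ s h : ℝ} (hh : h ≠ 0) (hκ : |κ * h| < 2) (s' : ℝ) :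
    collar A θ κ (s, h) ≠ arcPoint A θ κ s' := by
  intro heq
  have hneg : dir (θ + κ * s + Real.pi / 2) = -dir (θ + κ * s - Real.pi / 2) := by
    rw [← dir_add_pi]; congr 1; ring
  have h1 : dir (θ - Real.pi / 2) + κ • (collar A θ κ (s, h) - A) =
      (1 - κ * h) • dir (θ + κ * s - Real.pi / 2) := by
    have := normal_arcPoint A θ κ s
    rw [sub_smul, one_smul, ← this, collar, hneg, ← this]
    module
  rw [heq, normal_arcPoint] at h1
  have h2 := congrArg norm h1
  rw [norm_smul, norm_dir, norm_dir, mul_one, Real.norm_eq_abs] at h2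
  have h3 : κ * h = 0 := by
    obtain ⟨h4, h5⟩ := abs_lt.1 hκ
    rcases abs_choice (1 - κ * h) with h6 | h6 <;> linarith
  have hκ0 : κ = 0 := (mul_eq_zero.1 h3).resolve_right hh
  subst hκ0
  simp only [collar, arcPoint_straight, zero_mul, add_zero] at heq
  have h5 : h • dir (θ + Real.pi / 2) = (s' - s) • dir θ := by
    have : h • dir (θ + Real.pi / 2) = (A + s • dir θ + h • dir (θ + Real.pi / 2)) -
      (A + s • dir θ) := by module
    rw [this, heq]; module
  have h6 := congrArg (fun w => cross (dir θ) w) h5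
  have h7 := cross_smul_smul 1 h (dir θ) (dir (θ + Real.pi / 2))
  have h8 := cross_smul_smul 1 (s' - s) (dir θ) (dir θ)
  rw [one_smul] at h7 h8
  rw [h7, h8, cross_dir_dir, cross_dir_dir] at h6
  simp at h6
  exact hh h6

namespace EdgeCycle

variable {n : ℕ} {P : EdgeCycle n}

/-- The union of the edges. -/
def curve (P : EdgeCycle n) : Set Plane := ⋃ i, P.point i '' Icc 0 (P.len i)

theorem isCompact_edge (P : EdgeCycle n) (i : Fin n) :
    IsCompact (P.point i '' Icc 0 (P.len i)) := isCompact_Icc.image (P.continuous_point i)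

theorem point_zero (P : EdgeCycle n) (i : Fin n) : P.point i 0 = P.vertex i := arcPoint_zero _ _ _

variable [NeZero n] {F U : Set Plane}

theorem Bounds.notMem_other_edge (h : P.Bounds F) {i j : Fin n} (hij : j ≠ i) {t : ℝ}
    (ht : t ∈ Ioo 0 (P.len i)) : P.point i t ∉ P.point j '' Icc 0 (P.len j) := by
  rintro ⟨s, hs, heq⟩
  rcases hs.2.lt_or_eq with hlt | rfl
  · exact hij (h.simple j i s ⟨hs.1, hlt⟩ t ⟨ht.1.le, ht.2⟩ heq).1
  -- The end of edge `j`, absent from the half-open range of `simple`, is the start of edge `j + 1`.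
  · rw [← h.vertex_succ, ← point_zero] at heq
    have := (h.simple (j + 1) i 0 ⟨le_rfl, h.len_pos _⟩ t ⟨ht.1.le, ht.2⟩ heq).2
    exact ht.1.ne this

/-- Near an inner point of an edge, the curve has only two sides. -/
theorem Bounds.exists_sides (h : P.Bounds F) {i : Fin n} {t : ℝ} (ht : t ∈ Ioo 0 (P.len i)) :
    ∃ S₁ S₂ : Set Plane, IsPreconnected S₁ ∧ IsPreconnected S₂ ∧ S₁ ⊆ P.curveᶜ ∧ S₂ ⊆ P.curveᶜ ∧
      S₁ ∪ S₂ ∪ P.curve ∈ nhds (P.point i t) := by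
  set ψ := collar (P.vertex i) (P.angle i) (P.curv i) with hψ
  have hψc : Continuous ψ := (contDiff_collar _ _ _).continuous
  have hψ0 : ∀ s, ψ (s, 0) = P.point i s := fun s => by simp [hψ, collar, EdgeCycle.point]
  set C : Set Plane := ⋃ j : {j // j ≠ i}, P.point j '' Icc 0 (P.len j)
  have hC : IsClosed C := isClosed_iUnion_of_finite fun j => (P.isCompact_edge j).isClosed
  have hyC : P.point i t ∉ C := by
    rw [mem_iUnion]
    rintro ⟨j, hj⟩
    exact h.notMem_other_edge j.2 ht hj
  have hev : ∀ᶠ p in nhds (t, (0 : ℝ)), ψ p ∉ C ∧ p.1 ∈ Ioo 0 (P.len i) ∧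
      |P.curv i * p.2| < 2 := by
    refine ((hψc.continuousAt.eventually (hC.isOpen_compl.mem_nhds ?_))).and
      ((continuous_fst.continuousAt.eventually (isOpen_Ioo.mem_nhds ht)).and ?_)
    · rw [hψ0]; exact hyC
    · have hc : Continuous fun p : ℝ × ℝ => |P.curv i * p.2| := by fun_prop
      exact hc.continuousAt.eventually (isOpen_Iio.mem_nhds (by simp))
  obtain ⟨ε, hε, hball⟩ := Metric.eventually_nhds_iff_ball.1 hev
  have hin : ∀ a ∈ Ioo (t - ε) (t + ε), ∀ b ∈ Ioo (-ε) ε, ((a, b) : ℝ × ℝ) ∈ Metric.ball (t, 0) ε :=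
    fun a ha b hb => by
      rw [← ball_prod_same, Real.ball_eq_Ioo, Real.ball_eq_Ioo]
      exact ⟨ha, by simpa using hb⟩
  have hoff : ∀ p ∈ Metric.ball (t, (0 : ℝ)) ε, p.2 ≠ 0 → ψ p ∈ P.curveᶜ := by
    rintro p hp h0 hcurve
    obtain ⟨h1, -, h3⟩ := hball p hp
    obtain ⟨j, hj⟩ := mem_iUnion.1 hcurve
    by_cases hji : j = i
    · subst hji
      obtain ⟨s', -, hs'⟩ := hj
      exact collar_notMem_arc (s := p.1) h0 h3 s' hs'.symm
    · exact h1 (mem_iUnion.2 ⟨⟨j, hji⟩, hj⟩)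
  have hpre : ∀ I J : Set ℝ, IsPreconnected I → IsPreconnected J → IsPreconnected (ψ '' (I ×ˢ J)) :=
    fun I J hI hJ => (hI.prod hJ).image ψ hψc.continuousOn
  -- The two sides are the images of the halves of a small square under the collar map.
  refine ⟨ψ '' (Ioo (t - ε) (t + ε) ×ˢ Ioo 0 ε), ψ '' (Ioo (t - ε) (t + ε) ×ˢ Ioo (-ε) 0),
    hpre _ _ isPreconnected_Ioo isPreconnected_Ioo, hpre _ _ isPreconnected_Ioo isPreconnected_Ioo,
    ?_, ?_, ?_⟩
  · rintro _ ⟨⟨a, b⟩, ⟨ha, hb⟩, rfl⟩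
    exact hoff _ (hin a ha b ⟨by linarith [hb.1], hb.2⟩) hb.1.ne'
  · rintro _ ⟨⟨a, b⟩, ⟨ha, hb⟩, rfl⟩
    exact hoff _ (hin a ha b ⟨hb.1, by linarith [hb.2]⟩) hb.2.ne
  · have hmap := map_collar_nhds (P.vertex i) (P.angle i) (P.curv i) t
    rw [EdgeCycle.point, ← hmap]
    refine Filter.mem_of_superset (Filter.image_mem_map (Metric.ball_mem_nhds _ hε)) ?_
    rintro _ ⟨⟨a, b⟩, hab, rfl⟩
    have hab' := hball _ hab
    rw [← ball_prod_same, Real.ball_eq_Ioo, Real.ball_eq_Ioo] at hab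
    obtain ⟨ha, hb⟩ := hab
    simp only [zero_sub, zero_add] at hb
    rcases lt_trichotomy b 0 with hb0 | rfl | hb0
    · exact Or.inl (Or.inr (mem_image_of_mem ψ ⟨ha, hb.1, hb0⟩))
    · refine Or.inr (mem_iUnion.2 ⟨i, a, ⟨hab'.2.1.1.le, hab'.2.1.2.le⟩, ?_⟩)
      exact (hψ0 a).symm
    · exact Or.inl (Or.inl (mem_image_of_mem ψ ⟨ha, hb0, hb.2⟩))

theorem _root_.IsPreconnected.not_meets_two {S O₁ O₂ O₃ : Set Plane} (hS : IsPreconnected S)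
    (h1 : IsOpen O₁) (h2 : IsOpen O₂) (h3 : IsOpen O₃) (h12 : Disjoint O₁ O₂)
    (h13 : Disjoint O₁ O₃) (hsub : S ⊆ O₁ ∪ O₂ ∪ O₃) (hm1 : (S ∩ O₁).Nonempty) :
    ¬ (S ∩ O₂).Nonempty ∧ ¬ (S ∩ O₃).Nonempty := by
  have hS1 : S ⊆ O₁ := hS.subset_left_of_subset_union h1 (h2.union h3) (h12.union_right h13)
    (by rwa [← union_assoc]) hm1
  exact ⟨fun ⟨x, hx, hx'⟩ => disjoint_left.1 h12 (hS1 hx) hx',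
    fun ⟨x, hx, hx'⟩ => disjoint_left.1 h13 (hS1 hx) hx'⟩

/-- This identifies `F` from its boundary without the Jordan curve theorem, `U` being the known
exterior of an explicit region. As `U` is connected, unbounded and disjoint from the boundary of
`F`, it is disjoint from `F`. What remains is to exclude a third, bounded open set `V` outside both.
-/
theorem Bounds.eq_compl (h : P.Bounds F) (hU : IsOpen U) (hUc : IsPreconnected U)
    (hUb : Bornology.IsBounded Uᶜ) (hfr : frontier U = P.curve) : F = Uᶜ := by
  have hFc : IsClosed F := h.isCompact.isClosed
  have hfF : frontier F = P.curve := h.frontier_eq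
  have hcU : Disjoint U P.curve := by
    rw [← hfr, disjoint_comm]
    exact disjoint_left.2 fun x hx hxU => hx.2 (by rwa [hU.interior_eq])
  have hcF : P.curve ⊆ F := by rw [← hfF]; exact hFc.frontier_subset
  have hUF : Disjoint U F := by
    have hsub : U ⊆ interior F ∪ Fᶜ := by
      intro x hx
      by_cases hxF : x ∈ F
      · left
        by_contra hxi
        exact disjoint_left.1 hcU hx (hfF ▸ ⟨subset_closure hxF, hxi⟩)
      · exact Or.inr hxF
    have hne : (U ∩ Fᶜ).Nonempty := by
      by_contra hne
      have hUF : U ⊆ F := fun x hx => by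
        by_contra hxF; exact hne ⟨x, hx, hxF⟩
      have : Bornology.IsBounded (univ : Set Plane) := by
        rw [← union_compl_self U]
        exact (h.isCompact.isBounded.subset hUF).union hUb
      exact NormedSpace.unbounded_univ ℝ Plane this
    have := hUc.subset_right_of_subset_union isOpen_interior hFc.isOpen_compl
      (disjoint_compl_right.mono_left interior_subset) hsub hne
    exact disjoint_left.2 fun x hx hxF => this hx hxF
  have hUFc : IsClosed (U ∪ F) := by
    refine isClosed_of_closure_subset ?_
    rw [closure_union, hFc.closure_eq]
    refine union_subset (fun x hx => ?_) subset_union_right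
    by_cases hxU : x ∈ U
    · exact Or.inl hxU
    · exact Or.inr (hcF (hfr ▸ ⟨hx, by rwa [hU.interior_eq]⟩))
  set V := (U ∪ F)ᶜ with hV
  have hVo : IsOpen V := hUFc.isOpen_compl
  have hUV : Disjoint U V := disjoint_compl_right.mono_left subset_union_left
  have hFV : Disjoint F V := disjoint_compl_right.mono_left subset_union_right
  have hcover : P.curveᶜ ⊆ U ∪ interior F ∪ V := by
    intro x hx
    by_cases hxU : x ∈ U
    · exact Or.inl (Or.inl hxU)
    by_cases hxF : x ∈ F
    · refine Or.inl (Or.inr ?_)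
      by_contra hxi
      exact hx (hfF ▸ ⟨subset_closure hxF, hxi⟩)
    · exact Or.inr fun h => h.elim hxU hxF
  have hUI : Disjoint U (interior F) := hUF.mono_right interior_subset
  have hIV : Disjoint (interior F) V := hFV.mono_left interior_subset
  set W : Set Plane := range P.vertex with hW
  have hWfin : W.Finite := finite_range _
  -- The boundary of `V` consists of vertices at most.
  have hlocal : closure V \ V ⊆ W := by
    rintro x ⟨hxV, hxnV⟩
    have hxU : x ∉ U := fun hxU =>
      disjoint_left.1 (hUV.closure_right hU) hxU hxV
    have hxF : x ∈ F := by
      by_contra hxF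
      exact hxnV fun h => h.elim hxU hxF
    have hxI : x ∉ interior F := fun hxI =>
      disjoint_left.1 (hIV.closure_right isOpen_interior) hxI hxV
    have hxc : x ∈ P.curve := hfF ▸ ⟨subset_closure hxF, hxI⟩
    obtain ⟨i, t, ht, rfl⟩ := mem_iUnion.1 hxc
    rcases ht.1.eq_or_lt with rfl | ht0
    · exact ⟨i, (P.point_zero i).symm⟩
    rcases ht.2.eq_or_lt with rfl | ht1
    · exact ⟨i + 1, h.vertex_succ i⟩
    exfalso
    -- At an inner point of an edge, `U`, `interior F` and `V` would all accumulate. There are only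
    -- two sides, and each of them, being connected and off the curve, meets at most one of these
    -- sets.
    obtain ⟨S₁, S₂, hp1, hp2, hs1, hs2, hnhds⟩ := h.exists_sides (i := i) ⟨ht0, ht1⟩
    have hmeet : ∀ O : Set Plane, P.point i t ∈ closure O → Disjoint O P.curve →
        (S₁ ∩ O).Nonempty ∨ (S₂ ∩ O).Nonempty := by
      intro O hO hd
      obtain ⟨x, hx, hxO⟩ := mem_closure_iff_nhds.1 hO _ hnhds
      rcases hx with (hx | hx) | hx
      · exact Or.inl ⟨x, hx, hxO⟩
      · exact Or.inr ⟨x, hx, hxO⟩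
      · exact absurd hx (disjoint_left.1 hd hxO)
    have mU := hmeet U (hfr.symm ▸ hxc : P.point i t ∈ frontier U).1 hcU
    have mI := hmeet (interior F) (by rw [h.closure_interior]; exact hxF) (by
      rw [← hfF]; exact disjoint_interior_frontier)
    have mV := hmeet V hxV (hFV.symm.mono_right hcF)
    have key : ∀ S, IsPreconnected S → S ⊆ P.curveᶜ →
        ¬ ((S ∩ U).Nonempty ∧ (S ∩ interior F).Nonempty) ∧
        ¬ ((S ∩ U).Nonempty ∧ (S ∩ V).Nonempty) ∧
        ¬ ((S ∩ interior F).Nonempty ∧ (S ∩ V).Nonempty) := by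
      intro S hS hsub
      have hsub' := hsub.trans hcover
      refine ⟨fun hh => ?_, fun hh => ?_, fun hh => ?_⟩
      · exact (hS.not_meets_two hU isOpen_interior hVo hUI hUV hsub' hh.1).1 hh.2
      · exact (hS.not_meets_two hU isOpen_interior hVo hUI hUV hsub' hh.1).2 hh.2
      · rw [union_comm U] at hsub'
        exact (hS.not_meets_two isOpen_interior hU hVo hUI.symm hIV hsub' hh.1).2 hh.2
    have k1 := key S₁ hp1 hs1
    have k2 := key S₂ hp2 hs2
    rcases mU with a | a <;> rcases mI with b | b
    · exact k1.1 ⟨a, b⟩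
    · exact mV.elim (fun c => k1.2.1 ⟨a, c⟩) fun c => k2.2.2 ⟨b, c⟩
    · exact mV.elim (fun c => k1.2.2 ⟨b, c⟩) fun c => k2.2.1 ⟨a, c⟩
    · exact k2.1 ⟨a, b⟩
  have hVb : Bornology.IsBounded V := hUb.subset (compl_subset_compl.2 subset_union_left)
  have hVempty : V = ∅ := by
    by_contra hne
    have hne := nonempty_iff_ne_empty.2 hne
    -- The plane minus finitely many points is connected, so a nonempty `V` would contain it and be
    -- unbounded.
    have hWc : IsPreconnected Wᶜ := by
      refine (hWfin.countable.isPathConnected_compl_of_one_lt_rank ?_).isConnected.isPreconnected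
      rw [← Module.finrank_eq_rank]
      simp
    have hsub : Wᶜ ⊆ V ∪ (closure V)ᶜ := by
      intro x hx
      by_cases hxV : x ∈ V
      · exact Or.inl hxV
      · exact Or.inr fun hxc => hx (hlocal ⟨hxc, hxV⟩)
    have hWV : (Wᶜ ∩ V).Nonempty := by
      have := (hWfin.countable.dense_compl ℝ).inter_open_nonempty V hVo hne
      rwa [inter_comm] at this
    have := hWc.subset_left_of_subset_union hVo isClosed_closure.isOpen_compl
      (disjoint_compl_right.mono_left subset_closure) hsub hWV
    have hb : Bornology.IsBounded (univ : Set Plane) := by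
      rw [← union_compl_self W]
      exact hWfin.isBounded.union (hVb.subset this)
    exact NormedSpace.unbounded_univ ℝ Plane hb
  have huniv : U ∪ F = univ := compl_empty_iff.1 hVempty
  refine Subset.antisymm (fun x hx hxU => disjoint_left.1 hUF hxU hx) fun x hx => ?_
  have : x ∈ U ∪ F := huniv ▸ mem_univ x
  exact this.resolve_left hx

end EdgeCycle

/-! ### Boundary arcs of Reuleaux triangles -/

/-- The circular arc of `corner q α ρ`. -/
def arcSet (q : Plane) (α ρ : ℝ) : Set Plane :=
  (fun t : ℝ => eis q α 0 (-ρ) + (Real.sqrt 3 * ρ) • dir (α + Real.pi / 6 + t)) ''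
    Icc 0 (Real.pi / 3)

theorem polar_coord (p : Plane) (α s t : ℝ) :
    coordB p α (p + s • dir (α + Real.pi / 6 + t)) - coordA p α (p + s • dir (α + Real.pi / 6 + t))
      = s * (2 * Real.sin t) ∧
    2 * coordA p α (p + s • dir (α + Real.pi / 6 + t)) +
      coordB p α (p + s • dir (α + Real.pi / 6 + t)) = s * (2 * Real.cos (Real.pi / 6 + t)) := by
  have h3 : 0 < Real.sqrt 3 := by positivity
  have hs := sq_sqrt_three
  rw [add_assoc α, coord_polar, coordA_eis, coordB_eis]
  constructor
  · rw [Real.sin_add, Real.cos_add, Real.cos_pi_div_six, Real.sin_pi_div_six]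
    field_simp
    linear_combination (-s * Real.cos t) * hs
  · field_simp; ring

theorem mem_arcSet {q : Plane} {α a b ρ : ℝ} (hρ : 0 < ρ) : eis q α a b ∈ arcSet q α ρ ↔
    0 ≤ b ∧ 0 ≤ a + b ∧ a ^ 2 + a * (b + ρ) + (b + ρ) ^ 2 = 3 * ρ ^ 2 := by
  have hπ := Real.pi_pos
  have h3 : 0 < Real.sqrt 3 := by positivity
  have hs := sq_sqrt_three
  set p := eis q α 0 (-ρ) with hp
  have hr2 : (Real.sqrt 3 * ρ) ^ 2 = 3 * ρ ^ 2 := by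
    rw [mul_pow, Real.sq_sqrt (by norm_num)]
  obtain ⟨cA, cB⟩ := coord_shift q α 0 (-ρ) (eis q α a b)
  rw [← hp, coordA_eis] at cA
  rw [← hp, coordB_eis] at cB
  have hd := dist_sq_coord p α (eis q α a b)
  rw [cA, cB, sub_zero, sub_neg_eq_add] at hd
  constructor
  · rintro ⟨t, ht, heq⟩
    simp only at heq
    rw [← hp] at heq
    have hpc := coord_polar p α (Real.sqrt 3 * ρ) (Real.pi / 6 + t)
    rw [← add_assoc, heq] at hpc
    have hA := congrArg (coordA p α) hpc
    have hB := congrArg (coordB p α) hpc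
    rw [cA, coordA_eis] at hA
    rw [cB, coordB_eis] at hB
    -- On the arc `b + ρ = 2 ρ sin (π/6 + t)` and `a + b + ρ = 2 ρ cos t`, so lower bounds of `1/2`
    -- are what `0 ≤ b` and `0 ≤ a + b` require.
    have hsin : 1 / 2 ≤ Real.sin (Real.pi / 6 + t) := by
      rw [← Real.sin_pi_div_six]
      exact Real.sin_le_sin_of_le_of_le_pi_div_two (by linarith) (by linarith [ht.2])
        (by linarith [ht.1])
    have hcos : 1 / 2 ≤ Real.cos t := by
      rw [← Real.cos_pi_div_three]
      exact Real.cos_le_cos_of_nonneg_of_le_pi ht.1 (by linarith) ht.2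
    have hB' : b + ρ = 2 * ρ * Real.sin (Real.pi / 6 + t) := by
      rw [sub_neg_eq_add] at hB
      rw [hB]; field_simp
    have hAB : a + b + ρ = 2 * ρ * Real.cos t := by
      rw [sub_zero] at hA
      have : a + b + ρ = Real.sqrt 3 * ρ * Real.cos (Real.pi / 6 + t) +
          ρ * Real.sin (Real.pi / 6 + t) := by
        rw [add_assoc, hB', hA]; field_simp; ring
      rw [this, Real.sin_add, Real.cos_add, Real.cos_pi_div_six, Real.sin_pi_div_six]
      linear_combination (ρ * Real.cos t / 2) * hs
    refine ⟨by nlinarith, by nlinarith, ?_⟩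
    rw [← hd, ← heq, add_sub_cancel_left, norm_smul, norm_dir, mul_one, Real.norm_eq_abs, sq_abs,
      hr2]
  · rintro ⟨hb, hab, hN⟩
    rw [hN, ← hr2] at hd
    have hn : ‖eis q α a b - p‖ = Real.sqrt 3 * ρ :=
      (pow_left_inj₀ (norm_nonneg _) (by positivity) two_ne_zero).1 hd
    obtain ⟨t, ht, hxt⟩ := exists_polar (α + Real.pi / 6) (eis q α a b - p)
    have hx' : eis q α a b = p + (Real.sqrt 3 * ρ) • dir (α + Real.pi / 6 + t) := by
      rw [← hn, ← hxt]; module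
    obtain ⟨h1, h2⟩ := polar_coord p α (Real.sqrt 3 * ρ) t
    rw [← hx', cA, cB] at h1 h2
    have hr : 0 < Real.sqrt 3 * ρ := by positivity
    have hs0 : 0 ≤ Real.sin t := by
      have : 0 ≤ Real.sqrt 3 * ρ * (2 * Real.sin t) := by
        rw [← h1]
        by_contra! h
        nlinarith [mul_nonneg hb hρ.le]
      have := (mul_nonneg_iff_of_pos_left hr).1 this
      linarith
    have hc0 : 0 ≤ Real.cos (Real.pi / 6 + t) := by
      have : 0 ≤ Real.sqrt 3 * ρ * (2 * Real.cos (Real.pi / 6 + t)) := by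
        rw [← h2]
        by_contra! h
        nlinarith [mul_nonneg hb hρ.le, mul_nonneg hab hρ.le, mul_nonneg hb hab]
      have := (mul_nonneg_iff_of_pos_left hr).1 this
      linarith
    refine ⟨t, ⟨?_, ?_⟩, hx'.symm⟩
    · by_contra! h
      linarith [Real.sin_neg_of_neg_of_neg_pi_lt h ht.1]
    · by_contra! h
      linarith [Real.cos_neg_of_pi_div_two_lt_of_lt (x := Real.pi / 6 + t)
        (by linarith) (by linarith [ht.2])]

theorem arcSet_eq (q : Plane) (α : ℝ) {ρ : ℝ} (hρ : 0 < ρ) :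
    arcSet q α ρ = corner q α ρ \ interior (reuleaux q α (Real.sqrt 3 * ρ)) := by
  ext x
  obtain ⟨a, b, rfl⟩ := exists_eis q α x
  rw [mem_arcSet hρ, mem_sdiff, mem_interior_reuleaux hρ, corner, mem_ofPred_eq, coordA_eis,
    coordB_eis]
  constructor
  · rintro ⟨h1, h2, h3⟩
    exact ⟨⟨h1, h2, h3.le⟩, fun h => by linarith [h.2.2]⟩
  · rintro ⟨⟨h1, h2, h3⟩, h4⟩
    refine ⟨h1, h2, le_antisymm h3 ?_⟩
    by_contra! h
    exact h4 ⟨by nlinarith, by nlinarith, h⟩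

theorem frontier_reuleaux (q : Plane) (α : ℝ) {ρ : ℝ} (hρ : 0 < ρ) :
    frontier (reuleaux q α (Real.sqrt 3 * ρ)) =
      arcSet q α ρ ∪ arcSet q (α + 2 * Real.pi / 3) ρ ∪ arcSet q (α + 4 * Real.pi / 3) ρ := by
  rw [(isClosed_reuleaux _ _ _).frontier_eq, arcSet_eq _ _ hρ, arcSet_eq _ _ hρ, arcSet_eq _ _ hρ,
    reuleaux_rotate _ _ hρ, reuleaux_rotate' _ _ hρ, ← union_sdiff_distrib, ← union_sdiff_distrib,
    ← reuleaux_eq_union _ _ hρ]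

/-- In polar coordinates the complement is the image of a half-line times the unit circle, both
connected. -/
theorem isPreconnected_compl_closedBall (c : Plane) {r : ℝ} (hr : 0 ≤ r) :
    IsPreconnected (Metric.closedBall c r)ᶜ := by
  have hrank : 1 < Module.rank ℝ Plane := by
    rw [← Module.finrank_eq_rank]; simp
  have h := (isPreconnected_Ioi (a := r)).prod
    (isPreconnected_sphere hrank (0 : Plane) 1)
  have himg : (Metric.closedBall c r)ᶜ =
      (fun y : ℝ × Plane => c + y.1 • y.2) '' (Ioi r ×ˢ Metric.sphere 0 1) := by
    ext x
    simp only [mem_compl_iff, Metric.mem_closedBall, not_le, mem_image, mem_prod, mem_Ioi,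
      mem_sphere_iff_norm, sub_zero, Prod.exists, dist_eq_norm]
    constructor
    · intro hx
      have h0 : ‖x - c‖ ≠ 0 := by linarith
      refine ⟨‖x - c‖, ‖x - c‖⁻¹ • (x - c), ⟨hx, ?_⟩, ?_⟩
      · rw [norm_smul, norm_inv, norm_norm, inv_mul_cancel₀ h0]
      · rw [smul_inv_smul₀ h0]; abel
    · rintro ⟨s, u, ⟨hs, hu⟩, rfl⟩
      rw [add_sub_cancel_left, norm_smul, hu, mul_one]
      exact hs.trans_le (le_abs_self s)
  rw [himg]
  exact h.image _ (by fun_prop)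

/-- The complement is the union of the exteriors of three disks, and these exteriors meet far away.
-/
theorem isPreconnected_compl_reuleaux (q : Plane) (α : ℝ) {ρ : ℝ} (hρ : 0 < ρ) :
    IsPreconnected (reuleaux q α (Real.sqrt 3 * ρ))ᶜ := by
  have hc : ∀ c : Plane, IsPreconnected (Metric.closedBall c (Real.sqrt 3 * ρ))ᶜ := fun c =>
    isPreconnected_compl_closedBall c (by positivity)
  have hne : ∀ K : Set Plane, Bornology.IsBounded K → Kᶜ.Nonempty := by
    intro K hK
    by_contra h
    rw [not_nonempty_iff_eq_empty, compl_empty_iff] at h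
    exact NormedSpace.unbounded_univ ℝ Plane (h ▸ hK)
  rw [reuleaux_eq_inter, compl_inter, compl_inter]
  refine IsPreconnected.union' ?_ (hc _) (IsPreconnected.union' ?_ (hc _) (hc _))
  · rw [← compl_inter, ← compl_union]
    exact hne _ (Metric.isBounded_closedBall.union
      (Metric.isBounded_closedBall.subset inter_subset_left))
  · rw [← compl_union]
    exact hne _ (Metric.isBounded_closedBall.union Metric.isBounded_closedBall)

theorem EdgeCycle.Bounds.eq_reuleaux {n : ℕ} [NeZero n] {P : EdgeCycle n} {F : Set Plane}
    (h : P.Bounds F) {q : Plane} {α ρ : ℝ} (hρ : 0 < ρ)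
    (hP : P.curve = arcSet q α ρ ∪ arcSet q (α + 2 * Real.pi / 3) ρ ∪
      arcSet q (α + 4 * Real.pi / 3) ρ) : F = reuleaux q α (Real.sqrt 3 * ρ) := by
  rw [← compl_compl (reuleaux q α (Real.sqrt 3 * ρ))]
  refine h.eq_compl (isClosed_reuleaux _ _ _).isOpen_compl (isPreconnected_compl_reuleaux q α hρ)
    ?_ ?_
  · rw [compl_compl]; exact isBounded_reuleaux _ _ _
  · rw [frontier_compl, frontier_reuleaux _ _ hρ, hP]

/-! ### Boundary of the chipped hexagon -/

theorem coord_combo (q : Plane) (α : ℝ) (x y : Plane) {s t : ℝ} (hst : s + t = 1) :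
    coordA q α (s • x + t • y) = s * coordA q α x + t * coordA q α y ∧
      coordB q α (s • x + t • y) = s * coordB q α x + t * coordB q α y := by
  obtain ⟨a, b, rfl⟩ := exists_eis q α x
  obtain ⟨a', b', rfl⟩ := exists_eis q α y
  have : s • eis q α a b + t • eis q α a' b' = eis q α (s * a + t * a') (s * b + t * b') := by
    obtain rfl : t = 1 - s := by linarith
    simp only [eis]; module
  rw [this]
  simp

theorem isPreconnected_halfPlane (q : Plane) (α l m n : ℝ) :
    IsPreconnected {x | l * coordA q α x + m * coordB q α x < n} := by
  refine Convex.isPreconnected fun x hx y hy s t hs ht hst => ?_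
  obtain ⟨h1, h2⟩ := coord_combo q α x y hst
  rw [mem_ofPred_eq] at *
  rw [h1, h2]
  rcases hs.eq_or_lt with rfl | hs
  · obtain rfl : t = 1 := by linarith
    linarith
  · obtain rfl : t = 1 - s := by linarith
    nlinarith [mul_lt_mul_of_pos_left hx hs, mul_le_mul_of_nonneg_left hy.le ht]

/-- On the ray towards a vertex the decisive disk inequality is `(t - ρ)(t + 2ρ) ≤ 0`; the other two
rays follow by rotation. -/
theorem reuleaux_axes {q : Plane} {α t ρ : ℝ} (hρ : 0 < ρ) (ht : 0 ≤ t) :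
    ((eis q α t 0 ∈ reuleaux q α (Real.sqrt 3 * ρ) ↔ t ≤ ρ) ∧
      (eis q α t 0 ∈ interior (reuleaux q α (Real.sqrt 3 * ρ)) ↔ t < ρ)) ∧
    ((eis q α (-t) t ∈ reuleaux q α (Real.sqrt 3 * ρ) ↔ t ≤ ρ) ∧
      (eis q α (-t) t ∈ interior (reuleaux q α (Real.sqrt 3 * ρ)) ↔ t < ρ)) ∧
    ((eis q α 0 (-t) ∈ reuleaux q α (Real.sqrt 3 * ρ) ↔ t ≤ ρ) ∧
      (eis q α 0 (-t) ∈ interior (reuleaux q α (Real.sqrt 3 * ρ)) ↔ t < ρ)) := by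
  have hc : ∀ β, (eis q β t 0 ∈ reuleaux q β (Real.sqrt 3 * ρ) ↔ t ≤ ρ) ∧
      (eis q β t 0 ∈ interior (reuleaux q β (Real.sqrt 3 * ρ)) ↔ t < ρ) := by
    intro β
    rw [mem_reuleaux hρ, mem_interior_reuleaux hρ]
    refine ⟨⟨fun h => ?_, fun h => ⟨?_, ?_, ?_⟩⟩, ⟨fun h => ?_, fun h => ⟨?_, ?_, ?_⟩⟩⟩
    · by_contra! h'; nlinarith [h.2.2]
    · nlinarith
    · nlinarith
    · nlinarith
    · by_contra! h'; nlinarith [h.2.2]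
    · nlinarith
    · nlinarith
    · nlinarith
  refine ⟨hc α, ?_, ?_⟩
  · have h := hc (α + 2 * Real.pi / 3)
    rw [reuleaux_rotate _ _ hρ, eis_rotate] at h
    simpa using h
  · have h := hc (α + 2 * Real.pi / 3 + 2 * Real.pi / 3)
    rw [reuleaux_rotate _ _ hρ, reuleaux_rotate _ _ hρ, eis_rotate, eis_rotate] at h
    simpa using h

/-- The complement is the union of six open half-planes and the interiors of the three chips. All
are convex, and when they are added one by one each meets the previous ones; a chip does so because
the third ray from its center leaves the hexagon, and the point at distance `ρ/2` on it is a common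
point. -/
theorem isPreconnected_compl_chippedHex {q : Plane} {α A m S B ρ : ℝ} (hρ : 0 < ρ) :
    IsPreconnected (chippedHex q α A m S B ρ)ᶜ := by
  have hI : ∀ q α, IsPreconnected (interior (reuleaux q α (Real.sqrt 3 * ρ))) := fun q α =>
    (convex_reuleaux _ _ _).interior.isPreconnected
  have hc : (chippedHex q α A m S B ρ)ᶜ =
      (((((({x | 0 * coordA q α x + 1 * coordB q α x < 0} ∪
        {x | -1 * coordA q α x + 0 * coordB q α x < -A}) ∪
        {x | -1 * coordA q α x + -1 * coordB q α x < -S}) ∪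
        {x | 0 * coordA q α x + -1 * coordB q α x < -B}) ∪
        {x | 1 * coordA q α x + 0 * coordB q α x < -m}) ∪
        {x | 1 * coordA q α x + 1 * coordB q α x < 0}) ∪
        interior (reuleaux q α (Real.sqrt 3 * ρ))) ∪
        interior (reuleaux (eis q α A (S - A)) α (Real.sqrt 3 * ρ)) ∪
        interior (reuleaux (eis q α (-m) B) α (Real.sqrt 3 * ρ)) := by
    ext x
    obtain ⟨a, b, rfl⟩ := exists_eis q α x
    simp only [chippedHex, openChips, mem_compl_iff, mem_sdiff, mem_union, mem_hexSet,
      mem_ofPred_eq, coordA_eis, coordB_eis, not_and_or, not_not, not_le]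
    simp only [zero_mul, one_mul, zero_add, add_zero, neg_mul, neg_lt_neg_iff,
      ← sub_eq_add_neg]
    have e1 : -a - b < -S ↔ S < a + b := by constructor <;> intro h <;> linarith
    have e2 : 0 - b < -B ↔ B < b := by constructor <;> intro h <;> linarith
    rw [e1, e2]
    simp only [or_assoc, or_left_comm, or_comm]
  have half : ρ / 2 < ρ := by linarith
  have hpos : 0 ≤ ρ / 2 := by linarith
  rw [hc]
  refine IsPreconnected.union' ?_ (IsPreconnected.union' ?_ (IsPreconnected.union' ?_
    (IsPreconnected.union' ?_ (IsPreconnected.union' ?_ (IsPreconnected.union' ?_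
    (IsPreconnected.union' ?_ (IsPreconnected.union' ?_ (isPreconnected_halfPlane _ _ _ _ _)
    (isPreconnected_halfPlane _ _ _ _ _)) (isPreconnected_halfPlane _ _ _ _ _))
    (isPreconnected_halfPlane _ _ _ _ _)) (isPreconnected_halfPlane _ _ _ _ _))
    (isPreconnected_halfPlane _ _ _ _ _)) (hI _ _)) (hI _ _)) (hI _ _)
  · refine ⟨eis q α (-m + -(ρ / 2)) (B + ρ / 2), Or.inl (Or.inl (Or.inl (Or.inl (Or.inr ?_)))), ?_⟩
    · simp; linarith
    · rw [← eis_eis]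
      exact (reuleaux_axes hρ hpos).2.1.2.2 half
  · refine ⟨eis q α (A + ρ / 2) (S - A + 0),
      Or.inl (Or.inl (Or.inl (Or.inl (Or.inl (Or.inr ?_))))), ?_⟩
    · simp; linarith
    · rw [← eis_eis]
      exact (reuleaux_axes hρ hpos).1.2.2 half
  · refine ⟨eis q α 0 (-(ρ / 2)), Or.inl (Or.inl (Or.inl (Or.inl (Or.inl ?_)))), ?_⟩
    · simp; linarith
    · exact (reuleaux_axes hρ hpos).2.2.2.2 half
  · refine ⟨eis q α (-|m| - 1) (-1), Or.inr ?_, ?_⟩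
    · simp; linarith [le_abs_self m]
    · simp; linarith [le_abs_self m, abs_nonneg m]
  · refine ⟨eis q α (-|m| - 1) (|B| + 1), Or.inr ?_, ?_⟩
    · simp; linarith [le_abs_self B]
    · simp; linarith [le_abs_self m]
  · refine ⟨eis q α (|A| + |S| + 1) (|B| + 1), Or.inr ?_, ?_⟩
    · simp; linarith [le_abs_self S, abs_nonneg A, abs_nonneg B]
    · simp; linarith [le_abs_self B]
  · refine ⟨eis q α (|A| + |S| + 1) (|B| + 1), Or.inr ?_, ?_⟩
    · simp; linarith [le_abs_self A, abs_nonneg S]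
    · simp; linarith [le_abs_self S, abs_nonneg A, abs_nonneg B]
  · refine ⟨eis q α (|A| + 1) (-1), ?_, ?_⟩
    · simp
    · simp; linarith [le_abs_self A]

/-- The straight edges of the chipped hexagon. -/
def chippedSides (q : Plane) (α A m S B ρ : ℝ) : Set Plane :=
  {x | coordB q α x = 0 ∧ ρ ≤ coordA q α x ∧ coordA q α x ≤ A} ∪
  {x | coordA q α x = A ∧ 0 ≤ coordB q α x ∧ coordB q α x ≤ S - A - ρ} ∪
  {x | coordA q α x + coordB q α x = S ∧ S - A + ρ ≤ coordB q α x ∧ coordB q α x ≤ B} ∪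
  {x | coordB q α x = B ∧ -m + ρ ≤ coordA q α x ∧ coordA q α x ≤ S - B} ∪
  {x | coordA q α x = -m ∧ m ≤ coordB q α x ∧ coordB q α x ≤ B - ρ} ∪
  {x | coordA q α x + coordB q α x = 0 ∧ ρ ≤ coordB q α x ∧ coordB q α x ≤ m}

theorem mem_chippedSides {q : Plane} {α A m S B ρ a b : ℝ} :
    eis q α a b ∈ chippedSides q α A m S B ρ ↔
      (((((b = 0 ∧ ρ ≤ a ∧ a ≤ A) ∨ (a = A ∧ 0 ≤ b ∧ b ≤ S - A - ρ)) ∨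
        (a + b = S ∧ S - A + ρ ≤ b ∧ b ≤ B)) ∨ (b = B ∧ -m + ρ ≤ a ∧ a ≤ S - B)) ∨
        (a = -m ∧ m ≤ b ∧ b ≤ B - ρ)) ∨ (a + b = 0 ∧ ρ ≤ b ∧ b ≤ m) := by
  simp [chippedSides]

/-- The boundary of the chipped hexagon. -/
def chippedCurve (q : Plane) (α A m S B ρ : ℝ) : Set Plane :=
  chippedSides q α A m S B ρ ∪ (arcSet q α ρ ∪
    arcSet (eis q α A (S - A)) (α + 2 * Real.pi / 3) ρ ∪
    arcSet (eis q α (-m) B) (α + 4 * Real.pi / 3) ρ)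

theorem notMem_interior_of_halfPlane {D : Set Plane} {q : Plane} {α a b : ℝ} (l k n : ℝ)
    (hlk : 0 < l ^ 2 + k ^ 2)
    (hD : ∀ a b, eis q α a b ∈ D → n ≤ l * a + k * b) (h0 : l * a + k * b = n) :
    eis q α a b ∉ interior D := by
  intro h
  -- Moving against the gradient of the linear form leaves the half-plane at once.
  have hc : Continuous fun t : ℝ => eis q α (a - t * l) (b - t * k) := by unfold eis; fun_prop
  have hU : (fun t : ℝ => eis q α (a - t * l) (b - t * k)) ⁻¹' interior D ∈ nhds (0 : ℝ) := by
    refine hc.continuousAt.preimage_mem_nhds (isOpen_interior.mem_nhds ?_)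
    simpa using h
  obtain ⟨ε, hε, hb⟩ := Metric.mem_nhds_iff.1 hU
  have hm : eis q α (a - ε / 2 * l) (b - ε / 2 * k) ∈ interior D := by
    refine hb (a := ε / 2) ?_
    rw [Metric.mem_ball, Real.dist_eq, sub_zero, abs_of_pos (by linarith)]
    linarith
  have := hD _ _ (interior_subset hm)
  nlinarith

theorem notMem_interior_of_disjoint_convex {D R : Set Plane} (hR : Convex ℝ R)
    (hne : (interior R).Nonempty) (hd : Disjoint D (interior R)) {x : Plane} (hx : x ∈ R) :
    x ∉ interior D := by
  intro h
  have hcl : x ∈ closure (interior R) := by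
    rw [hR.closure_interior_eq_closure_of_nonempty_interior hne]
    exact subset_closure hx
  obtain ⟨y, hy1, hy2⟩ := mem_closure_iff.1 hcl _ isOpen_interior h
  exact Set.disjoint_left.1 hd (interior_subset hy1) hy2

theorem nonempty_interior_reuleaux (q : Plane) (α : ℝ) {ρ : ℝ} (hρ : 0 < ρ) :
    (interior (reuleaux q α (Real.sqrt 3 * ρ))).Nonempty :=
  ⟨eis q α 0 0, ((reuleaux_axes hρ le_rfl).1.2).2 hρ⟩

/-- Each side of the hexagon lies on a ray from a chip center to a chip vertex, so on a side,
membership in that chip is an inequality for one coordinate. -/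
theorem chip_axes {q : Plane} {α A m S B ρ : ℝ} (hρ : 0 < ρ) {a b : ℝ} :
    (b = 0 → 0 ≤ a →
      (eis q α a b ∈ reuleaux q α (Real.sqrt 3 * ρ) ↔ a ≤ ρ) ∧
      (eis q α a b ∈ interior (reuleaux q α (Real.sqrt 3 * ρ)) ↔ a < ρ)) ∧
    (a + b = 0 → 0 ≤ b →
      (eis q α a b ∈ reuleaux q α (Real.sqrt 3 * ρ) ↔ b ≤ ρ) ∧
      (eis q α a b ∈ interior (reuleaux q α (Real.sqrt 3 * ρ)) ↔ b < ρ)) ∧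
    (a = A → b ≤ S - A →
      (eis q α a b ∈ reuleaux (eis q α A (S - A)) α (Real.sqrt 3 * ρ) ↔ S - A - ρ ≤ b) ∧
      (eis q α a b ∈ interior (reuleaux (eis q α A (S - A)) α (Real.sqrt 3 * ρ)) ↔
        S - A - ρ < b)) ∧
    (a + b = S → S - A ≤ b →
      (eis q α a b ∈ reuleaux (eis q α A (S - A)) α (Real.sqrt 3 * ρ) ↔ b ≤ S - A + ρ) ∧
      (eis q α a b ∈ interior (reuleaux (eis q α A (S - A)) α (Real.sqrt 3 * ρ)) ↔
        b < S - A + ρ)) ∧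
    (b = B → -m ≤ a →
      (eis q α a b ∈ reuleaux (eis q α (-m) B) α (Real.sqrt 3 * ρ) ↔ a ≤ -m + ρ) ∧
      (eis q α a b ∈ interior (reuleaux (eis q α (-m) B) α (Real.sqrt 3 * ρ)) ↔ a < -m + ρ)) ∧
    (a = -m → b ≤ B →
      (eis q α a b ∈ reuleaux (eis q α (-m) B) α (Real.sqrt 3 * ρ) ↔ B - ρ ≤ b) ∧
      (eis q α a b ∈ interior (reuleaux (eis q α (-m) B) α (Real.sqrt 3 * ρ)) ↔ B - ρ < b)) := by
  refine ⟨?_, ?_, ?_, ?_, ?_, ?_⟩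
  · rintro rfl h; exact (reuleaux_axes hρ h).1
  · intro h h'
    obtain rfl : a = -b := by linarith
    exact (reuleaux_axes hρ h').2.1
  · rintro rfl h
    obtain ⟨h1, h2⟩ := (reuleaux_axes (q := eis q α a (S - a)) (α := α) hρ
      (show 0 ≤ S - a - b by linarith)).2.2
    rw [eis_eis, show a + 0 = a by ring, show S - a + -(S - a - b) = b by ring] at h1 h2
    exact ⟨h1.trans (by constructor <;> intro h <;> linarith),
      h2.trans (by constructor <;> intro h <;> linarith)⟩
  · intro h h'
    obtain ⟨h1, h2⟩ := (reuleaux_axes (q := eis q α A (S - A)) (α := α) hρ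
      (show 0 ≤ b - (S - A) by linarith)).2.1
    rw [eis_eis, show A + -(b - (S - A)) = a by linarith,
      show S - A + (b - (S - A)) = b by ring] at h1 h2
    exact ⟨h1.trans (by constructor <;> intro h <;> linarith),
      h2.trans (by constructor <;> intro h <;> linarith)⟩
  · rintro rfl h
    obtain ⟨h1, h2⟩ := (reuleaux_axes (q := eis q α (-m) b) (α := α) hρ
      (show 0 ≤ a + m by linarith)).1
    rw [eis_eis, show -m + (a + m) = a by ring, show b + 0 = b by ring] at h1 h2
    exact ⟨h1.trans (by constructor <;> intro h <;> linarith),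
      h2.trans (by constructor <;> intro h <;> linarith)⟩
  · rintro rfl h
    obtain ⟨h1, h2⟩ := (reuleaux_axes (q := eis q α (-m) B) (α := α) hρ
      (show 0 ≤ B - b by linarith)).2.2
    rw [eis_eis, show -m + 0 = -m by ring, show B + -(B - b) = b by ring] at h1 h2
    exact ⟨h1.trans (by constructor <;> intro h <;> linarith),
      h2.trans (by constructor <;> intro h <;> linarith)⟩

theorem frontier_subset_chippedCurve {q : Plane} {α A m S B ρ : ℝ} (h : LongSides A m S B ρ) :
    frontier (chippedHex q α A m S B ρ) ⊆ chippedCurve q α A m S B ρ := by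
  obtain ⟨hρ, h0, h1, h2, h3, h4, h5⟩ := h
  rw [(isClosed_chippedHex _ _ _ _ _ _ _).frontier_eq]
  intro x hx
  obtain ⟨a, b, rfl⟩ := exists_eis q α x
  obtain ⟨⟨hH, hO⟩, hI⟩ := hx
  obtain ⟨m0, m1, m2⟩ := mem_corner_chips (q := q) (α := α) (a := a) (b := b) (A := A) (m := m)
    (S := S) (B := B) hρ
  obtain ⟨x0, x5, x1, x2, x3, x4⟩ := chip_axes (q := q) (α := α) (a := a) (b := b) (A := A)
    (m := m) (S := S) (B := B) hρ
  have hH' := hH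
  rw [mem_hexSet] at hH'
  simp only [openChips, mem_union, not_or] at hO
  obtain ⟨⟨c1, c2⟩, ⟨c3, c4⟩, c5, c6⟩ := hH'
  rw [chippedCurve, mem_union, mem_union, mem_union, arcSet_eq _ _ hρ, arcSet_eq _ _ hρ,
    arcSet_eq _ _ hρ, reuleaux_rotate _ _ hρ, reuleaux_rotate' _ _ hρ]
  by_cases k0 : eis q α a b ∈ reuleaux q α (Real.sqrt 3 * ρ)
  · exact Or.inr (Or.inl (Or.inl ⟨m0.2 ⟨k0, c1, c5⟩, hO.1.1⟩))
  by_cases k1 : eis q α a b ∈ reuleaux (eis q α A (S - A)) α (Real.sqrt 3 * ρ)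
  · exact Or.inr (Or.inl (Or.inr ⟨m1.2 ⟨k1, c6, c4⟩, hO.1.2⟩))
  by_cases k2 : eis q α a b ∈ reuleaux (eis q α (-m) B) α (Real.sqrt 3 * ρ)
  · exact Or.inr (Or.inr ⟨m2.2 ⟨k2, c3, c2⟩, hO.2⟩)
  left
  rw [mem_chippedSides]
  by_cases e0 : b = 0
  · refine Or.inl (Or.inl (Or.inl (Or.inl (Or.inl ⟨e0, ?_, c4⟩))))
    by_contra! hlt
    exact k0 ((x0 e0 (by linarith)).1.2 hlt.le)
  by_cases e5 : a + b = 0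
  · refine Or.inr ⟨e5, ?_, by linarith⟩
    by_contra! hlt
    exact k0 ((x5 e5 (by linarith)).1.2 hlt.le)
  by_cases e1 : a = A
  · refine Or.inl (Or.inl (Or.inl (Or.inl (Or.inr ⟨e1, c1, ?_⟩))))
    by_contra! hlt
    exact k1 ((x1 e1 (by linarith)).1.2 hlt.le)
  by_cases e2 : a + b = S
  · refine Or.inl (Or.inl (Or.inl (Or.inr ⟨e2, ?_, c2⟩)))
    by_contra! hlt
    exact k1 ((x2 e2 (by linarith)).1.2 hlt.le)
  by_cases e3 : b = B
  · refine Or.inl (Or.inl (Or.inr ⟨e3, ?_, by linarith⟩))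
    by_contra! hlt
    exact k2 ((x3 e3 (by linarith)).1.2 hlt.le)
  by_cases e4 : a = -m
  · refine Or.inl (Or.inr ⟨e4, by linarith, ?_⟩)
    by_contra! hlt
    exact k2 ((x4 e4 (by linarith)).1.2 hlt.le)
  -- The point is now off all sides and all closed chips, so every inequality is strict and persists
  -- nearby, against the assumption that it is not interior.
  exfalso
  refine hI (mem_interior.2 ⟨{x | 0 < coordB q α x} ∩ {x | coordB q α x < B} ∩
    {x | -m < coordA q α x} ∩ {x | coordA q α x < A} ∩ {x | 0 < coordA q α x + coordB q α x} ∩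
    {x | coordA q α x + coordB q α x < S} ∩ (chips q α A m S B ρ)ᶜ, ?_, ?_, ?_⟩)
  · rintro y ⟨⟨⟨⟨⟨⟨l1, l2⟩, l3⟩, l4⟩, l5⟩, l6⟩, l7⟩
    simp only [mem_ofPred_eq] at l1 l2 l3 l4 l5 l6
    refine ⟨⟨⟨l1.le, l2.le⟩, ⟨l3.le, l4.le⟩, l5.le, l6.le⟩, fun hy => l7 ?_⟩
    rcases hy with (hy | hy) | hy
    · exact Or.inl (Or.inl (interior_subset hy))
    · exact Or.inl (Or.inr (interior_subset hy))
    · exact Or.inr (interior_subset hy)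
  · refine IsOpen.inter (IsOpen.inter (IsOpen.inter (IsOpen.inter (IsOpen.inter (IsOpen.inter ?_ ?_)
      ?_) ?_) ?_) ?_) (isClosed_chips _ _ _ _ _ _ _).isOpen_compl <;>
    exact isOpen_lt (by fun_prop) (by fun_prop)
  · refine ⟨⟨⟨⟨⟨⟨?_, ?_⟩, ?_⟩, ?_⟩, ?_⟩, ?_⟩, ?_⟩ <;>
      try simp only [mem_ofPred_eq, coordA_eis, coordB_eis]
    · exact lt_of_le_of_ne c1 (Ne.symm e0)
    · exact lt_of_le_of_ne c2 e3
    · exact lt_of_le_of_ne c3 (Ne.symm e4)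
    · exact lt_of_le_of_ne c4 e1
    · exact lt_of_le_of_ne c5 (Ne.symm e5)
    · exact lt_of_le_of_ne c6 e2
    · rintro ((h | h) | h)
      exacts [k0 h, k1 h, k2 h]

theorem chippedSides_subset_frontier {q : Plane} {α A m S B ρ : ℝ} (h : LongSides A m S B ρ) :
    chippedSides q α A m S B ρ ⊆ frontier (chippedHex q α A m S B ρ) := by
  obtain ⟨hρ, h0, h1, h2, h3, h4, h5⟩ := h
  rw [(isClosed_chippedHex _ _ _ _ _ _ _).frontier_eq]
  intro x hx
  obtain ⟨a, b, rfl⟩ := exists_eis q α x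
  obtain ⟨x0, x5, x1, x2, x3, x4⟩ := chip_axes (q := q) (α := α) (a := a) (b := b) (A := A)
    (m := m) (S := S) (B := B) hρ
  obtain ⟨s0, s1, s2⟩ := chips_support (q := q) (α := α) (a := a) (b := b) (A := A) (m := m)
    (S := S) (B := B) hρ
  have hD : ∀ a b, eis q α a b ∈ chippedHex q α A m S B ρ →
      (0 ≤ b ∧ b ≤ B) ∧ (-m ≤ a ∧ a ≤ A) ∧ 0 ≤ a + b ∧ a + b ≤ S := fun a b h =>
    mem_hexSet.1 h.1
  have hout : (eis q α a b ∉ interior (reuleaux q α (Real.sqrt 3 * ρ)) ∧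
      eis q α a b ∉ interior (reuleaux (eis q α A (S - A)) α (Real.sqrt 3 * ρ)) ∧
      eis q α a b ∉ interior (reuleaux (eis q α (-m) B) α (Real.sqrt 3 * ρ))) →
      eis q α a b ∉ openChips q α A m S B ρ := by
    rintro ⟨o0, o1, o2⟩ ((h | h) | h)
    exacts [o0 h, o1 h, o2 h]
  have t0 := fun h => s0 (interior_subset h)
  have t1 := fun h => s1 (interior_subset h)
  have t2 := fun h => s2 (interior_subset h)
  rcases mem_chippedSides.1 hx with (((((⟨e, l, u⟩ | ⟨e, l, u⟩) | ⟨e, l, u⟩) | ⟨e, l, u⟩) |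
    ⟨e, l, u⟩) | ⟨e, l, u⟩)
  · refine ⟨⟨mem_hexSet.2 (by refine ⟨⟨?_, ?_⟩, ⟨?_, ?_⟩, ?_, ?_⟩ <;> linarith),
      hout ⟨fun h => ?_, fun h => ?_, fun h => ?_⟩⟩,
      notMem_interior_of_halfPlane 0 1 0 (by norm_num)
        (fun a b h => by have := hD a b h; linarith) (by linarith)⟩
    · linarith [(x0 e (by linarith)).2.1 h]
    · linarith [(t1 h).2.2.1]
    · linarith [(t2 h).2.2.1]
  · refine ⟨⟨mem_hexSet.2 (by refine ⟨⟨?_, ?_⟩, ⟨?_, ?_⟩, ?_, ?_⟩ <;> linarith),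
      hout ⟨fun h => ?_, fun h => ?_, fun h => ?_⟩⟩,
      notMem_interior_of_halfPlane (-1) 0 (-A) (by norm_num)
        (fun a b h => by have := hD a b h; linarith) (by linarith)⟩
    · linarith [(t0 h).2.1]
    · linarith [(x1 e (by linarith)).2.1 h]
    · linarith [(t2 h).2.1]
  · refine ⟨⟨mem_hexSet.2 (by refine ⟨⟨?_, ?_⟩, ⟨?_, ?_⟩, ?_, ?_⟩ <;> linarith),
      hout ⟨fun h => ?_, fun h => ?_, fun h => ?_⟩⟩,
      notMem_interior_of_halfPlane (-1) (-1) (-S) (by norm_num)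
        (fun a b h => by have := hD a b h; linarith) (by linarith)⟩
    · linarith [(t0 h).2.2.2.2.2]
    · linarith [(x2 e (by linarith)).2.1 h]
    · linarith [(t2 h).2.2.2.2.2]
  · refine ⟨⟨mem_hexSet.2 (by refine ⟨⟨?_, ?_⟩, ⟨?_, ?_⟩, ?_, ?_⟩ <;> linarith),
      hout ⟨fun h => ?_, fun h => ?_, fun h => ?_⟩⟩,
      notMem_interior_of_halfPlane 0 (-1) (-B) (by norm_num)
        (fun a b h => by have := hD a b h; linarith) (by linarith)⟩
    · linarith [(t0 h).2.2.2.1]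
    · linarith [(t1 h).2.2.2.1]
    · linarith [(x3 e (by linarith)).2.1 h]
  · refine ⟨⟨mem_hexSet.2 (by refine ⟨⟨?_, ?_⟩, ⟨?_, ?_⟩, ?_, ?_⟩ <;> linarith),
      hout ⟨fun h => ?_, fun h => ?_, fun h => ?_⟩⟩,
      notMem_interior_of_halfPlane 1 0 (-m) (by norm_num)
        (fun a b h => by have := hD a b h; linarith) (by linarith)⟩
    · linarith [(t0 h).1]
    · linarith [(t1 h).1]
    · linarith [(x4 e (by linarith)).2.1 h]
  · refine ⟨⟨mem_hexSet.2 (by refine ⟨⟨?_, ?_⟩, ⟨?_, ?_⟩, ?_, ?_⟩ <;> linarith),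
      hout ⟨fun h => ?_, fun h => ?_, fun h => ?_⟩⟩,
      notMem_interior_of_halfPlane 1 1 0 (by norm_num)
        (fun a b h => by have := hD a b h; linarith) (by linarith)⟩
    · linarith [(x5 e (by linarith)).2.1 h]
    · linarith [(t1 h).2.2.2.2.1]
    · linarith [(t2 h).2.2.2.2.1]

theorem frontier_chippedHex {q : Plane} {α A m S B ρ : ℝ} (h : LongSides A m S B ρ) :
    frontier (chippedHex q α A m S B ρ) = chippedCurve q α A m S B ρ := by
  refine (frontier_subset_chippedCurve h).antisymm
    (union_subset (chippedSides_subset_frontier h) ?_)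
  have hρ := h.pos
  obtain ⟨d1, d2, d3⟩ := disjoint_chips (q := q) (α := α) h
  obtain ⟨c1, c2, c3⟩ := corner_subset_chips (q := q) (α := α) (A := A) (m := m) (S := S)
    (B := B) hρ
  have hH := hexSet_eq_union (q := q) (α := α) h
  have hR : ∀ {p : Plane}, interior (reuleaux p α (Real.sqrt 3 * ρ)) ⊆ openChips q α A m S B ρ →
      ∀ x ∈ reuleaux p α (Real.sqrt 3 * ρ), x ∉ interior (chippedHex q α A m S B ρ) :=
    fun hp x hx => notMem_interior_of_disjoint_convex (convex_reuleaux _ _ _)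
      (nonempty_interior_reuleaux _ _ hρ) (disjoint_sdiff_left.mono_right hp) hx
  rw [(isClosed_chippedHex _ _ _ _ _ _ _).frontier_eq, arcSet_eq _ _ hρ, arcSet_eq _ _ hρ,
    arcSet_eq _ _ hρ, reuleaux_rotate _ _ hρ, reuleaux_rotate' _ _ hρ]
  refine union_subset (union_subset ?_ ?_) ?_ <;> rintro x ⟨hx, hn⟩
  · refine ⟨⟨hH ▸ Or.inl (Or.inl (Or.inr hx)), ?_⟩,
      hR (fun y hy => Or.inl (Or.inl hy)) x (c1 hx)⟩
    rintro ((h | h) | h)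
    · exact hn h
    · exact Set.disjoint_left.1 d1 (c1 hx) (interior_subset h)
    · exact Set.disjoint_left.1 d2 (c1 hx) (interior_subset h)
  · refine ⟨⟨hH ▸ Or.inl (Or.inr hx), ?_⟩, hR (fun y hy => Or.inl (Or.inr hy)) x (c2 hx)⟩
    rintro ((h | h) | h)
    · exact Set.disjoint_left.1 d1 (interior_subset h) (c2 hx)
    · exact hn h
    · exact Set.disjoint_left.1 d3 (c2 hx) (interior_subset h)
  · refine ⟨⟨hH ▸ Or.inr hx, ?_⟩, hR (fun y hy => Or.inr hy) x (c3 hx)⟩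
    rintro ((h | h) | h)
    · exact Set.disjoint_left.1 d2 (interior_subset h) (c3 hx)
    · exact Set.disjoint_left.1 d3 (interior_subset h) (c3 hx)
    · exact hn h

theorem EdgeCycle.Bounds.eq_chippedHex {n : ℕ} [NeZero n] {P : EdgeCycle n} {F : Set Plane}
    (h : P.Bounds F) {q : Plane} {α A m S B ρ : ℝ} (hL : LongSides A m S B ρ)
    (hP : P.curve = chippedCurve q α A m S B ρ) : F = chippedHex q α A m S B ρ := by
  rw [← compl_compl (chippedHex q α A m S B ρ)]
  refine h.eq_compl (isClosed_chippedHex _ _ _ _ _ _ _).isOpen_compl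
    (isPreconnected_compl_chippedHex hL.pos) ?_ ?_
  · rw [compl_compl]; exact (isBounded_hexSet _ _ _ _ _ _).subset sdiff_subset
  · rw [frontier_compl, frontier_chippedHex hL, hP]

/-! ### Edges in coordinates -/

theorem integral_congr_dir {θ φ : ℝ} (h : dir θ = dir φ) (X : Plane → Plane) (A : Plane)
    (κ L : ℝ) : ∫ t in (0 : ℝ)..L, cross (X (arcPoint A θ κ t)) (dir (θ + κ * t)) =
      ∫ t in (0 : ℝ)..L, cross (X (arcPoint A φ κ t)) (dir (φ + κ * t)) := by
  simp only [arcPoint_congr h, dir_congr_add h]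

theorem integral_segment (X : Plane → Plane) (A : Plane) (θ : ℝ) {L : ℝ} (hL : L ≠ 0) :
    ∫ t in (0 : ℝ)..L, cross (X (arcPoint A θ 0 t)) (dir (θ + 0 * t)) =
      segFlux X A (A + L • dir θ) := by
  have h : ∀ t : ℝ, cross (X (A + t • (A + L • dir θ - A))) (A + L • dir θ - A) =
      L * cross (X (arcPoint A θ 0 (L * t))) (dir (θ + 0 * (L * t))) := fun t => by
    rw [arcPoint_straight, add_sub_cancel_left, smul_smul, mul_comm t, zero_mul, add_zero]
    simp only [cross, PiLp.smul_apply, smul_eq_mul]; ring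
  simp only [segFlux, h]
  rw [intervalIntegral.integral_const_mul,
    intervalIntegral.integral_comp_mul_left
      (fun t => cross (X (arcPoint A θ 0 t)) (dir (θ + 0 * t))) hL, smul_eq_mul, ← mul_assoc,
    mul_inv_cancel₀ hL, one_mul, mul_zero, mul_one]

theorem center_eq (q : Plane) (α ρ : ℝ) :
    eis q α ρ 0 - (Real.sqrt 3 * ρ) • dir (α + Real.pi / 6) = eis q α 0 (-ρ) ∧
    eis q α (-ρ) ρ - (Real.sqrt 3 * ρ) • dir (α + Real.pi / 2) = eis q α 0 (-ρ) := by
  have h3 : Real.sqrt 3 ≠ 0 := by positivity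
  rw [show α + Real.pi / 2 = α + Real.pi / 3 + Real.pi / 6 by ring, dir_add_pi_div_six,
    dir_add_pi_div_six, show α + Real.pi / 3 + Real.pi / 3 = α + 2 * Real.pi / 3 by ring,
    dir_add_two_pi_div_three]
  simp only [eis, smul_smul, show Real.sqrt 3 * ρ * (1 / Real.sqrt 3) = ρ by field_simp]
  constructor <;> module

/-- A left-turning edge that leaves a vertex of the Reuleaux triangle in direction `α + 2π/3` runs
along the circle around another vertex, with angle `p t`. -/
theorem arcPoint_left {p ρ : ℝ} (hρ : 0 < ρ) (hp : p * (Real.sqrt 3 * ρ) = 1) (q : Plane)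
    (α t : ℝ) : arcPoint (eis q α ρ 0) (α + 2 * Real.pi / 3) p t =
      eis q α 0 (-ρ) + (Real.sqrt 3 * ρ) • dir (α + Real.pi / 6 + p * t) := by
  have h3 : 0 < Real.sqrt 3 := by positivity
  have hp0 : p ≠ 0 := by rintro rfl; simp at hp
  rw [arcPoint_curved _ _ _ hp0, ← (center_eq q α ρ).1,
    show 1 / p = Real.sqrt 3 * ρ by rw [← hp]; field_simp,
    show α + 2 * Real.pi / 3 - Real.pi / 2 = α + Real.pi / 6 by ring]
  module

/-- This is the same arc traversed backwards, as a concave edge of the neighboring tile; hence the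
angle `π/3 - p t`. -/
theorem arcPoint_right {p ρ : ℝ} (hρ : 0 < ρ) (hp : p * (Real.sqrt 3 * ρ) = 1) (q : Plane)
    (α t : ℝ) : arcPoint (eis q α (-ρ) ρ) α (-p) t =
      eis q α 0 (-ρ) + (Real.sqrt 3 * ρ) • dir (α + Real.pi / 6 + (Real.pi / 3 - p * t)) := by
  have h3 : 0 < Real.sqrt 3 := by positivity
  have hp0 : p ≠ 0 := by rintro rfl; simp at hp
  rw [arcPoint_curved _ _ _ (neg_ne_zero.2 hp0), ← (center_eq q α ρ).2,
    show 1 / -p = -(Real.sqrt 3 * ρ) by rw [← hp]; field_simp,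
    show α + Real.pi / 2 = α - Real.pi / 2 + Real.pi by ring, dir_add_pi,
    show α + Real.pi / 6 + (Real.pi / 3 - p * t) = α - Real.pi / 2 + -p * t + Real.pi by ring,
    dir_add_pi]
  module

theorem image_arc_left {p ρ : ℝ} (hρ : 0 < ρ) (hp : p * (Real.sqrt 3 * ρ) = 1) (q : Plane)
    (α : ℝ) : arcPoint (eis q α ρ 0) (α + 2 * Real.pi / 3) p '' Icc 0 (Real.pi / 3 / p) =
      arcSet q α ρ := by
  have hp0 : 0 < p := by
    by_contra! h; nlinarith [mul_pos (show 0 < Real.sqrt 3 by positivity) hρ]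
  ext x
  simp only [arcSet, mem_image, arcPoint_left hρ hp]
  constructor
  · rintro ⟨t, ⟨h0, h1⟩, rfl⟩
    rw [le_div_iff₀ hp0] at h1
    exact ⟨p * t, ⟨by positivity, by linarith⟩, rfl⟩
  · rintro ⟨t, ⟨h0, h1⟩, rfl⟩
    refine ⟨t / p, ⟨by positivity, by gcongr⟩, ?_⟩
    rw [mul_div_cancel₀ _ hp0.ne']

theorem image_arc_right {p ρ : ℝ} (hρ : 0 < ρ) (hp : p * (Real.sqrt 3 * ρ) = 1) (q : Plane)
    (α : ℝ) : arcPoint (eis q α (-ρ) ρ) α (-p) '' Icc 0 (Real.pi / 3 / p) = arcSet q α ρ := by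
  have hp0 : 0 < p := by
    by_contra! h; nlinarith [mul_pos (show 0 < Real.sqrt 3 by positivity) hρ]
  ext x
  simp only [arcSet, mem_image, arcPoint_right hρ hp]
  constructor
  · rintro ⟨t, ⟨h0, h1⟩, rfl⟩
    rw [le_div_iff₀ hp0] at h1
    exact ⟨Real.pi / 3 - p * t, ⟨by linarith, by nlinarith⟩, rfl⟩
  · rintro ⟨t, ⟨h0, h1⟩, rfl⟩
    refine ⟨(Real.pi / 3 - t) / p, ⟨div_nonneg (by linarith) hp0.le, by gcongr; linarith⟩, ?_⟩
    rw [mul_div_cancel₀ _ hp0.ne', sub_sub_cancel]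

theorem integral_arc_left {p ρ : ℝ} (hρ : 0 < ρ) (hp : p * (Real.sqrt 3 * ρ) = 1)
    (X : Plane → Plane) (q : Plane) (α : ℝ) :
    ∫ t in (0 : ℝ)..Real.pi / 3 / p, cross (X (arcPoint (eis q α ρ 0) (α + 2 * Real.pi / 3) p t))
      (dir (α + 2 * Real.pi / 3 + p * t)) = cornerFlux X q α ρ := by
  have h3 : 0 < Real.sqrt 3 := by positivity
  have hp0 : p ≠ 0 := by rintro rfl; simp at hp
  have h : ∀ t : ℝ, cross (X (arcPoint (eis q α ρ 0) (α + 2 * Real.pi / 3) p t))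
      (dir (α + 2 * Real.pi / 3 + p * t)) = p * cross (X (eis q α 0 (-ρ) + (Real.sqrt 3 * ρ) •
        dir (α + Real.pi / 6 + p * t)))
          ((Real.sqrt 3 * ρ) • dir (α + Real.pi / 6 + p * t + Real.pi / 2)) := fun t => by
    rw [arcPoint_left hρ hp, show α + Real.pi / 6 + p * t + Real.pi / 2 =
      α + 2 * Real.pi / 3 + p * t by ring]
    generalize X _ = v
    generalize dir (α + 2 * Real.pi / 3 + p * t) = w
    simp only [cross, PiLp.smul_apply, smul_eq_mul]
    linear_combination (-(v 0 * w 1 - v 1 * w 0)) * hp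
  simp only [h]
  rw [intervalIntegral.integral_const_mul, intervalIntegral.integral_comp_mul_left
      (fun t => cross (X (eis q α 0 (-ρ) + (Real.sqrt 3 * ρ) •
        dir (α + Real.pi / 6 + t)))
          ((Real.sqrt 3 * ρ) • dir (α + Real.pi / 6 + t + Real.pi / 2))) hp0, smul_eq_mul,
    ← mul_assoc, mul_inv_cancel₀ hp0, one_mul, mul_zero, mul_div_cancel₀ _ hp0, cornerFlux, arcFlux]

theorem integral_arc_right {p ρ : ℝ} (hρ : 0 < ρ) (hp : p * (Real.sqrt 3 * ρ) = 1)
    (X : Plane → Plane) (q : Plane) (α : ℝ) :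
    ∫ t in (0 : ℝ)..Real.pi / 3 / p, cross (X (arcPoint (eis q α (-ρ) ρ) α (-p) t))
      (dir (α + -p * t)) = -cornerFlux X q α ρ := by
  have h3 : 0 < Real.sqrt 3 := by positivity
  have hp0 : p ≠ 0 := by rintro rfl; simp at hp
  have h : ∀ t : ℝ, cross (X (arcPoint (eis q α (-ρ) ρ) α (-p) t))
      (dir (α + -p * t)) = -p * cross (X (eis q α 0 (-ρ) + (Real.sqrt 3 * ρ) •
        dir (α + Real.pi / 6 + (Real.pi / 3 - p * t))))
          ((Real.sqrt 3 * ρ) • dir (α + Real.pi / 6 + (Real.pi / 3 - p * t) + Real.pi / 2)) :=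
    fun t => by
    rw [arcPoint_right hρ hp, show α + Real.pi / 6 + (Real.pi / 3 - p * t) + Real.pi / 2 =
      α + -p * t + Real.pi by ring, dir_add_pi]
    generalize X _ = v
    generalize dir (α + -p * t) = w
    simp only [cross, PiLp.smul_apply, PiLp.neg_apply, smul_eq_mul]
    linear_combination (-(v 0 * w 1 - v 1 * w 0)) * hp
  simp only [h]
  rw [intervalIntegral.integral_const_mul, intervalIntegral.integral_comp_sub_mul
      (fun t => cross (X (eis q α 0 (-ρ) + (Real.sqrt 3 * ρ) •
        dir (α + Real.pi / 6 + t)))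
          ((Real.sqrt 3 * ρ) • dir (α + Real.pi / 6 + t + Real.pi / 2))) hp0, smul_eq_mul,
    ← mul_assoc, mul_zero, mul_div_cancel₀ _ hp0, sub_self, sub_zero, cornerFlux, arcFlux,
    neg_mul, mul_inv_cancel₀ hp0, neg_one_mul]

/-! ### Curvilinear triangles -/

theorem dir_sub_dir (θ : ℝ) : dir θ - dir (θ + Real.pi / 3) = dir (θ - Real.pi / 3) := by
  have h := dir_add_five_pi_div_three θ
  rw [← h, show θ + 5 * Real.pi / 3 = θ - Real.pi / 3 + 2 * Real.pi by ring, dir_add_two_pi]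

theorem eq_of_cos_eq {y : ℝ} (h0 : Real.pi / 3 < y) (h1 : y < 4 * Real.pi / 3)
    (h : Real.cos y = -1 / 2) : y = 2 * Real.pi / 3 := by
  have hπ := Real.pi_pos
  rw [← cos_two_pi_div_three] at h
  rcases le_total y Real.pi with hy | hy
  · exact Real.injOn_cos ⟨by linarith, hy⟩ ⟨by linarith, by linarith⟩ h
  · have := Real.injOn_cos (x₁ := 2 * Real.pi - y) (x₂ := 2 * Real.pi / 3)
      ⟨by linarith, by linarith⟩ ⟨by linarith, by linarith⟩ (by rw [Real.cos_two_pi_sub, h])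
    linarith

/-- Since `dir ψ = -(dir θ + dir φ)` is a unit vector, `2 + 2 cos (φ - θ) = 1`. -/
theorem cos_of_sum_dir_eq_zero {θ φ ψ : ℝ} (h : dir θ + dir φ + dir ψ = 0) :
    Real.cos (φ - θ) = -1 / 2 := by
  have h0 := congrArg (fun x : Plane => x 0) h
  have h1 := congrArg (fun x : Plane => x 1) h
  simp only [PiLp.add_apply, dir_apply_zero, dir_apply_one, PiLp.zero_apply] at h0 h1
  have c := Real.sin_sq_add_cos_sq ψ
  have a := Real.sin_sq_add_cos_sq θ
  have b := Real.sin_sq_add_cos_sq φ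
  rw [Real.cos_sub]
  have e0 : Real.cos ψ = -(Real.cos θ + Real.cos φ) := by linarith
  have e1 : Real.sin ψ = -(Real.sin θ + Real.sin φ) := by linarith
  rw [e0, e1] at c
  linarith

theorem fin3_two_add_one : (2 : Fin 3) + 1 = 0 := rfl

/-- The opening angles `xᵢ = p · len i` have sum `π` by the turning condition. The curve closes, and
this becomes the vanishing of a sum of three unit vectors, which must then be at angles of 120°; the
range of the angles leaves only `xᵢ = π/3`. -/
theorem EdgeCycle.Bounds.triangle_len {P : EdgeCycle 3} {F : Set Plane} (h : P.Bounds F) {p : ℝ}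
    (hp : 0 < p) (hc : ∀ i, P.curv i = p) (i : Fin 3) : P.len i = Real.pi / 3 / p := by
  have hπ := Real.pi_pos
  have ht := h.turning
  simp only [Fin.sum_univ_three, hc] at ht
  set x₀ := p * P.len 0 with hx0
  set x₁ := p * P.len 1 with hx1
  set x₂ := p * P.len 2 with hx2
  have p0 : 0 < x₀ := mul_pos hp (h.len_pos 0)
  have p1 : 0 < x₁ := mul_pos hp (h.len_pos 1)
  have p2 : 0 < x₂ := mul_pos hp (h.len_pos 2)
  have hsum : x₀ + x₁ + x₂ = Real.pi := by linarith
  set b := P.angle 0 - Real.pi / 2 with hb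
  have a1 : dir (P.angle 1 - Real.pi / 2) = dir (b + x₀ + Real.pi / 3) := by
    have := dir_congr_add (h.angle_succ 0) (-(Real.pi / 2))
    rw [zero_add, hc, ← hx0] at this
    rw [sub_eq_add_neg, this]; congr 1; rw [hb]; ring
  have a2 : dir (P.angle 2 - Real.pi / 2) = dir (b + x₀ + x₁ + 2 * Real.pi / 3) := by
    have := dir_congr_add (h.angle_succ 1) (-(Real.pi / 2))
    rw [show (1 : Fin 3) + 1 = 2 from rfl, hc, ← hx1] at this
    have h2 := dir_congr_add a1 (x₁ + Real.pi / 3)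
    rw [sub_eq_add_neg, this, show P.angle 1 + x₁ + Real.pi / 3 + -(Real.pi / 2) =
      P.angle 1 - Real.pi / 2 + (x₁ + Real.pi / 3) by ring, h2]
    congr 1; ring
  have hpt : ∀ i, P.vertex (i + 1) = P.vertex i + (1 / p) •
      (dir (P.angle i - Real.pi / 2 + p * P.len i) - dir (P.angle i - Real.pi / 2)) := fun i => by
    rw [h.vertex_succ i, EdgeCycle.point, hc, arcPoint_curved _ _ _ hp.ne']
  have v0 := hpt 0
  have v1 := hpt 1
  have v2 := hpt 2
  rw [fin3_two_add_one] at v2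
  rw [show (1 : Fin 3) + 1 = 2 from rfl] at v1
  rw [zero_add] at v0
  rw [← hx0, ← hb] at v0
  rw [← hx1, dir_congr_add a1, a1] at v1
  rw [← hx2, dir_congr_add a2, a2] at v2
  -- The chords are regrouped by vertices: at each one the normal jumps by `π/3`, and `dir ψ - dir
  -- (ψ + π/3)` is again a unit vector, by `dir_sub_dir`.
  have hz : (1 / p) • (dir (b + x₀ - Real.pi / 3) + dir (b + x₀ + x₁) +
      dir (b + 4 * Real.pi / 3)) = 0 := by
    have e1 := dir_sub_dir (b + x₀)
    have e2 := dir_sub_dir (b + x₀ + x₁ + Real.pi / 3)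
    have e3 := dir_sub_dir (b + 5 * Real.pi / 3)
    rw [add_sub_cancel_right, show b + x₀ + x₁ + Real.pi / 3 + Real.pi / 3 =
      b + x₀ + x₁ + 2 * Real.pi / 3 by ring] at e2
    rw [show b + 5 * Real.pi / 3 + Real.pi / 3 = b + 2 * Real.pi by ring, dir_add_two_pi,
      show b + 5 * Real.pi / 3 - Real.pi / 3 = b + 4 * Real.pi / 3 by ring] at e3
    rw [show b + x₀ + x₁ + 2 * Real.pi / 3 + x₂ = b + 5 * Real.pi / 3 by linarith] at v2
    rw [show b + x₀ + Real.pi / 3 + x₁ = b + x₀ + x₁ + Real.pi / 3 by ring] at v1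
    rw [v1, v0] at v2
    rw [← e1, ← e2, ← e3]
    have : P.vertex 0 - P.vertex 0 = 0 := sub_self _
    nth_rewrite 1 [v2] at this
    rw [← this]; module
  have hz' := (smul_eq_zero.1 hz).resolve_left (by positivity)
  have c1 := cos_of_sum_dir_eq_zero hz'
  have c2 := cos_of_sum_dir_eq_zero (θ := b + x₀ + x₁) (φ := b + 4 * Real.pi / 3)
    (ψ := b + x₀ - Real.pi / 3) (by rw [← hz']; abel)
  have r1 := eq_of_cos_eq (by linarith) (by linarith) c1
  have r2 := eq_of_cos_eq (by linarith) (by linarith) c2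
  rw [eq_div_iff hp.ne', mul_comm]
  fin_cases i
  · change x₀ = _; linarith
  · change x₁ = _; linarith
  · change x₂ = _; linarith

theorem EdgeCycle.Bounds.triangle {P : EdgeCycle 3} {F : Set Plane} (h : P.Bounds F) {p ρ : ℝ}
    (hρ : 0 < ρ) (hp : p * (Real.sqrt 3 * ρ) = 1) (hc : ∀ i, P.curv i = p) {q : Plane} {α : ℝ}
    (hq : q = P.vertex 0 - ρ • dir α) (hα : α = P.angle 0 - 2 * Real.pi / 3) :
    (P.vertex 0 = eis q α ρ 0 ∧ dir (P.angle 0) = dir (α + 2 * Real.pi / 3)) ∧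
    (P.vertex 1 = eis q (α + 2 * Real.pi / 3) ρ 0 ∧
      dir (P.angle 1) = dir (α + 2 * Real.pi / 3 + 2 * Real.pi / 3)) ∧
    (P.vertex 2 = eis q (α + 4 * Real.pi / 3) ρ 0 ∧
      dir (P.angle 2) = dir (α + 4 * Real.pi / 3 + 2 * Real.pi / 3)) := by
  have hp0 : 0 < p := by
    by_contra! h; nlinarith [mul_pos (show 0 < Real.sqrt 3 by positivity) hρ]
  have hl := h.triangle_len hp0 hc
  have step : ∀ (i : Fin 3) (β : ℝ), P.vertex i = eis q β ρ 0 →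
      dir (P.angle i) = dir (β + 2 * Real.pi / 3) →
      P.vertex (i + 1) = eis q (β + 2 * Real.pi / 3) ρ 0 ∧
      dir (P.angle (i + 1)) = dir (β + 2 * Real.pi / 3 + 2 * Real.pi / 3) := by
    intro i β hv ha
    constructor
    · rw [h.vertex_succ, EdgeCycle.point, arcPoint_congr ha, hv, hc, hl, arcPoint_left hρ hp,
        mul_div_cancel₀ _ hp0.ne', (corner_rotate_endpoints q β ρ).1, ← (center_eq q β ρ).2,
        show β + Real.pi / 6 + Real.pi / 3 = β + Real.pi / 2 by ring, sub_add_cancel]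
    · rw [h.angle_succ, hc, hl, mul_div_cancel₀ _ hp0.ne', add_assoc, dir_congr_add ha]
      congr 1; ring
  have s0 : P.vertex 0 = eis q α ρ 0 ∧ dir (P.angle 0) = dir (α + 2 * Real.pi / 3) := by
    constructor
    · rw [hq]; simp only [eis]; module
    · rw [hα, sub_add_cancel]
  have s1 := step 0 α s0.1 s0.2
  have s2 := step 1 _ s1.1 s1.2
  rw [show α + 2 * Real.pi / 3 + 2 * Real.pi / 3 = α + 4 * Real.pi / 3 by ring] at s2
  exact ⟨s0, s1, s2⟩

theorem EdgeCycle.Bounds.triangle_eq {P : EdgeCycle 3} {F : Set Plane} (h : P.Bounds F) {p ρ : ℝ}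
    (hρ : 0 < ρ) (hp : p * (Real.sqrt 3 * ρ) = 1) (hc : ∀ i, P.curv i = p) {q : Plane} {α : ℝ}
    (hq : q = P.vertex 0 - ρ • dir α) (hα : α = P.angle 0 - 2 * Real.pi / 3) :
    F = reuleaux q α (Real.sqrt 3 * ρ) ∧
      perimeter F = ENNReal.ofReal (Real.pi * (Real.sqrt 3 * ρ)) := by
  have hp0 : 0 < p := by
    by_contra! h; nlinarith [mul_pos (show 0 < Real.sqrt 3 by positivity) hρ]
  have hl := h.triangle_len hp0 hc
  obtain ⟨⟨v0, a0⟩, ⟨v1, a1⟩, v2, a2⟩ := h.triangle hρ hp hc hq hα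
  have hF : F = reuleaux q α (Real.sqrt 3 * ρ) := by
    refine h.eq_reuleaux hρ ?_
    ext x
    simp only [EdgeCycle.curve, mem_iUnion, Fin.exists_fin_succ, IsEmpty.exists_iff, or_false,
      mem_union, ← image_arc_left hρ hp]
    have hpt : ∀ i, P.point i = arcPoint (P.vertex i) (P.angle i) p := fun i => by
      rw [← hc i]; rfl
    simp only [hpt, Fin.succ_zero_eq_one, Fin.succ_one_eq_two, hl]
    rw [v0, arcPoint_congr a0, v1, arcPoint_congr a1, v2, arcPoint_congr a2, or_assoc]
  refine ⟨hF, ?_⟩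
  rw [P.perimeter_eq h.len_pos h.simple (E := F)]
  · simp only [hl, Fin.sum_univ_three]
    congr 1
    have : 1 / p = Real.sqrt 3 * ρ := by rw [← hp]; field_simp
    rw [← this]; ring
  · rw [hF]
    refine (hasFlux_reuleaux q α hρ).congr fun X _ => ?_
    simp only [EdgeCycle.flux, Fin.sum_univ_three, EdgeCycle.point, hl, hc]
    rw [integral_congr_dir a0, integral_congr_dir a1, integral_congr_dir a2, v0, v1, v2,
      integral_arc_left hρ hp, integral_arc_left hρ hp, integral_arc_left hρ hp]

/-! ### Contacts between tiles -/

theorem mem_shiftSet {g x : Plane} {E : Set Plane} : x ∈ shiftSet g E ↔ x - g ∈ E := by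
  constructor
  · rintro ⟨y, hy, rfl⟩; simpa using hy
  · intro h; exact ⟨x - g, h, by simp⟩

theorem shiftSet_eq_preimage (g : Plane) (E : Set Plane) :
    shiftSet g E = (fun x => x - g) ⁻¹' E := ext fun _ => mem_shiftSet

theorem shiftSet_ae_eq {E F : Set Plane} (h : E =ᵐ[volume] F) (g : Plane) :
    (shiftSet g E : Set Plane) =ᵐ[volume] shiftSet g F := by
  rw [shiftSet_eq_preimage, shiftSet_eq_preimage]
  exact (measurePreserving_sub_right volume g).quasiMeasurePreserving.preimage_ae_eq h

theorem isOpen_shiftSet {E : Set Plane} (h : IsOpen E) (g : Plane) : IsOpen (shiftSet g E) := by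
  rw [shiftSet_eq_preimage]; exact h.preimage (by fun_prop)

theorem isClosed_shiftSet {E : Set Plane} (h : IsClosed E) (g : Plane) :
    IsClosed (shiftSet g E) := by
  rw [shiftSet_eq_preimage]; exact h.preimage (by fun_prop)

namespace PeriodicTiling

variable {N : ℕ} (T : PeriodicTiling N)

instance countable_lattice : Countable T.lattice :=
  have := T.discrete
  TopologicalSpace.separableSpace_iff_countable.1 inferInstance

theorem finite_lattice_inter {s : Set Plane} (hs : Bornology.IsBounded s) :
    (s ∩ (T.lattice : Set Plane)).Finite := by
  have := T.discrete
  refine Metric.finite_isBounded_inter_isClosed DiscreteTopology.isDiscrete hs ?_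
  exact AddSubgroup.isClosed_of_discrete (H := T.lattice.toAddSubgroup)

variable {T} {F : Fin N → Set Plane}

theorem disjoint_of_ae_eq (hF : ∀ k, F k =ᵐ[volume] T.tile k) {k l : Fin N} {g h : Plane}
    (hg : g ∈ T.lattice) (hh : h ∈ T.lattice) (hne : (k, g) ≠ (l, h)) :
    volume (shiftSet g (F k) ∩ shiftSet h (F l)) = 0 := by
  rw [measure_congr ((shiftSet_ae_eq (hF k) g).inter (shiftSet_ae_eq (hF l) h))]
  exact T.disjoint k l g hg h hh hne

theorem cover_of_ae_eq (hF : ∀ k, F k =ᵐ[volume] T.tile k) :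
    volume (⋃ k, ⋃ g : T.lattice, shiftSet g.1 (F k))ᶜ = 0 := by
  have h : (⋃ k, ⋃ g : T.lattice, shiftSet g.1 (F k) : Set Plane) =ᵐ[volume]
      (⋃ k, ⋃ g : T.lattice, shiftSet g.1 (T.tile k) : Set Plane) :=
    Filter.EventuallyEq.countable_iUnion fun k => Filter.EventuallyEq.countable_iUnion fun g =>
      shiftSet_ae_eq (hF k) g
  rw [measure_congr h.compl]
  have e : ∀ k, (⋃ g : T.lattice, shiftSet g.1 (T.tile k)) =
      ⋃ g ∈ T.lattice, shiftSet g (T.tile k) := fun k =>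
    iUnion_subtype (fun g => g ∈ T.lattice) fun g => shiftSet g.1 (T.tile k)
  simp only [e]
  exact T.cover

/-- A boundary point of a tile is a boundary point of some other tile. -/
theorem exists_mem_frontier (hF : ∀ k, F k =ᵐ[volume] T.tile k) (hc : ∀ k, IsCompact (F k))
    (hr : ∀ k, closure (interior (F k)) = F k) {k₀ : Fin N} {y : Plane}
    (hy : y ∈ frontier (F k₀)) :
    ∃ k, ∃ g ∈ T.lattice, (k₀, (0 : Plane)) ≠ (k, g) ∧ y - g ∈ frontier (F k) := by
  have hcl : ∀ k, IsClosed (F k) := fun k => (hc k).isClosed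
  -- Only finitely many other tiles come near `y`, so their union is closed.
  set I : Set (Fin N × T.lattice) := {i | (k₀, (0 : Plane)) ≠ (i.1, i.2.1) ∧
    (shiftSet i.2.1 (F i.1) ∩ Metric.closedBall y 1).Nonempty} with hI
  have hfin : I.Finite := by
    have hk : ∀ k, {g : T.lattice | (shiftSet g.1 (F k) ∩ Metric.closedBall y 1).Nonempty}.Finite := by
      intro k
      have hb : Bornology.IsBounded (image2 (fun a b => a - b) (Metric.closedBall y 1) (F k)) :=
        Metric.isBounded_closedBall.sub (hc k).isBounded
      refine Finite.of_finite_image (f := Subtype.val) ((T.finite_lattice_inter hb).subset ?_)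
        Subtype.val_injective.injOn
      rintro _ ⟨g, ⟨x, hx, hx'⟩, rfl⟩
      exact ⟨⟨x, hx', x - g.1, mem_shiftSet.1 hx, by simp⟩, g.2⟩
    refine (finite_iUnion fun k => ((hk k).image (Prod.mk k))).subset ?_
    rintro ⟨k, g⟩ ⟨-, h⟩
    exact mem_iUnion.2 ⟨k, g, h, rfl⟩
  have hU : IsClosed (⋃ i ∈ I, shiftSet i.2.1 (F i.1)) :=
    hfin.isClosed_biUnion fun i _ => isClosed_shiftSet (hcl _) _
  have hyU : y ∈ ⋃ i ∈ I, shiftSet i.2.1 (F i.1) := by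
    by_contra hn
    -- If no other tile contains `y`, the neighborhood `V` is covered by `F k₀` almost everywhere.
    -- As `F k₀` is closed it contains `V`, and `y` is not on its frontier.
    set V := Metric.ball y 1 ∩ (⋃ i ∈ I, shiftSet i.2.1 (F i.1))ᶜ with hV
    have hVo : IsOpen V := Metric.isOpen_ball.inter hU.isOpen_compl
    have hnull : volume (V ∩ (F k₀)ᶜ) = 0 := by
      refine measure_mono_null ?_ (cover_of_ae_eq hF)
      rintro x ⟨⟨hx1, hx2⟩, hx3⟩ hx4
      obtain ⟨k, g, hx⟩ := by simpa only [mem_iUnion] using hx4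
      by_cases he : (k₀, (0 : Plane)) = (k, g.1)
      · obtain ⟨rfl, h0⟩ := Prod.mk.inj he
        rw [mem_shiftSet, ← h0, sub_zero] at hx
        exact hx3 hx
      · exact hx2 (mem_iUnion₂.2 ⟨(k, g), ⟨he, x, hx, Metric.ball_subset_closedBall hx1⟩, hx⟩)
    have hemp : V ∩ (F k₀)ᶜ = ∅ :=
      ((hVo.inter (hcl k₀).isOpen_compl).measure_eq_zero_iff volume).1 hnull
    have : V ⊆ F k₀ := by
      rw [← Set.sdiff_eq, sdiff_eq_empty] at hemp
      exact hemp
    exact hy.2 (mem_interior.2 ⟨V, this, hVo, Metric.mem_ball_self one_pos, hn⟩)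
  obtain ⟨⟨k, g⟩, ⟨hne, -⟩, hyg⟩ := mem_iUnion₂.1 hyU
  refine ⟨k, g.1, g.2, hne, subset_closure (mem_shiftSet.1 hyg), fun hint => ?_⟩
  -- If `y` were interior to the other tile, the two interiors would meet in a nonempty open set, of
  -- positive measure.
  have hy0 : y ∈ closure (interior (F k₀)) := by rw [hr, ← (hcl k₀).closure_eq]; exact hy.1
  have hWo : IsOpen (shiftSet g.1 (interior (F k))) := isOpen_shiftSet isOpen_interior _
  obtain ⟨z, hz1, hz2⟩ := mem_closure_iff.1 hy0 _ hWo (mem_shiftSet.2 hint)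
  have h0 : volume (shiftSet g.1 (interior (F k)) ∩ interior (F k₀)) = 0 := by
    refine measure_mono_null ?_ (disjoint_of_ae_eq hF T.lattice.zero_mem g.2 hne)
    rintro x ⟨hx1, hx2⟩
    refine ⟨mem_shiftSet.2 ?_, mem_shiftSet.2 (interior_subset (mem_shiftSet.1 hx1))⟩
    rw [sub_zero]; exact interior_subset hx2
  exact Set.eq_empty_iff_forall_notMem.1
    (((hWo.inter isOpen_interior).measure_eq_zero_iff volume).1 h0) z ⟨hz1, hz2⟩

end PeriodicTiling

/-! ### Intersections of circles and lines -/

theorem countable_dir_eq (w : Plane) : {u | dir u = w}.Countable := by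
  by_cases h : ∃ u, dir u = w
  · obtain ⟨v, rfl⟩ := h
    refine (countable_range fun k : ℤ => v + k * (2 * Real.pi)).mono ?_
    intro u hu
    obtain ⟨k, rfl⟩ := dir_eq_dir_iff.1 (Eq.symm hu)
    exact ⟨k, rfl⟩
  · convert countable_empty
    exact Set.eq_empty_iff_forall_notMem.2 fun u hu => h ⟨u, hu⟩

/-- The equation determines the conjugate expression `l sin u - k cos u` up to sign. The two values
together determine `dir u`, hence `u` modulo `2π`. -/
theorem countable_cos_sin {l k : ℝ} (h : l ≠ 0 ∨ k ≠ 0) (n : ℝ) :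
    {u | l * Real.cos u + k * Real.sin u = n}.Countable := by
  have hpos : 0 < l ^ 2 + k ^ 2 := by
    rcases h with h | h <;> positivity
  have hw : ∀ s, {u | l * Real.cos u + k * Real.sin u = n ∧
      l * Real.sin u - k * Real.cos u = s}.Countable := fun s => by
    refine (countable_dir_eq !₂[(l * n - k * s) / (l ^ 2 + k ^ 2),
      (k * n + l * s) / (l ^ 2 + k ^ 2)]).mono fun u hu => ?_
    obtain ⟨h1, h2⟩ := hu
    apply plane_ext
    · simp only [dir_apply_zero, Matrix.cons_val_zero]
      rw [eq_div_iff hpos.ne', ← h1, ← h2]; ring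
    · simp only [dir_apply_one, Matrix.cons_val_one, Matrix.cons_val_fin_one]
      rw [eq_div_iff hpos.ne', ← h1, ← h2]; ring
  refine ((hw (Real.sqrt (l ^ 2 + k ^ 2 - n ^ 2))).union
    (hw (-Real.sqrt (l ^ 2 + k ^ 2 - n ^ 2)))).mono fun u hu => ?_
  have hu' : l * Real.cos u + k * Real.sin u = n := hu
  have hsq : (l * Real.sin u - k * Real.cos u) ^ 2 = l ^ 2 + k ^ 2 - n ^ 2 := by
    rw [← hu']
    linear_combination (l ^ 2 + k ^ 2) * Real.sin_sq_add_cos_sq u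
  have hs := Real.sq_sqrt (hsq ▸ sq_nonneg (l * Real.sin u - k * Real.cos u))
  rcases sq_eq_sq_iff_eq_or_eq_neg.1 (hsq.trans hs.symm) with e | e
  · exact Or.inl ⟨hu, e⟩
  · exact Or.inr ⟨hu, e⟩

theorem countable_mem_line {r : ℝ} (hr : r ≠ 0) (c A : Plane) (θ : ℝ) :
    {u | ∃ t : ℝ, c + r • dir u = A + t • dir θ}.Countable := by
  have h : Real.sin θ ≠ 0 ∨ -Real.cos θ ≠ 0 := by
    by_contra! h
    have := Real.sin_sq_add_cos_sq θ
    rw [h.1, neg_eq_zero.1 h.2] at this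
    norm_num at this
  refine (countable_cos_sin h ((Real.sin θ * (A 0 - c 0) - Real.cos θ * (A 1 - c 1)) / r)).mono ?_
  rintro u ⟨t, ht⟩
  obtain ⟨h0, h1⟩ := plane_ext_iff.1 ht
  simp only [PiLp.add_apply, PiLp.smul_apply, smul_eq_mul, dir_apply_zero, dir_apply_one] at h0 h1
  rw [mem_ofPred_eq, eq_div_iff hr]
  linear_combination Real.sin θ * h0 - Real.cos θ * h1

/-- Subtracting the equations of the two circles leaves a linear equation in `cos u` and `sin u`,
nontrivial because the centers differ. -/
theorem countable_mem_circle {r : ℝ} (hr : r ≠ 0) {c C : Plane} (hcC : c ≠ C) :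
    {u | ∃ v : ℝ, c + r • dir u = C + r • dir v}.Countable := by
  have h : C 0 - c 0 ≠ 0 ∨ C 1 - c 1 ≠ 0 := by
    by_contra! h
    exact hcC (plane_ext (by linarith) (by linarith))
  refine (countable_cos_sin h (((C 0 - c 0) ^ 2 + (C 1 - c 1) ^ 2) / (2 * r))).mono ?_
  rintro u ⟨v, hv⟩
  obtain ⟨h0, h1⟩ := plane_ext_iff.1 hv
  simp only [PiLp.add_apply, PiLp.smul_apply, smul_eq_mul, dir_apply_zero, dir_apply_one] at h0 h1
  rw [mem_ofPred_eq, eq_div_iff (by positivity)]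
  have e0 : r * Real.cos v = c 0 - C 0 + r * Real.cos u := by linarith
  have e1 : r * Real.sin v = c 1 - C 1 + r * Real.sin u := by linarith
  have : (r * Real.cos v) ^ 2 + (r * Real.sin v) ^ 2 = r ^ 2 := by
    linear_combination r ^ 2 * Real.sin_sq_add_cos_sq v
  rw [e0, e1] at this
  linear_combination -this + r ^ 2 * Real.sin_sq_add_cos_sq u

theorem reuleaux_congr {θ φ : ℝ} (h : dir θ = dir φ) (v : Plane) (r : ℝ) :
    reuleaux v θ r = reuleaux v φ r := by
  simp only [reuleaux, dir_congr_add h]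

theorem reuleaux_add_int_mul (q : Plane) (α : ℝ) {ρ : ℝ} (hρ : 0 < ρ) (k : ℤ) :
    reuleaux q (α + k * (2 * Real.pi / 3)) (Real.sqrt 3 * ρ) =
      reuleaux q α (Real.sqrt 3 * ρ) := by
  induction k using Int.induction_on with
  | zero => simp
  | succ n ih =>
    refine Eq.trans ?_ ((reuleaux_rotate q (α + _) hρ).trans ih)
    push_cast; congr 1; ring
  | pred n ih =>
    rw [← ih, ← reuleaux_rotate _ (α + ((-(n : ℤ) - 1 : ℤ) : ℝ) * _) hρ]; push_cast; congr 1; ring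

theorem arcSet_subset_frontier (q : Plane) (α : ℝ) {ρ : ℝ} (hρ : 0 < ρ) (k : ℤ) :
    arcSet q (α + k * (2 * Real.pi / 3)) ρ ⊆ frontier (reuleaux q α (Real.sqrt 3 * ρ)) := by
  rw [← reuleaux_add_int_mul q α hρ k, frontier_reuleaux _ _ hρ]
  exact fun x hx => Or.inl (Or.inl hx)

theorem exists_mem_arcSet {q : Plane} {α ρ : ℝ} (hρ : 0 < ρ) {x : Plane}
    (hx : x ∈ frontier (reuleaux q α (Real.sqrt 3 * ρ))) :
    ∃ k : ℤ, x ∈ arcSet q (α + k * (2 * Real.pi / 3)) ρ := by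
  rw [frontier_reuleaux _ _ hρ] at hx
  rcases hx with (hx | hx) | hx
  · exact ⟨0, by simpa using hx⟩
  · exact ⟨1, by simpa using hx⟩
  · refine ⟨2, ?_⟩
    rwa [show α + ((2 : ℤ) : ℝ) * (2 * Real.pi / 3) = α + 4 * Real.pi / 3 by push_cast; ring]

theorem not_countable_Ioo {a b : ℝ} (h : a < b) : ¬ (Ioo a b).Countable := fun hc => by
  have := hc.measure_zero volume
  rw [Real.volume_Ioo, ENNReal.ofReal_eq_zero] at this
  linarith

/-- If an interval avoids, up to a countable set, the periodic family of intervals of length `π / 3`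
and period `2 π / 3`, then its length is at most `π / 3`. -/
theorem gap_le {ψ β z : ℝ} {C : Set ℝ} (hC : C.Countable)
    (h : ∀ (i : ℤ), ∀ u ∈ Ioo (ψ + i * (2 * Real.pi / 3)) (ψ + i * (2 * Real.pi / 3) + Real.pi / 3),
      u ∈ Ioo β (β + z) → u ∈ C) :
    z ≤ Real.pi / 3 ∧ (z = Real.pi / 3 → ∃ k : ℤ, β = ψ + Real.pi / 3 + k * (2 * Real.pi / 3)) := by
  have hπ := Real.pi_pos
  -- The interval with index `k` is the first whose right end exceeds `β`. Overlapping with `(β, β +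
  -- z)` would produce an uncountable intersection, so `(β, β + z)`, if nonempty, ends before it
  -- begins.
  obtain ⟨k, ⟨h1, h2⟩, -⟩ := existsUnique_add_zsmul_mem_Ioc
    (show 0 < 2 * Real.pi / 3 by positivity) (ψ + Real.pi / 3) β
  rw [zsmul_eq_mul] at h1 h2
  have key : z ≤ 0 ∨ β + z ≤ ψ + k * (2 * Real.pi / 3) := by
    by_contra! hn
    refine not_countable_Ioo (a := max β (ψ + k * (2 * Real.pi / 3)))
      (b := min (ψ + k * (2 * Real.pi / 3) + Real.pi / 3) (β + z)) ?_ (hC.mono fun u hu => ?_)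
    · refine max_lt (lt_min ?_ ?_) (lt_min ?_ ?_) <;> linarith
    · obtain ⟨hu1, hu2⟩ := hu
      rw [max_lt_iff] at hu1
      rw [lt_min_iff] at hu2
      exact h k u ⟨hu1.2, hu2.1⟩ ⟨hu1.1, hu2.2⟩
  refine ⟨by rcases key with h | h <;> linarith, fun hz => ⟨k - 1, ?_⟩⟩
  push_cast
  rcases key with h | h
  · linarith
  · linarith

theorem int_mul_two_pi_eq_zero {m : ℤ} (h0 : -(2 * Real.pi) < m * (2 * Real.pi))
    (h1 : m * (2 * Real.pi) < 2 * Real.pi) : m = 0 := by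
  have hπ := Real.pi_pos
  have a : (-1 : ℝ) < m := by nlinarith
  have b : (m : ℝ) < 1 := by nlinarith
  have a' : -1 < m := by exact_mod_cast a
  have b' : m < 1 := by exact_mod_cast b
  omega

/-- The normals of the three sides fill disjoint sets of directions, so an inner normal direction of
a side determines the side, that is, its index modulo 3. -/
theorem int_eq_of_dir_eq {α : ℝ} {i j : ℤ} {s t : ℝ} (hs : s ∈ Ioo 0 (Real.pi / 3))
    (ht : t ∈ Icc 0 (Real.pi / 3))
    (h : dir (α + i * (2 * Real.pi / 3) + s) = dir (α + j * (2 * Real.pi / 3) + t)) :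
    ∃ m : ℤ, j + 3 * m = i := by
  have hπ := Real.pi_pos
  obtain ⟨m, hm⟩ := dir_eq_dir_iff.1 h
  refine ⟨-m, ?_⟩
  have key : ((j - 3 * m - i : ℤ) : ℝ) * (2 * Real.pi) = 3 * (s - t) := by
    push_cast; linarith
  have := int_mul_two_pi_eq_zero (m := j - 3 * m - i) (by rw [key]; linarith [hs.1, ht.2])
    (by rw [key]; linarith [hs.2, ht.1])
  omega

/-! ### Matching the concave arcs with the sides of the Reuleaux triangle. -/

/-- The arc number `n` of a curvilinear polygon of nine edges. -/
def arcIndex (n : Fin 3) : Fin 9 := ⟨3 * n + 2, by omega⟩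

section Matching

variable {T : PeriodicTiling 2} {F : Fin 2 → Set Plane} {P : EdgeCycle 9} {q : Plane} {α p ρ : ℝ}

/-- The center of the circle that contains the edge `j`, if this has curvature `-1/r`. -/
noncomputable def EdgeCycle.center (P : EdgeCycle 9) (r : ℝ) (j : Fin 9) : Plane :=
  P.vertex j - r • dir (P.angle j + Real.pi / 2)

theorem EdgeCycle.point_curved {P : EdgeCycle 9} {p r : ℝ} (hp : p * r = 1) {j : Fin 9}
    (hj : P.curv j = -p) (s : ℝ) :
    P.point j s = P.center r j + r • dir (P.angle j + Real.pi / 2 - p * s) := by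
  have hp0 : p ≠ 0 := by rintro rfl; simp at hp
  have h1 : 1 / -p = -r := by rw [← hp]; field_simp
  rw [EdgeCycle.point, hj, arcPoint_curved _ _ _ (neg_ne_zero.2 hp0), h1, EdgeCycle.center,
    show P.angle j + Real.pi / 2 = P.angle j - Real.pi / 2 + Real.pi by ring,
    show P.angle j - Real.pi / 2 + Real.pi - p * s = P.angle j - Real.pi / 2 + -p * s + Real.pi by
      ring, dir_add_pi, dir_add_pi]
  module

/-- Almost every point of the arc `i` of the Reuleaux triangle lies on a concave arc of a chipped
hexagon. -/
theorem countable_unmatched (hρ : 0 < ρ) (hp : p * (Real.sqrt 3 * ρ) = 1)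
    (hF : ∀ k, F k =ᵐ[volume] T.tile k) (h0 : F 0 = reuleaux q α (Real.sqrt 3 * ρ))
    (hP : P.Bounds (F 1)) (hc : ∀ j : Fin 9, P.curv j = if (j : ℕ) % 3 = 2 then -p else 0)
    (i : ℤ) :
    {t ∈ Ioo 0 (Real.pi / 3) | ¬ ∃ n, ∃ g ∈ T.lattice, ∃ s ∈ Icc 0 (P.len (arcIndex n)),
      P.center (Real.sqrt 3 * ρ) (arcIndex n) + g = eis q (α + i * (2 * Real.pi / 3)) 0 (-ρ) ∧
      dir (α + Real.pi / 6 + i * (2 * Real.pi / 3) + t) =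
        dir (P.angle (arcIndex n) + Real.pi / 2 - p * s)}.Countable := by
  have hr : Real.sqrt 3 * ρ ≠ 0 := by positivity
  set r := Real.sqrt 3 * ρ with hr_def
  set ctr : ℤ → Plane := fun i => eis q (α + i * (2 * Real.pi / 3)) 0 (-ρ) with hctr
  set τ := α + Real.pi / 6 + i * (2 * Real.pi / 3) with hτ
  have hcirc : ∀ C : Plane, {u | ctr i ≠ C ∧ ∃ v : ℝ, ctr i + r • dir u = C + r • dir v}.Countable :=
    fun C => by
      by_cases h : ctr i = C
      · convert countable_empty
        exact Set.eq_empty_iff_forall_notMem.2 fun u hu => hu.1 h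
      · exact (countable_mem_circle hr h).mono fun u hu => hu.2
  -- The exceptional directions: points on the line of an edge of a translate of `E₂`, on a circle
  -- associated with such an edge but with another center, or on a circle of a translated triangle
  -- with another center. The translates are countably many.
  have hK : ({u | ∃ g : T.lattice, ∃ j : Fin 9, ∃ t : ℝ, ctr i + r • dir u =
        P.vertex j + g.1 + t • dir (P.angle j)} ∪
      {u | ∃ g : T.lattice, ∃ j : Fin 9, ctr i ≠ P.center r j + g.1 ∧
        ∃ v : ℝ, ctr i + r • dir u = P.center r j + g.1 + r • dir v} ∪
      {u | ∃ g : T.lattice, ∃ j : ℤ, ctr i ≠ ctr j + g.1 ∧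
        ∃ v : ℝ, ctr i + r • dir u = ctr j + g.1 + r • dir v}).Countable := by
    refine Countable.union (Countable.union ?_ ?_) ?_ <;> simp only [ofPred_exists]
    · exact countable_iUnion fun g => countable_iUnion fun j => by
        simpa only [ofPred_exists] using countable_mem_line hr (ctr i) (P.vertex j + g.1) (P.angle j)
    · exact countable_iUnion fun g => countable_iUnion fun j => hcirc _
    · exact countable_iUnion fun g => countable_iUnion fun j => hcirc _
  refine (hK.preimage (f := fun t => τ + t) (add_right_injective _)).mono ?_
  rintro t ⟨ht, hn⟩
  set y := ctr i + r • dir (τ + t) with hy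
  have hyF : y ∈ frontier (F 0) := by
    rw [h0]
    refine arcSet_subset_frontier q α hρ i ⟨t, ⟨ht.1.le, ht.2.le⟩, ?_⟩
    simp only [hy, hctr, hτ]
    congr 3; ring
  have hcomp : ∀ k, IsCompact (F k) := by
    intro k
    fin_cases k
    · change IsCompact (F 0)
      rw [h0]
      exact Metric.isCompact_of_isClosed_isBounded (isClosed_reuleaux _ _ _)
        (isBounded_reuleaux _ _ _)
    · exact hP.isCompact
  have hreg : ∀ k, closure (interior (F k)) = F k := by
    intro k
    fin_cases k
    · change closure (interior (F 0)) = F 0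
      rw [h0, (convex_reuleaux _ _ _).closure_interior_eq_closure_of_nonempty_interior
        (nonempty_interior_reuleaux _ _ hρ), (isClosed_reuleaux _ _ _).closure_eq]
    · exact hP.closure_interior
  obtain ⟨k, g, hg, hne, hyg⟩ := PeriodicTiling.exists_mem_frontier hF hcomp hreg hyF
  fin_cases k
  · right
    change y - g ∈ frontier (F 0) at hyg
    rw [h0] at hyg
    obtain ⟨j, v, hv, hyv⟩ := exists_mem_arcSet hρ hyg
    have hyv' : ctr i + r • dir (τ + t) =
        ctr j + g + r • dir (α + Real.pi / 6 + j * (2 * Real.pi / 3) + v) := by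
      rw [← hy, eq_add_of_sub_eq hyv.symm]
      simp only [hctr]
      rw [show α + Real.pi / 6 + j * (2 * Real.pi / 3) + v =
        α + j * (2 * Real.pi / 3) + Real.pi / 6 + v by ring]
      module
    -- Contact with a translated triangle along the same circle is impossible: the direction
    -- identifies the side, and then the translation is zero, against the distinctness of the tiles.
    refine ⟨⟨g, hg⟩, j, fun he => ?_, _, hyv'⟩
    simp only at he
    rw [← he] at hyv'
    obtain ⟨m, hm⟩ := int_eq_of_dir_eq ht hv (smul_right_injective _ hr (add_left_cancel hyv'))
    have hij : ctr i = ctr j := by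
      have : dir (α + i * (2 * Real.pi / 3)) = dir (α + j * (2 * Real.pi / 3)) := by
        rw [← dir_add_int_mul (α + j * (2 * Real.pi / 3)) m, ← hm]
        congr 1; push_cast; ring
      simp only [hctr, eis, this, dir_congr_add this]
    refine hne ?_
    rw [hij] at he
    have : g = 0 := by simpa using he.symm
    rw [this]; rfl
  · change y - g ∈ frontier (F 1) at hyg
    rw [hP.frontier_eq, mem_iUnion] at hyg
    obtain ⟨j, s, hs, hys⟩ := hyg
    left
    by_cases hj : (j : ℕ) % 3 = 2
    · have hcj : P.curv j = -p := by rw [hc, if_pos hj]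
      obtain ⟨n, rfl⟩ : ∃ n, j = arcIndex n :=
        ⟨⟨j / 3, by omega⟩, Fin.ext (by simp only [arcIndex]; omega)⟩
      rw [EdgeCycle.point_curved hp hcj] at hys
      have hys' : ctr i + r • dir (τ + t) = P.center r (arcIndex n) + g +
          r • dir (P.angle (arcIndex n) + Real.pi / 2 - p * s) := by
        rw [← hy, eq_add_of_sub_eq hys.symm]; abel
      refine Or.inr ⟨⟨g, hg⟩, arcIndex n, fun he => hn ?_, _, hys'⟩
      simp only at he
      rw [← he] at hys'
      exact ⟨n, g, hg, s, hs, he.symm, smul_right_injective _ hr (add_left_cancel hys')⟩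
    · have hcj : P.curv j = 0 := by rw [hc, if_neg hj]
      rw [EdgeCycle.point, hcj, arcPoint_straight] at hys
      refine Or.inl ⟨⟨g, hg⟩, j, s, ?_⟩
      change y = _
      rw [eq_add_of_sub_eq hys.symm]; abel

end Matching

section Matching

variable {T : PeriodicTiling 2} {F : Fin 2 → Set Plane} {P : EdgeCycle 9} {q : Plane} {α p ρ : ℝ}

/-- Nine vertices turn by `3π` in all, so the concave arcs turn back by `π`. Between the starts of
consecutive concave arcs the tangent turns by `π` minus the opening angle of the first. -/
theorem EdgeCycle.Bounds.arc_angles {E : Set Plane} (hP : P.Bounds E)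
    (hc : ∀ j : Fin 9, P.curv j = if (j : ℕ) % 3 = 2 then -p else 0) :
    p * P.len 2 + p * P.len 5 + p * P.len 8 = Real.pi ∧
    dir (P.angle 5) = dir (P.angle 2 + (p * P.len 5 + p * P.len 8)) ∧
    dir (P.angle 8) = dir (P.angle 2 + (p * P.len 8 + Real.pi)) := by
  have c : P.curv 0 = 0 ∧ P.curv 1 = 0 ∧ P.curv 2 = -p ∧ P.curv 3 = 0 ∧ P.curv 4 = 0 ∧
      P.curv 5 = -p ∧ P.curv 6 = 0 ∧ P.curv 7 = 0 ∧ P.curv 8 = -p := by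
    simp only [hc]
    refine ⟨?_, ?_, ?_, ?_, ?_, ?_, ?_, ?_, ?_⟩ <;> rfl
  obtain ⟨c0, c1, c2, c3, c4, c5, c6, c7, c8⟩ := c
  have ht := hP.turning
  have hsum : ∀ f : Fin 9 → ℝ, ∑ i, f i = f 0 + f 1 + f 2 + f 3 + f 4 + f 5 + f 6 + f 7 + f 8 :=
    fun f => by
      rw [Fin.sum_univ_castSucc, Fin.sum_univ_eight]; rfl
  rw [hsum, c0, c1, c2, c3, c4, c5, c6, c7, c8] at ht
  have hx : p * P.len 2 + p * P.len 5 + p * P.len 8 = Real.pi := by linarith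
  have step : ∀ (i : Fin 9) (s : ℝ), dir (P.angle (i + 1) + s) =
      dir (P.angle i + (P.curv i * P.len i + Real.pi / 3 + s)) := fun i s => by
    rw [dir_congr_add (hP.angle_succ i) s]; congr 1; ring
  have a3 := step 2
  have a4 := step 3
  have a5 := step 4 0
  have a6 := step 5
  have a7 := step 6
  have a8 := step 7 0
  rw [show (2 : Fin 9) + 1 = 3 from rfl] at a3
  rw [show (3 : Fin 9) + 1 = 4 from rfl] at a4
  rw [show (4 : Fin 9) + 1 = 5 from rfl] at a5
  rw [show (5 : Fin 9) + 1 = 6 from rfl] at a6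
  rw [show (6 : Fin 9) + 1 = 7 from rfl] at a7
  rw [show (7 : Fin 9) + 1 = 8 from rfl] at a8
  rw [a4, a3, add_zero, c2, c3, c4] at a5
  rw [a7, a6, add_zero, c5, c6, c7] at a8
  have h5 : dir (P.angle 5) = dir (P.angle 2 + (p * P.len 5 + p * P.len 8)) := by
    rw [a5]; congr 2; linarith
  refine ⟨hx, h5, ?_⟩
  rw [a8, dir_congr_add h5]
  congr 1; linarith

theorem no_int {u v lo hi : ℝ} (m : ℤ) (h : u = v + m * (2 * Real.pi)) (h0 : lo < u - v)
    (h1 : u - v < hi) (hlo : lo = 0 ∧ hi = 2 * Real.pi ∨ lo = -(2 * Real.pi) ∧ hi = 0) : False := by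
  have hd : (m : ℝ) * (2 * Real.pi) = u - v := by linarith
  have hπ := Real.pi_pos
  rcases hlo with ⟨rfl, rfl⟩ | ⟨rfl, rfl⟩
  · have := int_mul_two_pi_eq_zero (m := m) (by linarith) (by linarith)
    rw [this] at hd; simp at hd; linarith
  · have := int_mul_two_pi_eq_zero (m := m) (by linarith) (by linarith)
    rw [this] at hd; simp at hd; linarith

/-- The arcs of the chipped hexagon match those of the Reuleaux triangle. -/
theorem exists_matching (hρ : 0 < ρ) (hp : p * (Real.sqrt 3 * ρ) = 1)
    (hF : ∀ k, F k =ᵐ[volume] T.tile k) (h0 : F 0 = reuleaux q α (Real.sqrt 3 * ρ))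
    (hP : P.Bounds (F 1)) (hc : ∀ j : Fin 9, P.curv j = if (j : ℕ) % 3 = 2 then -p else 0) :
    ∃ k : ℤ, ∀ n : Fin 3, P.len (arcIndex n) = Real.pi / 3 / p ∧
      dir (P.angle (arcIndex n)) = dir (α + (k + (n : ℕ) : ℤ) * (2 * Real.pi / 3)) ∧
      ∃ g ∈ T.lattice, P.vertex (arcIndex n) -
        ρ • dir (α + (k + (n : ℕ) : ℤ) * (2 * Real.pi / 3) + 2 * Real.pi / 3) + g = q := by
  have hπ := Real.pi_pos
  have hp0 : 0 < p := by
    by_contra! h; nlinarith [mul_pos (show 0 < Real.sqrt 3 by positivity) hρ]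
  obtain ⟨hsum, h5, h8⟩ := hP.arc_angles hc
  set x := p * P.len 2 with hx
  set y := p * P.len 5 with hy
  set z := p * P.len 8 with hz
  have px : 0 < x := mul_pos hp0 (hP.len_pos _)
  have py : 0 < y := mul_pos hp0 (hP.len_pos _)
  have pz : 0 < z := mul_pos hp0 (hP.len_pos _)
  set β := P.angle 2 + Real.pi / 2 with hβ
  set ψ := α + Real.pi / 6 with hψ
  set C : Set ℝ := ⋃ i : ℤ, (fun u => u - (ψ + i * (2 * Real.pi / 3))) ⁻¹'
    {t ∈ Ioo 0 (Real.pi / 3) | ¬ ∃ n, ∃ g ∈ T.lattice, ∃ s ∈ Icc 0 (P.len (arcIndex n)),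
      P.center (Real.sqrt 3 * ρ) (arcIndex n) + g = eis q (α + i * (2 * Real.pi / 3)) 0 (-ρ) ∧
      dir (α + Real.pi / 6 + i * (2 * Real.pi / 3) + t) =
        dir (P.angle (arcIndex n) + Real.pi / 2 - p * s)} with hCdef
  have hC : C.Countable := countable_iUnion fun i =>
    (countable_unmatched hρ hp hF h0 hP hc i).preimage (sub_left_injective)
  have hmatch : ∀ (i : ℤ) u, u ∈ Ioo (ψ + i * (2 * Real.pi / 3))
      (ψ + i * (2 * Real.pi / 3) + Real.pi / 3) → u ∉ C →
      ∃ n, ∃ g ∈ T.lattice, ∃ s ∈ Icc 0 (P.len (arcIndex n)),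
      P.center (Real.sqrt 3 * ρ) (arcIndex n) + g = eis q (α + i * (2 * Real.pi / 3)) 0 (-ρ) ∧
      dir u = dir (P.angle (arcIndex n) + Real.pi / 2 - p * s) := by
    intro i u hu huC
    by_contra hn
    refine huC (mem_iUnion.2 ⟨i, ⟨by linarith [hu.1], by linarith [hu.2]⟩, ?_⟩)
    rw [hψ] at *
    simpa only [add_sub_cancel] using hn
  have e2 : ∀ s, P.angle 2 + Real.pi / 2 - s = β - s := fun s => by rw [hβ]
  have e5 : ∀ s, dir (P.angle 5 + Real.pi / 2 - s) = dir (β + y + z - s) := fun s => by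
    rw [add_sub_assoc, dir_congr_add h5]; congr 1; rw [hβ]; ring
  have e8 : ∀ s, dir (P.angle 8 + Real.pi / 2 - s) = dir (β + Real.pi + z - s) := fun s => by
    rw [add_sub_assoc, dir_congr_add h8]; congr 1; rw [hβ]; ring
  -- Modulo `2π`, the radial directions of the three concave arcs fill the intervals `[β - x, β]`,
  -- `[β + z, β + y + z]` and `[β + π, β + π + z]`. Since `x + y + z = π`, the gaps between them
  -- have lengths `z`, `x` and `y`.
  have hN : ∀ (i : ℤ) u, u ∈ Ioo (ψ + i * (2 * Real.pi / 3))
      (ψ + i * (2 * Real.pi / 3) + Real.pi / 3) → u ∉ C →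
      ∃ v, (v ∈ Icc (β - x) β ∨ v ∈ Icc (β + z) (β + y + z) ∨
        v ∈ Icc (β + Real.pi) (β + Real.pi + z)) ∧ ∃ m : ℤ, u = v + m * (2 * Real.pi) := by
    intro i u hu huC
    obtain ⟨n, g, -, s, ⟨hs0, hs1⟩, -, hd⟩ := hmatch i u hu huC
    have hps0 : 0 ≤ p * s := by positivity
    have hps1 := mul_le_mul_of_nonneg_left hs1 hp0.le
    fin_cases n
    · change dir u = dir (P.angle 2 + Real.pi / 2 - p * s) at hd
      change p * s ≤ x at hps1
      refine ⟨β - p * s, Or.inl ⟨by linarith, by linarith⟩, dir_eq_dir_iff.1 hd.symm⟩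
    · change dir u = dir (P.angle 5 + Real.pi / 2 - p * s) at hd
      change p * s ≤ y at hps1
      rw [e5] at hd
      refine ⟨β + y + z - p * s, Or.inr (Or.inl ⟨by linarith, by linarith⟩),
        dir_eq_dir_iff.1 hd.symm⟩
    · change dir u = dir (P.angle 8 + Real.pi / 2 - p * s) at hd
      change p * s ≤ z at hps1
      rw [e8] at hd
      refine ⟨β + Real.pi + z - p * s, Or.inr (Or.inr ⟨by linarith, by linarith⟩),
        dir_eq_dir_iff.1 hd.symm⟩
  -- A direction of the triangle lying in a gap is matched by no concave arc, so there are only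
  -- countably many of them and `gap_le` applies to each of the three gaps.
  have gz := gap_le (ψ := ψ) (β := β) (z := z) hC fun i u hu hu' => by
    by_contra huC
    obtain ⟨v, hv, m, hm⟩ := hN i u hu huC
    rcases hv with hv | hv | hv
    · exact no_int m hm (by linarith [hv.2, hu'.1]) (by linarith [hv.1, hu'.2]) (Or.inl ⟨rfl, rfl⟩)
    · exact no_int m hm (by linarith [hv.2, hu'.1]) (by linarith [hv.1, hu'.2]) (Or.inr ⟨rfl, rfl⟩)
    · exact no_int m hm (by linarith [hv.2, hu'.1]) (by linarith [hv.1, hu'.2]) (Or.inr ⟨rfl, rfl⟩)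
  have gx := gap_le (ψ := ψ) (β := β + y + z) (z := x) hC fun i u hu hu' => by
    by_contra huC
    obtain ⟨v, hv, m, hm⟩ := hN i u hu huC
    rcases hv with hv | hv | hv
    · exact no_int m hm (by linarith [hv.2, hu'.1]) (by linarith [hv.1, hu'.2]) (Or.inl ⟨rfl, rfl⟩)
    · exact no_int m hm (by linarith [hv.2, hu'.1]) (by linarith [hv.1, hu'.2]) (Or.inl ⟨rfl, rfl⟩)
    · exact no_int m hm (by linarith [hv.2, hu'.1]) (by linarith [hv.1, hu'.2]) (Or.inr ⟨rfl, rfl⟩)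
  have gy := gap_le (ψ := ψ) (β := β + Real.pi + z) (z := y) hC fun i u hu hu' => by
    by_contra huC
    obtain ⟨v, hv, m, hm⟩ := hN i u hu huC
    rcases hv with hv | hv | hv
    · exact no_int m hm (by linarith [hv.2, hu'.1]) (by linarith [hv.1, hu'.2]) (Or.inl ⟨rfl, rfl⟩)
    · exact no_int m hm (by linarith [hv.2, hu'.1]) (by linarith [hv.1, hu'.2]) (Or.inl ⟨rfl, rfl⟩)
    · exact no_int m hm (by linarith [hv.2, hu'.1]) (by linarith [hv.1, hu'.2]) (Or.inl ⟨rfl, rfl⟩)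
  -- Three numbers at most `π/3` with sum `π`. The equality case of `gap_le` then aligns the concave
  -- arcs with the triangle.
  have hx3 : x = Real.pi / 3 := by linarith [gx.1, gy.1, gz.1]
  have hy3 : y = Real.pi / 3 := by linarith [gx.1, gy.1, gz.1]
  have hz3 : z = Real.pi / 3 := by linarith [gx.1, gy.1, gz.1]
  obtain ⟨k, hk⟩ := gz.2 hz3
  have hlen : ∀ n, P.len (arcIndex n) = Real.pi / 3 / p := by
    intro n
    rw [eq_div_iff hp0.ne', mul_comm]
    fin_cases n
    exacts [hx3, hy3, hz3]
  have hang : ∀ n : Fin 3, dir (P.angle (arcIndex n)) =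
      dir (α + (k + (n : ℕ) : ℤ) * (2 * Real.pi / 3)) := by
    have ha : P.angle 2 = α + k * (2 * Real.pi / 3) := by linarith
    intro n
    fin_cases n
    · change dir (P.angle 2) = _
      rw [ha]; simp
    · change dir (P.angle 5) = _
      rw [h5, ha, hy3, hz3]
      congr 1; push_cast; ring
    · change dir (P.angle 8) = _
      rw [h8, ha, hz3]
      congr 1; push_cast; ring
  refine ⟨k, fun n => ⟨hlen n, hang n, ?_⟩⟩
  set i : ℤ := k + (n : ℕ) with hi
  -- One matched direction per side suffices: it can only come from the concave arc `n`, and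
  -- equality of the circle centers then gives the lattice vector between the chip center and `q`.
  obtain ⟨u, hu, huC⟩ : ∃ u ∈ Ioo (ψ + i * (2 * Real.pi / 3))
      (ψ + i * (2 * Real.pi / 3) + Real.pi / 3), u ∉ C := by
    by_contra! hn
    exact not_countable_Ioo (by linarith) (hC.mono hn)
  obtain ⟨n', g, hg, s, ⟨hs0, hs1⟩, hcen, hd⟩ := hmatch i u hu huC
  have hps0 : 0 ≤ p * s := by positivity
  have hps1 := mul_le_mul_of_nonneg_left hs1 hp0.le
  rw [hlen, mul_div_cancel₀ _ hp0.ne'] at hps1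
  obtain ⟨m, hm⟩ := int_eq_of_dir_eq (α := ψ) (i := i) (j := k + (n' : ℕ))
    (s := u - (ψ + i * (2 * Real.pi / 3))) (t := Real.pi / 3 - p * s)
    ⟨by linarith [hu.1], by linarith [hu.2]⟩ ⟨by linarith, by linarith⟩ (by
      rw [add_sub_cancel, hd, add_sub_assoc, dir_congr_add (hang n')]
      congr 1; rw [hψ]; ring)
  obtain rfl : n' = n := by
    have := n.2; have := n'.2
    apply Fin.ext; omega
  refine ⟨g, hg, ?_⟩
  have hv : P.vertex (arcIndex n') = P.center (Real.sqrt 3 * ρ) (arcIndex n') +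
      (Real.sqrt 3 * ρ) • dir (α + i * (2 * Real.pi / 3) + Real.pi / 2) := by
    rw [EdgeCycle.center, dir_congr_add (hang n')]; abel
  have hce := (center_eq q (α + i * (2 * Real.pi / 3)) ρ).2
  have : eis q (α + i * (2 * Real.pi / 3)) (-ρ) ρ =
      q + ρ • dir (α + i * (2 * Real.pi / 3) + 2 * Real.pi / 3) :=
    ((reuleaux_center q (α + i * (2 * Real.pi / 3)) ρ).2.1).symm
  rw [hv, eq_sub_of_add_eq hcen, ← hce, this]
  abel

end Matching

/-! ### Curvilinear polygons with nine edges -/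

theorem dir_directions (γ : ℝ) :
    dir γ = (1 : ℝ) • dir γ + (0 : ℝ) • dir (γ + Real.pi / 3) ∧
    dir (γ + Real.pi / 3) = (0 : ℝ) • dir γ + (1 : ℝ) • dir (γ + Real.pi / 3) ∧
    dir (γ + 2 * Real.pi / 3) = (-1 : ℝ) • dir γ + (1 : ℝ) • dir (γ + Real.pi / 3) ∧
    dir (γ + Real.pi) = (-1 : ℝ) • dir γ + (0 : ℝ) • dir (γ + Real.pi / 3) ∧
    dir (γ + 4 * Real.pi / 3) = (0 : ℝ) • dir γ + (-1 : ℝ) • dir (γ + Real.pi / 3) ∧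
    dir (γ + 5 * Real.pi / 3) = (1 : ℝ) • dir γ + (-1 : ℝ) • dir (γ + Real.pi / 3) := by
  rw [dir_add_two_pi_div_three, dir_add_pi, dir_add_four_pi_div_three, dir_add_five_pi_div_three]
  refine ⟨?_, ?_, ?_, ?_, ?_, ?_⟩ <;> module

theorem arcPoint_eis {γ θ dx dy : ℝ} (h : dir θ = dx • dir γ + dy • dir (γ + Real.pi / 3))
    (q : Plane) (a b t : ℝ) :
    arcPoint (eis q γ a b) θ 0 t = eis q γ (a + t * dx) (b + t * dy) := by
  rw [arcPoint_straight, h]; simp only [eis]; module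

theorem mem_edge_iff {q : Plane} {γ θ dx dy : ℝ}
    (h : dir θ = dx • dir γ + dy • dir (γ + Real.pi / 3)) {a₀ b₀ L a b : ℝ} :
    eis q γ a b ∈ arcPoint (eis q γ a₀ b₀) θ 0 '' Icc 0 L ↔
      ∃ t ∈ Icc 0 L, a = a₀ + t * dx ∧ b = b₀ + t * dy := by
  simp only [mem_image, arcPoint_eis h]
  refine exists_congr fun t => and_congr_right fun _ => ⟨fun h => ?_, ?_⟩
  · obtain ⟨h1, h2⟩ := eis_injective h
    exact ⟨h1.symm, h2.symm⟩
  · rintro ⟨rfl, rfl⟩; rfl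

/-- The edges of `P`, in the oblique coordinates with origin `q` and direction `γ`, are those of a
chipped hexagon. -/
structure EdgeCycle.IsChipped (P : EdgeCycle 9) (q : Plane) (γ A m S B ρ : ℝ) : Prop where
  long : LongSides A m S B ρ
  vertex_eq : P.vertex 0 = eis q γ ρ 0 ∧ P.vertex 1 = eis q γ A 0 ∧
    P.vertex 2 = eis (eis q γ A (S - A)) (γ + 2 * Real.pi / 3) (-ρ) ρ ∧
    P.vertex 3 = eis q γ (A - ρ) (S - A + ρ) ∧ P.vertex 4 = eis q γ (S - B) B ∧
    P.vertex 5 = eis (eis q γ (-m) B) (γ + 4 * Real.pi / 3) (-ρ) ρ ∧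
    P.vertex 6 = eis q γ (-m) (B - ρ) ∧ P.vertex 7 = eis q γ (-m) m ∧
    P.vertex 8 = eis q γ (-ρ) ρ
  angle_eq : P.angle 0 = γ ∧ dir (P.angle 1) = dir (γ + Real.pi / 3) ∧
    dir (P.angle 2) = dir (γ + 2 * Real.pi / 3) ∧ dir (P.angle 3) = dir (γ + 2 * Real.pi / 3) ∧
    dir (P.angle 4) = dir (γ + Real.pi) ∧ dir (P.angle 5) = dir (γ + 4 * Real.pi / 3) ∧
    dir (P.angle 6) = dir (γ + 4 * Real.pi / 3) ∧ dir (P.angle 7) = dir (γ + 5 * Real.pi / 3) ∧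
    dir (P.angle 8) = dir γ
  len_eq : P.len 0 = A - ρ ∧ P.len 1 = S - A - ρ ∧ P.len 3 = A + B - S - ρ ∧
    P.len 4 = S - B + m - ρ ∧ P.len 6 = B - m - ρ ∧ P.len 7 = m - ρ

section NineEdges

variable {P : EdgeCycle 9} {E : Set Plane} {p ρ : ℝ}

theorem EdgeCycle.curv_values
    (hc : ∀ j : Fin 9, P.curv j = if (j : ℕ) % 3 = 2 then -p else 0) :
    P.curv 0 = 0 ∧ P.curv 1 = 0 ∧ P.curv 2 = -p ∧ P.curv 3 = 0 ∧ P.curv 4 = 0 ∧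
      P.curv 5 = -p ∧ P.curv 6 = 0 ∧ P.curv 7 = 0 ∧ P.curv 8 = -p := by
  simp only [hc]
  refine ⟨?_, ?_, ?_, ?_, ?_, ?_, ?_, ?_, ?_⟩ <;> rfl

theorem EdgeCycle.Bounds.exists_isChipped (hP : P.Bounds E) (hρ : 0 < ρ)
    (hp : p * (Real.sqrt 3 * ρ) = 1)
    (hc : ∀ j : Fin 9, P.curv j = if (j : ℕ) % 3 = 2 then -p else 0)
    (hlen : ∀ n : Fin 3, P.len (arcIndex n) = Real.pi / 3 / p) :
    ∃ A m S B, P.IsChipped (P.vertex 0 - ρ • dir (P.angle 0)) (P.angle 0) A m S B ρ := by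
  have hp0 : 0 < p := by
    by_contra! h; nlinarith [mul_pos (show 0 < Real.sqrt 3 by positivity) hρ]
  obtain ⟨c0, c1, c2, c3, c4, c5, c6, c7, c8⟩ := EdgeCycle.curv_values hc
  have l2 : P.len 2 = Real.pi / 3 / p := hlen 0
  have l5 : P.len 5 = Real.pi / 3 / p := hlen 1
  have l8 : P.len 8 = Real.pi / 3 / p := hlen 2
  set γ := P.angle 0 with hγ
  set q := P.vertex 0 - ρ • dir γ with hq
  obtain ⟨d0, d1, d2, d3, d4, d5⟩ := dir_directions γ
  have flat : ∀ i θ, P.curv i = 0 → dir (P.angle i) = dir θ →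
      dir (P.angle (i + 1)) = dir (θ + Real.pi / 3) := fun i θ h hθ => by
    rw [hP.angle_succ, h, zero_mul, add_zero, dir_congr_add hθ]
  have curved : ∀ i θ, P.curv i = -p → P.len i = Real.pi / 3 / p → dir (P.angle i) = dir θ →
      dir (P.angle (i + 1)) = dir θ := fun i θ h hl hθ => by
    rw [hP.angle_succ, h, hl, neg_mul, mul_div_cancel₀ _ hp0.ne', neg_add_cancel_right, hθ]
  have a1 := flat 0 γ c0 rfl
  have a2 := flat 1 _ c1 a1
  have a3 := curved 2 _ c2 l2 a2
  have a4 := flat 3 _ c3 a3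
  have a5 := flat 4 _ c4 a4
  have a6 := curved 5 _ c5 l5 a5
  have a7 := flat 6 _ c6 a6
  have a8 := flat 7 _ c7 a7
  rw [show γ + Real.pi / 3 + Real.pi / 3 = γ + 2 * Real.pi / 3 by ring] at a2 a3 a4 a5 a6 a7 a8
  rw [show γ + 2 * Real.pi / 3 + Real.pi / 3 = γ + Real.pi by ring] at a4 a5 a6 a7 a8
  rw [show γ + Real.pi + Real.pi / 3 = γ + 4 * Real.pi / 3 by ring] at a5 a6 a7 a8
  rw [show γ + 4 * Real.pi / 3 + Real.pi / 3 = γ + 5 * Real.pi / 3 by ring] at a7 a8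
  rw [show γ + 5 * Real.pi / 3 + Real.pi / 3 = γ + 2 * Real.pi by ring, dir_add_two_pi] at a8
  have vflat : ∀ i a b dx dy, P.curv i = 0 →
      dir (P.angle i) = dx • dir γ + dy • dir (γ + Real.pi / 3) → P.vertex i = eis q γ a b →
      P.vertex (i + 1) = eis q γ (a + P.len i * dx) (b + P.len i * dy) := by
    intro i a b dx dy h hθ hv
    rw [hP.vertex_succ, EdgeCycle.point, h, hv, arcPoint_eis hθ]
  have vcurved : ∀ i q' θ, P.curv i = -p → P.len i = Real.pi / 3 / p → dir (P.angle i) = dir θ →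
      P.vertex i = eis q' θ (-ρ) ρ → P.vertex (i + 1) = eis q' θ ρ 0 := by
    intro i q' θ h hl hθ hv
    rw [hP.vertex_succ, EdgeCycle.point, h, hl, hv, arcPoint_congr hθ, arcPoint_right hρ hp,
      mul_div_cancel₀ _ hp0.ne', sub_self, add_zero, ← (center_eq q' θ ρ).1, sub_add_cancel]
  -- The straight edges, prolonged by `ρ` at each chip, are the sides of the hexagon. The first four
  -- lengths define the parameters, and closing determines the last two.
  obtain ⟨A, hA⟩ : ∃ A, A = ρ + P.len 0 := ⟨_, rfl⟩
  obtain ⟨S, hS⟩ : ∃ S, S = A + ρ + P.len 1 := ⟨_, rfl⟩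
  obtain ⟨B, hB⟩ : ∃ B, B = S - A + ρ + P.len 3 := ⟨_, rfl⟩
  obtain ⟨m, hm⟩ : ∃ m, m = ρ - S + B + P.len 4 := ⟨_, rfl⟩
  have v0 : P.vertex 0 = eis q γ ρ 0 := by rw [hq]; simp only [eis]; module
  have v1 : P.vertex 1 = eis q γ A 0 := by
    have := vflat 0 _ _ _ _ c0 d0 v0
    rw [zero_add] at this
    rw [this]; congr 1 <;> linarith
  obtain ⟨-, r2, -, -⟩ := corner_rotate_endpoints (eis q γ A (S - A)) γ ρ
  obtain ⟨r3, -, -, -⟩ := corner_rotate_endpoints (eis q γ A (S - A)) γ ρ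
  obtain ⟨-, -, r6, r5⟩ := corner_rotate_endpoints (eis q γ (-m) B) γ ρ
  have v2 : P.vertex 2 = eis (eis q γ A (S - A)) (γ + 2 * Real.pi / 3) (-ρ) ρ := by
    have := vflat 1 _ _ _ _ c1 (a1.trans d1) v1
    rw [show (1 : Fin 9) + 1 = 2 from rfl] at this
    rw [this, r2, eis_eis]; congr 1 <;> linarith
  have v3 : P.vertex 3 = eis q γ (A - ρ) (S - A + ρ) := by
    have := vcurved 2 _ _ c2 l2 a2 v2
    rw [show (2 : Fin 9) + 1 = 3 from rfl, r3, eis_eis] at this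
    rw [this]; congr 1
  have v4 : P.vertex 4 = eis q γ (S - B) B := by
    have := vflat 3 _ _ _ _ c3 (a3.trans d2) v3
    rw [show (3 : Fin 9) + 1 = 4 from rfl] at this
    rw [this]; congr 1 <;> linarith
  have v5 : P.vertex 5 = eis (eis q γ (-m) B) (γ + 4 * Real.pi / 3) (-ρ) ρ := by
    have := vflat 4 _ _ _ _ c4 (a4.trans d3) v4
    rw [show (4 : Fin 9) + 1 = 5 from rfl] at this
    rw [this, r5, eis_eis]; congr 1 <;> linarith
  have v6 : P.vertex 6 = eis q γ (-m) (B - ρ) := by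
    have := vcurved 5 _ _ c5 l5 a5 v5
    rw [show (5 : Fin 9) + 1 = 6 from rfl, r6, eis_eis] at this
    rw [this]; congr 1; ring
  have v7 : P.vertex 7 = eis q γ (-m) (B - ρ - P.len 6) := by
    have := vflat 6 _ _ _ _ c6 (a6.trans d4) v6
    rw [show (6 : Fin 9) + 1 = 7 from rfl] at this
    rw [this]; congr 1 <;> ring
  have v8 : P.vertex 8 = eis q γ (-m + P.len 7) (B - ρ - P.len 6 - P.len 7) := by
    have := vflat 7 _ _ _ _ c7 (a7.trans d5) v7
    rw [show (7 : Fin 9) + 1 = 8 from rfl] at this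
    rw [this]; congr 1 <;> ring
  have v8' : P.vertex 8 = eis (eis q γ (-m + P.len 7 + ρ) (B - ρ - P.len 6 - P.len 7 - ρ)) γ
      (-ρ) ρ := by
    rw [v8, eis_eis]; congr 1 <;> ring
  -- The closing condition, which yields `P.len 6` and `P.len 7`.
  have v9 := vcurved 8 _ _ c8 l8 a8 v8'
  rw [show (8 : Fin 9) + 1 = 0 from rfl, v0, eis_eis] at v9
  obtain ⟨e1, e2⟩ := eis_injective v9
  have h6 : P.len 6 = B - m - ρ := by linarith
  have h7 : P.len 7 = m - ρ := by linarith
  refine ⟨A, m, S, B, ⟨hρ, ?_, ?_, ?_, ?_, ?_, ?_⟩, ⟨v0, v1, v2, v3, v4, v5, v6, ?_, ?_⟩,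
    ⟨hγ.symm, a1, a2, a3, a4, a5, a6, a7, a8⟩, by linarith, by linarith, by linarith, by linarith,
    h6, h7⟩
  · linarith [hP.len_pos 0]
  · linarith [hP.len_pos 1]
  · linarith [hP.len_pos 3]
  · linarith [hP.len_pos 4]
  · linarith [hP.len_pos 6]
  · linarith [hP.len_pos 7]
  · rw [v7]; congr 1; linarith
  · rw [v8]; congr 1 <;> linarith

theorem EdgeCycle.Bounds.chipped_eq (hP : P.Bounds E) (hρ : 0 < ρ)
    (hp : p * (Real.sqrt 3 * ρ) = 1)
    (hc : ∀ j : Fin 9, P.curv j = if (j : ℕ) % 3 = 2 then -p else 0)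
    (hlen : ∀ n : Fin 3, P.len (arcIndex n) = Real.pi / 3 / p) {q : Plane} {γ A m S B : ℝ}
    (h : P.IsChipped q γ A m S B ρ) :
    E = chippedHex q γ A m S B ρ ∧ perimeter E =
      ENNReal.ofReal (Real.pi * (Real.sqrt 3 * ρ) + (A + S + B + m - 6 * ρ)) := by
  obtain ⟨c0, c1, c2, c3, c4, c5, c6, c7, c8⟩ := EdgeCycle.curv_values hc
  have l2 : P.len 2 = Real.pi / 3 / p := hlen 0
  have l5 : P.len 5 = Real.pi / 3 / p := hlen 1
  have l8 : P.len 8 = Real.pi / 3 / p := hlen 2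
  obtain ⟨hL, ⟨v0, v1, v2, v3, v4, v5, v6, v7, v8⟩, ⟨a0, a1, a2, a3, a4, a5, a6, a7, a8⟩,
    l0, l1, l3, l4, l6, l7⟩ := h
  obtain ⟨d0, d1, d2, d3, d4, d5⟩ := dir_directions γ
  obtain ⟨-, k0, k1, k3, k4, k6, k7⟩ := id hL
  have hpt : ∀ i, P.point i = arcPoint (P.vertex i) (P.angle i) (P.curv i) := fun _ => rfl
  have hE : E = chippedHex q γ A m S B ρ := by
    refine hP.eq_chippedHex hL ?_
    have s2 := image_arc_right hρ hp (eis q γ A (S - A)) (γ + 2 * Real.pi / 3)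
    have s5 := image_arc_right hρ hp (eis q γ (-m) B) (γ + 4 * Real.pi / 3)
    have s8 := image_arc_right hρ hp q γ
    rw [← arcPoint_congr a2] at s2
    rw [← arcPoint_congr a5] at s5
    rw [← arcPoint_congr a8] at s8
    ext x
    obtain ⟨a, b, rfl⟩ := exists_eis q γ x
    have hcurve : eis q γ a b ∈ P.curve ↔
        eis q γ a b ∈ P.point 0 '' Icc 0 (P.len 0) ∨ eis q γ a b ∈ P.point 1 '' Icc 0 (P.len 1) ∨
        eis q γ a b ∈ P.point 2 '' Icc 0 (P.len 2) ∨ eis q γ a b ∈ P.point 3 '' Icc 0 (P.len 3) ∨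
        eis q γ a b ∈ P.point 4 '' Icc 0 (P.len 4) ∨ eis q γ a b ∈ P.point 5 '' Icc 0 (P.len 5) ∨
        eis q γ a b ∈ P.point 6 '' Icc 0 (P.len 6) ∨ eis q γ a b ∈ P.point 7 '' Icc 0 (P.len 7) ∨
        eis q γ a b ∈ P.point 8 '' Icc 0 (P.len 8) := by
      rw [EdgeCycle.curve, mem_iUnion]
      constructor
      · rintro ⟨i, hi⟩
        fin_cases i
        exacts [Or.inl hi, Or.inr (Or.inl hi), Or.inr (Or.inr (Or.inl hi)),
          Or.inr (Or.inr (Or.inr (Or.inl hi))), Or.inr (Or.inr (Or.inr (Or.inr (Or.inl hi)))),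
          Or.inr (Or.inr (Or.inr (Or.inr (Or.inr (Or.inl hi))))),
          Or.inr (Or.inr (Or.inr (Or.inr (Or.inr (Or.inr (Or.inl hi)))))),
          Or.inr (Or.inr (Or.inr (Or.inr (Or.inr (Or.inr (Or.inr (Or.inl hi))))))),
          Or.inr (Or.inr (Or.inr (Or.inr (Or.inr (Or.inr (Or.inr (Or.inr hi)))))))]
      · rintro (h | h | h | h | h | h | h | h | h)
        exacts [⟨_, h⟩, ⟨_, h⟩, ⟨_, h⟩, ⟨_, h⟩, ⟨_, h⟩, ⟨_, h⟩, ⟨_, h⟩, ⟨_, h⟩, ⟨_, h⟩]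
    have f0 : eis q γ a b ∈ P.point 0 '' Icc 0 (P.len 0) ↔ b = 0 ∧ ρ ≤ a ∧ a ≤ A := by
      rw [hpt, c0, v0, mem_edge_iff (by rw [a0]; exact d0), l0]
      exact ⟨fun ⟨t, ht, h1, h2⟩ => ⟨by linarith, by linarith [ht.1], by linarith [ht.2]⟩,
        fun ⟨h1, h2, h3⟩ => ⟨a - ρ, ⟨by linarith, by linarith⟩, by linarith, by linarith⟩⟩
    have f1 : eis q γ a b ∈ P.point 1 '' Icc 0 (P.len 1) ↔ a = A ∧ 0 ≤ b ∧ b ≤ S - A - ρ := by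
      rw [hpt, c1, v1, mem_edge_iff (a1.trans d1), l1]
      exact ⟨fun ⟨t, ht, h1, h2⟩ => ⟨by linarith, by linarith [ht.1], by linarith [ht.2]⟩,
        fun ⟨h1, h2, h3⟩ => ⟨b, ⟨by linarith, by linarith⟩, by linarith, by linarith⟩⟩
    have f3 : eis q γ a b ∈ P.point 3 '' Icc 0 (P.len 3) ↔
        a + b = S ∧ S - A + ρ ≤ b ∧ b ≤ B := by
      rw [hpt, c3, v3, mem_edge_iff (a3.trans d2), l3]
      exact ⟨fun ⟨t, ht, h1, h2⟩ => ⟨by linarith, by linarith [ht.1], by linarith [ht.2]⟩,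
        fun ⟨h1, h2, h3⟩ => ⟨b - (S - A + ρ), ⟨by linarith, by linarith⟩, by linarith,
          by linarith⟩⟩
    have f4 : eis q γ a b ∈ P.point 4 '' Icc 0 (P.len 4) ↔
        b = B ∧ -m + ρ ≤ a ∧ a ≤ S - B := by
      rw [hpt, c4, v4, mem_edge_iff (a4.trans d3), l4]
      exact ⟨fun ⟨t, ht, h1, h2⟩ => ⟨by linarith, by linarith [ht.2], by linarith [ht.1]⟩,
        fun ⟨h1, h2, h3⟩ => ⟨S - B - a, ⟨by linarith, by linarith⟩, by linarith,
          by linarith⟩⟩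
    have f6 : eis q γ a b ∈ P.point 6 '' Icc 0 (P.len 6) ↔
        a = -m ∧ m ≤ b ∧ b ≤ B - ρ := by
      rw [hpt, c6, v6, mem_edge_iff (a6.trans d4), l6]
      exact ⟨fun ⟨t, ht, h1, h2⟩ => ⟨by linarith, by linarith [ht.2], by linarith [ht.1]⟩,
        fun ⟨h1, h2, h3⟩ => ⟨B - ρ - b, ⟨by linarith, by linarith⟩, by linarith,
          by linarith⟩⟩
    have f7 : eis q γ a b ∈ P.point 7 '' Icc 0 (P.len 7) ↔
        a + b = 0 ∧ ρ ≤ b ∧ b ≤ m := by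
      rw [hpt, c7, v7, mem_edge_iff (a7.trans d5), l7]
      exact ⟨fun ⟨t, ht, h1, h2⟩ => ⟨by linarith, by linarith [ht.2], by linarith [ht.1]⟩,
        fun ⟨h1, h2, h3⟩ => ⟨m - b, ⟨by linarith, by linarith⟩, by linarith,
          by linarith⟩⟩
    rw [hcurve, f0, f1, f3, f4, f6, f7, hpt, c2, v2, l2, s2, hpt, c5, v5, l5, s5, hpt, c8, v8, l8,
      s8, chippedCurve, mem_union, mem_union, mem_union, mem_chippedSides]
    simp only [or_assoc, or_left_comm, or_comm]
  refine ⟨hE, ?_⟩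
  have hsum : ∀ f : Fin 9 → ℝ, ∑ i, f i = f 0 + f 1 + f 2 + f 3 + f 4 + f 5 + f 6 + f 7 + f 8 :=
    fun f => by
      rw [Fin.sum_univ_castSucc, Fin.sum_univ_eight]; rfl
  rw [P.perimeter_eq hP.len_pos hP.simple (E := E)]
  · have hp0 : p ≠ 0 := by rintro rfl; simp at hp
    have : 1 / p = Real.sqrt 3 * ρ := by rw [← hp]; field_simp
    rw [hsum, l0, l1, l2, l3, l4, l5, l6, l7, l8, ← this]
    congr 1; ring
  · rw [hE]
    refine (hasFlux_chippedHex q γ hL).congr fun X _ => ?_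
    have w2 : ∀ C : Plane, eis C (γ + 2 * Real.pi / 3) (-ρ) ρ = eis C γ 0 (-ρ) := fun C =>
      (corner_rotate_endpoints C γ ρ).2.1
    have w5 : ∀ C : Plane, eis C (γ + 4 * Real.pi / 3) (-ρ) ρ = eis C γ ρ 0 := fun C =>
      (corner_rotate_endpoints C γ ρ).2.2.2
    have fe : ∀ (θ dx dy a b L : ℝ), dir θ = dx • dir γ + dy • dir (γ + Real.pi / 3) →
        eis q γ a b + L • dir θ = eis q γ (a + L * dx) (b + L * dy) := fun θ dx dy a b L h => by
      rw [h]; simp only [eis]; module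
    simp only [EdgeCycle.flux, hsum, hpt]
    rw [c0, c1, c2, c3, c4, c5, c6, c7, c8, integral_congr_dir a2, integral_congr_dir a5,
      integral_congr_dir a8, v2, v5, v8, l2, l5, l8, integral_arc_right hρ hp,
      integral_arc_right hρ hp, integral_arc_right hρ hp,
      integral_segment _ _ _ (hP.len_pos 0).ne', integral_segment _ _ _ (hP.len_pos 1).ne',
      integral_segment _ _ _ (hP.len_pos 3).ne', integral_segment _ _ _ (hP.len_pos 4).ne',
      integral_segment _ _ _ (hP.len_pos 6).ne', integral_segment _ _ _ (hP.len_pos 7).ne',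
      v0, v1, v3, v4, v6, v7, fe _ _ _ _ _ _ (by rw [a0]; exact d0), fe _ _ _ _ _ _ (a1.trans d1),
      fe _ _ _ _ _ _ (a3.trans d2), fe _ _ _ _ _ _ (a4.trans d3), fe _ _ _ _ _ _ (a6.trans d4),
      fe _ _ _ _ _ _ (a7.trans d5), l0, l1, l3, l4, l6, l7, chippedFlux]
    rw [show ρ + (A - ρ) * 1 = A by ring, show 0 + (A - ρ) * 0 = 0 by ring,
      show A + (S - A - ρ) * 0 = A by ring, show 0 + (S - A - ρ) * 1 = S - A - ρ by ring,
      show A - ρ + (A + B - S - ρ) * -1 = S - B by ring,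
      show S - A + ρ + (A + B - S - ρ) * 1 = B by ring,
      show S - B + (S - B + m - ρ) * -1 = -m + ρ by ring,
      show B + (S - B + m - ρ) * 0 = B by ring, show -m + (B - m - ρ) * 0 = -m by ring,
      show B - ρ + (B - m - ρ) * -1 = m by ring, show -m + (m - ρ) * 1 = -ρ by ring,
      show m + (m - ρ) * -1 = ρ by ring]
    ring

end NineEdges

/-! ### From the `(3;9)` type to a chipped honeycomb. -/

theorem perimeter_congr {E F : Set Plane} (h : E =ᵐ[volume] F) : perimeter E = perimeter F := by
  simp only [perimeter, setIntegral_congr_set h]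

/-- The tiles of `T` are a Reuleaux triangle and a chipped hexagon, not necessarily regular, the
three chips of which are translates of the triangle by vectors of the lattice. -/
structure PeriodicTiling.IsChippedHoneycomb (T : PeriodicTiling 2) (q : Plane)
    (γ A m S B ρ : ℝ) : Prop where
  long : LongSides A m S B ρ
  tile_zero : ∃ g ∈ T.lattice, T.tile 0 =ᵐ[volume] reuleaux (q + g) γ (Real.sqrt 3 * ρ)
  tile_one : T.tile 1 =ᵐ[volume] chippedHex q γ A m S B ρ
  mem₁ : eis q γ A (S - A) - q ∈ T.lattice
  mem₂ : eis q γ (-m) B - q ∈ T.lattice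
  per_eq : T.per = ENNReal.ofReal
    (Real.pi * (Real.sqrt 3 * ρ) - 3 * ρ + (A + S + B + m) / 2)

theorem PeriodicTiling.IsType39.exists_isChippedHoneycomb {T : PeriodicTiling 2}
    (h : T.IsType39) : ∃ q γ A m S B ρ, T.IsChippedHoneycomb q γ A m S B ρ := by
  obtain ⟨p, P₁, P₂, F₁, F₂, hp0, hP₁, hF₁, hc₁, hP₂, hF₂, hc₂⟩ := h
  have h3 : 0 < Real.sqrt 3 := by positivity
  -- A Reuleaux triangle of width `1/p` has circumradius `1/(√3 p)`.
  obtain ⟨ρ, hρ, hp⟩ : ∃ ρ, 0 < ρ ∧ p * (Real.sqrt 3 * ρ) = 1 :=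
    ⟨1 / (Real.sqrt 3 * p), by positivity, by field_simp⟩
  obtain ⟨hF₁', hper₁⟩ := hP₁.triangle_eq hρ hp hc₁ rfl rfl
  set α := P₁.angle 0 - 2 * Real.pi / 3
  set q₀ := P₁.vertex 0 - ρ • dir α
  have hF : ∀ k, (![F₁, F₂] : Fin 2 → Set Plane) k =ᵐ[volume] T.tile k := by
    intro k
    fin_cases k
    exacts [hF₁, hF₂]
  obtain ⟨k, hk⟩ := exists_matching (T := T) (F := ![F₁, F₂]) hρ hp hF hF₁' hP₂ hc₂
  have hlen := fun n => (hk n).1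
  obtain ⟨A, m, S, B, hch⟩ := hP₂.exists_isChipped hρ hp hc₂ hlen
  obtain ⟨hF₂', hper₂⟩ := hP₂.chipped_eq hρ hp hc₂ hlen hch
  set γ := P₂.angle 0
  set q := P₂.vertex 0 - ρ • dir γ
  obtain ⟨hL, ⟨-, -, v2, -, -, v5, -, -, v8⟩, ⟨-, -, a2, -, -, a5, -, -, a8⟩, -⟩ := hch
  -- The center of each chip is congruent to the center `q₀` of the triangular tile modulo the
  -- lattice; differences of chip centers are therefore lattice vectors.
  have hcen : ∀ n Q θ, P₂.vertex (arcIndex n) = eis Q θ (-ρ) ρ →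
      dir (P₂.angle (arcIndex n)) = dir θ → ∃ g ∈ T.lattice, Q + g = q₀ := by
    intro n Q θ hv ha
    obtain ⟨-, hd, g, hg, he⟩ := hk n
    refine ⟨g, hg, ?_⟩
    rw [hv, ← dir_congr_add hd, dir_congr_add ha, ← (reuleaux_center Q θ ρ).2.1,
      add_sub_cancel_right] at he
    exact he
  obtain ⟨g₂, hg₂, h₂⟩ := hcen 0 _ _ v2 a2
  obtain ⟨g₄, hg₄, h₄⟩ := hcen 1 _ _ v5 a5
  obtain ⟨g₀, hg₀, h₀⟩ := hcen 2 _ _ v8 a8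
  have hR : reuleaux q₀ α (Real.sqrt 3 * ρ) = reuleaux q₀ γ (Real.sqrt 3 * ρ) := by
    rw [← reuleaux_add_int_mul q₀ α hρ (k + ((2 : Fin 3) : ℕ) : ℤ)]
    exact reuleaux_congr ((hk 2).2.1.symm.trans a8) _ _
  refine ⟨q, γ, A, m, S, B, ρ, hL, ⟨g₀, hg₀, ?_⟩, ?_, ?_, ?_, ?_⟩
  · rw [h₀, ← hR, ← hF₁']; exact hF₁.symm
  · rw [← hF₂']; exact hF₂.symm
  · have : eis q γ A (S - A) - q = g₀ - g₂ := by
      rw [sub_eq_sub_iff_add_eq_add, h₂, ← h₀, add_comm]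
    rw [this]; exact T.lattice.sub_mem hg₀ hg₂
  · have : eis q γ (-m) B - q = g₀ - g₄ := by
      rw [sub_eq_sub_iff_add_eq_add, h₄, ← h₀, add_comm]
    rw [this]; exact T.lattice.sub_mem hg₀ hg₄
  · obtain ⟨-, k0, k1, k3, k4, k6, k7⟩ := hL
    have hπ := Real.pi_pos
    have hpos : 0 < Real.pi * (Real.sqrt 3 * ρ) := by positivity
    rw [PeriodicTiling.per, Fin.sum_univ_two, ← perimeter_congr hF₁, ← perimeter_congr hF₂, hper₁,
      hper₂, ← ENNReal.ofReal_add hpos.le (by linarith),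
      ← ENNReal.ofReal_ofNat 2, ← ENNReal.ofReal_div_of_pos two_pos]
    congr 1; ring

/-! ### Lattices -/

theorem linearIndependent_of_cross {u v : Plane} (h : cross u v ≠ 0) :
    LinearIndependent ℝ ![u, v] := by
  rw [LinearIndependent.pair_iff]
  intro s t hst
  obtain ⟨h0, h1⟩ := plane_ext_iff.1 hst
  simp only [PiLp.add_apply, PiLp.smul_apply, smul_eq_mul, PiLp.zero_apply] at h0 h1
  constructor
  · refine (mul_eq_zero.1 (?_ : s * cross u v = 0)).resolve_right h
    rw [cross]; linear_combination v 1 * h0 - v 0 * h1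
  · refine (mul_eq_zero.1 (?_ : t * cross u v = 0)).resolve_right h
    rw [cross]; linear_combination u 0 * h1 - u 1 * h0

/-- The basis `u, v` of the plane. -/
noncomputable def pairBasis {u v : Plane} (h : cross u v ≠ 0) : Module.Basis (Fin 2) ℝ Plane :=
  basisOfLinearIndependentOfCardEqFinrank (linearIndependent_of_cross h) (by simp)

theorem coe_pairBasis {u v : Plane} (h : cross u v ≠ 0) : ⇑(pairBasis h) = ![u, v] :=
  coe_basisOfLinearIndependentOfCardEqFinrank _ _

theorem range_pairBasis {u v : Plane} (h : cross u v ≠ 0) : range (pairBasis h) = {u, v} := by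
  rw [coe_pairBasis, Matrix.range_cons, Matrix.range_cons, Matrix.range_empty, union_empty]
  rfl

theorem volume_fundamentalDomain_pair {u v : Plane} (h : cross u v ≠ 0) :
    volume.real (ZSpan.fundamentalDomain (pairBasis h)) = |cross u v| := by
  set e := EuclideanSpace.basisFun (Fin 2) ℝ
  have h1 : volume.real (ZSpan.fundamentalDomain e.toBasis) = 1 := by
    rw [measureReal_congr (ZSpan.fundamentalDomain_ae_parallelepiped e.toBasis volume),
      OrthonormalBasis.coe_toBasis, measureReal_def, e.volume_parallelepiped, ENNReal.toReal_one]
  rw [ZSpan.measureReal_fundamentalDomain _ _ e.toBasis, h1, mul_one, Module.Basis.det_apply,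
    Matrix.det_fin_two, coe_pairBasis]
  simp only [Module.Basis.toMatrix_apply, e, OrthonormalBasis.coe_toBasis_repr_apply,
    EuclideanSpace.basisFun_repr, cross]
  simp only [Matrix.cons_val_zero, Matrix.cons_val_one]
  congr 1; ring

theorem discreteTopology_span_pair {u v : Plane} (h : cross u v ≠ 0) :
    DiscreteTopology (Submodule.span ℤ {u, v}) := by
  rw [← range_pairBasis h]; infer_instance

theorem isZLattice_span_pair {u v : Plane} (h : cross u v ≠ 0)
    [DiscreteTopology (Submodule.span ℤ {u, v})] : IsZLattice ℝ (Submodule.span ℤ {u, v}) := by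
  refine ⟨?_⟩
  rw [← range_pairBasis h]
  exact (instIsZLatticeRealSpan (pairBasis h)).span_top

theorem covolume_span_pair {u v : Plane} (h : cross u v ≠ 0)
    [DiscreteTopology (Submodule.span ℤ {u, v})] [IsZLattice ℝ (Submodule.span ℤ {u, v})] :
    ZLattice.covolume (Submodule.span ℤ {u, v}) = |cross u v| := by
  rw [← volume_fundamentalDomain_pair h]
  refine ZLattice.covolume_eq_measure_fundamentalDomain _ _ ?_
  have := ZSpan.isAddFundamentalDomain (pairBasis h) volume
  rwa [range_pairBasis h] at this

open scoped Pointwise in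
theorem PeriodicTiling.isAddFundamentalDomain (T : PeriodicTiling 2) :
    IsAddFundamentalDomain T.lattice (T.tile 0 ∪ T.tile 1) := by
  have hv : ∀ (g : T.lattice) (E : Set Plane), g +ᵥ E = shiftSet g.1 E := fun g E => by
    rw [shiftSet]
    ext x
    simp only [mem_vadd_set, mem_image]
    refine exists_congr fun y => and_congr_right fun _ => ?_
    rw [show g +ᵥ y = g.1 + y from rfl, add_comm]
  refine ⟨((T.measurableSet_tile 0).union (T.measurableSet_tile 1)).nullMeasurableSet, ?_, ?_⟩
  · have := T.cover
    rw [measure_eq_zero_iff_ae_notMem] at this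
    filter_upwards [this] with x hx
    rw [mem_compl_iff, not_not] at hx
    simp only [mem_iUnion] at hx
    obtain ⟨k, g, hg, hxg⟩ := hx
    refine ⟨-⟨g, hg⟩, ?_⟩
    have he : (-⟨g, hg⟩ : T.lattice) +ᵥ x = x - g := by
      change -g + x = x - g; abel
    rw [he]
    rw [mem_shiftSet] at hxg
    fin_cases k
    exacts [Or.inl hxg, Or.inr hxg]
  · intro g h hgh
    change volume ((g +ᵥ (T.tile 0 ∪ T.tile 1)) ∩ (h +ᵥ (T.tile 0 ∪ T.tile 1))) = 0
    have hu : ∀ g : T.lattice, g +ᵥ (T.tile 0 ∪ T.tile 1) =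
        shiftSet g.1 (T.tile 0) ∪ shiftSet g.1 (T.tile 1) := fun g => by
      rw [hv]; exact image_union _ _ _
    rw [hu, hu, union_inter_distrib_right, inter_union_distrib_left, inter_union_distrib_left]
    have hd : ∀ k l, volume (shiftSet g.1 (T.tile k) ∩ shiftSet h.1 (T.tile l)) = 0 := fun k l =>
      T.disjoint k l _ g.2 _ h.2 fun he => hgh (Subtype.ext (Prod.mk.inj he).2)
    simp only [measure_union_null_iff, hd, and_self]

/-- The union of the generators is a fundamental domain, and they overlap in a null set. -/
theorem PeriodicTiling.covolume_eq (T : PeriodicTiling 2) (h0 : volume (T.tile 0) ≠ ⊤)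
    (h1 : volume (T.tile 1) ≠ ⊤) : have := T.discrete; have := T.isZLattice
    ZLattice.covolume T.lattice = volume.real (T.tile 0) + volume.real (T.tile 1) := by
  have := T.discrete
  have := T.isZLattice
  have hd : AEDisjoint volume (T.tile 0) (T.tile 1) := by
    have := T.disjoint 0 1 0 T.lattice.zero_mem 0 T.lattice.zero_mem (by simp)
    have hs : ∀ E : Set Plane, shiftSet 0 E = E := fun E => by simp [shiftSet]
    rwa [hs, hs] at this
  change ZLattice.covolume T.lattice = _
  rw [ZLattice.covolume_eq_measure_fundamentalDomain _ _ T.isAddFundamentalDomain,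
    measureReal_def, measure_union₀ (T.measurableSet_tile 1).nullMeasurableSet hd,
    ENNReal.toReal_add h0 h1]
  rfl

namespace PeriodicTiling.IsChippedHoneycomb

variable {T : PeriodicTiling 2} {q : Plane} {γ A m S B ρ : ℝ}

theorem volume_tile_zero (h : T.IsChippedHoneycomb q γ A m S B ρ) :
    volume.real (T.tile 0) = 3 * ((Real.pi - Real.sqrt 3) / 2 * ρ ^ 2) := by
  obtain ⟨g, -, hg⟩ := h.tile_zero
  rw [measureReal_congr hg, area_reuleaux _ _ h.long.pos]

theorem volume_tile_one (h : T.IsChippedHoneycomb q γ A m S B ρ) :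
    volume.real (T.tile 1) =
      Real.sqrt 3 / 2 * ((A + m) * B - m ^ 2 / 2 - (A + B - S) ^ 2 / 2) -
        3 * ((Real.pi - Real.sqrt 3) / 2 * ρ ^ 2) := by
  rw [measureReal_congr h.tile_one, area_chippedHex _ _ h.long]

theorem volume_ne_top (h : T.IsChippedHoneycomb q γ A m S B ρ) (k : Fin 2) :
    volume (T.tile k) ≠ ⊤ := by
  fin_cases k
  · obtain ⟨g, -, hg⟩ := h.tile_zero
    change volume (T.tile 0) ≠ ⊤
    rw [measure_congr hg]
    exact (isBounded_reuleaux _ _ _).measure_lt_top.ne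
  · change volume (T.tile 1) ≠ ⊤
    rw [measure_congr h.tile_one]
    exact ((isBounded_hexSet q γ A m S B).subset sdiff_subset).measure_lt_top.ne

/-- The hexagon is centrally symmetric, and its translations generate the lattice. -/
theorem lattice_eq (h : T.IsChippedHoneycomb q γ A m S B ρ) : S = A + B - m ∧
    T.lattice = Submodule.span ℤ {eis q γ A (S - A) - q, eis q γ (-m) B - q} := by
  have := T.discrete
  have := T.isZLattice
  obtain ⟨hρ, k0, k1, k2, k3, k4, k5⟩ := h.long
  have h3 : 0 < Real.sqrt 3 := by positivity
  set u := eis q γ A (S - A) - q with hu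
  set v := eis q γ (-m) B - q with hv
  have hcross : cross u v = (A * B + m * (S - A)) * (Real.sqrt 3 / 2) := by
    rw [← cross_frame γ]
    simp only [hu, hv, cross, eis, PiLp.sub_apply, PiLp.add_apply, PiLp.smul_apply, smul_eq_mul]
    ring
  have hdet : 0 < A * B + m * (S - A) :=
    add_pos (mul_pos (by linarith) (by linarith)) (mul_pos (by linarith) (by linarith))
  have hne : cross u v ≠ 0 := by rw [hcross]; positivity
  have := discreteTopology_span_pair hne
  have := isZLattice_span_pair hne
  have hle : Submodule.span ℤ {u, v} ≤ T.lattice := by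
    rw [Submodule.span_le]
    rintro x (rfl | rfl)
    exacts [h.mem₁, h.mem₂]
  -- The sublattice spanned by the two differences of chip centers has covolume `K` times that of
  -- the lattice, for a natural number `K`.
  have hidx := ZLattice.covolume_div_covolume_eq_relIndex' (Submodule.span ℤ {u, v}) T.lattice hle
  set K := (Submodule.span ℤ {u, v}).toAddSubgroup.relIndex T.lattice.toAddSubgroup with hK
  have hcov : ZLattice.covolume T.lattice =
      Real.sqrt 3 / 2 * ((A + m) * B - m ^ 2 / 2 - (A + B - S) ^ 2 / 2) := by
    have := T.covolume_eq (h.volume_ne_top 0) (h.volume_ne_top 1)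
    rw [h.volume_tile_zero, h.volume_tile_one] at this
    exact this.trans (by ring)
  rw [covolume_span_pair hne, hcross, abs_of_pos (by positivity),
    div_eq_iff (ZLattice.covolume_ne_zero T.lattice volume), hcov] at hidx
  have hidx' : A * B + m * (S - A) =
      K * ((A + m) * B - m ^ 2 / 2 - (A + B - S) ^ 2 / 2) := by
    have h32 : Real.sqrt 3 / 2 ≠ 0 := by positivity
    apply mul_right_cancel₀ h32
    linear_combination hidx
  set N := (A + m) * B - m ^ 2 / 2 - (A + B - S) ^ 2 / 2 with hN
  -- `A + B - S` and `m` are the lengths of two opposite sides, so the excess of the sublattice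
  -- covolume measures the failure of central symmetry.
  have hdN : A * B + m * (S - A) = N + (A + B - S - m) ^ 2 / 2 := by rw [hN]; ring
  -- The difference is bounded by `A` and `B` if it is nonnegative, and in absolute value by `m` and
  -- `S - A` otherwise. Hence `N` exceeds half the determinant and `K < 2`.
  have hsmall : (A + B - S - m) ^ 2 < A * B + m * (S - A) := by
    rcases le_total m (A + B - S) with hc | hc
    · have : (A + B - S - m) * (A + B - S - m) ≤ A * B :=
        mul_le_mul (by linarith) (by linarith) (by linarith) (by linarith)
      nlinarith [mul_pos (show 0 < m by linarith) (show 0 < S - A by linarith)]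
    · have : (m - (A + B - S)) * (m - (A + B - S)) ≤ m * (S - A) :=
        mul_le_mul (by linarith) (by linarith) (by linarith) (by linarith)
      nlinarith [mul_pos (show 0 < A by linarith) (show 0 < B by linarith)]
  have hNpos : 0 < N := by nlinarith
  have hK1 : K = 1 := by
    have hk0 : K ≠ 0 := by
      intro h0
      rw [h0, Nat.cast_zero, zero_mul] at hidx'
      linarith
    have hk2 : (K : ℝ) < 2 := by
      by_contra! h2
      nlinarith [sq_nonneg (A + B - S - m)]
    have : K < 2 := by exact_mod_cast hk2
    omega
  constructor
  · rw [hK1, Nat.cast_one, one_mul] at hidx'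
    have : (A + B - S - m) ^ 2 = 0 := by linarith
    have := pow_eq_zero_iff two_ne_zero |>.1 this
    linarith
  · refine le_antisymm ?_ hle
    have := AddSubgroup.relIndex_eq_one.1 hK1
    exact this

end PeriodicTiling.IsChippedHoneycomb

/-! ### The regular honeycomb -/

/-- The lattice of the honeycomb with hexagons of side `ℓ`, one of whose edges has the direction
`γ`. -/
def hexLattice (γ ℓ : ℝ) : Submodule ℤ Plane :=
  Submodule.span ℤ {ℓ • dir γ + ℓ • dir (γ + Real.pi / 3),
    (-ℓ) • dir γ + (2 * ℓ) • dir (γ + Real.pi / 3)}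

/-- In units of `ℓ` the lattice is `{(x, y) : y ≡ x mod 3}`, and the tiling property becomes a
question about small integers. -/
theorem mem_hexLattice {γ ℓ : ℝ} {g : Plane} : g ∈ hexLattice γ ℓ ↔
    ∃ x y : ℤ, (∃ j : ℤ, y = x + 3 * j) ∧
      g = (ℓ * x) • dir γ + (ℓ * y) • dir (γ + Real.pi / 3) := by
  rw [hexLattice, Submodule.mem_span_pair]
  constructor
  · rintro ⟨i, j, rfl⟩
    refine ⟨i - j, i + 2 * j, ⟨j, by ring⟩, ?_⟩
    push_cast
    simp only [← Int.cast_smul_eq_zsmul ℝ]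
    module
  · rintro ⟨x, _, ⟨j, rfl⟩, rfl⟩
    refine ⟨x + j, j, ?_⟩
    push_cast
    simp only [← Int.cast_smul_eq_zsmul ℝ]
    push_cast
    module

theorem eis_sub_combo (q : Plane) (γ a b x y : ℝ) :
    eis q γ a b - (x • dir γ + y • dir (γ + Real.pi / 3)) = eis q γ (a - x) (b - y) := by
  simp only [eis]; module

theorem cross_hexLattice {γ ℓ : ℝ} (hℓ : ℓ ≠ 0) :
    cross (ℓ • dir γ + ℓ • dir (γ + Real.pi / 3))
      ((-ℓ) • dir γ + (2 * ℓ) • dir (γ + Real.pi / 3)) ≠ 0 := by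
  rw [cross_combo, cross_frame]
  have : ℓ * (2 * ℓ) - ℓ * -ℓ = 3 * ℓ ^ 2 := by ring
  rw [this]; positivity

theorem convex_hexSet (q : Plane) (γ A m S B : ℝ) : Convex ℝ (hexSet q γ A m S B) := by
  rintro x ⟨⟨h1, h2⟩, ⟨h3, h4⟩, h5, h6⟩ y ⟨⟨k1, k2⟩, ⟨k3, k4⟩, k5, k6⟩ s t hs ht hst
  obtain ⟨hA, hB⟩ := coord_combo q γ x y hst
  obtain rfl : t = 1 - s := by linarith
  rw [hexSet, mem_ofPred_eq, hA, hB]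
  refine ⟨⟨?_, ?_⟩, ⟨?_, ?_⟩, ?_, ?_⟩
  · linarith [mul_nonneg hs h1, mul_nonneg ht k1]
  · linarith [mul_le_mul_of_nonneg_left h2 hs, mul_le_mul_of_nonneg_left k2 ht]
  · linarith [mul_le_mul_of_nonneg_left h3 hs, mul_le_mul_of_nonneg_left k3 ht]
  · linarith [mul_le_mul_of_nonneg_left h4 hs, mul_le_mul_of_nonneg_left k4 ht]
  · linarith [mul_nonneg hs h5, mul_nonneg ht k5]
  · linarith [mul_le_mul_of_nonneg_left h6 hs, mul_le_mul_of_nonneg_left k6 ht]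

theorem mem_interior_hexSet {q : Plane} {γ A m S B a b : ℝ}
    (h : eis q γ a b ∈ interior (hexSet q γ A m S B)) :
    (0 < b ∧ b < B) ∧ (-m < a ∧ a < A) ∧ 0 < a + b ∧ a + b < S := by
  have hD : ∀ a b, eis q γ a b ∈ hexSet q γ A m S B → _ := fun a b => mem_hexSet.1
  obtain ⟨⟨h1, h2⟩, ⟨h3, h4⟩, h5, h6⟩ := hD _ _ (interior_subset h)
  refine ⟨⟨lt_of_le_of_ne h1 fun e => ?_, lt_of_le_of_ne h2 fun e => ?_⟩,
    ⟨lt_of_le_of_ne h3 fun e => ?_, lt_of_le_of_ne h4 fun e => ?_⟩,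
    lt_of_le_of_ne h5 fun e => ?_, lt_of_le_of_ne h6 fun e => ?_⟩
  · exact notMem_interior_of_halfPlane 0 1 0 (by norm_num)
      (fun a b h => by have := hD a b h; linarith) (by linarith) h
  · exact notMem_interior_of_halfPlane 0 (-1) (-B) (by norm_num)
      (fun a b h => by have := hD a b h; linarith) (by linarith) h
  · exact notMem_interior_of_halfPlane 1 0 (-m) (by norm_num)
      (fun a b h => by have := hD a b h; linarith) (by linarith) h
  · exact notMem_interior_of_halfPlane (-1) 0 (-A) (by norm_num)
      (fun a b h => by have := hD a b h; linarith) (by linarith) h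
  · exact notMem_interior_of_halfPlane 1 1 0 (by norm_num)
      (fun a b h => by have := hD a b h; linarith) (by linarith) h
  · exact notMem_interior_of_halfPlane (-1) (-1) (-S) (by norm_num)
      (fun a b h => by have := hD a b h; linarith) (by linarith) h

/-- The hexagons of the honeycomb cover the plane. -/
theorem exists_mem_hexSet (q : Plane) (γ : ℝ) {ℓ : ℝ} (hℓ : 0 < ℓ) (z : Plane) :
    ∃ g ∈ hexLattice γ ℓ, z - g ∈ hexSet q γ ℓ ℓ (2 * ℓ) (2 * ℓ) := by
  have key : ∀ s t : ℝ, ∃ x y : ℤ, (∃ j : ℤ, y = x + 3 * j) ∧ |s - x| ≤ 1 ∧ |t - y| ≤ 1 ∧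
      |s + t - (x + y)| ≤ 1 := by
    intro s t
    have s0 := Int.floor_le s
    have s1 := (Int.lt_floor_add_one s).le
    have t0 := Int.floor_le t
    have t1 := (Int.lt_floor_add_one t).le
    -- A lattice point is sought among the corners of the unit square of `(s, t)`. If the lower left
    -- corner is one, so is the upper right, and the antidiagonal decides between them; otherwise
    -- exactly one of the other two corners qualifies.
    obtain ⟨j, hj | hj | hj⟩ : ∃ j : ℤ, ⌊t⌋ = ⌊s⌋ + 3 * j ∨ ⌊t⌋ + 1 = ⌊s⌋ + 3 * j ∨
        ⌊t⌋ = ⌊s⌋ + 1 + 3 * j := ⟨(⌊t⌋ - ⌊s⌋ + 1) / 3, by omega⟩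
    · rcases le_total (s + t) (⌊s⌋ + ⌊t⌋ + 1) with h | h
      · refine ⟨⌊s⌋, ⌊t⌋, ⟨j, hj⟩, ?_, ?_, ?_⟩ <;> rw [abs_le] <;> constructor <;> linarith
      · refine ⟨⌊s⌋ + 1, ⌊t⌋ + 1, ⟨j, by omega⟩, ?_, ?_, ?_⟩ <;> push_cast <;> rw [abs_le] <;>
          constructor <;> linarith
    · refine ⟨⌊s⌋, ⌊t⌋ + 1, ⟨j, by omega⟩, ?_, ?_, ?_⟩ <;> push_cast <;> rw [abs_le] <;>
          constructor <;> linarith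
    · refine ⟨⌊s⌋ + 1, ⌊t⌋, ⟨j, by omega⟩, ?_, ?_, ?_⟩ <;> push_cast <;> rw [abs_le] <;>
          constructor <;> linarith
  obtain ⟨a, b, rfl⟩ := exists_eis q γ z
  -- The `-1` recenters: the hexagon has its center at `(0, ℓ)`.
  obtain ⟨x, y, hj, h1, h2, h3⟩ := key (a / ℓ) (b / ℓ - 1)
  refine ⟨_, mem_hexLattice.2 ⟨x, y, hj, rfl⟩, ?_⟩
  rw [eis_sub_combo, mem_hexSet]
  rw [abs_le] at h1 h2 h3
  have ha : a = ℓ * (a / ℓ) := by field_simp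
  have hb : b = ℓ * (b / ℓ - 1) + ℓ := by field_simp; ring
  generalize a / ℓ = s at *
  generalize b / ℓ - 1 = t at *
  subst ha hb
  refine ⟨⟨?_, ?_⟩, ⟨?_, ?_⟩, ?_, ?_⟩ <;> nlinarith

/-- The generator of the hexagonal tiles. -/
def hexTile (q : Plane) (γ ℓ ρ : ℝ) : Set Plane :=
  interior (hexSet q γ ℓ ℓ (2 * ℓ) (2 * ℓ)) \ chips q γ ℓ ℓ (2 * ℓ) (2 * ℓ) ρ

theorem hexTile_ae_eq (q : Plane) (γ ℓ ρ : ℝ) : (hexTile q γ ℓ ρ : Set Plane) =ᵐ[volume]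
    chippedHex q γ ℓ ℓ (2 * ℓ) (2 * ℓ) ρ :=
  ((interior_ae_eq_of_null_frontier ((convex_hexSet _ _ _ _ _ _).addHaar_frontier volume)).diff
    (Filter.EventuallyEq.refl _ _)).trans (chippedHex_ae_eq q γ ℓ ℓ (2 * ℓ) (2 * ℓ) ρ).symm

theorem int_between {ℓ lo hi : ℝ} (hℓ : 0 < ℓ) {x m n : ℤ} (h0 : ℓ * m ≤ lo) (h1 : lo < ℓ * x)
    (h2 : ℓ * x < hi) (h3 : hi ≤ ℓ * n) : m < x ∧ x < n := by
  constructor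
  · have : (m : ℝ) < x := lt_of_mul_lt_mul_left (h0.trans_lt h1) hℓ.le
    exact_mod_cast this
  · have : (x : ℝ) < n := lt_of_mul_lt_mul_left (h2.trans_le h3) hℓ.le
    exact_mod_cast this

/-- Lattice vectors are determined by the differences of their coordinates from those of a point of
an open hexagon. -/
theorem int_eq_zero_of_small {ℓ : ℝ} (hℓ : 0 < ℓ) {x y : ℤ} (hj : ∃ j : ℤ, y = x + 3 * j)
    (h1 : |ℓ * x| < 2 * ℓ) (h2 : |ℓ * y| < 2 * ℓ) (h3 : |ℓ * x + ℓ * y| < 2 * ℓ) :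
    x = 0 ∧ y = 0 := by
  rw [abs_lt] at h1 h2 h3
  have e1 := int_between (m := -2) (n := 2) hℓ (by push_cast; linarith) h1.1 h1.2
    (by push_cast; linarith)
  have e2 := int_between (m := -2) (n := 2) hℓ (by push_cast; linarith) h2.1 h2.2
    (by push_cast; linarith)
  have e3 := int_between (x := x + y) (m := -2) (n := 2) hℓ (lo := -(2 * ℓ)) (hi := 2 * ℓ)
    (by push_cast; linarith) (by push_cast; linarith) (by push_cast; linarith)
    (by push_cast; linarith)
  omega

section RegularTiling

variable {q : Plane} {γ ℓ ρ : ℝ}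

theorem exists_coord_shift {g h : Plane} (hg : g ∈ hexLattice γ ℓ) (hh : h ∈ hexLattice γ ℓ)
    (z : Plane) : ∃ a b : ℝ, ∃ x y : ℤ, (∃ j : ℤ, y = x + 3 * j) ∧ z - h = eis q γ a b ∧
      z - g = eis q γ (a - ℓ * x) (b - ℓ * y) ∧ (x = 0 ∧ y = 0 → g = h) ∧
      (g - h = (ℓ * x) • dir γ + (ℓ * y) • dir (γ + Real.pi / 3)) := by
  obtain ⟨a, b, hz⟩ := exists_eis q γ (z - h)
  obtain ⟨x, y, hj, hxy⟩ := mem_hexLattice.1 ((hexLattice γ ℓ).sub_mem hg hh)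
  refine ⟨a, b, x, y, hj, hz, ?_, ?_, hxy⟩
  · rw [← eis_sub_combo, ← hz, ← hxy]; abel
  · rintro ⟨rfl, rfl⟩
    simpa [sub_eq_zero] using hxy

theorem disjoint_triangles (hρ : 0 < ρ) (hℓ : ρ < ℓ) {g h : Plane} (hg : g ∈ hexLattice γ ℓ)
    (hh : h ∈ hexLattice γ ℓ) (hne : g ≠ h) :
    shiftSet g (reuleaux q γ (Real.sqrt 3 * ρ)) ∩ shiftSet h (reuleaux q γ (Real.sqrt 3 * ρ)) =
      ∅ := by
  refine Set.eq_empty_iff_forall_notMem.2 fun z ⟨hzg, hzh⟩ => ?_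
  obtain ⟨a, b, x, y, hj, e1, e2, e3, -⟩ := exists_coord_shift (q := q) hg hh z
  rw [mem_shiftSet, e2] at hzg
  rw [mem_shiftSet, e1] at hzh
  obtain ⟨h1, h2, h3, h4, h5, h6⟩ := reuleaux_support hρ hzg
  obtain ⟨k1, k2, k3, k4, k5, k6⟩ := reuleaux_support hρ hzh
  refine hne (e3 (int_eq_zero_of_small (hρ.trans hℓ) hj ?_ ?_ ?_)) <;> rw [abs_lt] <;>
    constructor <;> linarith

theorem disjoint_hexTiles (hℓ : 0 < ℓ) {g h : Plane} (hg : g ∈ hexLattice γ ℓ)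
    (hh : h ∈ hexLattice γ ℓ) (hne : g ≠ h) :
    shiftSet g (hexTile q γ ℓ ρ) ∩ shiftSet h (hexTile q γ ℓ ρ) = ∅ := by
  refine Set.eq_empty_iff_forall_notMem.2 fun z ⟨hzg, hzh⟩ => ?_
  obtain ⟨a, b, x, y, hj, e1, e2, e3, -⟩ := exists_coord_shift (q := q) hg hh z
  rw [mem_shiftSet, e2] at hzg
  rw [mem_shiftSet, e1] at hzh
  obtain ⟨⟨h1, h2⟩, ⟨h3, h4⟩, h5, h6⟩ := mem_interior_hexSet hzg.1
  obtain ⟨⟨k1, k2⟩, ⟨k3, k4⟩, k5, k6⟩ := mem_interior_hexSet hzh.1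
  refine hne (e3 (int_eq_zero_of_small hℓ hj ?_ ?_ ?_)) <;> rw [abs_lt] <;>
    constructor <;> linarith

theorem disjoint_triangle_hexTile (hρ : 0 < ρ) (hℓ : ρ < ℓ) {g h : Plane}
    (hg : g ∈ hexLattice γ ℓ) (hh : h ∈ hexLattice γ ℓ) :
    shiftSet g (reuleaux q γ (Real.sqrt 3 * ρ)) ∩ shiftSet h (hexTile q γ ℓ ρ) = ∅ := by
  refine Set.eq_empty_iff_forall_notMem.2 fun z ⟨hzg, hzh⟩ => ?_
  have hℓ0 := hρ.trans hℓ
  obtain ⟨a, b, x, y, hj, e1, e2, -, -⟩ := exists_coord_shift (q := q) hg hh z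
  rw [mem_shiftSet, e2] at hzg
  rw [mem_shiftSet, e1] at hzh
  obtain ⟨h1, h2, h3, h4, h5, h6⟩ := reuleaux_support hρ hzg
  obtain ⟨⟨k1, k2⟩, ⟨k3, k4⟩, k5, k6⟩ := mem_interior_hexSet hzh.1
  have i1 := int_between (x := x) (lo := -(2 * ℓ)) (hi := 2 * ℓ) (m := -2) (n := 2) hℓ0
    (by push_cast; linarith) (by linarith) (by linarith) (by push_cast; linarith)
  have i2 := int_between (x := y) (lo := -ℓ) (hi := 3 * ℓ) (m := -1) (n := 3) hℓ0
    (by push_cast; linarith) (by linarith) (by linarith) (by push_cast; linarith)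
  have i3 := int_between (x := x + y) (lo := -ℓ) (hi := 3 * ℓ) (m := -1) (n := 3) hℓ0
    (by push_cast; linarith) (by push_cast; linarith) (by push_cast; linarith)
    (by push_cast; linarith)
  refine hzh.2 ?_
  -- The support bounds and the congruence modulo 3 leave three translates of the triangle,
  -- precisely the chips removed from the tile.
  obtain ⟨rfl, rfl⟩ | ⟨rfl, rfl⟩ | ⟨rfl, rfl⟩ : (x = 0 ∧ y = 0) ∨ (x = 1 ∧ y = 1) ∨
      (x = -1 ∧ y = 2) := by omega
  · refine Or.inl (Or.inl ?_)
    simpa using hzg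
  · refine Or.inl (Or.inr ?_)
    rw [eis_eq_shift q γ a b ℓ (2 * ℓ - ℓ)]
    have : ∀ p : Plane, eis p γ (a - ℓ) (b - (2 * ℓ - ℓ)) ∈ reuleaux p γ (Real.sqrt 3 * ρ) ↔
        eis q γ (a - ℓ * (1 : ℤ)) (b - ℓ * (1 : ℤ)) ∈ reuleaux q γ (Real.sqrt 3 * ρ) := fun p => by
      rw [show a - ℓ * (1 : ℤ) = a - ℓ by push_cast; ring,
        show b - ℓ * (1 : ℤ) = b - (2 * ℓ - ℓ) by push_cast; ring, mem_reuleaux hρ, mem_reuleaux hρ]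
    exact (this _).2 hzg
  · refine Or.inr ?_
    rw [eis_eq_shift q γ a b (-ℓ) (2 * ℓ)]
    have : ∀ p : Plane, eis p γ (a - -ℓ) (b - 2 * ℓ) ∈ reuleaux p γ (Real.sqrt 3 * ρ) ↔
        eis q γ (a - ℓ * (-1 : ℤ)) (b - ℓ * (2 : ℤ)) ∈ reuleaux q γ (Real.sqrt 3 * ρ) := fun p => by
      rw [show a - ℓ * (-1 : ℤ) = a - -ℓ by push_cast; ring,
        show b - ℓ * (2 : ℤ) = b - 2 * ℓ by push_cast; ring, mem_reuleaux hρ, mem_reuleaux hρ]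
    exact (this _).2 hzg

theorem hexLattice_generators_mem : ℓ • dir γ + ℓ • dir (γ + Real.pi / 3) ∈ hexLattice γ ℓ ∧
    (-ℓ) • dir γ + (2 * ℓ) • dir (γ + Real.pi / 3) ∈ hexLattice γ ℓ :=
  ⟨Submodule.subset_span (Or.inl rfl), Submodule.subset_span (Or.inr rfl)⟩

theorem reuleaux_add (q g : Plane) (γ r : ℝ) : reuleaux (q + g) γ r = shiftSet g (reuleaux q γ r) := by
  ext x
  rw [mem_shiftSet]
  simp only [reuleaux, mem_iInter, Metric.mem_closedBall, dist_eq_norm]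
  refine forall_congr' fun k => ?_
  rw [show x - g - (q + (r / Real.sqrt 3) • dir (γ + k * (2 * Real.pi / 3))) =
    x - (q + g + (r / Real.sqrt 3) • dir (γ + k * (2 * Real.pi / 3))) by abel]

theorem chips_hex (q : Plane) (γ ℓ ρ : ℝ) : chips q γ ℓ ℓ (2 * ℓ) (2 * ℓ) ρ =
    reuleaux q γ (Real.sqrt 3 * ρ) ∪
      shiftSet (ℓ • dir γ + ℓ • dir (γ + Real.pi / 3)) (reuleaux q γ (Real.sqrt 3 * ρ)) ∪
      shiftSet ((-ℓ) • dir γ + (2 * ℓ) • dir (γ + Real.pi / 3))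
        (reuleaux q γ (Real.sqrt 3 * ρ)) := by
  rw [← reuleaux_add, ← reuleaux_add, chips]
  congr 4
  · simp only [eis]; module
  · simp only [eis]; module

theorem cover_hexTiles (q : Plane) (γ : ℝ) (hℓ : 0 < ℓ) (ρ : ℝ) :
    volume (⋃ k : Fin 2, ⋃ g ∈ hexLattice γ ℓ,
      shiftSet g ((![reuleaux q γ (Real.sqrt 3 * ρ), hexTile q γ ℓ ρ] : Fin 2 → Set Plane) k))ᶜ =
      0 := by
  set H := hexSet q γ ℓ ℓ (2 * ℓ) (2 * ℓ)
  have hcount : Countable (hexLattice γ ℓ) := by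
    have : DiscreteTopology (hexLattice γ ℓ) :=
      discreteTopology_span_pair (cross_hexLattice (γ := γ) hℓ.ne')
    exact TopologicalSpace.separableSpace_iff_countable.1
      (inferInstanceAs (TopologicalSpace.SeparableSpace (hexLattice γ ℓ)))
  have hnull : volume (⋃ g : hexLattice γ ℓ, shiftSet g.1 (frontier H)) = 0 := by
    rw [measure_iUnion_null_iff]
    intro g
    rw [shiftSet_eq_preimage, (measurePreserving_sub_right volume g.1).measure_preimage
      isClosed_frontier.measurableSet.nullMeasurableSet]
    exact (convex_hexSet _ _ _ _ _ _).addHaar_frontier volume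
  -- A point that is not covered lies on the frontier of one of the countably many hexagons.
  refine measure_mono_null (fun z hz => ?_) hnull
  by_contra hn
  refine hz ?_
  obtain ⟨g, hg, hzg⟩ := exists_mem_hexSet q γ hℓ z
  have hint : z - g ∈ interior H := by
    by_contra hi
    refine hn (mem_iUnion.2 ⟨⟨g, hg⟩, mem_shiftSet.2 ?_⟩)
    rw [(isClosed_hexSet _ _ _ _ _ _).frontier_eq]
    exact ⟨hzg, hi⟩
  have tri : ∀ g ∈ hexLattice γ ℓ, z - g ∈ reuleaux q γ (Real.sqrt 3 * ρ) →
      z ∈ ⋃ k : Fin 2, ⋃ g ∈ hexLattice γ ℓ,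
        shiftSet g ((![reuleaux q γ (Real.sqrt 3 * ρ), hexTile q γ ℓ ρ] : Fin 2 → Set Plane) k) :=
    fun g hg h => mem_iUnion.2 ⟨0, mem_iUnion₂.2 ⟨g, hg, mem_shiftSet.2 h⟩⟩
  by_cases hc : z - g ∈ chips q γ ℓ ℓ (2 * ℓ) (2 * ℓ) ρ
  · rw [chips_hex] at hc
    rcases hc with (hc | hc) | hc
    · exact tri g hg hc
    · rw [mem_shiftSet, sub_sub] at hc
      exact tri _ ((hexLattice γ ℓ).add_mem hg hexLattice_generators_mem.1) hc
    · rw [mem_shiftSet, sub_sub] at hc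
      exact tri _ ((hexLattice γ ℓ).add_mem hg hexLattice_generators_mem.2) hc
  · exact mem_iUnion.2 ⟨1, mem_iUnion₂.2 ⟨g, hg, mem_shiftSet.2 ⟨hint, hc⟩⟩⟩

/-- The honeycomb tiling by regular hexagons, with Reuleaux triangles at every second vertex. -/
noncomputable def hexTiling (q : Plane) (γ : ℝ) {ℓ ρ : ℝ} (hρ : 0 < ρ) (hℓ : ρ < ℓ) :
    PeriodicTiling 2 where
  lattice := hexLattice γ ℓ
  discrete := discreteTopology_span_pair (cross_hexLattice (hρ.trans hℓ).ne')
  isZLattice :=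
    have := discreteTopology_span_pair (cross_hexLattice (γ := γ) (hρ.trans hℓ).ne')
    isZLattice_span_pair (cross_hexLattice (γ := γ) (hρ.trans hℓ).ne')
  tile := ![reuleaux q γ (Real.sqrt 3 * ρ), hexTile q γ ℓ ρ]
  measurableSet_tile := by
    intro k
    fin_cases k
    · exact (isClosed_reuleaux _ _ _).measurableSet
    · exact isOpen_interior.measurableSet.diff (isClosed_chips _ _ _ _ _ _ _).measurableSet
  disjoint := by
    intro k l g hg h hh hne
    fin_cases k <;> fin_cases l
    · change volume (shiftSet g (reuleaux q γ _) ∩ shiftSet h (reuleaux q γ _)) = 0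
      rw [disjoint_triangles hρ hℓ hg hh (fun e => hne (by rw [e])), measure_empty]
    · change volume (shiftSet g (reuleaux q γ _) ∩ shiftSet h (hexTile q γ ℓ ρ)) = 0
      rw [disjoint_triangle_hexTile hρ hℓ hg hh, measure_empty]
    · change volume (shiftSet g (hexTile q γ ℓ ρ) ∩ shiftSet h (reuleaux q γ _)) = 0
      rw [inter_comm, disjoint_triangle_hexTile hρ hℓ hh hg, measure_empty]
    · change volume (shiftSet g (hexTile q γ ℓ ρ) ∩ shiftSet h (hexTile q γ ℓ ρ)) = 0
      rw [disjoint_hexTiles (hρ.trans hℓ) hg hh (fun e => hne (by rw [e])), measure_empty]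
  cover := cover_hexTiles q γ (hρ.trans hℓ) ρ

end RegularTiling

/-! ### Comparison with the regular honeycomb -/

theorem abs_segFlux_le {X : Plane → Plane} (h1 : ∀ x, ‖X x‖ ≤ 1) (C D : Plane) :
    |segFlux X C D| ≤ ‖D - C‖ := by
  have := intervalIntegral.norm_integral_le_of_norm_le_const (a := 0) (b := 1) (C := ‖D - C‖)
    (f := fun t => cross (X (C + t • (D - C))) (D - C)) fun t _ =>
      (abs_cross_le _ _).trans (mul_le_of_le_one_left (norm_nonneg _) (h1 _))
  simpa [segFlux] using this

theorem abs_cornerFlux_le {X : Plane → Plane} (h1 : ∀ x, ‖X x‖ ≤ 1) (q : Plane) (α : ℝ) {ρ : ℝ}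
    (hρ : 0 < ρ) : |cornerFlux X q α ρ| ≤ Real.sqrt 3 * ρ * (Real.pi / 3) := by
  have hπ := Real.pi_pos
  have := intervalIntegral.norm_integral_le_of_norm_le_const (a := 0) (b := Real.pi / 3)
    (C := Real.sqrt 3 * ρ)
    (f := fun t => cross (X (eis q α 0 (-ρ) + (Real.sqrt 3 * ρ) • dir (α + Real.pi / 6 + t)))
      ((Real.sqrt 3 * ρ) • dir (α + Real.pi / 6 + t + Real.pi / 2))) fun t _ => by
    refine (abs_cross_le _ _).trans ?_
    rw [norm_smul, norm_dir, mul_one, Real.norm_of_nonneg (by positivity)]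
    exact mul_le_of_le_one_left (by positivity) (h1 _)
  rw [sub_zero, abs_of_pos (show 0 < Real.pi / 3 by positivity)] at this
  exact this

theorem segFlux_eis_le {X : Plane → Plane} (h1 : ∀ x, ‖X x‖ ≤ 1) (q : Plane)
    (γ a b a' b' : ℝ) {L : ℝ} (hL : 0 ≤ L)
    (h : (a' - a) ^ 2 + (a' - a) * (b' - b) + (b' - b) ^ 2 = L ^ 2) :
    segFlux X (eis q γ a b) (eis q γ a' b') ≤ L := by
  refine (le_abs_self _).trans ((abs_segFlux_le h1 _ _).trans (le_of_eq ?_))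
  rw [← dist_eq_norm]
  refine (pow_left_inj₀ dist_nonneg hL two_ne_zero).1 ?_
  rw [dist_sq_eis, h]

/-- The competitor enters only through an upper bound of its perimeter, so bounding the flux of each
piece of its boundary is enough. -/
theorem perimeter_reuleaux_le (q : Plane) (γ : ℝ) {ρ : ℝ} (hρ : 0 < ρ) :
    perimeter (reuleaux q γ (Real.sqrt 3 * ρ)) ≤
      ENNReal.ofReal (Real.pi * (Real.sqrt 3 * ρ)) := by
  refine perimeter_le (hasFlux_reuleaux q γ hρ) fun X _ h1 => ?_
  have h := fun α => (le_abs_self _).trans (abs_cornerFlux_le h1 q α hρ)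
  linarith [h γ, h (γ + 2 * Real.pi / 3), h (γ + 4 * Real.pi / 3)]

theorem perimeter_chippedHex_le (q : Plane) (γ : ℝ) {A m S B ρ : ℝ} (hL : LongSides A m S B ρ) :
    perimeter (chippedHex q γ A m S B ρ) ≤
      ENNReal.ofReal (Real.pi * (Real.sqrt 3 * ρ) + (A + S + B + m - 6 * ρ)) := by
  refine perimeter_le (hasFlux_chippedHex q γ hL) fun X _ h1 => ?_
  obtain ⟨hρ, k0, k1, k2, k3, k4, k5⟩ := hL
  have h := fun p α => neg_le_of_abs_le (abs_cornerFlux_le h1 p α hρ)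
  have s0 := segFlux_eis_le h1 q γ ρ 0 A 0 (L := A - ρ) (by linarith) (by ring)
  have s1 := segFlux_eis_le h1 q γ A 0 A (S - A - ρ) (L := S - A - ρ) (by linarith) (by ring)
  have s2 := segFlux_eis_le h1 q γ (A - ρ) (S - A + ρ) (S - B) B (L := A + B - S - ρ)
    (by linarith) (by ring)
  have s3 := segFlux_eis_le h1 q γ (S - B) B (-m + ρ) B (L := S - B + m - ρ) (by linarith)
    (by ring)
  have s4 := segFlux_eis_le h1 q γ (-m) (B - ρ) (-m) m (L := B - m - ρ) (by linarith) (by ring)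
  have s5 := segFlux_eis_le h1 q γ (-m) m (-ρ) ρ (L := m - ρ) (by linarith) (by ring)
  have c0 := h q γ
  have c1 := h (eis q γ A (S - A)) (γ + 2 * Real.pi / 3)
  have c2 := h (eis q γ (-m) B) (γ + 4 * Real.pi / 3)
  rw [chippedFlux]
  linarith

theorem longSides_regular {ℓ ρ : ℝ} (hρ : 0 < ρ) (hℓ : ρ < ℓ) :
    LongSides ℓ ℓ (2 * ℓ) (2 * ℓ) ρ := by
  refine ⟨hρ, ?_, ?_, ?_, ?_, ?_, ?_⟩ <;> linarith

theorem hexTiling_per_le (q : Plane) (γ : ℝ) {ℓ ρ : ℝ} (hρ : 0 < ρ) (hℓ : ρ < ℓ) :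
    (hexTiling q γ hρ hℓ).per ≤
      ENNReal.ofReal (Real.pi * (Real.sqrt 3 * ρ) - 3 * ρ + 3 * ℓ) := by
  have h0 := perimeter_reuleaux_le q γ hρ
  have h1 := perimeter_chippedHex_le q γ (longSides_regular hρ hℓ)
  rw [← perimeter_congr (hexTile_ae_eq q γ ℓ ρ)] at h1
  rw [PeriodicTiling.per, Fin.sum_univ_two]
  have hπ := Real.pi_pos
  have hpos : 0 < Real.pi * (Real.sqrt 3 * ρ) := by positivity
  calc (perimeter (reuleaux q γ (Real.sqrt 3 * ρ)) + perimeter (hexTile q γ ℓ ρ)) / 2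
      ≤ (ENNReal.ofReal (Real.pi * (Real.sqrt 3 * ρ)) + ENNReal.ofReal (Real.pi * (Real.sqrt 3 * ρ)
        + (ℓ + 2 * ℓ + 2 * ℓ + ℓ - 6 * ρ))) / 2 := by gcongr
    _ = ENNReal.ofReal (Real.pi * (Real.sqrt 3 * ρ) - 3 * ρ + 3 * ℓ) := by
      rw [← ENNReal.ofReal_add hpos.le (by linarith),
        ← ENNReal.ofReal_ofNat 2, ← ENNReal.ofReal_div_of_pos two_pos]
      congr 1; ring

theorem volume_hexTile (q : Plane) (γ : ℝ) {ℓ ρ : ℝ} (hρ : 0 < ρ) (hℓ : ρ < ℓ) :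
    volume.real (hexTile q γ ℓ ρ) = Real.sqrt 3 / 2 * (3 * ℓ ^ 2) -
      3 * ((Real.pi - Real.sqrt 3) / 2 * ρ ^ 2) := by
  rw [measureReal_congr (hexTile_ae_eq q γ ℓ ρ), area_chippedHex _ _ (longSides_regular hρ hℓ)]
  ring

namespace PeriodicTiling.IsChippedHoneycomb

variable {T : PeriodicTiling 2} {q : Plane} {γ A m S B ρ : ℝ}

/-- In an isoperimetric tiling, the hexagon is regular. -/
theorem regular (h : T.IsChippedHoneycomb q γ A m S B ρ) (hiso : T.Isoperimetric) :
    A = m ∧ S = 2 * m ∧ B = 2 * m := by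
  obtain ⟨hρ, k0, k1, k2, k3, k4, k5⟩ := h.long
  have hS := h.lattice_eq.1
  have hπ := Real.pi_pos
  -- By central symmetry the side lengths are `A`, `m`, `B - m`, and `N` is the sum of their
  -- pairwise products.
  set N := A * B + m * (B - m) with hN
  have hNe : (A + m) * B - m ^ 2 / 2 - (A + B - S) ^ 2 / 2 = N := by rw [hS, hN]; ring
  have hNρ : 3 * ρ ^ 2 < N := by
    have e1 : ρ * ρ < A * m := mul_lt_mul'' k0 k5 hρ.le hρ.le
    have e2 : ρ * ρ < A * (B - m) := mul_lt_mul'' k0 k4 hρ.le hρ.le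
    have e3 : ρ * ρ < m * (B - m) := mul_lt_mul'' k5 k4 hρ.le hρ.le
    rw [hN]; nlinarith
  have hNpos : 0 < N := by nlinarith
  -- The side of the regular hexagon of equal area. It exceeds `ρ` because each side of the given
  -- hexagon does, so the chips fit.
  set ℓ := Real.sqrt (N / 3) with hℓdef
  have hℓ2 : 3 * ℓ ^ 2 = N := by rw [hℓdef, Real.sq_sqrt (by positivity)]; ring
  have hℓ0 : 0 ≤ ℓ := Real.sqrt_nonneg _
  have hℓ : ρ < ℓ := by
    refine lt_of_pow_lt_pow_left₀ 2 hℓ0 ?_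
    linarith
  have hvol : ∀ k, volume ((hexTiling q γ hρ hℓ).tile k) = volume (T.tile k) := by
    have hr : ∀ k, volume.real ((hexTiling q γ hρ hℓ).tile k) = volume.real (T.tile k) := by
      intro k
      fin_cases k
      · exact (area_reuleaux q γ hρ).trans h.volume_tile_zero.symm
      · refine (volume_hexTile q γ hρ hℓ).trans (Eq.trans ?_ h.volume_tile_one.symm)
        rw [hℓ2, hNe]
    intro k
    refine (ENNReal.toReal_eq_toReal_iff' ?_ (h.volume_ne_top k)).1 (hr k)
    fin_cases k
    · exact (isBounded_reuleaux q γ (Real.sqrt 3 * ρ)).measure_lt_top.ne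
    · refine ((isBounded_hexSet q γ ℓ ℓ (2 * ℓ) (2 * ℓ)).subset ?_).measure_lt_top.ne
      exact fun x hx => interior_subset hx.1
  have hper := (hiso _ hvol).trans (hexTiling_per_le q γ hρ hℓ)
  have h3 : 1 < Real.sqrt 3 := by
    rw [Real.lt_sqrt (by norm_num)]; norm_num
  have hπρ : 3 * ρ < Real.pi * (Real.sqrt 3 * ρ) := by
    have e1 : 3 * 1 < Real.pi * Real.sqrt 3 :=
      mul_lt_mul'' Real.pi_gt_three h3 (by norm_num) (by norm_num)
    nlinarith
  rw [h.per_eq, ENNReal.ofReal_le_ofReal_iff (by linarith)] at hper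
  have hle : A + B ≤ 3 * ℓ := by linarith
  have hsq : (A + B) ^ 2 ≤ 3 * N := by
    have := pow_le_pow_left₀ (by linarith) hle 2
    linarith
  -- The equality case of `3 (ab + bc + ca) ≤ (a + b + c)²`.
  have e : (A - m) ^ 2 + (A - (B - m)) ^ 2 + (m - (B - m)) ^ 2 = 2 * ((A + B) ^ 2 - 3 * N) := by
    rw [hN]; ring
  have z1 : (A - m) ^ 2 = 0 := by
    nlinarith [sq_nonneg (A - m), sq_nonneg (A - (B - m)), sq_nonneg (m - (B - m))]
  have z2 : (m - (B - m)) ^ 2 = 0 := by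
    nlinarith [sq_nonneg (A - m), sq_nonneg (A - (B - m)), sq_nonneg (m - (B - m))]
  have y1 := pow_eq_zero_iff two_ne_zero |>.1 z1
  have y2 := pow_eq_zero_iff two_ne_zero |>.1 z2
  refine ⟨?_, ?_, ?_⟩ <;> linarith

end PeriodicTiling.IsChippedHoneycomb

/-- `T` is the honeycomb tiling with Reuleaux triangles. -/
structure PeriodicTiling.IsRegularHoneycomb (T : PeriodicTiling 2) (q : Plane) (γ ℓ ρ : ℝ) :
    Prop where
  pos : 0 < ρ
  lt : ρ < ℓ
  lattice_eq : T.lattice = hexLattice γ ℓ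
  tile_zero : ∃ g ∈ T.lattice, T.tile 0 =ᵐ[volume] reuleaux (q + g) γ (Real.sqrt 3 * ρ)
  tile_one : T.tile 1 =ᵐ[volume] chippedHex q γ ℓ ℓ (2 * ℓ) (2 * ℓ) ρ
  per_eq : T.per = ENNReal.ofReal (Real.pi * (Real.sqrt 3 * ρ) - 3 * ρ + 3 * ℓ)
  volume_zero : volume.real (T.tile 0) = 3 * ((Real.pi - Real.sqrt 3) / 2 * ρ ^ 2)
  volume_one : volume.real (T.tile 1) = Real.sqrt 3 / 2 * (3 * ℓ ^ 2) -
      3 * ((Real.pi - Real.sqrt 3) / 2 * ρ ^ 2)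

theorem PeriodicTiling.IsType39.exists_isRegularHoneycomb {T : PeriodicTiling 2}
    (h : T.IsType39) (hiso : T.Isoperimetric) : ∃ q γ ℓ ρ, T.IsRegularHoneycomb q γ ℓ ρ := by
  obtain ⟨q, γ, A, m, S, B, ρ, hc⟩ := h.exists_isChippedHoneycomb
  obtain ⟨rfl, rfl, rfl⟩ := hc.regular hiso
  refine ⟨q, γ, A, ρ, hc.long.pos, hc.long.side₀, ?_, hc.tile_zero, hc.tile_one, ?_,
    hc.volume_tile_zero, ?_⟩
  · rw [hc.lattice_eq.2, hexLattice]
    congr 2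
    · simp only [eis]; module
    · congr 1; simp only [eis]; module
  · rw [hc.per_eq]; congr 1; ring
  · rw [hc.volume_tile_one]; ring

/-! ### The regular hexagon -/

/-- With center `(0, ℓ)` in the frame and initial direction `γ - 2π/3`, the vertex with index 0 is
`q` and the chips are at the even indices. -/
theorem hexVertex_eq (q : Plane) (γ ℓ : ℝ) :
    hexVertex (eis q γ 0 ℓ) (γ - 2 * Real.pi / 3) ℓ 0 = eis q γ 0 0 ∧
    hexVertex (eis q γ 0 ℓ) (γ - 2 * Real.pi / 3) ℓ 1 = eis q γ ℓ 0 ∧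
    hexVertex (eis q γ 0 ℓ) (γ - 2 * Real.pi / 3) ℓ 2 = eis q γ ℓ ℓ ∧
    hexVertex (eis q γ 0 ℓ) (γ - 2 * Real.pi / 3) ℓ 3 = eis q γ 0 (2 * ℓ) ∧
    hexVertex (eis q γ 0 ℓ) (γ - 2 * Real.pi / 3) ℓ 4 = eis q γ (-ℓ) (2 * ℓ) ∧
    hexVertex (eis q γ 0 ℓ) (γ - 2 * Real.pi / 3) ℓ 5 = eis q γ (-ℓ) ℓ := by
  obtain ⟨-, -, d2, d3, d4, d5⟩ := dir_directions γ
  simp only [hexVertex]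
  refine ⟨?_, ?_, ?_, ?_, ?_, ?_⟩
  · rw [← dir_add_two_pi, show γ - 2 * Real.pi / 3 + (0 : ℕ) * (Real.pi / 3) + 2 * Real.pi =
      γ + 4 * Real.pi / 3 by push_cast; ring, d4]
    simp only [eis]; module
  · rw [← dir_add_two_pi, show γ - 2 * Real.pi / 3 + (1 : ℕ) * (Real.pi / 3) + 2 * Real.pi =
      γ + 5 * Real.pi / 3 by push_cast; ring, d5]
    simp only [eis]; module
  · rw [show γ - 2 * Real.pi / 3 + (2 : ℕ) * (Real.pi / 3) = γ by push_cast; ring]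
    simp only [eis]; module
  · rw [show γ - 2 * Real.pi / 3 + (3 : ℕ) * (Real.pi / 3) = γ + Real.pi / 3 by push_cast; ring]
    simp only [eis]; module
  · rw [show γ - 2 * Real.pi / 3 + (4 : ℕ) * (Real.pi / 3) = γ + 2 * Real.pi / 3 by
      push_cast; ring, d2]
    simp only [eis]; module
  · rw [show γ - 2 * Real.pi / 3 + (5 : ℕ) * (Real.pi / 3) = γ + Real.pi by
      push_cast; ring, d3]
    simp only [eis]; module

theorem regularHexagon_eq (q : Plane) (γ : ℝ) {ℓ : ℝ} (hℓ : 0 < ℓ) :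
    regularHexagon (eis q γ 0 ℓ) (γ - 2 * Real.pi / 3) ℓ =
      hexSet q γ ℓ ℓ (2 * ℓ) (2 * ℓ) := by
  obtain ⟨e0, e1, e2, e3, e4, e5⟩ := hexVertex_eq q γ ℓ
  set c := eis q γ 0 ℓ with hc
  set θ := γ - 2 * Real.pi / 3
  set H := regularHexagon c θ ℓ with hH
  have hconv : Convex ℝ H := convex_convexHull ℝ _
  refine Subset.antisymm (convexHull_min ?_ (convex_hexSet _ _ _ _ _ _)) fun x hx => ?_
  · rintro _ ⟨k, rfl⟩
    fin_cases k
    · change hexVertex c θ ℓ 0 ∈ _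
      rw [e0, mem_hexSet]; refine ⟨⟨?_, ?_⟩, ⟨?_, ?_⟩, ?_, ?_⟩ <;> linarith
    · change hexVertex c θ ℓ 1 ∈ _
      rw [e1, mem_hexSet]; refine ⟨⟨?_, ?_⟩, ⟨?_, ?_⟩, ?_, ?_⟩ <;> linarith
    · change hexVertex c θ ℓ 2 ∈ _
      rw [e2, mem_hexSet]; refine ⟨⟨?_, ?_⟩, ⟨?_, ?_⟩, ?_, ?_⟩ <;> linarith
    · change hexVertex c θ ℓ 3 ∈ _
      rw [e3, mem_hexSet]; refine ⟨⟨?_, ?_⟩, ⟨?_, ?_⟩, ?_, ?_⟩ <;> linarith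
    · change hexVertex c θ ℓ 4 ∈ _
      rw [e4, mem_hexSet]; refine ⟨⟨?_, ?_⟩, ⟨?_, ?_⟩, ?_, ?_⟩ <;> linarith
    · change hexVertex c θ ℓ 5 ∈ _
      rw [e5, mem_hexSet]; refine ⟨⟨?_, ?_⟩, ⟨?_, ?_⟩, ?_, ?_⟩ <;> linarith
  · have hv : ∀ k : Fin 6, hexVertex c θ ℓ k ∈ H := fun k => subset_convexHull ℝ _ ⟨k, rfl⟩
    have v0 : eis q γ 0 0 ∈ H := e0 ▸ hv 0
    have v1 : eis q γ ℓ 0 ∈ H := e1 ▸ hv 1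
    have v2 : eis q γ ℓ ℓ ∈ H := e2 ▸ hv 2
    have v3 : eis q γ 0 (2 * ℓ) ∈ H := e3 ▸ hv 3
    have v4 : eis q γ (-ℓ) (2 * ℓ) ∈ H := e4 ▸ hv 4
    have v5 : eis q γ (-ℓ) ℓ ∈ H := e5 ▸ hv 5
    have comb : ∀ {a₁ b₁ a₂ b₂ : ℝ}, eis q γ a₁ b₁ ∈ H → eis q γ a₂ b₂ ∈ H → ∀ s : ℝ, 0 ≤ s →
        s ≤ 1 → eis q γ ((1 - s) * a₁ + s * a₂) ((1 - s) * b₁ + s * b₂) ∈ H := by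
      intro a₁ b₁ a₂ b₂ h₁ h₂ s hs hs'
      have := hconv h₁ h₂ (sub_nonneg.2 hs') hs (by ring)
      convert this using 1
      simp only [eis]; module
    have hcen : eis q γ 0 ℓ ∈ H := by
      have := comb v0 v3 (1 / 2) (by norm_num) (by norm_num)
      rwa [show (1 - 1 / 2 : ℝ) * 0 + 1 / 2 * 0 = 0 by ring,
        show (1 - 1 / 2 : ℝ) * 0 + 1 / 2 * (2 * ℓ) = ℓ by ring] at this
    -- The hexagon is the union of six triangles with apex at the center. The signs of `a`, `b - ℓ`
    -- and `a + b - ℓ` tell which of them contains the point.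
    have sector : ∀ {a₁ b₁ a₂ b₂ : ℝ}, eis q γ a₁ b₁ ∈ H → eis q γ a₂ b₂ ∈ H → ∀ s t : ℝ,
        0 ≤ s → 0 ≤ t → s + t ≤ 1 →
        eis q γ (s * a₁ + t * a₂) (ℓ + s * (b₁ - ℓ) + t * (b₂ - ℓ)) ∈ H := by
      intro a₁ b₁ a₂ b₂ h₁ h₂ s t hs ht hst
      rcases (add_nonneg hs ht).eq_or_lt with h0 | h0
      · obtain rfl : s = 0 := by linarith
        obtain rfl : t = 0 := by linarith
        simpa using hcen
      · have h12 := comb h₁ h₂ (t / (s + t)) (by positivity)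
          ((div_le_one h0).2 (by linarith))
        have := comb hcen h12 (s + t) h0.le hst
        convert this using 2 <;> field_simp <;> ring
    obtain ⟨a, b, rfl⟩ := exists_eis q γ x
    obtain ⟨⟨h1, h2⟩, ⟨h3, h4⟩, h5, h6⟩ := mem_hexSet.1 hx
    have hd : ∀ y : ℝ, y / ℓ * ℓ = y := fun y => by field_simp
    have fin : ∀ {a₁ b₁ a₂ b₂ : ℝ}, eis q γ a₁ b₁ ∈ H → eis q γ a₂ b₂ ∈ H → ∀ s t : ℝ,
        0 ≤ s → 0 ≤ t → s + t ≤ ℓ → a * ℓ = s * a₁ + t * a₂ →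
        (b - ℓ) * ℓ = s * (b₁ - ℓ) + t * (b₂ - ℓ) → eis q γ a b ∈ H := by
      intro a₁ b₁ a₂ b₂ h₁ h₂ s t hs ht hst hA hB
      have := sector h₁ h₂ (s / ℓ) (t / ℓ) (by positivity) (by positivity)
        (by rw [← add_div, div_le_one hℓ]; exact hst)
      convert this using 2
      · field_simp; linarith
      · field_simp; linarith
    rcases le_total 0 a with ha | ha <;> rcases le_total ℓ b with hb | hb
    · exact fin v2 v3 a (b - ℓ) ha (by linarith) (by linarith) (by ring) (by ring)
    · rcases le_total ℓ (a + b) with hs | hs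
      · exact fin v1 v2 (ℓ - b) (a + b - ℓ) (by linarith) (by linarith) (by linarith)
          (by ring) (by ring)
      · exact fin v0 v1 (ℓ - a - b) a (by linarith) (by linarith) (by linarith) (by ring) (by ring)
    · rcases le_total ℓ (a + b) with hs | hs
      · exact fin v3 v4 (a + b - ℓ) (-a) (by linarith) (by linarith) (by linarith) (by ring)
          (by ring)
      · exact fin v4 v5 (b - ℓ) (ℓ - a - b) (by linarith) (by linarith) (by linarith) (by ring)
          (by ring)
    · exact fin v5 v0 (-a) (ℓ - b) (by linarith) (by linarith) (by linarith) (by ring) (by ring)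

/-- The two generators on the left are `-v` and `u - v`, where `u, v` are those on the right: a
unimodular change of basis. -/
theorem honeycombLattice_eq (γ ℓ : ℝ) :
    honeycombLattice (γ - 2 * Real.pi / 3) ℓ = hexLattice γ ℓ := by
  have h3 : Real.sqrt 3 ≠ 0 := by positivity
  obtain ⟨-, -, -, -, d4, d5⟩ := dir_directions γ
  have w0 : dir (γ - 2 * Real.pi / 3) = (-1 : ℝ) • dir (γ + Real.pi / 3) := by
    rw [← dir_add_two_pi, show γ - 2 * Real.pi / 3 + 2 * Real.pi = γ + 4 * Real.pi / 3 by ring, d4]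
    module
  have w1 : dir (γ - 2 * Real.pi / 3 + Real.pi / 3) = dir γ - dir (γ + Real.pi / 3) := by
    rw [← dir_add_two_pi, show γ - 2 * Real.pi / 3 + Real.pi / 3 + 2 * Real.pi =
      γ + 5 * Real.pi / 3 by ring, d5]
    module
  set u := ℓ • dir γ + ℓ • dir (γ + Real.pi / 3) with hu
  set v := (-ℓ) • dir γ + (2 * ℓ) • dir (γ + Real.pi / 3) with hv
  have e0 : (Real.sqrt 3 * ℓ) • dir (γ - 2 * Real.pi / 3 + Real.pi / 6) = -v := by
    rw [dir_add_pi_div_six, w0, w1, smul_smul,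
      show Real.sqrt 3 * ℓ * (1 / Real.sqrt 3) = ℓ by field_simp, hv]
    module
  have e1 : (Real.sqrt 3 * ℓ) • dir (γ - 2 * Real.pi / 3 + Real.pi / 2) = u - v := by
    rw [show γ - 2 * Real.pi / 3 + Real.pi / 2 = γ - 2 * Real.pi / 3 + Real.pi / 3 + Real.pi / 6 by
      ring, dir_add_pi_div_six, w1,
      show γ - 2 * Real.pi / 3 + Real.pi / 3 + Real.pi / 3 = γ by ring, smul_smul,
      show Real.sqrt 3 * ℓ * (1 / Real.sqrt 3) = ℓ by field_simp, hu, hv]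
    module
  rw [honeycombLattice, hexLattice, e0, e1, ← hu, ← hv]
  refine le_antisymm (Submodule.span_le.2 ?_) (Submodule.span_le.2 ?_)
  · have hu' : u ∈ Submodule.span ℤ {u, v} := Submodule.subset_span (Or.inl rfl)
    have hv' : v ∈ Submodule.span ℤ {u, v} := Submodule.subset_span (Or.inr rfl)
    rintro x (rfl | rfl)
    exacts [Submodule.neg_mem _ hv', Submodule.sub_mem _ hu' hv']
  · have h1 : -v ∈ Submodule.span ℤ {-v, u - v} := Submodule.subset_span (Or.inl rfl)
    have h2 : u - v ∈ Submodule.span ℤ {-v, u - v} := Submodule.subset_span (Or.inr rfl)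
    rintro x (rfl | rfl)
    · have := Submodule.sub_mem _ h2 h1
      rwa [show u - v - -v = u by abel] at this
    · simpa using Submodule.neg_mem _ h1

theorem reuleaux_sub_rotate (q : Plane) (γ : ℝ) {ρ : ℝ} (hρ : 0 < ρ) :
    reuleaux q (γ - 2 * Real.pi / 3) (Real.sqrt 3 * ρ) = reuleaux q γ (Real.sqrt 3 * ρ) := by
  have := reuleaux_add_int_mul q γ hρ (-1)
  rwa [show γ + ((-1 : ℤ) : ℝ) * (2 * Real.pi / 3) = γ - 2 * Real.pi / 3 by push_cast; ring] at this

theorem chips_eq_iUnion (q : Plane) (γ : ℝ) {ℓ ρ : ℝ} (hρ : 0 < ρ) :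
    chips q γ ℓ ℓ (2 * ℓ) (2 * ℓ) ρ = ⋃ k : Fin 3,
      reuleaux (hexVertex (eis q γ 0 ℓ) (γ - 2 * Real.pi / 3) ℓ (2 * k))
        (γ - 2 * Real.pi / 3) (Real.sqrt 3 * ρ) := by
  obtain ⟨e0, -, e2, -, e4, -⟩ := hexVertex_eq q γ ℓ
  have hU : ∀ f : Fin 3 → Set Plane, ⋃ k, f k = f 0 ∪ f 1 ∪ f 2 := fun f => by
    ext x
    simp only [mem_iUnion, mem_union]
    constructor
    · rintro ⟨k, hk⟩
      fin_cases k
      exacts [Or.inl (Or.inl hk), Or.inl (Or.inr hk), Or.inr hk]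
    · rintro ((h | h) | h)
      exacts [⟨0, h⟩, ⟨1, h⟩, ⟨2, h⟩]
  rw [hU]
  change _ = reuleaux (hexVertex _ _ ℓ 0) _ _ ∪ reuleaux (hexVertex _ _ ℓ 2) _ _ ∪
    reuleaux (hexVertex _ _ ℓ 4) _ _
  rw [e0, e2, e4, reuleaux_sub_rotate _ _ hρ, reuleaux_sub_rotate _ _ hρ,
    reuleaux_sub_rotate _ _ hρ, chips, eis_zero, show 2 * ℓ - ℓ = ℓ by ring]

/-! ### Change of frame -/

/-- The isometry that carries the frame with origin `q` and direction `γ` to the frame with origin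
`q'` and direction `γ'`. -/
noncomputable def frameChange (q : Plane) (γ : ℝ) (q' : Plane) (γ' : ℝ) : Plane ≃ᵢ Plane where
  toFun x := eis q' γ' (coordA q γ x) (coordB q γ x)
  invFun x := eis q γ (coordA q' γ' x) (coordB q' γ' x)
  left_inv x := by
    obtain ⟨a, b, rfl⟩ := exists_eis q γ x
    simp
  right_inv x := by
    obtain ⟨a, b, rfl⟩ := exists_eis q' γ' x
    simp
  isometry_toFun := by
    refine Isometry.of_dist_eq fun x y => ?_
    obtain ⟨a, b, rfl⟩ := exists_eis q γ x
    obtain ⟨a', b', rfl⟩ := exists_eis q γ y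
    refine (pow_left_inj₀ dist_nonneg dist_nonneg two_ne_zero).1 ?_
    simp only [coordA_eis, coordB_eis, dist_sq_eis]

section FrameChange

variable {q q' : Plane} {γ γ' : ℝ}

@[simp] theorem frameChange_eis (a b : ℝ) :
    frameChange q γ q' γ' (eis q γ a b) = eis q' γ' a b := by
  change eis q' γ' (coordA q γ (eis q γ a b)) (coordB q γ (eis q γ a b)) = _
  simp

theorem image_frameChange {E E' : Set Plane}
    (h : ∀ a b, eis q γ a b ∈ E ↔ eis q' γ' a b ∈ E') : frameChange q γ q' γ' '' E = E' := by
  ext x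
  obtain ⟨a, b, rfl⟩ := exists_eis q' γ' x
  rw [← h, ← frameChange_eis (q := q) (γ := γ), (frameChange q γ q' γ').injective.mem_set_image]

theorem image_frameChange_null {E : Set Plane} (h : volume E = 0) :
    volume (frameChange q γ q' γ' '' E) = 0 := by
  refine addHaar_image_eq_zero_of_differentiableOn_of_addHaar_eq_zero volume (fun x _ => ?_) h
  refine DifferentiableAt.differentiableWithinAt ?_
  change DifferentiableAt ℝ (fun x => eis q' γ' (coordA q γ x) (coordB q γ x)) x
  unfold eis coordA coordB cross
  fun_prop

theorem image_frameChange_ae_eq {E F : Set Plane} (h : E =ᵐ[volume] F) :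
    (frameChange q γ q' γ' '' E : Set Plane) =ᵐ[volume] (frameChange q γ q' γ' '' F : Set Plane) := by
  rw [ae_eq_set] at h ⊢
  rw [← image_sdiff (frameChange q γ q' γ').injective, ← image_sdiff (frameChange q γ q' γ').injective]
  exact ⟨image_frameChange_null h.1, image_frameChange_null h.2⟩

theorem image_frameChange_shiftSet {E E' : Set Plane}
    (h : ∀ a b, eis q γ a b ∈ E ↔ eis q' γ' a b ∈ E') (x y : ℝ) :
    frameChange q γ q' γ' '' shiftSet (x • dir γ + y • dir (γ + Real.pi / 3)) E =
      shiftSet (x • dir γ' + y • dir (γ' + Real.pi / 3)) E' :=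
  image_frameChange fun a b => by
    rw [mem_shiftSet, mem_shiftSet, eis_sub_combo, eis_sub_combo, h]

end FrameChange

theorem shiftSet_shiftSet (g h : Plane) (E : Set Plane) :
    shiftSet g (shiftSet h E) = shiftSet (g + h) E := by
  ext x
  rw [mem_shiftSet, mem_shiftSet, mem_shiftSet, sub_sub]

/-- Two tilings with the same tiles, up to translations in the lattice, in different frames are
congruent. -/
theorem PeriodicTiling.congruent_of_frames {T T' : PeriodicTiling 2} {q q' : Plane} {γ γ' ℓ : ℝ}
    (hG : T.lattice = hexLattice γ ℓ) (hG' : T'.lattice = hexLattice γ' ℓ)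
    {D D' : Fin 2 → Set Plane} (hD : ∀ k a b, eis q γ a b ∈ D k ↔ eis q' γ' a b ∈ D' k)
    (hT : ∀ k, ∃ g ∈ T.lattice, T.tile k =ᵐ[volume] shiftSet g (D k))
    (hT' : ∀ k, ∃ g ∈ T'.lattice, T'.tile k =ᵐ[volume] shiftSet g (D' k)) : T.Congruent T' := by
  refine ⟨frameChange q γ q' γ', fun k => ?_⟩
  obtain ⟨g₀, hg₀, h₀⟩ := hT k
  obtain ⟨g₀', hg₀', h₀'⟩ := hT' k
  -- Generators are defined up to lattice translations `g₀`, `g₀'`; translates correspond when their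
  -- total translations have equal coordinates in the two frames.
  have key : ∀ g g' : Plane, ∀ x y : ℝ, g + g₀ = x • dir γ + y • dir (γ + Real.pi / 3) →
      g' + g₀' = x • dir γ' + y • dir (γ' + Real.pi / 3) →
      frameChange q γ q' γ' '' shiftSet g (T.tile k) =ᵐ[volume] shiftSet g' (T'.tile k) := by
    intro g g' x y hg hg'
    refine (image_frameChange_ae_eq (shiftSet_ae_eq h₀ g)).trans ?_
    refine Filter.EventuallyEq.trans ?_ (shiftSet_ae_eq h₀' g').symm
    rw [shiftSet_shiftSet, shiftSet_shiftSet, hg, hg', image_frameChange_shiftSet (hD k)]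
    exact Filter.EventuallyEq.rfl
  constructor
  · intro g hg
    have hs := T.lattice.add_mem hg hg₀
    rw [hG] at hs
    obtain ⟨x, y, hj, hxy⟩ := mem_hexLattice.1 hs
    refine ⟨(ℓ * x) • dir γ' + (ℓ * y) • dir (γ' + Real.pi / 3) - g₀', ?_,
      key _ _ _ _ hxy (sub_add_cancel _ _)⟩
    refine T'.lattice.sub_mem ?_ hg₀'
    rw [hG']
    exact mem_hexLattice.2 ⟨x, y, hj, rfl⟩
  · intro g' hg'
    have hs := T'.lattice.add_mem hg' hg₀'
    rw [hG'] at hs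
    obtain ⟨x, y, hj, hxy⟩ := mem_hexLattice.1 hs
    refine ⟨(ℓ * x) • dir γ + (ℓ * y) • dir (γ + Real.pi / 3) - g₀, ?_,
      key _ _ _ _ (sub_add_cancel _ _) hxy⟩
    refine T.lattice.sub_mem ?_ hg₀
    rw [hG]
    exact mem_hexLattice.2 ⟨x, y, hj, rfl⟩

/-! ### Areas, perimeter and uniqueness for the regular honeycomb. -/

namespace PeriodicTiling.IsRegularHoneycomb

variable {T T' : PeriodicTiling 2} {q q' : Plane} {γ γ' ℓ ℓ' ρ ρ' : ℝ}

/-- The area of the triangle determines `ρ`, the total area then determines `ℓ`, and tilings with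
equal parameters differ only by the frame. -/
theorem congruent (h : T.IsRegularHoneycomb q γ ℓ ρ) (h' : T'.IsRegularHoneycomb q' γ' ℓ' ρ')
    (hv : ∀ k, volume (T'.tile k) = volume (T.tile k)) : T.Congruent T' := by
  have h3 : 0 < Real.sqrt 3 := by positivity
  have hπ3 : 0 < Real.pi - Real.sqrt 3 := by
    have : Real.sqrt 3 < 3 := by rw [Real.sqrt_lt' (by norm_num)]; norm_num
    linarith [Real.pi_gt_three]
  have hr : ∀ k, volume.real (T'.tile k) = volume.real (T.tile k) := fun k => by
    rw [measureReal_def, hv, measureReal_def]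
  have hr0 := hr 0
  have hr1 := hr 1
  rw [h.volume_zero, h'.volume_zero] at hr0
  rw [h.volume_one, h'.volume_one] at hr1
  obtain rfl : ρ' = ρ := by
    refine (pow_left_inj₀ h'.pos.le h.pos.le two_ne_zero).1 ?_
    have : (Real.pi - Real.sqrt 3) * (ρ' ^ 2 - ρ ^ 2) = 0 := by linarith
    linarith [(mul_eq_zero.1 this).resolve_left hπ3.ne']
  obtain rfl : ℓ' = ℓ := by
    refine (pow_left_inj₀ (h'.pos.trans h'.lt).le (h.pos.trans h.lt).le two_ne_zero).1 ?_
    have : Real.sqrt 3 * (ℓ' ^ 2 - ℓ ^ 2) = 0 := by linarith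
    linarith [(mul_eq_zero.1 this).resolve_left h3.ne']
  have hρ := h.pos
  refine congruent_of_frames (q := q) (q' := q') h.lattice_eq h'.lattice_eq
    (D := ![reuleaux q γ (Real.sqrt 3 * ρ'), chippedHex q γ ℓ' ℓ' (2 * ℓ') (2 * ℓ') ρ'])
    (D' := ![reuleaux q' γ' (Real.sqrt 3 * ρ'), chippedHex q' γ' ℓ' ℓ' (2 * ℓ') (2 * ℓ') ρ'])
    (fun k a b => ?_) (fun k => ?_) (fun k => ?_)
  · fin_cases k
    · change eis q γ a b ∈ reuleaux q γ _ ↔ eis q' γ' a b ∈ reuleaux q' γ' _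
      rw [mem_reuleaux hρ, mem_reuleaux hρ]
    · change eis q γ a b ∈ chippedHex q γ _ _ _ _ _ ↔ eis q' γ' a b ∈ chippedHex q' γ' _ _ _ _ _
      simp only [chippedHex, openChips, mem_sdiff, mem_union, mem_hexSet]
      rw [mem_interior_reuleaux hρ, mem_interior_reuleaux hρ,
        eis_eq_shift q γ a b ℓ' (2 * ℓ' - ℓ'), eis_eq_shift q' γ' a b ℓ' (2 * ℓ' - ℓ'),
        mem_interior_reuleaux hρ, mem_interior_reuleaux hρ, ← eis_eq_shift, ← eis_eq_shift,
        eis_eq_shift q γ a b (-ℓ') (2 * ℓ'), eis_eq_shift q' γ' a b (-ℓ') (2 * ℓ'),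
        mem_interior_reuleaux hρ, mem_interior_reuleaux hρ]
  · fin_cases k
    · obtain ⟨g, hg, e⟩ := h.tile_zero
      rw [reuleaux_add] at e
      exact ⟨g, hg, e⟩
    · refine ⟨0, T.lattice.zero_mem, ?_⟩
      have : ∀ E : Set Plane, shiftSet 0 E = E := fun E => by simp [shiftSet]
      rw [this]
      exact h.tile_one
  · fin_cases k
    · obtain ⟨g, hg, e⟩ := h'.tile_zero
      rw [reuleaux_add] at e
      exact ⟨g, hg, e⟩
    · refine ⟨0, T'.lattice.zero_mem, ?_⟩
      have : ∀ E : Set Plane, shiftSet 0 E = E := fun E => by simp [shiftSet]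
      rw [this]
      exact h'.tile_one

theorem sqrt_three_lt_pi : Real.sqrt 3 < Real.pi := by
  have : Real.sqrt 3 < 3 := by rw [Real.sqrt_lt' (by norm_num)]; norm_num
  exact this.trans Real.pi_gt_three

/-- The first term equals `√3 (π - √3) ρ`. The total area is `(3√3/2) ℓ²` and `12^(1/4) = √(2√3)`,
so the second term is `3 ℓ`. -/
theorem per_formula (h : T.IsRegularHoneycomb q γ ℓ ρ) : T.per = ENNReal.ofReal
    (Real.sqrt 2 * Real.sqrt (Real.pi - Real.sqrt 3) * Real.sqrt (volume.real (T.tile 0))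
      + (12 : ℝ) ^ (1 / 4 : ℝ) *
        Real.sqrt (volume.real (T.tile 0) + volume.real (T.tile 1))) := by
  have hρ := h.pos
  have hℓ := h.pos.trans h.lt
  have hs := sq_sqrt_three
  have h3 : 0 < Real.sqrt 3 := by positivity
  have hπ3 : 0 < Real.pi - Real.sqrt 3 := sub_pos.2 sqrt_three_lt_pi
  rw [h.per_eq, h.volume_one, h.volume_zero]
  congr 1
  have e1 : Real.sqrt 2 * Real.sqrt (Real.pi - Real.sqrt 3) *
      Real.sqrt (3 * ((Real.pi - Real.sqrt 3) / 2 * ρ ^ 2)) =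
      Real.sqrt 3 * (Real.pi - Real.sqrt 3) * ρ := by
    rw [← Real.sqrt_mul (by norm_num), ← Real.sqrt_mul (by positivity), Real.sqrt_eq_iff_mul_self_eq
      (by positivity) (by positivity)]
    linear_combination (-(Real.pi - Real.sqrt 3) ^ 2 * ρ ^ 2) * hs
  have e2 : (12 : ℝ) ^ (1 / 4 : ℝ) = Real.sqrt (2 * Real.sqrt 3) := by
    rw [Real.sqrt_eq_rpow, show 2 * Real.sqrt 3 = (12 : ℝ) ^ (1 / 2 : ℝ) by
      rw [← Real.sqrt_eq_rpow, show (12 : ℝ) = 2 ^ 2 * 3 by norm_num, Real.sqrt_mul (by norm_num),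
        Real.sqrt_sq (by norm_num)], ← Real.rpow_mul (by norm_num)]
    norm_num
  have e3 : (12 : ℝ) ^ (1 / 4 : ℝ) * Real.sqrt (3 * ((Real.pi - Real.sqrt 3) / 2 * ρ ^ 2) +
      (Real.sqrt 3 / 2 * (3 * ℓ ^ 2) - 3 * ((Real.pi - Real.sqrt 3) / 2 * ρ ^ 2))) = 3 * ℓ := by
    rw [e2, ← Real.sqrt_mul (by positivity), Real.sqrt_eq_iff_mul_self_eq
      (by ring_nf; positivity) (by positivity)]
    linear_combination (3 * ℓ ^ 2) * hs
  rw [e1, e3]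
  linear_combination ρ * hs

/-- The ratio is `(π/√3 - 1) ρ²/ℓ²`, and `ρ < ℓ`. -/
theorem area_ratio (h : T.IsRegularHoneycomb q γ ℓ ρ) :
    0 < volume.real (T.tile 0) / (volume.real (T.tile 0) + volume.real (T.tile 1)) ∧
    volume.real (T.tile 0) / (volume.real (T.tile 0) + volume.real (T.tile 1))
      < Real.pi / Real.sqrt 3 - 1 := by
  have hρ := h.pos
  have hℓ := h.pos.trans h.lt
  have h3 : 0 < Real.sqrt 3 := by positivity
  have hπ3 : 0 < Real.pi - Real.sqrt 3 := sub_pos.2 sqrt_three_lt_pi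
  rw [h.volume_one, h.volume_zero, add_sub_cancel]
  refine ⟨by positivity, ?_⟩
  rw [div_lt_iff₀ (by positivity)]
  have : (Real.pi / Real.sqrt 3 - 1) * (Real.sqrt 3 / 2 * (3 * ℓ ^ 2)) =
      3 * ((Real.pi - Real.sqrt 3) / 2 * ℓ ^ 2) := by
    field_simp
  rw [this]
  have := h.lt
  gcongr

end PeriodicTiling.IsRegularHoneycomb

theorem theorem3p3 (T : PeriodicTiling 2) (hnd : T.NonDegenerate) (hiso : T.Isoperimetric)
    (h39 : T.IsType39) :
    -- the honeycomb structure
    (∃ (c : Plane) (θ ℓ r : ℝ), 0 < r ∧ 0 < ℓ ∧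
      T.lattice = honeycombLattice θ ℓ ∧
      (∃ g ∈ T.lattice, T.tile 0 =ᵐ[volume] reuleaux (hexVertex c θ ℓ 0 + g) θ r) ∧
      T.tile 1 =ᵐ[volume]
        (regularHexagon c θ ℓ \ ⋃ k : Fin 3, reuleaux (hexVertex c θ ℓ (2 * k)) θ r : Set Plane)) ∧
    -- the admissible areas
    0 < volume.real (T.tile 0) / (volume.real (T.tile 0) + volume.real (T.tile 1)) ∧
    volume.real (T.tile 0) / (volume.real (T.tile 0) + volume.real (T.tile 1))
      < Real.pi / Real.sqrt 3 - 1 ∧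
    -- the perimeter
    T.per = ENNReal.ofReal
      (Real.sqrt 2 * Real.sqrt (Real.pi - Real.sqrt 3) * Real.sqrt (volume.real (T.tile 0))
        + (12 : ℝ) ^ (1 / 4 : ℝ) *
          Real.sqrt (volume.real (T.tile 0) + volume.real (T.tile 1))) ∧
    -- uniqueness up to isometry
    (∀ T' : PeriodicTiling 2, T'.NonDegenerate → T'.Isoperimetric → T'.IsType39 →
      (∀ k, volume (T'.tile k) = volume (T.tile k)) → T.Congruent T') := by
  obtain ⟨q, γ, ℓ, ρ, h⟩ := h39.exists_isRegularHoneycomb hiso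
  have hρ := h.pos
  have hℓ := h.pos.trans h.lt
  refine ⟨⟨eis q γ 0 ℓ, γ - 2 * Real.pi / 3, ℓ, Real.sqrt 3 * ρ, by positivity, hℓ, ?_, ?_, ?_⟩,
    h.area_ratio.1, h.area_ratio.2, h.per_formula, fun T' _ hiso' h39' hv => ?_⟩
  · rw [honeycombLattice_eq, h.lattice_eq]
  · obtain ⟨g, hg, e⟩ := h.tile_zero
    refine ⟨g, hg, ?_⟩
    rw [(hexVertex_eq q γ ℓ).1, eis_zero, reuleaux_sub_rotate _ _ hρ]
    exact e
  · rw [regularHexagon_eq q γ hℓ, ← chips_eq_iUnion q γ hρ]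
    exact h.tile_one.trans (chippedHex_ae_eq _ _ _ _ _ _ _)
  · obtain ⟨q', γ', ℓ', ρ', h'⟩ := h39'.exists_isRegularHoneycomb hiso'
    exact h.congruent h' hv
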